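/- Let $\tfrac45<\alpha<1$ and $\alpha+\beta=1$. On $\mathbb{R}^2$ consider the Boussinesq system $$ \partial_t u+u\cdot\nabla u+\Lambda^\alpha u=-\nabla p+\theta\,\mathbf e_2,\qquad \nabla\cdot u=0,\qquad \partial_t\theta+u\cdot\nabla\theta+\Lambda^\beta\theta=0,\qquad u(0)=u_0,\quad \theta(0)=\theta_0, $$ where $\Lambda^a$ is the Fourier multiplier with symbol $|\xi|^a$ (with $\hat f(\xi)=\int e^{-ix\cdot\xi}f(x)\,dx$) and $\mathbf e_2=(0,1)$. Let $$ G=\omega-\Lambda^{-\alpha}\partial_1\theta,\qquad \omega=\partial_1u_2-\partial_2u_1 . $$ Assume $$ 2<q<q_0:=\frac{8-4\alpha}{8-7\alpha}. $$ Then for all $T>0$ and $M$ there is a constant $C=C(\alpha,q,T,M)$ with the following property. Let $u_0\in H^2(\mathbb{R}^2)^2$ and $\theta_0\in B^2_{2,1}(\mathbb{R}^2)$ be real-valued, with $H^2$ norm of each component of $u_0$ and $B^2_{2,1}$ norm of $\theta_0$ at most $M$ (the Besov norm being computed with a fixed Littlewood--Paley decomposition, on which $C$ may also depend). Let $(u,p,\theta)$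 be a real-valued solution of the system on a time interval $[0,S]$, $S>0$, with these data and with $u\in C([0,S];H^2)$, $\theta\in C([0,S];B^2_{2,1})$; the equations are understood as identities in $L^2(\mathbb{R}^2)$ for every $t\in(0,S)$, with $u$ and $\theta$ differentiable in time as $L^2$-valued maps, and $p(t)$ locally integrable with locally integrable weak gradient. Then $$ \|G(t)\|_{L^q}\le C\qquad\text{for all } t\in[0,S] \text{ with } t\le T . $$ -/

import Mathlib

open MeasureTheory Set Filter Topology
open scoped FourierTransform ContDiff

noncomputable section

namespace Boussinesq

/-- The plane `ℝ²` with its Euclidean norm. -/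
abbrev Plane : Type := EuclideanSpace ℝ (Fin 2)

/-- Real-valued square integrable functions on the plane. -/
abbrev L2 : Type := Lp ℝ 2 (volume : Measure Plane)

/-- Complex-valued square integrable functions on the plane. -/
abbrev L2C : Type := Lp ℂ 2 (volume : Measure Plane)

/-- A real `L²` function regarded as a complex one. -/
def complexify (f : L2) : L2C := Complex.ofRealCLM.compLp f

open Classical in
/-- The Fourier multiplier operator on `L²` with symbol `m`. The symbol is written in the frequency
variable of the convention `f̂(ξ) = ∫ e^{-i x·ξ} f(x) dx`; since Mathlib's transform is
`𝓕 f (ξ) = ∫ e^{-2π i x·ξ} f(x) dx`, the symbol is evaluated at `2πξ`. The value is the one expected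
whenever `m f̂ ∈ L²`, i.e. when `f` is in the `L²` domain of the operator (and `0` otherwise). -/
def multiplierC (m : Plane → ℂ) (f : L2C) : L2C :=
  if h : MemLp (fun ξ => m ((2 * Real.pi) • ξ) * (𝓕 f : L2C) ξ) 2 (volume : Measure Plane) then
    𝓕⁻ (h.toLp : L2C)
  else 0

/-- The Fourier multiplier operator on real `L²` functions, for symbols with
`m (-ξ) = conj (m ξ)`; such operators preserve real-valuedness, so the real part loses nothing. -/
def multiplier (m : Plane → ℂ) (f : L2) : L2 :=
  Complex.reCLM.compLp (multiplierC m (complexify f))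

/-- The partial derivative `∂ᵢ f`, with symbol `i ξᵢ`. -/
def partialD (i : Fin 2) (f : L2) : L2 :=
  multiplier (fun ξ => Complex.I * (ξ i : ℂ)) f

/-- The fractional Laplacian `Λ^a = (-Δ)^{a/2}`, with symbol `|ξ|^a`. -/
def fracLap (a : ℝ) (f : L2) : L2 :=
  multiplier (fun ξ => ((‖ξ‖ ^ a : ℝ) : ℂ)) f

/-- The operator `R_a = Λ^{-a} ∂₁`, with symbol `|ξ|^{-a} i ξ₁`. -/
def rieszOp (a : ℝ) (f : L2) : L2 :=
  multiplier (fun ξ => ((‖ξ‖ ^ (-a) : ℝ) : ℂ) * (Complex.I * (ξ 0 : ℂ))) f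

/-- The `H^s` norm of an `L²` function (`s ≥ 0`); it is `∞` when the function is not in `H^s`. -/
def sobolevNorm (s : ℝ) (f : L2) : ENNReal :=
  eLpNorm (fun ξ => (((1 + ‖(2 * Real.pi) • ξ‖ ^ 2) ^ (s / 2) : ℝ) : ℂ) *
    (𝓕 (complexify f) : L2C) ξ) 2 (volume : Measure Plane)

/-- A Littlewood-Paley decomposition, given by the Fourier transform `Φ̂₀` of its generator:
`Φ̂ⱼ(ξ) = Φ̂₀(2^{-j} ξ)` is supported in `{2^{j-1} ≤ |ξ| < 2^{j+1}}`, and the `Φ̂ⱼ` sum to `1`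
away from the origin. -/
structure LittlewoodPaley where
  /-- the function `Φ̂₀` -/
  gen : Plane → ℂ
  smooth : ContDiff ℝ ∞ gen
  supp : tsupport gen ⊆ {ξ | 1 / 2 ≤ ‖ξ‖ ∧ ‖ξ‖ < 2}
  sum_eq_one : ∀ ξ : Plane, ξ ≠ 0 → HasSum (fun j : ℤ => gen ((2 : ℝ) ^ (-j) • ξ)) 1

namespace LittlewoodPaley

/-- Littlewood-Paley decompositions exist. -/
theorem nonempty : Nonempty LittlewoodPaley := by
  let χ : ContDiffBump (0 : Plane) := ⟨1 / 2, 3 / 4, by norm_num, by norm_num⟩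
  have χone : ∀ x : Plane, ‖x‖ ≤ 1 / 2 → χ x = 1 := fun x hx =>
    χ.one_of_mem_closedBall (by rw [mem_closedBall_zero_iff]; exact hx)
  have χzero : ∀ x : Plane, 3 / 4 ≤ ‖x‖ → χ x = 0 := fun x hx =>
    χ.zero_of_le_dist (by rw [dist_zero_right]; exact hx)
  refine ⟨⟨fun ξ => ((χ ((2 : ℝ)⁻¹ • ξ) - χ ξ : ℝ) : ℂ), ?_, ?_, ?_⟩⟩
  · have h1 : ContDiff ℝ ∞ (fun ξ : Plane => χ ((2 : ℝ)⁻¹ • ξ)) :=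
      χ.contDiff.comp (contDiff_id.const_smul _)
    exact Complex.ofRealCLM.contDiff.comp (h1.sub χ.contDiff)
  · have hsub : tsupport (fun ξ : Plane => ((χ ((2 : ℝ)⁻¹ • ξ) - χ ξ : ℝ) : ℂ)) ⊆
        {ξ : Plane | 1 / 2 ≤ ‖ξ‖ ∧ ‖ξ‖ ≤ 3 / 2} := by
      refine closure_minimal ?_ ?_
      · intro ξ hξ
        by_contra hcon
        apply hξ
        change ¬ (1 / 2 ≤ ‖ξ‖ ∧ ‖ξ‖ ≤ 3 / 2) at hcon
        rw [not_and_or, not_le, not_le] at hcon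
        change ((χ ((2 : ℝ)⁻¹ • ξ) - χ ξ : ℝ) : ℂ) = 0
        have hn : ‖(2 : ℝ)⁻¹ • ξ‖ = ‖ξ‖ / 2 := by
          rw [norm_smul]; norm_num; ring
        rcases hcon with h | h
        · rw [χone ξ h.le, χone _ (by rw [hn]; linarith [norm_nonneg ξ])]; simp
        · rw [χzero ξ (by linarith), χzero _ (by rw [hn]; linarith)]; simp
      · exact (isClosed_le continuous_const continuous_norm).inter
          (isClosed_le continuous_norm continuous_const)
    intro ξ hξ
    have h := hsub hξ
    exact ⟨h.1, by linarith [h.2]⟩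
  · intro ξ hξ
    have hpos : 0 < ‖ξ‖ := norm_pos_iff.mpr hξ
    have hn : ∀ j : ℤ, ‖(2 : ℝ) ^ (-j) • ξ‖ = (2 : ℝ) ^ (-j) * ‖ξ‖ := fun j => by
      rw [norm_smul, Real.norm_of_nonneg (by positivity)]
    obtain ⟨n, hnn⟩ := pow_unbounded_of_one_lt (2 * ‖ξ‖) (one_lt_two : (1 : ℝ) < 2)
    obtain ⟨m, hm⟩ := pow_unbounded_of_one_lt (1 / ‖ξ‖) (one_lt_two : (1 : ℝ) < 2)
    let c : ℤ → ℝ := fun j => χ ((2 : ℝ) ^ (-j) • ξ)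
    have hc : ∀ j : ℤ, ((χ ((2 : ℝ)⁻¹ • (2 : ℝ) ^ (-j) • ξ) - χ ((2 : ℝ) ^ (-j) • ξ) : ℝ) : ℂ)
        = ((c (j + 1) - c j : ℝ) : ℂ) := fun j => by
      have : (2 : ℝ)⁻¹ * (2 : ℝ) ^ (-j) = (2 : ℝ) ^ (-(j + 1)) := by
        rw [neg_add, zpow_add₀ two_ne_zero, zpow_neg_one, mul_comm]
      simp only [c, smul_smul, this]
    have c1 : ∀ j : ℤ, (n : ℤ) ≤ j → c j = 1 := fun j hj => by
      apply χone
      rw [hn, zpow_neg, inv_mul_le_iff₀ (by positivity)]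
      have : (2 : ℝ) ^ n ≤ (2 : ℝ) ^ j := by
        rw [← zpow_natCast]; exact zpow_le_zpow_right₀ one_le_two hj
      linarith
    have c0 : ∀ j : ℤ, j ≤ -(m : ℤ) → c j = 0 := fun j hj => by
      apply χzero
      rw [hn]
      have h2 : (2 : ℝ) ^ m ≤ (2 : ℝ) ^ (-j) := by
        rw [← zpow_natCast]; exact zpow_le_zpow_right₀ one_le_two (by omega)
      have h3 : 1 < (2 : ℝ) ^ m * ‖ξ‖ := by rwa [div_lt_iff₀ hpos] at hm
      nlinarith
    simp only [hc]
    have key : HasSum (fun j : ℤ => ((c (j + 1) - c j : ℝ) : ℂ))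
        (∑ j ∈ Finset.Ico (-(m : ℤ)) n, ((c (j + 1) - c j : ℝ) : ℂ)) := by
      refine hasSum_sum_of_ne_finset_zero fun j hj => ?_
      rw [Finset.mem_Ico, not_and_or, not_le, not_lt] at hj
      rcases hj with h | h
      · rw [c0 j h.le, c0 (j + 1) (by omega)]; simp
      · rw [c1 j h, c1 (j + 1) (by omega)]; simp
    have tel : ∀ k : ℕ, ∑ j ∈ Finset.Ico (-(m : ℤ)) (-(m : ℤ) + k), (c (j + 1) - c j)
        = c (-(m : ℤ) + k) - c (-(m : ℤ)) := fun k => by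
      induction k with
      | zero => simp
      | succ k ih =>
        have : Finset.Ico (-(m : ℤ)) (-(m : ℤ) + (k + 1 : ℕ)) =
            insert (-(m : ℤ) + k) (Finset.Ico (-(m : ℤ)) (-(m : ℤ) + k)) := by
          ext x; simp only [Finset.mem_Ico, Finset.mem_insert]; push_cast; omega
        rw [this, Finset.sum_insert (by simp), ih]
        push_cast
        rw [← add_assoc]; ring
    have hfin := tel (m + n)
    have e : -(m : ℤ) + ((m + n : ℕ) : ℤ) = n := by push_cast; ring
    rw [e, c1 _ le_rfl, c0 _ le_rfl, sub_zero] at hfin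
    rw [← Complex.ofReal_sum, hfin] at key
    simpa using key

variable (LP : LittlewoodPaley)

/-- Symbols of the inhomogeneous blocks: index `0` is `Δ₋₁`, with symbol
`Ψ̂ = 1 - ∑_{j ≥ 0} Φ̂ⱼ`, and index `j + 1` is `Δⱼ`, with symbol `Φ̂ⱼ`, for `j ≥ 0`. -/
def blockSymbol : ℕ → Plane → ℂ
  | 0 => fun ξ => 1 - ∑' j : ℕ, LP.gen ((2 : ℝ) ^ (-(j : ℤ)) • ξ)
  | j + 1 => fun ξ => LP.gen ((2 : ℝ) ^ (-(j : ℤ)) • ξ)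

/-- The norm of the inhomogeneous Besov space `B^s_{2,1}` (`s ≥ 0`) of an `L²` function,
`∑_{j ≥ -1} 2^{js} ‖Δⱼ f‖_{L²}`; it is `∞` when the function is not in `B^s_{2,1}`. -/
def besovNorm (s : ℝ) (f : L2) : ENNReal :=
  ∑' k : ℕ, ENNReal.ofReal ((2 : ℝ) ^ (((k : ℝ) - 1) * s)) *
    eLpNorm (multiplierC (LP.blockSymbol k) (complexify f)) 2 (volume : Measure Plane)

end LittlewoodPaley

/-- `f ∈ C([0,S]; X)`, where `X` is the space of `L²` functions with finite norm `N`. -/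
def ContinuousInTime (N : L2 → ENNReal) (S : ℝ) (f : ℝ → L2) : Prop :=
  ∀ t ∈ Icc 0 S, N (f t) < ⊤ ∧
    Tendsto (fun τ => N (f τ - f t)) (𝓝[Icc 0 S] t) (𝓝 0)

/-- `g` is the weak partial derivative `∂ᵢ p` of a locally integrable function `p`. -/
def IsWeakPartial (i : Fin 2) (p g : Plane → ℝ) : Prop :=
  LocallyIntegrable p ∧ LocallyIntegrable g ∧
    ∀ φ : Plane → ℝ, ContDiff ℝ ∞ φ → HasCompactSupport φ →
      ∫ x, p x * fderiv ℝ φ x (EuclideanSpace.single i 1) = -∫ x, g x * φ x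

/-- `(u, p, θ)` solves, on the time interval `[0,S]`, the Boussinesq system
`∂ₜu + u·∇u + Λ^α u = -∇p + θ e₂`, `∇·u = 0`, `∂ₜθ + u·∇θ + Λ^β θ = 0`
with data `(u₀, θ₀)`, in the class `u ∈ C([0,S]; H²)`, `θ ∈ C([0,S]; B²_{2,1})`. In this class every
term of the equations is an `L²` function of `x`; the time derivatives are derivatives of `L²`-valued
maps and the equations hold almost everywhere in `x`, for every `t ∈ (0,S)`. -/
structure IsSolution (LP : LittlewoodPaley) (α β S : ℝ) (u₀ : Fin 2 → L2) (θ₀ : L2)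
    (u : ℝ → Fin 2 → L2) (p : ℝ → Plane → ℝ) (θ : ℝ → L2) : Prop where
  velocity_init : u 0 = u₀
  temperature_init : θ 0 = θ₀
  velocity_cont : ∀ i, ContinuousInTime (sobolevNorm 2) S (fun t => u t i)
  temperature_cont : ContinuousInTime (LP.besovNorm 2) S θ
  div_free : ∀ t ∈ Icc 0 S, partialD 0 (u t 0) + partialD 1 (u t 1) = 0
  velocity_eq : ∀ t ∈ Ioo 0 S, ∀ i, ∃ (du : L2) (dp : Plane → ℝ),
    HasDerivAt (fun τ => u τ i) du t ∧ IsWeakPartial i (p t) dp ∧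
    ∀ᵐ x : Plane, du x + (∑ j, u t j x * partialD j (u t i) x) + fracLap α (u t i) x
      = -dp x + (if i = 1 then θ t x else 0)
  temperature_eq : ∀ t ∈ Ioo 0 S, ∃ dθ : L2,
    HasDerivAt θ dθ t ∧
    ∀ᵐ x : Plane, dθ x + (∑ j, u t j x * partialD j (θ t) x) + fracLap β (θ t) x = 0

/-- The vorticity `ω = ∂₁u₂ - ∂₂u₁`. -/
def vorticity (u : Fin 2 → L2) : L2 := partialD 0 (u 1) - partialD 1 (u 0)

/-- The combined quantity `G = ω - R_α θ`. -/
def combined (α : ℝ) (u : Fin 2 → L2) (θ : L2) : L2 := vorticity u - rieszOp α θ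

end Boussinesq

end

/-! # A global `L^q` bound for the Boussinesq system -/

open MeasureTheory Set Filter Topology
open scoped FourierTransform ContDiff

noncomputable section

namespace Boussinesq

/-! ### The Fourier transform of real square integrable functions -/

/-! The vorticity solves ∂ₜω + u·∇ω + Λ^α ω = ∂₁θ, and this forcing costs a full derivative of θ.
Put R_a = Λ^{-a}∂₁. Since Λ^α R_α = ∂₁, subtracting R_α θ removes the forcing, and with α + β = 1
one finds ∂ₜG + u·∇G + Λ^α G = (R_α(u·∇θ) - u·∇R_α θ) + R_{2α-1} θ. The weak form of this identity,
tested against f = φ(G), is `Solenoidal.balance`.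

Write q = p + 2, E = ∫ |G|^q, δ_z f = f - f(· - z), and take f close to |G|^p G. Transport
contributes nothing because div u = 0. All remaining operators are superpositions of heat operators,
whose Gaussian kernels at scale √s are denoted by g_s. The dissipation becomes a positive multiple
of ∫ s^{-1-α/2} ∫ g_s(z) ⟨δ_z f, δ_z G⟩ dz ds, with nonnegative integrand since φ is monotone. By
`commTerm_eq` the commutator becomes a multiple of the integral over s of s^{α/2-2} times integrals
of second derivatives of the Gaussian against ∫ δ_z f · δ_z u_j · θ(· - z). The linear term likewise
can be written with δ_z f. So every bad term contains the factor that the dissipation controls: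
`abs_powTrunc_sub_mul_le` gives |δ_z f| |h| ≤ η δ_z f δ_z G + C η⁻¹ (|G|^q + |G(· - z)|^q + |h|^q).

The maximum principle bounds θ in L^∞, and the energy inequality bounds u in L². The Biot–Savart
law, with ω = G + R_α θ, then gives ∫ |δ_z u|^q ≤ A (1 + E) |z|^{γq} for every 0 ≤ γ < α
(`exists_increment_bound`). After absorption the commutator leaves (1 + E) s^{3α/2-3+γ} at scale s.
This is integrable at s = 0 when γ > 2 - 3α/2, which is compatible with γ < α exactly when α > 4/5;
γ = 1 - α/4 is used. The linear term leaves s^{5α/2-3}, with the same threshold. For s > 1 the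
choice γ = 0 and a bound of the linear term without dissipation suffice. Hence the growth is at most
C (1 + E) (`exists_growth_bound`), and Gronwall's inequality concludes.

Two points need care. G is only in H¹ and its time derivative is not an L² function, so |G|^p G is
replaced by the Lipschitz function min(|G|, n)^p G, which stays in H¹; the energy is differentiated
by convexity (`Regular.hasDerivAt_energy`), and `gronwall_of_truncations` removes the truncation.
Finiteness of E comes from H¹ ⊂ L² ∩ L⁴, for which q ≤ 4 is enough, and q₀ < 4 because α < 1. -/

/-- The Fourier transform (in Mathlib's normalization) of a real `L²` function. -/
def hat (f : L2) : L2C := 𝓕 (complexify f)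

theorem coeFn_complexify (f : L2) : complexify f =ᵐ[volume] fun x => (f x : ℂ) :=
  Complex.ofRealCLM.coeFn_compLp f

/-- Complexification as a continuous linear map. -/
def complexifyL : L2 →L[ℝ] L2C := Complex.ofRealCLM.compLpL 2 volume

theorem complexify_add (f g : L2) : complexify (f + g) = complexify f + complexify g :=
  map_add complexifyL f g

theorem complexify_sub (f g : L2) : complexify (f - g) = complexify f - complexify g :=
  map_sub complexifyL f g

theorem complexify_smul (c : ℝ) (f : L2) : complexify (c • f) = c • complexify f :=
  map_smul complexifyL c f

theorem hat_add (f g : L2) : hat (f + g) = hat f + hat g := by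
  rw [hat, complexify_add]; exact (Lp.fourierTransformₗᵢ Plane ℂ).map_add _ _

theorem hat_sub (f g : L2) : hat (f - g) = hat f - hat g := by
  rw [hat, complexify_sub]; exact (Lp.fourierTransformₗᵢ Plane ℂ).map_sub _ _

theorem hat_smul (c : ℝ) (f : L2) : hat (c • f) = (c : ℂ) • hat f := by
  rw [hat, complexify_smul]
  exact (Lp.fourierTransformₗᵢ Plane ℂ).map_smul (c : ℂ) (complexify f)

theorem inner_complexify (f g : L2) :
    inner ℂ (complexify f) (complexify g) = ((inner ℝ f g : ℝ) : ℂ) := by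
  rw [L2.inner_def, L2.inner_def, ← integral_complex_ofReal]
  refine integral_congr_ae ?_
  filter_upwards [coeFn_complexify f, coeFn_complexify g] with x hf hg
  rw [hf, hg]; simp

theorem inner_hat (f g : L2) : inner ℂ (hat f) (hat g) = ((inner ℝ f g : ℝ) : ℂ) := by
  rw [hat, hat, Lp.inner_fourier_eq, inner_complexify]

theorem inner_eq_integral (f g : L2) : inner ℝ f g = ∫ x, f x * g x := by
  rw [L2.inner_def]; refine integral_congr_ae (.of_forall fun x => ?_)
  simp [mul_comm]

theorem inner_eq_hat (f g : L2) :
    inner ℝ f g = (∫ ξ, (starRingEnd ℂ) (hat f ξ) * hat g ξ).re := by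
  have h := inner_hat f g
  rw [L2.inner_def] at h
  rw [← Complex.ofReal_re (inner ℝ f g), ← h]
  congr 1
  refine integral_congr_ae (.of_forall fun x => ?_)
  simp [mul_comm]

theorem norm_hat (f : L2) : ‖hat f‖ = ‖f‖ := by
  have h := inner_hat f f
  rw [inner_self_eq_norm_sq_to_K, real_inner_self_eq_norm_sq] at h
  have h2 : ‖hat f‖ ^ 2 = ‖f‖ ^ 2 := by
    apply Complex.ofReal_injective
    rw [← h]; push_cast; rfl
  exact (sq_eq_sq₀ (norm_nonneg _) (norm_nonneg _)).1 h2

theorem hat_injective {f g : L2} (h : hat f = hat g) : f = g := by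
  have : ‖hat (f - g)‖ = 0 := by rw [hat_sub, h, sub_self, norm_zero]
  rw [norm_hat, norm_eq_zero, sub_eq_zero] at this
  exact this

/-- An a.e. multiplication identity between continuous maps on `L²` extends from Schwartz
functions. -/
theorem ae_mul_of_dense {A B : L2C → L2C} (hA : Continuous A) (hB : Continuous B)
    (m : Plane → ℂ)
    (h : ∀ φ : SchwartzMap Plane ℂ, A (φ.toLp 2) =ᵐ[volume] fun x => m x * B (φ.toLp 2) x)
    (f : L2C) : A f =ᵐ[volume] fun x => m x * B f x := by
  have hd : DenseRange (SchwartzMap.toLpCLM ℝ (E := Plane) ℂ 2 volume) :=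
    SchwartzMap.denseRange_toLpCLM (by norm_num)
  obtain ⟨v, hv, hu⟩ := mem_closure_iff_seq_limit.1 (hd f)
  choose u hu' using hv
  replace hu : Tendsto (fun n => ((u n).toLp 2 : L2C)) atTop (𝓝 f) :=
    hu.congr fun n => (hu' n).symm
  have h1 : Tendsto (fun n => A ((u n).toLp 2)) atTop (𝓝 (A f)) :=
    (hA.tendsto f).comp hu
  have h2 : Tendsto (fun n => B ((u n).toLp 2)) atTop (𝓝 (B f)) :=
    (hB.tendsto f).comp hu
  obtain ⟨ns, hns, h3⟩ := (tendstoInMeasure_of_tendsto_Lp h1).exists_seq_tendsto_ae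
  have h4 : Tendsto (fun n => B ((u (ns n)).toLp 2)) atTop (𝓝 (B f)) :=
    h2.comp hns.tendsto_atTop
  obtain ⟨ms, hms, h5⟩ := (tendstoInMeasure_of_tendsto_Lp h4).exists_seq_tendsto_ae
  have h6 : ∀ᵐ x : Plane, ∀ n, A ((u n).toLp 2) x = m x * B ((u n).toLp 2) x :=
    ae_all_iff.2 fun n => h (u n)
  filter_upwards [h3, h5, h6] with x hx3 hx5 hx6
  have h7 := hx3.comp hms.tendsto_atTop
  refine tendsto_nhds_unique h7 ?_
  refine (hx5.const_mul (m x)).congr fun n => ?_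
  exact (hx6 _).symm

/-- Translation of real functions by `z`. -/
theorem measurePreserving_sub (z : Plane) :
    MeasurePreserving (fun x : Plane => x - z) volume volume :=
  measurePreserving_sub_right volume z

theorem measurePreserving_neg' : MeasurePreserving (fun x : Plane => -x) volume volume :=
  Measure.measurePreserving_neg volume

/-- Pointwise conjugation on complex `L²`. -/
def conjL : L2C →L[ℝ] L2C := (Complex.conjCLE : ℂ →L[ℝ] ℂ).compLpL 2 volume

theorem coeFn_conjL (f : L2C) : conjL f =ᵐ[volume] fun x => (starRingEnd ℂ) (f x) :=
  (Complex.conjCLE : ℂ →L[ℝ] ℂ).coeFn_compLp f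

/-- Reflection composed with conjugation. -/
def reflConj (f : L2C) : L2C :=
  conjL (Lp.compMeasurePreserving (fun x : Plane => -x) measurePreserving_neg' f)

theorem continuous_reflConj : Continuous reflConj :=
  conjL.continuous.comp (Lp.isometry_compMeasurePreserving measurePreserving_neg').continuous

theorem coeFn_reflConj (f : L2C) :
    reflConj f =ᵐ[volume] fun x => (starRingEnd ℂ) (f (-x)) := by
  filter_upwards [coeFn_conjL (Lp.compMeasurePreserving (fun x : Plane => -x)
    measurePreserving_neg' f), Lp.coeFn_compMeasurePreserving f measurePreserving_neg'] with x h1 h2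
  rw [reflConj, h1, h2]; rfl

/-- For Schwartz functions, conjugating the Fourier integral reverses the sign of the frequency.
Both sides are continuous on `L²`, so `ae_mul_of_dense` with the constant symbol 1 extends the
identity. -/
theorem fourier_conjL (f : L2C) : (𝓕 (conjL f) : L2C) = reflConj (𝓕 f) := by
  have key := ae_mul_of_dense (A := fun f => (𝓕 (conjL f) : L2C)) (B := fun f => reflConj (𝓕 f))
    ((Lp.fourierTransformₗᵢ Plane ℂ).continuous.comp conjL.continuous)
    (continuous_reflConj.comp (Lp.fourierTransformₗᵢ Plane ℂ).continuous) (fun _ => 1) ?_ f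
  · refine Lp.ext ?_
    filter_upwards [key] with x hx
    rw [hx, one_mul]
  · intro φ
    set ψ : SchwartzMap Plane ℂ := φ.postcompCLM (Complex.conjCLE : ℂ →L[ℝ] ℂ) with hψ
    have h1 : conjL (φ.toLp 2) = ψ.toLp 2 := by
      refine Lp.ext ?_
      filter_upwards [coeFn_conjL (φ.toLp 2), φ.coeFn_toLp 2 volume, ψ.coeFn_toLp 2 volume]
        with x h1 h2 h3
      rw [h1, h2, h3, hψ, SchwartzMap.postcompCLM_apply]; rfl
    have h2 : (𝓕 (conjL (φ.toLp 2)) : L2C) = (𝓕 ψ).toLp 2 := by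
      rw [h1]; exact SchwartzMap.toLp_fourier_eq ψ
    have h3 : (𝓕 (φ.toLp 2) : L2C) = (𝓕 φ).toLp 2 := SchwartzMap.toLp_fourier_eq φ
    rw [h2, h3]
    have h5 := (measurePreserving_neg'.quasiMeasurePreserving).ae ((𝓕 φ).coeFn_toLp 2 volume)
    filter_upwards [(𝓕 ψ).coeFn_toLp 2 volume, coeFn_reflConj ((𝓕 φ).toLp 2), h5] with x h4 h6 h5
    rw [h4, h6, h5, one_mul]
    change 𝓕 (ψ : Plane → ℂ) x = (starRingEnd ℂ) (𝓕 (φ : Plane → ℂ) (-x))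
    rw [Real.fourier_eq, Real.fourier_eq, ← integral_conj]
    refine integral_congr_ae (.of_forall fun y => ?_)
    simp only [hψ, SchwartzMap.postcompCLM_apply, Circle.smul_def, smul_eq_mul, map_mul,
      inner_neg_right, neg_neg, Real.fourierChar_apply, ← Complex.exp_conj]
    refine congrArg₂ (· * ·) (congrArg Complex.exp ?_) rfl
    simp [map_ofNat]

theorem conjL_complexify (f : L2) : conjL (complexify f) = complexify f := by
  refine Lp.ext ?_
  filter_upwards [coeFn_conjL (complexify f), coeFn_complexify f] with x h1 h2
  rw [h1, h2, Complex.conj_ofReal]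

theorem hat_neg (f : L2) : ∀ᵐ ξ : Plane, hat f ξ = (starRingEnd ℂ) (hat f (-ξ)) := by
  have h := fourier_conjL (complexify f)
  rw [conjL_complexify] at h
  have h2 := coeFn_reflConj (hat f)
  rw [hat, ← h] at h2
  exact h2

theorem complexify_re_of_conj {g : L2C} (h : conjL g = g) :
    complexify (Complex.reCLM.compLp g) = g := by
  refine Lp.ext ?_
  have h1 := coeFn_conjL g
  rw [h] at h1
  filter_upwards [h1, coeFn_complexify (Complex.reCLM.compLp g),
    Complex.reCLM.coeFn_compLp g] with x h1 h2 h3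
  rw [h2, h3]
  exact Complex.conj_eq_iff_re.1 h1.symm

theorem fourier_injective {f g : L2C} (h : (𝓕 f : L2C) = 𝓕 g) : f = g :=
  (Lp.fourierTransformₗᵢ Plane ℂ).injective h

/-- The inverse transform of a Hermitian function is real. -/
theorem exists_hat_eq {F : L2C} (h : ∀ᵐ ξ : Plane, F ξ = (starRingEnd ℂ) (F (-ξ))) :
    complexify (Complex.reCLM.compLp (𝓕⁻ F : L2C)) = (𝓕⁻ F : L2C) := by
  apply complexify_re_of_conj
  apply fourier_injective
  rw [fourier_conjL, FourierTransform.fourier_fourierInv_eq]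
  refine Lp.ext ?_
  filter_upwards [coeFn_reflConj F, h] with x h1 h2
  rw [h1, ← h2]

/-! ### Multipliers as relations between real functions -/

/-- `g = m(D) f`, with the symbol `m` in Mathlib's frequency variable. -/
def HasMult (m : Plane → ℂ) (f g : L2) : Prop := hat g =ᵐ[volume] fun ξ => m ξ * hat f ξ

/-- Symbols of operators preserving real-valuedness. -/
structure RealSymbol (m : Plane → ℂ) : Prop where
  meas : Measurable m
  herm : ∀ ξ, m (-ξ) = (starRingEnd ℂ) (m ξ)

theorem multiplierC_spec {m : Plane → ℂ} {f : L2C}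
    (h : MemLp (fun ξ => m ((2 * Real.pi) • ξ) * (𝓕 f : L2C) ξ) 2 (volume : Measure Plane)) :
    (𝓕 (multiplierC m f) : L2C) =ᵐ[volume] fun ξ => m ((2 * Real.pi) • ξ) * (𝓕 f : L2C) ξ := by
  rw [multiplierC, dif_pos h, FourierTransform.fourier_fourierInv_eq]
  exact h.coeFn_toLp

/-- A Hermitian symbol times the Hermitian transform of a real function is Hermitian, so its inverse
transform is already real and taking the real part in `multiplier` discards nothing. -/
theorem complexify_multiplier {m : Plane → ℂ} (hm : ∀ ξ, m (-ξ) = (starRingEnd ℂ) (m ξ)) {f : L2}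
    (h : MemLp (fun ξ => m ((2 * Real.pi) • ξ) * hat f ξ) 2 (volume : Measure Plane)) :
    complexify (multiplier m f) = multiplierC m (complexify f) := by
  have h' : MemLp (fun ξ => m ((2 * Real.pi) • ξ) * (𝓕 (complexify f) : L2C) ξ) 2
    (volume : Measure Plane) := h
  rw [multiplier, multiplierC, dif_pos h']
  apply exists_hat_eq
  have h5 := (measurePreserving_neg'.quasiMeasurePreserving).ae h'.coeFn_toLp
  filter_upwards [h'.coeFn_toLp, h5, hat_neg f] with ξ h1 h2 h3
  rw [h1, h2, map_mul, smul_neg, hm, RingHomCompTriple.comp_apply, RingHom.id_apply]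
  congr 1

theorem hasMult_multiplier {m : Plane → ℂ} (hm : ∀ ξ, m (-ξ) = (starRingEnd ℂ) (m ξ)) {f : L2}
    (h : MemLp (fun ξ => m ((2 * Real.pi) • ξ) * hat f ξ) 2 (volume : Measure Plane)) :
    HasMult (fun ξ => m ((2 * Real.pi) • ξ)) f (multiplier m f) := by
  rw [HasMult, hat, complexify_multiplier hm h]
  exact multiplierC_spec h

theorem exists_hasMult {m : Plane → ℂ} (hm : ∀ ξ, m (-ξ) = (starRingEnd ℂ) (m ξ)) {f : L2}
    (h : MemLp (fun ξ => m ξ * hat f ξ) 2 (volume : Measure Plane)) :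
    ∃ g, HasMult m f g := by
  have e : (fun ξ : Plane => m ((2 * Real.pi)⁻¹ • (2 * Real.pi) • ξ)) = m := by
    funext ξ
    rw [smul_smul, inv_mul_cancel₀ (by positivity), one_smul]
  have := hasMult_multiplier (m := fun ξ => m ((2 * Real.pi)⁻¹ • ξ)) (f := f)
    (fun ξ => by rw [smul_neg, hm]) (by
      have e' : ∀ ξ : Plane, m ((2 * Real.pi)⁻¹ • (2 * Real.pi) • ξ) = m ξ := congrFun e
      simpa only [e'] using h)
  rw [e] at this
  exact ⟨_, this⟩

namespace HasMult

variable {m n : Plane → ℂ} {f g h : L2}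

theorem unique (h1 : HasMult m f g) (h2 : HasMult m f h) : g = h :=
  hat_injective (Lp.ext (h1.trans h2.symm))

theorem congr (h1 : HasMult m f g) (h2 : ∀ᵐ ξ : Plane, m ξ = n ξ) : HasMult n f g := by
  filter_upwards [h1, h2] with ξ a b
  rw [a, b]

theorem comp (h1 : HasMult m f g) (h2 : HasMult n g h) : HasMult (fun ξ => n ξ * m ξ) f h := by
  filter_upwards [h1, h2] with ξ a b
  rw [b, a, mul_assoc]

theorem add {f' g' : L2} (h1 : HasMult m f g) (h2 : HasMult m f' g') :
    HasMult m (f + f') (g + g') := by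
  rw [HasMult, hat_add, hat_add]
  filter_upwards [h1, h2, Lp.coeFn_add (hat g) (hat g'), Lp.coeFn_add (hat f) (hat f')]
    with ξ a b c d
  rw [c, d, Pi.add_apply, Pi.add_apply, a, b, mul_add]

theorem sub {f' g' : L2} (h1 : HasMult m f g) (h2 : HasMult m f' g') :
    HasMult m (f - f') (g - g') := by
  rw [HasMult, hat_sub, hat_sub]
  filter_upwards [h1, h2, Lp.coeFn_sub (hat g) (hat g'), Lp.coeFn_sub (hat f) (hat f')]
    with ξ a b c d
  rw [c, d, Pi.sub_apply, Pi.sub_apply, a, b, mul_sub]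

theorem smul (c : ℝ) (h1 : HasMult m f g) : HasMult m (c • f) (c • g) := by
  rw [HasMult, hat_smul, hat_smul]
  filter_upwards [h1, Lp.coeFn_smul (c : ℂ) (hat g), Lp.coeFn_smul (c : ℂ) (hat f)] with ξ a b d
  rw [b, d, Pi.smul_apply, Pi.smul_apply, a, smul_eq_mul, smul_eq_mul]; ring

theorem memLp (h1 : HasMult m f g) : MemLp (fun ξ => m ξ * hat f ξ) 2 (volume : Measure Plane) :=
  (memLp_congr_ae h1).1 (Lp.memLp _)

theorem norm_le {C : ℝ} (h1 : HasMult m f g) (hC : ∀ ξ, ‖m ξ‖ ≤ C) : ‖g‖ ≤ C * ‖f‖ := by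
  rw [← norm_hat g, ← norm_hat f]
  refine Lp.norm_le_mul_norm_of_ae_le_mul ?_
  filter_upwards [h1] with ξ a
  rw [a, norm_mul]
  exact mul_le_mul_of_nonneg_right (hC ξ) (norm_nonneg _)

/-- Plancherel's formula makes an operator with purely imaginary symbol skew-adjoint. In this form
derivatives and Riesz operators are moved onto test functions. -/
theorem inner_eq_neg {f' g' : L2} (h1 : HasMult m f g) (h2 : HasMult m f' g')
    (hm : ∀ ξ, (starRingEnd ℂ) (m ξ) = -m ξ) : inner ℝ g f' = -inner ℝ f g' := by
  rw [inner_eq_hat, inner_eq_hat, ← Complex.neg_re, ← integral_neg]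
  congr 1
  refine integral_congr_ae ?_
  filter_upwards [h1, h2] with ξ a b
  rw [a, b, map_mul, hm]; ring

theorem of_bounded (hm : RealSymbol m) {C : ℝ} (hC : ∀ ξ, ‖m ξ‖ ≤ C) (f : L2) :
    ∃ g, HasMult m f g :=
  exists_hasMult hm.herm <| (Lp.memLp (hat f)).of_le_mul
    (hm.meas.aestronglyMeasurable.mul (Lp.aestronglyMeasurable _))
    (.of_forall fun ξ => by
      rw [norm_mul]; exact mul_le_mul_of_nonneg_right (hC ξ) (norm_nonneg _))

end HasMult

/-- Integrability of the Fourier side of a pairing. -/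
theorem integrable_conj_mul_hat {f g : L2} {m : Plane → ℂ}
    (h : MemLp (fun ξ => m ξ * hat g ξ) 2 (volume : Measure Plane)) :
    Integrable fun ξ => (starRingEnd ℂ) (hat f ξ) * (m ξ * hat g ξ) := by
  have h1 : MemLp (fun ξ => (starRingEnd ℂ) (hat f ξ)) 2 (volume : Measure Plane) :=
    (Lp.memLp (hat f)).star
  exact h1.integrable_mul h

/-! ### Translations and convolution kernels -/

/-- Translation of a real `L²` function by `z`. -/
def trans (z : Plane) (f : L2) : L2 :=
  Lp.compMeasurePreserving (fun x : Plane => x - z) (measurePreserving_sub z) f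

/-- Translation of a complex `L²` function by `z`. -/
def transC (z : Plane) (f : L2C) : L2C :=
  Lp.compMeasurePreserving (fun x : Plane => x - z) (measurePreserving_sub z) f

theorem coeFn_trans (z : Plane) (f : L2) : trans z f =ᵐ[volume] fun x => f (x - z) :=
  Lp.coeFn_compMeasurePreserving f (measurePreserving_sub z)

theorem coeFn_transC (z : Plane) (f : L2C) : transC z f =ᵐ[volume] fun x => f (x - z) :=
  Lp.coeFn_compMeasurePreserving f (measurePreserving_sub z)

theorem ae_sub {P : Plane → Prop} (z : Plane) (h : ∀ᵐ x : Plane, P x) :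
    ∀ᵐ x : Plane, P (x - z) :=
  (measurePreserving_sub z).quasiMeasurePreserving.ae h

theorem complexify_trans (z : Plane) (f : L2) :
    complexify (trans z f) = transC z (complexify f) := by
  refine Lp.ext ?_
  filter_upwards [coeFn_complexify (trans z f), coeFn_trans z f, coeFn_transC z (complexify f),
    ae_sub z (coeFn_complexify f)] with x h1 h2 h3 h4
  rw [h1, h2, h3, h4]

/-- The character `ξ ↦ e^{-2πi z·ξ}`. -/
def chr (z ξ : Plane) : ℂ := Real.fourierChar (-inner ℝ z ξ)

theorem norm_chr (z ξ : Plane) : ‖chr z ξ‖ = 1 := Circle.norm_coe _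

theorem continuous_chr : Continuous fun p : Plane × Plane => chr p.1 p.2 := by
  unfold chr
  exact Continuous.subtype_val (Real.continuous_fourierChar.comp (by fun_prop))

theorem hasMult_trans (z : Plane) (f : L2) : HasMult (chr z) f (trans z f) := by
  rw [HasMult, hat, complexify_trans]
  refine ae_mul_of_dense (A := fun f => (𝓕 (transC z f) : L2C)) (B := fun f => (𝓕 f : L2C))
    ((Lp.fourierTransformₗᵢ Plane ℂ).continuous.comp
      (Lp.isometry_compMeasurePreserving (measurePreserving_sub z)).continuous)
    ((Lp.fourierTransformₗᵢ Plane ℂ).continuous) (chr z) ?_ (complexify f)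
  intro φ
  set ψ : SchwartzMap Plane ℂ := φ.compSubConstCLM ℂ z with hψ
  have h1 : transC z (φ.toLp 2) = ψ.toLp 2 := by
    refine Lp.ext ?_
    filter_upwards [coeFn_transC z (φ.toLp 2), ae_sub z (φ.coeFn_toLp 2 volume),
      ψ.coeFn_toLp 2 volume] with x h1 h2 h3
    rw [h1, h2, h3, hψ, SchwartzMap.compSubConstCLM_apply]
  have h2 : (𝓕 (transC z (φ.toLp 2)) : L2C) = (𝓕 ψ).toLp 2 := by
    rw [h1]; exact SchwartzMap.toLp_fourier_eq ψ
  have h3 : (𝓕 (φ.toLp 2) : L2C) = (𝓕 φ).toLp 2 := SchwartzMap.toLp_fourier_eq φ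
  rw [h2, h3]
  filter_upwards [(𝓕 ψ).coeFn_toLp 2 volume, (𝓕 φ).coeFn_toLp 2 volume] with x h4 h5
  rw [h4, h5]
  have h6 := congrFun (VectorFourier.fourierIntegral_comp_add_right Real.fourierChar
    (volume : Measure Plane) (innerₗ Plane) (φ : Plane → ℂ) (-z)) x
  have h7 : (φ : Plane → ℂ) ∘ (fun v => v + -z) = (ψ : Plane → ℂ) := by
    funext v
    rw [hψ, SchwartzMap.compSubConstCLM_apply, Function.comp_apply, sub_eq_add_neg]
  rw [h7] at h6
  change VectorFourier.fourierIntegral Real.fourierChar volume (innerₗ Plane) (ψ : Plane → ℂ) x =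
    chr z x * VectorFourier.fourierIntegral Real.fourierChar volume (innerₗ Plane)
      (φ : Plane → ℂ) x
  rw [h6, chr, Circle.smul_def, smul_eq_mul]
  simp

theorem inner_trans (a b : L2) (z : Plane) :
    inner ℝ a (trans z b) = (∫ ξ, (starRingEnd ℂ) (hat a ξ) * (chr z ξ * hat b ξ)).re := by
  rw [inner_eq_hat]
  congr 1
  refine integral_congr_ae ?_
  filter_upwards [hasMult_trans z b] with ξ h
  rw [h]

theorem fourier_eq_chr (k : Plane → ℂ) (ξ : Plane) : 𝓕 k ξ = ∫ z, chr z ξ * k z := by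
  rw [Real.fourier_eq]; rfl

theorem integrable_chr_mul {k : Plane → ℝ} (hk : Integrable k) (a b : L2) :
    Integrable (fun p : Plane × Plane =>
      (k p.1 : ℂ) * ((starRingEnd ℂ) (hat a p.2) * (chr p.1 p.2 * hat b p.2)))
      (volume.prod volume) := by
  have h1 : Integrable fun ξ => (starRingEnd ℂ) (hat a ξ) * hat b ξ := by
    simpa using integrable_conj_mul_hat (f := a) (g := b) (m := fun _ => 1)
      (by simpa using Lp.memLp (hat b))
  have h2 := (hk.ofReal (𝕜 := ℂ)).mul_prod h1
  have h3 : Integrable (fun p : Plane × Plane =>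
      chr p.1 p.2 * ((k p.1 : ℂ) * ((starRingEnd ℂ) (hat a p.2) * hat b p.2)))
      (volume.prod volume) :=
    h2.bdd_mul (c := 1) continuous_chr.aestronglyMeasurable
      (.of_forall fun p => (norm_chr _ _).le)
  exact h3.congr (.of_forall fun p => by ring)

/-- Pairing with a convolution: physical and frequency side. -/
theorem integral_kernel {k : Plane → ℝ} (hk : Integrable k) (a b : L2) :
    ∫ z, k z * inner ℝ a (trans z b) =
      (∫ ξ, (starRingEnd ℂ) (hat a ξ) * (𝓕 (fun z => (k z : ℂ)) ξ * hat b ξ)).re := by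
  have h3 := integrable_chr_mul hk a b
  have h4 : ∀ z, k z * inner ℝ a (trans z b) =
      (∫ ξ, (k z : ℂ) * ((starRingEnd ℂ) (hat a ξ) * (chr z ξ * hat b ξ))).re := fun z => by
    rw [inner_trans, integral_const_mul, Complex.re_ofReal_mul]
  simp_rw [h4]
  have h5 := integral_re (f := fun z : Plane => ∫ ξ, (k z : ℂ) * ((starRingEnd ℂ) (hat a ξ) *
    (chr z ξ * hat b ξ))) h3.integral_prod_left
  change (∫ z, RCLike.re (∫ ξ, (k z : ℂ) * ((starRingEnd ℂ) (hat a ξ) *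
    (chr z ξ * hat b ξ)))) = _
  rw [h5, integral_integral_swap h3]
  change Complex.re _ = _
  congr 1
  refine integral_congr_ae (.of_forall fun ξ => ?_)
  dsimp only
  rw [fourier_eq_chr, ← integral_mul_const, ← integral_const_mul]
  refine integral_congr_ae (.of_forall fun z => ?_)
  ring

theorem integrable_kernel {k : Plane → ℝ} (hk : Integrable k) (a b : L2) :
    Integrable fun z => k z * inner ℝ a (trans z b) := by
  have h3 := (integrable_chr_mul hk a b).integral_prod_left.re
  refine h3.congr (.of_forall fun z => ?_)
  dsimp only
  rw [inner_trans, integral_const_mul]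
  exact Complex.re_ofReal_mul _ _

theorem inner_trans_eq_integral (a b : L2) (z : Plane) :
    inner ℝ a (trans z b) = ∫ x, a x * b (x - z) := by
  rw [inner_eq_integral]
  refine integral_congr_ae ?_
  filter_upwards [coeFn_trans z b] with x h
  rw [h]

/-! ### Gaussian kernels -/

/-- The standard Gaussian. -/
def gauss (z : Plane) : ℝ := Real.exp (-Real.pi * ‖z‖ ^ 2)

/-- Majorant of the Gaussian kernels. -/
def wide (z : Plane) : ℝ := Real.exp (-(Real.pi / 2) * ‖z‖ ^ 2)

theorem integrable_exp_neg_sq {b : ℝ} (hb : 0 < b) :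
    Integrable fun z : Plane => Real.exp (-b * ‖z‖ ^ 2) := by
  have h := GaussianFourier.integrable_cexp_neg_mul_sq_norm_add (V := Plane) (b := (b : ℂ))
    (by simpa using hb) 0 0
  refine h.norm.congr (.of_forall fun z => ?_)
  simp [Complex.norm_exp, ← Complex.ofReal_pow]

/-- `C¹` functions dominated, with their derivative, by a Gaussian. -/
structure GaussKernel (F : Plane → ℝ) (C : ℝ) : Prop where
  smooth : ContDiff ℝ 1 F
  bound : ∀ z, |F z| ≤ C * wide z
  bound_fderiv : ∀ z, ‖fderiv ℝ F z‖ ≤ C * wide z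

theorem integrable_wide : Integrable wide := integrable_exp_neg_sq (by positivity)

namespace GaussKernel

variable {F : Plane → ℝ} {C : ℝ}

theorem integrable (h : GaussKernel F C) : Integrable F :=
  (integrable_wide.const_mul C).mono' h.smooth.continuous.aestronglyMeasurable
    (.of_forall h.bound)

theorem integrable_fderiv (h : GaussKernel F C) : Integrable (fderiv ℝ F) :=
  (integrable_wide.const_mul C).mono'
    (h.smooth.continuous_fderiv one_ne_zero).aestronglyMeasurable (.of_forall h.bound_fderiv)

theorem nonneg (h : GaussKernel F C) : 0 ≤ C := by
  have := (abs_nonneg _).trans (h.bound 0)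
  have h2 : 0 < wide 0 := Real.exp_pos _
  exact nonneg_of_mul_nonneg_left this h2

/-- Fourier transform of a directional derivative. -/
theorem fourier_fderiv_apply (h : GaussKernel F C) (v ξ : Plane) :
    𝓕 (fun z => ((fderiv ℝ F z v : ℝ) : ℂ)) ξ =
      2 * Real.pi * Complex.I * (inner ℝ v ξ : ℝ) * 𝓕 (fun z => (F z : ℂ)) ξ := by
  have hd : ∀ z, HasFDerivAt (fun z => (F z : ℂ)) (Complex.ofRealCLM.comp (fderiv ℝ F z)) z :=
    fun z => Complex.ofRealCLM.hasFDerivAt.comp z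
      ((h.smooth.differentiable one_ne_zero) z).hasFDerivAt
  have hf : fderiv ℝ (fun z => (F z : ℂ)) = fun z => Complex.ofRealCLM.comp (fderiv ℝ F z) :=
    funext fun z => (hd z).fderiv
  have hi : Integrable (fderiv ℝ (fun z => (F z : ℂ))) := by
    rw [hf]
    exact (ContinuousLinearMap.compL ℝ Plane ℝ ℂ Complex.ofRealCLM).integrable_comp
      h.integrable_fderiv
  have hc : Integrable fun z => (F z : ℂ) := h.integrable.ofReal (𝕜 := ℂ)
  have h1 := Real.fourier_fderiv hc
    (fun z => (hd z).differentiableAt) hi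
  have h2 := congrArg (fun L : Plane →L[ℝ] ℂ => L v) (congrFun h1 ξ)
  rw [Real.fourier_continuousLinearMap_apply hi, hf] at h2
  refine h2.trans ?_
  rw [VectorFourier.fourierSMulRight_apply]
  have e : ((-innerSL ℝ : Plane →L[ℝ] Plane →L[ℝ] ℝ) ξ) v = -inner ℝ v ξ := by
    rw [real_inner_comm]; rfl
  rw [e, smul_eq_mul, Complex.real_smul]
  push_cast
  ring

/-- Mean value inequality on the unit ball about z. There ‖z‖² ≤ 2‖y‖² + 2, so the decay rate π/2 at
y survives as the rate π/4 at z. -/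
theorem abs_sub_le (h : GaussKernel F C) {v z : Plane} (hv : ‖v‖ ≤ 1) :
    |F (z - v) - F z| ≤ ‖v‖ * (C * Real.exp (Real.pi / 2) *
      Real.exp (-(Real.pi / 4) * ‖z‖ ^ 2)) := by
  have h1 : ∀ y ∈ Metric.closedBall z 1, ‖fderiv ℝ F y‖ ≤
      C * Real.exp (Real.pi / 2) * Real.exp (-(Real.pi / 4) * ‖z‖ ^ 2) := fun y hy => by
    refine (h.bound_fderiv y).trans ?_
    rw [mul_assoc, wide, ← Real.exp_add]
    refine mul_le_mul_of_nonneg_left (Real.exp_le_exp.2 ?_) h.nonneg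
    have h2 : ‖z‖ ≤ ‖y‖ + 1 := by
      have := norm_sub_norm_le z y
      have h3 : ‖z - y‖ ≤ 1 := by
        rw [← dist_eq_norm, dist_comm]; exact Metric.mem_closedBall.1 hy
      linarith
    have h3 : ‖z‖ ^ 2 ≤ 2 * ‖y‖ ^ 2 + 2 := by nlinarith [norm_nonneg z, sq_nonneg (‖y‖ - 1)]
    nlinarith [Real.pi_pos]
  have h2 := (convex_closedBall z 1).norm_image_sub_le_of_norm_fderiv_le (𝕜 := ℝ)
    (fun y _ => (h.smooth.differentiable one_ne_zero) y) h1
    (Metric.mem_closedBall_self zero_le_one)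
    (show z - v ∈ Metric.closedBall z 1 by simpa [Metric.mem_closedBall, dist_eq_norm] using hv)
  rw [← Real.norm_eq_abs]
  refine h2.trans (le_of_eq ?_)
  rw [mul_comm]; congr 1
  simp

/-- `L¹` modulus of continuity. -/
theorem exists_integral_sub_le (h : GaussKernel F C) : ∃ K : ℝ, 0 ≤ K ∧
    ∀ γ : ℝ, 0 ≤ γ → γ ≤ 1 → ∀ v : Plane, ∫ z, |F (z - v) - F z| ≤ K * ‖v‖ ^ γ := by
  set J : ℝ := ∫ z : Plane, C * Real.exp (Real.pi / 2) * Real.exp (-(Real.pi / 4) * ‖z‖ ^ 2)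
  have hJ : 0 ≤ J := integral_nonneg fun z => mul_nonneg (mul_nonneg h.nonneg (Real.exp_pos _).le)
    (Real.exp_pos _).le
  set N : ℝ := ∫ z, |F z| with hN
  have hN0 : 0 ≤ N := integral_nonneg fun z => abs_nonneg _
  have hint : ∀ v, Integrable fun z => F (z - v) := fun v => h.integrable.comp_sub_right v
  refine ⟨J + 2 * N, by positivity, fun γ hγ hγ' v => ?_⟩
  -- Short shifts use the derivative and ‖v‖ ≤ ‖v‖^γ; long shifts use the triangle inequality and 1
  -- ≤ ‖v‖^γ. The resulting constant is the same for all γ in [0, 1].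
  rcases le_total ‖v‖ 1 with hv | hv
  · have h1 : ∫ z, |F (z - v) - F z| ≤ ‖v‖ * J := by
      rw [← integral_const_mul]
      refine integral_mono ((hint v).sub h.integrable).abs ?_ fun z => h.abs_sub_le hv
      exact ((integrable_exp_neg_sq (by positivity)).const_mul _).const_mul _
    have h2 : ‖v‖ ≤ ‖v‖ ^ γ := by
      rcases eq_or_lt_of_le (norm_nonneg v) with h0 | h0
      · rw [← h0]; positivity
      · simpa using Real.rpow_le_rpow_of_exponent_ge h0 hv hγ'
    nlinarith [Real.rpow_nonneg (norm_nonneg v) γ]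
  · have h1 : ∫ z, |F (z - v) - F z| ≤ 2 * N := by
      have h3 : ∫ z, |F (z - v) - F z| ≤ ∫ z, (|F (z - v)| + |F z|) :=
        integral_mono ((hint v).sub h.integrable).abs ((hint v).abs.add h.integrable.abs)
          fun z => abs_sub _ _
      rw [integral_add (hint v).abs h.integrable.abs,
        integral_sub_right_eq_self (fun z => |F z|) v] at h3
      linarith
    have h2 : 1 ≤ ‖v‖ ^ γ := Real.one_le_rpow hv hγ
    nlinarith

end GaussKernel

/-- Coordinate as a continuous linear form. -/
def coordL (i : Fin 2) : Plane →L[ℝ] ℝ := EuclideanSpace.proj i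

theorem coordL_apply (i : Fin 2) (z : Plane) : coordL i z = z i := rfl

theorem abs_coord_le (i : Fin 2) (z : Plane) : |z i| ≤ ‖z‖ := by
  simpa using PiLp.norm_apply_le z i

theorem norm_coordL_le (i : Fin 2) : ‖coordL i‖ ≤ 1 :=
  ContinuousLinearMap.opNorm_le_bound _ zero_le_one fun z => by
    rw [one_mul]; exact abs_coord_le i z

/-! ### The Gaussian, its first two derivatives, and their Fourier transforms -/

theorem hasFDerivAt_gauss (z : Plane) :
    HasFDerivAt gauss ((-2 * Real.pi * gauss z) • innerSL ℝ z) z := by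
  have h := ((hasStrictFDerivAt_norm_sq z).hasFDerivAt.const_mul (-Real.pi)).exp
  refine h.congr_fderiv ?_
  ext v
  simp [gauss]
  ring

/-- First derivatives of the Gaussian. -/
def gauss₁ (i : Fin 2) (z : Plane) : ℝ := -2 * Real.pi * (z i * gauss z)

/-- Second derivatives of the Gaussian. -/
def gauss₂ (i j : Fin 2) (z : Plane) : ℝ :=
  -2 * Real.pi * ((if i = j then 1 else 0) + -2 * Real.pi * (z i * z j)) * gauss z

theorem gauss_nonneg (z : Plane) : 0 ≤ gauss z := (Real.exp_pos _).le

/-- The Gaussian is the square of `wide`, and one of the two factors absorbs the polynomial. -/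
theorem polynomial_mul_gauss_le (z : Plane) : (1 + ‖z‖) ^ 3 * gauss z ≤ 8 * wide z := by
  have h1 : gauss z = wide z * wide z := by
    rw [gauss, wide, ← Real.exp_add]; congr 1; ring
  have h2 : (1 + ‖z‖) ^ 3 * wide z ≤ 8 := by
    have h3 : 1 + ‖z‖ ^ 4 ≤ Real.exp ((Real.pi / 2) * ‖z‖ ^ 2) := by
      have h4 := Real.quadratic_le_exp_of_nonneg (x := (Real.pi / 2) * ‖z‖ ^ 2) (by positivity)
      have h5 : (8 : ℝ) ≤ Real.pi ^ 2 := by nlinarith [Real.pi_gt_three]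
      nlinarith [sq_nonneg (‖z‖ ^ 2), Real.pi_pos, mul_nonneg Real.pi_pos.le (sq_nonneg ‖z‖)]
    have h6 : (1 + ‖z‖) ^ 3 ≤ 8 * (1 + ‖z‖ ^ 4) := by
      have h0 := norm_nonneg z
      nlinarith [sq_nonneg (‖z‖ - 1), sq_nonneg (‖z‖ ^ 2 - 1), sq_nonneg (‖z‖ ^ 2 - ‖z‖),
        mul_nonneg h0 (sq_nonneg (‖z‖ - 1))]
    have h7 : wide z = (Real.exp ((Real.pi / 2) * ‖z‖ ^ 2))⁻¹ := by
      rw [wide, ← Real.exp_neg]; congr 1; ring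
    rw [h7, ← div_eq_mul_inv, div_le_iff₀ (Real.exp_pos _)]
    linarith
  rw [h1, ← mul_assoc]
  exact mul_le_mul_of_nonneg_right h2 (Real.exp_pos _).le

theorem contDiff_gauss : ContDiff ℝ 1 gauss :=
  (contDiff_const.mul (contDiff_norm_sq ℝ)).exp

theorem norm_fderiv_gauss (z : Plane) : ‖fderiv ℝ gauss z‖ ≤ 2 * Real.pi * ‖z‖ * gauss z := by
  rw [(hasFDerivAt_gauss z).fderiv, norm_smul, innerSL_apply_norm, Real.norm_eq_abs, abs_mul,
    abs_mul, abs_of_nonneg (gauss_nonneg z), abs_neg, abs_two, abs_of_pos Real.pi_pos]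
  linarith

/-- Quadratic growth covers the prefactors of all derivatives up to order two. Differentiating the
exponential costs one further power of ‖z‖, whence the cube in `polynomial_mul_gauss_le`. -/
theorem gaussKernel_of_polynomial {P : Plane → ℝ} {K : ℝ} (hP : ContDiff ℝ 1 P)
    (hb : ∀ z, |P z| ≤ K * (1 + ‖z‖) ^ 2) (hb' : ∀ z, ‖fderiv ℝ P z‖ ≤ K * (1 + ‖z‖) ^ 2) :
    GaussKernel (fun z => P z * gauss z) (K * (1 + 2 * Real.pi) * 8) := by
  have hK : 0 ≤ K := by simpa using (abs_nonneg _).trans (hb 0)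
  have key : ∀ z : Plane, K * (1 + 2 * Real.pi) * ((1 + ‖z‖) ^ 3 * gauss z) ≤
      K * (1 + 2 * Real.pi) * 8 * wide z := fun z => by
    rw [mul_assoc _ 8]
    exact mul_le_mul_of_nonneg_left (polynomial_mul_gauss_le z)
      (mul_nonneg hK (by positivity))
  have hpi := Real.pi_pos
  refine ⟨hP.mul contDiff_gauss, fun z => ?_, fun z => ?_⟩
  · refine le_trans ?_ (key z)
    rw [abs_mul, abs_of_nonneg (gauss_nonneg z)]
    have h0 := norm_nonneg z
    have h1 : (1 + ‖z‖) ^ 2 ≤ (1 + 2 * Real.pi) * (1 + ‖z‖) ^ 3 := by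
      have h2 : 1 ≤ (1 + 2 * Real.pi) * (1 + ‖z‖) := by nlinarith
      calc (1 + ‖z‖) ^ 2 = (1 + ‖z‖) ^ 2 * 1 := (mul_one _).symm
        _ ≤ (1 + ‖z‖) ^ 2 * ((1 + 2 * Real.pi) * (1 + ‖z‖)) :=
          mul_le_mul_of_nonneg_left h2 (by positivity)
        _ = _ := by ring
    calc |P z| * gauss z ≤ K * (1 + ‖z‖) ^ 2 * gauss z :=
          mul_le_mul_of_nonneg_right (hb z) (gauss_nonneg z)
      _ ≤ K * ((1 + 2 * Real.pi) * (1 + ‖z‖) ^ 3) * gauss z :=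
          mul_le_mul_of_nonneg_right (mul_le_mul_of_nonneg_left h1 hK) (gauss_nonneg z)
      _ = _ := by ring
  · refine le_trans ?_ (key z)
    have hd := ((hP.differentiable one_ne_zero z).hasFDerivAt).mul
      ((contDiff_gauss.differentiable one_ne_zero z).hasFDerivAt)
    have hd' : fderiv ℝ (fun z => P z * gauss z) z =
      P z • fderiv ℝ gauss z + gauss z • fderiv ℝ P z := hd.fderiv
    rw [hd']
    have h0 := norm_nonneg z
    have hg := gauss_nonneg z
    calc ‖P z • fderiv ℝ gauss z + gauss z • fderiv ℝ P z‖
        ≤ |P z| * ‖fderiv ℝ gauss z‖ + gauss z * ‖fderiv ℝ P z‖ := by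
          refine (norm_add_le _ _).trans (le_of_eq ?_)
          rw [norm_smul, norm_smul, Real.norm_eq_abs, Real.norm_of_nonneg hg]
      _ ≤ K * (1 + ‖z‖) ^ 2 * (2 * Real.pi * ‖z‖ * gauss z) +
          gauss z * (K * (1 + ‖z‖) ^ 2) := by
          refine add_le_add (mul_le_mul (hb z) (norm_fderiv_gauss z) (norm_nonneg _) (by positivity))
            (mul_le_mul_of_nonneg_left (hb' z) hg)
      _ = K * (1 + ‖z‖) ^ 2 * gauss z * (1 + 2 * Real.pi * ‖z‖) := by ring
      _ ≤ K * (1 + ‖z‖) ^ 2 * gauss z * ((1 + 2 * Real.pi) * (1 + ‖z‖)) := by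
          refine mul_le_mul_of_nonneg_left ?_ (by positivity)
          nlinarith
      _ = _ := by ring

theorem gaussKernel_gauss : ∃ C, GaussKernel gauss C := by
  have := gaussKernel_of_polynomial (P := fun _ => 1) (K := 1) contDiff_const
    (fun z => by rw [abs_one]; nlinarith [norm_nonneg z])
    (fun z => by
      rw [fderiv_const_apply, norm_zero]; positivity)
  exact ⟨_, by simpa using this⟩

theorem gaussKernel_gauss₁ (i : Fin 2) : ∃ C, GaussKernel (gauss₁ i) C := by
  have hpi := Real.pi_pos
  have := gaussKernel_of_polynomial (P := fun z => ((-2 * Real.pi) • coordL i) z)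
    (K := 2 * Real.pi) (ContinuousLinearMap.contDiff _) (fun z => ?_) (fun z => ?_)
  · refine ⟨2 * Real.pi * (1 + 2 * Real.pi) * 8, ?_⟩
    convert! this using 2 with z
    simp only [gauss₁, smul_apply, coordL_apply, smul_eq_mul]
    ring
  · simp only [smul_apply, coordL_apply, smul_eq_mul, abs_mul, abs_neg,
      abs_two, abs_of_pos hpi]
    refine mul_le_mul_of_nonneg_left ?_ (by positivity)
    nlinarith [abs_coord_le i z, norm_nonneg z]
  · rw [ContinuousLinearMap.fderiv, norm_smul, Real.norm_eq_abs, abs_mul, abs_neg, abs_two,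
      abs_of_pos hpi]
    refine mul_le_mul_of_nonneg_left ((norm_coordL_le i).trans ?_) (by positivity)
    nlinarith [norm_nonneg z]

theorem gaussKernel_gauss₂ (i j : Fin 2) : ∃ C, GaussKernel (gauss₂ i j) C := by
  have hpi := Real.pi_pos
  set P : Plane → ℝ := fun z => -2 * Real.pi * ((if i = j then 1 else 0) +
    -2 * Real.pi * (coordL i z * coordL j z)) with hPdef
  have hd : ∀ z, HasFDerivAt P ((-2 * Real.pi) • ((-2 * Real.pi) •
      (coordL i z • coordL j + coordL j z • coordL i))) z := fun z => by
    have h1 := ((coordL i).hasFDerivAt (x := z)).mul ((coordL j).hasFDerivAt (x := z))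
    exact ((h1.const_mul (-2 * Real.pi)).const_add _).const_mul (-2 * Real.pi)
  have := gaussKernel_of_polynomial (P := P) (K := 8 * Real.pi ^ 2 + 2 * Real.pi)
    ?_ (fun z => ?_) (fun z => ?_)
  · exact ⟨_, this⟩
  · exact contDiff_const.mul (contDiff_const.add (contDiff_const.mul
      ((coordL i).contDiff.mul (coordL j).contDiff)))
  · have h1 : |(if i = j then (1 : ℝ) else 0)| ≤ 1 := by split_ifs <;> simp
    have h2 : |coordL i z * coordL j z| ≤ ‖z‖ ^ 2 := by
      rw [abs_mul, sq]
      exact mul_le_mul (abs_coord_le i z) (abs_coord_le j z) (abs_nonneg _) (norm_nonneg _)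
    simp only [hPdef, abs_mul (-2 * Real.pi), abs_neg, abs_two, abs_mul (-2) Real.pi,
      abs_of_pos hpi]
    have h3 := abs_add_le (if i = j then (1 : ℝ) else 0) (-2 * Real.pi * (coordL i z * coordL j z))
    rw [abs_mul (-2 * Real.pi), abs_mul (-2) Real.pi, abs_neg, abs_two, abs_of_pos hpi] at h3
    have h4 : |(if i = j then (1 : ℝ) else 0) + -2 * Real.pi * (coordL i z * coordL j z)| ≤
        1 + 2 * Real.pi * ‖z‖ ^ 2 := by
      have := mul_le_mul_of_nonneg_left h2 (by positivity : 0 ≤ 2 * Real.pi)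
      linarith
    have h5 := mul_le_mul_of_nonneg_left h4 (by positivity : 0 ≤ 2 * Real.pi)
    have h0 := norm_nonneg z
    nlinarith [mul_nonneg hpi.le h0, mul_nonneg (sq_nonneg Real.pi) h0,
      mul_nonneg (sq_nonneg Real.pi) (sq_nonneg ‖z‖), mul_nonneg hpi.le (sq_nonneg ‖z‖),
      sq_nonneg Real.pi]
  · rw [(hd z).fderiv, norm_smul, norm_smul, Real.norm_eq_abs, abs_mul, abs_neg, abs_two,
      abs_of_pos hpi]
    have h0 := norm_nonneg z
    have h1 : ‖coordL i z • coordL j + coordL j z • coordL i‖ ≤ 2 * ‖z‖ := by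
      refine (norm_add_le _ _).trans ?_
      rw [norm_smul, norm_smul, Real.norm_eq_abs, Real.norm_eq_abs]
      have := mul_le_mul (abs_coord_le i z) (norm_coordL_le j) (norm_nonneg _) h0
      have := mul_le_mul (abs_coord_le j z) (norm_coordL_le i) (norm_nonneg _) h0
      simp only [coordL_apply]
      linarith
    have h5 := mul_le_mul_of_nonneg_left h1 (by positivity : 0 ≤ 2 * Real.pi * (2 * Real.pi))
    nlinarith [mul_nonneg hpi.le h0, mul_nonneg (sq_nonneg Real.pi) h0,
      mul_nonneg (sq_nonneg Real.pi) (sq_nonneg ‖z‖), mul_nonneg hpi.le (sq_nonneg ‖z‖),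
      sq_nonneg Real.pi]

theorem fourier_gauss (ξ : Plane) :
    𝓕 (fun z : Plane => (gauss z : ℂ)) ξ = (gauss ξ : ℂ) := by
  have h := fourier_gaussian_innerProductSpace (V := Plane) (b := (Real.pi : ℂ))
    (by simpa using Real.pi_pos) ξ
  have e1 : (fun z : Plane => (gauss z : ℂ)) =
      fun v : Plane => Complex.exp (-(Real.pi : ℂ) * ‖v‖ ^ 2) := by
    funext z; simp [gauss]
  rw [e1, h, div_self (by exact_mod_cast Real.pi_ne_zero), Complex.one_cpow, one_mul]
  simp only [gauss, Complex.ofReal_exp]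
  congr 1
  push_cast
  field_simp [Complex.ofReal_ne_zero.2 Real.pi_ne_zero]

theorem fderiv_gauss_single (i : Fin 2) (z : Plane) :
    fderiv ℝ gauss z (EuclideanSpace.single i 1) = gauss₁ i z := by
  rw [(hasFDerivAt_gauss z).fderiv]
  simp [gauss₁, EuclideanSpace.inner_single_right]
  ring

theorem fderiv_gauss₁_single (i j : Fin 2) (z : Plane) :
    fderiv ℝ (gauss₁ i) z (EuclideanSpace.single j 1) = gauss₂ i j z := by
  have h1 := (((coordL i).hasFDerivAt (x := z)).mul (hasFDerivAt_gauss z)).const_mul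
    (-2 * Real.pi)
  have h2 : HasFDerivAt (gauss₁ i) _ z := h1
  rw [h2.fderiv]
  simp [gauss₂, EuclideanSpace.inner_single_right, coordL]
  rcases eq_or_ne i j with rfl | hij
  · simp; ring
  · simp [hij]; ring

theorem inner_single (i : Fin 2) (ξ : Plane) :
    inner ℝ (EuclideanSpace.single i (1 : ℝ)) ξ = ξ i := by
  simp [EuclideanSpace.inner_single_left]

/-- Symbol of `∂ᵢ` in Mathlib's frequency variable. -/
def dsym (i : Fin 2) (ξ : Plane) : ℂ := 2 * Real.pi * Complex.I * (ξ i : ℝ)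

theorem fourier_gauss₁ (i : Fin 2) (ξ : Plane) :
    𝓕 (fun z : Plane => (gauss₁ i z : ℂ)) ξ = dsym i ξ * (gauss ξ : ℂ) := by
  obtain ⟨C, hC⟩ := gaussKernel_gauss
  have h := hC.fourier_fderiv_apply (EuclideanSpace.single i 1) ξ
  simp only [fderiv_gauss_single] at h
  rw [h, fourier_gauss, inner_single, dsym]

theorem fourier_gauss₂ (i j : Fin 2) (ξ : Plane) :
    𝓕 (fun z : Plane => (gauss₂ i j z : ℂ)) ξ = dsym j ξ * dsym i ξ * (gauss ξ : ℂ) := by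
  obtain ⟨C, hC⟩ := gaussKernel_gauss₁ i
  have h := hC.fourier_fderiv_apply (EuclideanSpace.single j 1) ξ
  simp only [fderiv_gauss₁_single] at h
  rw [h, fourier_gauss₁, inner_single, dsym, dsym]
  ring

/-! ### Dilated kernels and the heat operators -/

/-- Dilation of a kernel to parabolic scale `s`. -/
def dil (F : Plane → ℝ) (s : ℝ) (z : Plane) : ℝ := s⁻¹ * F ((Real.sqrt s)⁻¹ • z)

/-- In the plane the Jacobian of z ↦ √s z is s, which the factor s⁻¹ in `dil` compensates; dilation
thus preserves the `L¹` norm and the total mass. -/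
theorem integral_dil_mul {E : Type*} [NormedAddCommGroup E] [NormedSpace ℝ E]
    (F : Plane → ℝ) {s : ℝ} (hs : 0 < s) (h : Plane → E) :
    ∫ z, dil F s z • h z = ∫ z, F z • h (Real.sqrt s • z) := by
  have h1 := Measure.integral_comp_inv_smul (volume : Measure Plane)
    (fun z => F z • h (Real.sqrt s • z)) (Real.sqrt s)
  have h0 : Real.sqrt s ≠ 0 := (Real.sqrt_pos.2 hs).ne'
  simp only [smul_inv_smul₀ h0, finrank_euclideanSpace, Fintype.card_fin,
    Real.sq_sqrt hs.le, abs_of_pos hs] at h1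
  simp only [dil, mul_smul]
  rw [integral_smul, h1, inv_smul_smul₀ hs.ne']

theorem integrable_dil {F : Plane → ℝ} (hF : Integrable F) {s : ℝ} (hs : 0 < s) :
    Integrable (dil F s) :=
  (hF.comp_smul (inv_ne_zero (Real.sqrt_pos.2 hs).ne')).const_mul _

theorem fourier_dil (F : Plane → ℝ) {s : ℝ} (hs : 0 < s) (ξ : Plane) :
    𝓕 (fun z => (dil F s z : ℂ)) ξ = 𝓕 (fun z => (F z : ℂ)) (Real.sqrt s • ξ) := by
  rw [fourier_eq_chr, fourier_eq_chr]
  have := integral_dil_mul F hs (fun z => chr z ξ)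
  simp only [Complex.real_smul] at this
  simp_rw [mul_comm (chr _ _)]
  rw [this]
  refine integral_congr_ae (.of_forall fun z => ?_)
  simp only [chr, real_inner_smul_left, real_inner_smul_right]

/-- Symbol of the heat operator at time `s`. -/
def heat (s : ℝ) (ξ : Plane) : ℂ := (Real.exp (-Real.pi * s * ‖ξ‖ ^ 2) : ℝ)

theorem gauss_sqrt_smul {s : ℝ} (hs : 0 < s) (ξ : Plane) :
    (gauss (Real.sqrt s • ξ) : ℂ) = heat s ξ := by
  rw [gauss, heat, norm_smul, mul_pow, Real.norm_of_nonneg (Real.sqrt_nonneg _),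
    Real.sq_sqrt hs.le, mul_assoc]

theorem dsym_sqrt_smul (s : ℝ) (i : Fin 2) (ξ : Plane) :
    dsym i (Real.sqrt s • ξ) = (Real.sqrt s : ℂ) * dsym i ξ := by
  simp [dsym]; ring

open Classical in
/-- The multiplier operator with symbol `m` (in Mathlib's frequency variable). -/
def op (m : Plane → ℂ) (f : L2) : L2 := if h : ∃ g, HasMult m f g then h.choose else 0

theorem hasMult_op {m : Plane → ℂ} {f : L2} (h : ∃ g, HasMult m f g) : HasMult m f (op m f) := by
  rw [op, dif_pos h]; exact h.choose_spec

theorem heat_eq (s : ℝ) (ξ : Plane) : heat s ξ = (Real.exp (-Real.pi * s * ‖ξ‖ ^ 2) : ℝ) := rfl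

theorem measurable_heat : Measurable fun p : ℝ × Plane => heat p.1 p.2 := by
  unfold heat
  exact (by fun_prop : Continuous fun p : ℝ × Plane =>
    ((Real.exp (-Real.pi * p.1 * ‖p.2‖ ^ 2) : ℝ) : ℂ)).measurable

theorem realSymbol_heat (s : ℝ) : RealSymbol (heat s) :=
  ⟨measurable_heat.comp measurable_prodMk_left, fun ξ => by simp only [heat, norm_neg,
    Complex.conj_ofReal]⟩

theorem continuous_dsym (i : Fin 2) : Continuous (dsym i) := by
  unfold dsym
  exact continuous_const.mul (Complex.continuous_ofReal.comp (coordL i).continuous)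

theorem realSymbol_dsym (i : Fin 2) : RealSymbol (dsym i) :=
  ⟨(continuous_dsym i).measurable, fun ξ => by simp [dsym, map_ofNat]⟩

theorem norm_dsym_le (i : Fin 2) (ξ : Plane) : ‖dsym i ξ‖ ≤ 2 * Real.pi * ‖ξ‖ := by
  rw [dsym, norm_mul, norm_mul, norm_mul, Complex.norm_I, mul_one, Complex.norm_real,
    Complex.norm_real, Complex.norm_ofNat, Real.norm_of_nonneg Real.pi_pos.le, Real.norm_eq_abs]
  exact mul_le_mul_of_nonneg_left (abs_coord_le i ξ) (by positivity)

theorem conj_dsym (i : Fin 2) (ξ : Plane) : (starRingEnd ℂ) (dsym i ξ) = -dsym i ξ := by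
  simp [dsym, map_ofNat]

theorem RealSymbol.mul {m n : Plane → ℂ} (hm : RealSymbol m) (hn : RealSymbol n) :
    RealSymbol fun ξ => m ξ * n ξ :=
  ⟨hm.meas.mul hn.meas, fun ξ => by rw [hm.herm, hn.herm, map_mul]⟩

theorem norm_heat_le {s : ℝ} (hs : 0 ≤ s) (ξ : Plane) : ‖heat s ξ‖ ≤ 1 := by
  rw [heat, Complex.norm_real, Real.norm_of_nonneg (Real.exp_pos _).le]
  exact Real.exp_le_one_iff.2 (by
    have := mul_nonneg (mul_nonneg Real.pi_pos.le hs) (sq_nonneg ‖ξ‖); linarith)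

/-- This identity and the next two pass from the frequency side, where the operators of the system
are defined, to integrals over translates, where pointwise inequalities can be used. Each derivative
costs a factor s^{-1/2}. -/
theorem heat_pairing {s : ℝ} (hs : 0 < s) (a b : L2) :
    (∫ ξ, (starRingEnd ℂ) (hat a ξ) * (heat s ξ * hat b ξ)).re =
      ∫ z, dil gauss s z * inner ℝ a (trans z b) := by
  obtain ⟨C, hC⟩ := gaussKernel_gauss
  rw [integral_kernel (integrable_dil hC.integrable hs)]
  simp only [fourier_dil gauss hs, fourier_gauss, gauss_sqrt_smul hs]

theorem heat_pairing₁ {s : ℝ} (hs : 0 < s) (i : Fin 2) (a b : L2) :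
    (∫ ξ, (starRingEnd ℂ) (hat a ξ) * (dsym i ξ * heat s ξ * hat b ξ)).re =
      (Real.sqrt s)⁻¹ * ∫ z, dil (gauss₁ i) s z * inner ℝ a (trans z b) := by
  obtain ⟨C, hC⟩ := gaussKernel_gauss₁ i
  have h0 : (Real.sqrt s : ℂ) ≠ 0 := Complex.ofReal_ne_zero.2 (Real.sqrt_pos.2 hs).ne'
  rw [integral_kernel (integrable_dil hC.integrable hs), ← Complex.re_ofReal_mul,
    ← integral_const_mul]
  simp only [fourier_dil (gauss₁ i) hs, fourier_gauss₁, gauss_sqrt_smul hs, dsym_sqrt_smul]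
  congr 1
  refine integral_congr_ae (.of_forall fun ξ => ?_)
  push_cast
  field_simp

theorem heat_pairing₂ {s : ℝ} (hs : 0 < s) (i j : Fin 2) (a b : L2) :
    (∫ ξ, (starRingEnd ℂ) (hat a ξ) * (dsym j ξ * dsym i ξ * heat s ξ * hat b ξ)).re =
      s⁻¹ * ∫ z, dil (gauss₂ i j) s z * inner ℝ a (trans z b) := by
  obtain ⟨C, hC⟩ := gaussKernel_gauss₂ i j
  have h0 : (s : ℂ) ≠ 0 := Complex.ofReal_ne_zero.2 hs.ne'
  have h1 : (Real.sqrt s : ℂ) * (Real.sqrt s : ℂ) = s := by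
    rw [← Complex.ofReal_mul, Real.mul_self_sqrt hs.le]
  rw [integral_kernel (integrable_dil hC.integrable hs), ← Complex.re_ofReal_mul,
    ← integral_const_mul]
  simp only [fourier_dil (gauss₂ i j) hs, fourier_gauss₂, gauss_sqrt_smul hs, dsym_sqrt_smul]
  congr 1
  refine integral_congr_ae (.of_forall fun ξ => ?_)
  dsimp only
  rw [show (Real.sqrt s : ℂ) * dsym j ξ * ((Real.sqrt s : ℂ) * dsym i ξ) * heat s ξ * hat b ξ =
    ((Real.sqrt s : ℂ) * (Real.sqrt s : ℂ)) * (dsym j ξ * dsym i ξ * heat s ξ * hat b ξ) by ring,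
    h1]
  push_cast
  field_simp

/-! ### Superpositions of heat symbols -/

/-- Fubini for superpositions of real symbols. -/
theorem superposition {w : ℝ → ℝ} {φ : ℝ → Plane → ℝ} {m : Plane → ℝ} {H : Plane → ℂ}
    (hw : Measurable w) (hφ : Measurable fun p : ℝ × Plane => φ p.1 p.2)
    (hw0 : ∀ s ∈ Ioi (0 : ℝ), 0 ≤ w s) (hφ0 : ∀ s ∈ Ioi (0 : ℝ), ∀ ξ, 0 ≤ φ s ξ)
    (hint : ∀ᵐ ξ : Plane, IntegrableOn (fun s => w s * φ s ξ) (Ioi 0))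
    (hm : ∀ᵐ ξ : Plane, ∫ s in Ioi 0, w s * φ s ξ = m ξ)
    (hH : AEStronglyMeasurable H) (hHm : Integrable fun ξ => (m ξ : ℂ) * H ξ) :
    IntegrableOn (fun s => (w s : ℂ) * ∫ ξ, (φ s ξ : ℂ) * H ξ) (Ioi 0) ∧
      ∫ s in Ioi 0, (w s : ℂ) * ∫ ξ, (φ s ξ : ℂ) * H ξ = ∫ ξ, (m ξ : ℂ) * H ξ := by
  set μ := (volume : Measure ℝ).restrict (Ioi 0) with hμ
  have hK : Integrable (fun p : ℝ × Plane => (w p.1 : ℂ) * ((φ p.1 p.2 : ℂ) * H p.2))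
      (μ.prod volume) := by
    have hmeas : AEStronglyMeasurable
        (fun p : ℝ × Plane => (w p.1 : ℂ) * ((φ p.1 p.2 : ℂ) * H p.2)) (μ.prod volume) := by
      refine AEStronglyMeasurable.mul ?_ (AEStronglyMeasurable.mul ?_ ?_)
      · exact (Complex.measurable_ofReal.comp (hw.comp measurable_fst)).aestronglyMeasurable
      · exact (Complex.measurable_ofReal.comp hφ).aestronglyMeasurable
      · exact hH.comp_snd
    refine (integrable_prod_iff' hmeas).2 ⟨?_, ?_⟩
    · filter_upwards [hint] with ξ hξ
      have h1 : Integrable (fun s => ((w s * φ s ξ : ℝ) : ℂ)) μ := hξ.ofReal (𝕜 := ℂ)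
      refine (h1.mul_const (H ξ)).congr (.of_forall fun s => ?_)
      push_cast; ring
    · refine hHm.norm.congr ?_
      filter_upwards [hm] with ξ hξ
      have h0 : 0 ≤ m ξ := by
        rw [← hξ]
        exact setIntegral_nonneg measurableSet_Ioi fun s hs => mul_nonneg (hw0 s hs) (hφ0 s hs ξ)
      rw [norm_mul, Complex.norm_real, Real.norm_of_nonneg h0, ← hξ, ← integral_mul_const]
      refine setIntegral_congr_fun measurableSet_Ioi fun s hs => ?_
      simp only [norm_mul, Complex.norm_real, Real.norm_of_nonneg (hw0 s hs),
        Real.norm_of_nonneg (hφ0 s hs ξ)]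
      ring
  have e : ∀ s, (w s : ℂ) * ∫ ξ, (φ s ξ : ℂ) * H ξ = ∫ ξ, (w s : ℂ) * ((φ s ξ : ℂ) * H ξ) :=
    fun s => (integral_const_mul _ _).symm
  simp_rw [e]
  refine ⟨hK.integral_prod_left, ?_⟩
  rw [integral_integral_swap hK]
  refine integral_congr_ae ?_
  filter_upwards [hm] with ξ hξ
  rw [← hξ]
  have h2 := integral_complex_ofReal (μ := μ) (f := fun s => w s * φ s ξ)
  rw [← h2, ← integral_mul_const]
  refine integral_congr_ae (.of_forall fun s => ?_)
  push_cast; ring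

theorem ae_norm_pos : ∀ᵐ ξ : Plane, 0 < ‖ξ‖ := by
  have : ∀ᵐ ξ : Plane, ξ ≠ 0 := by
    simp [ae_iff, measure_singleton]
  filter_upwards [this] with ξ h using norm_pos_iff.2 h

/-- `∫₀^∞ s^{a-1} e^{-π s x²} ds = Γ(a) π^{-a} x^{-2a}`. -/
theorem gamma_integral {a x : ℝ} (ha : 0 < a) (hx : 0 < x) :
    IntegrableOn (fun s => s ^ (a - 1) * Real.exp (-Real.pi * s * x ^ 2)) (Ioi 0) ∧
      ∫ s in Ioi 0, s ^ (a - 1) * Real.exp (-Real.pi * s * x ^ 2) =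
        (Real.Gamma a * Real.pi ^ (-a)) * x ^ (-(2 * a)) := by
  have hr : 0 < Real.pi * x ^ 2 := by positivity
  have e : ∀ s, s ^ (a - 1) * Real.exp (-Real.pi * s * x ^ 2) =
      s ^ (a - 1) * Real.exp (-((Real.pi * x ^ 2) * s)) := fun s => by
    congr 2; ring
  have hval : ∫ s in Ioi 0, s ^ (a - 1) * Real.exp (-((Real.pi * x ^ 2) * s)) =
      (Real.Gamma a * Real.pi ^ (-a)) * x ^ (-(2 * a)) := by
    rw [Real.integral_rpow_mul_exp_neg_mul_Ioi ha hr, one_div,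
      Real.inv_rpow hr.le, ← Real.rpow_neg hr.le, Real.mul_rpow Real.pi_pos.le (sq_nonneg x),
      ← Real.rpow_natCast x 2, ← Real.rpow_mul hx.le]
    push_cast
    rw [show (2 : ℝ) * -a = -(2 * a) by ring]; ring
  simp_rw [e]
  refine ⟨?_, hval⟩
  -- The Bochner integral of a non-integrable function is 0, whereas the value just computed is
  -- positive; integrability follows from the value.
  by_contra hcon
  rw [integral_undef hcon] at hval
  have : 0 < (Real.Gamma a * Real.pi ^ (-a)) * x ^ (-(2 * a)) := by
    have := Real.Gamma_pos_of_pos ha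
    positivity
  linarith

/-- The constant in the heat representation of `|ξ|^{2a}`. -/
def stableConst (a : ℝ) : ℝ := ∫ s in Ioi (0 : ℝ), s ^ (-1 - a) * (1 - Real.exp (-s))

theorem one_sub_exp_nonneg {s : ℝ} (hs : 0 ≤ s) : 0 ≤ 1 - Real.exp (-s) :=
  sub_nonneg.2 (Real.exp_le_one_iff.2 (by linarith))

/-- Near 0 the bound 1 - e^{-s} ≤ s leaves s^{-a}, integrable because a < 1; at infinity the factor
is at most 1 and s^{-1-a} is integrable because a > 0. -/
theorem integrableOn_stable {a : ℝ} (ha : 0 < a) (ha' : a < 1) :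
    IntegrableOn (fun s : ℝ => s ^ (-1 - a) * (1 - Real.exp (-s))) (Ioi 0) := by
  have hmeas : ∀ μ : Measure ℝ,
      AEStronglyMeasurable (fun s : ℝ => s ^ (-1 - a) * (1 - Real.exp (-s))) μ := fun μ => by
    exact (by fun_prop : Measurable fun s : ℝ =>
      s ^ (-1 - a) * (1 - Real.exp (-s))).aestronglyMeasurable
  rw [← Ioc_union_Ioi_eq_Ioi (zero_le_one' ℝ)]
  refine IntegrableOn.union ?_ ?_
  · have h1 : IntegrableOn (fun s : ℝ => s ^ (-a)) (Ioc 0 1) := by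
      have := intervalIntegral.intervalIntegrable_rpow' (a := 0) (b := 1) (r := -a) (by linarith)
      rwa [intervalIntegrable_iff_integrableOn_Ioc_of_le zero_le_one] at this
    refine h1.mono' (hmeas _) ?_
    filter_upwards [ae_restrict_mem measurableSet_Ioc] with s hs
    have h0 := one_sub_exp_nonneg hs.1.le
    rw [Real.norm_of_nonneg (mul_nonneg (Real.rpow_nonneg hs.1.le _) h0)]
    have h2 : 1 - Real.exp (-s) ≤ s := by linarith [Real.add_one_le_exp (-s)]
    calc s ^ (-1 - a) * (1 - Real.exp (-s)) ≤ s ^ (-1 - a) * s :=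
          mul_le_mul_of_nonneg_left h2 (Real.rpow_nonneg hs.1.le _)
      _ = s ^ (-a) := by
          rw [← Real.rpow_add_one hs.1.ne']; congr 1; ring
  · have h1 : IntegrableOn (fun s : ℝ => s ^ (-1 - a)) (Ioi 1) :=
      integrableOn_Ioi_rpow_of_lt (by linarith) one_pos
    refine h1.mono' (hmeas _) ?_
    filter_upwards [ae_restrict_mem measurableSet_Ioi] with s hs
    have hs0 : (0 : ℝ) < s := one_pos.trans hs
    have h0 := one_sub_exp_nonneg hs0.le
    rw [Real.norm_of_nonneg (mul_nonneg (Real.rpow_nonneg hs0.le _) h0)]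
    exact mul_le_of_le_one_right (Real.rpow_nonneg hs0.le _) (by linarith [Real.exp_pos (-s)])

theorem stableConst_pos {a : ℝ} (ha : 0 < a) (ha' : a < 1) : 0 < stableConst a := by
  have h1 := integrableOn_stable ha ha'
  rw [stableConst, setIntegral_pos_iff_support_of_nonneg_ae _ h1]
  · have : Ioi (0 : ℝ) ⊆ Function.support (fun s : ℝ => s ^ (-1 - a) * (1 - Real.exp (-s))) ∩
        Ioi 0 := fun s hs => by
      refine ⟨?_, hs⟩
      have h2 : 0 < 1 - Real.exp (-s) := sub_pos.2 (by
        have : (0 : ℝ) < s := hs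
        rw [← Real.exp_zero]
        exact Real.exp_lt_exp.2 (by linarith))
      exact (mul_pos (Real.rpow_pos_of_pos hs _) h2).ne'
    exact lt_of_lt_of_le (by simp) (measure_mono this)
  · filter_upwards [ae_restrict_mem measurableSet_Ioi] with s hs
    exact mul_nonneg (Real.rpow_nonneg (le_of_lt hs) _) (one_sub_exp_nonneg (le_of_lt hs))

theorem stable_integral {a x : ℝ} (ha : 0 < a) (ha' : a < 1) (hx : 0 < x) :
    IntegrableOn (fun s => s ^ (-1 - a) * (1 - Real.exp (-Real.pi * s * x ^ 2))) (Ioi 0) ∧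
      ∫ s in Ioi 0, s ^ (-1 - a) * (1 - Real.exp (-Real.pi * s * x ^ 2)) =
        (stableConst a * Real.pi ^ a) * x ^ (2 * a) := by
  set r : ℝ := Real.pi * x ^ 2 with hr
  have hr0 : 0 < r := by positivity
  have e : ∀ s ∈ Ioi (0 : ℝ), r ^ (1 + a) * ((r * s) ^ (-1 - a) * (1 - Real.exp (-(r * s)))) =
      s ^ (-1 - a) * (1 - Real.exp (-Real.pi * s * x ^ 2)) := fun s hs => by
    rw [Real.mul_rpow hr0.le (le_of_lt hs), ← mul_assoc, ← mul_assoc, ← Real.rpow_add hr0,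
      show (1 + a + (-1 - a)) = 0 by ring, Real.rpow_zero, one_mul]
    congr 3; rw [hr]; ring
  have h1 : IntegrableOn (fun s : ℝ => (r * s) ^ (-1 - a) * (1 - Real.exp (-(r * s)))) (Ioi 0) := by
    have := (integrableOn_Ioi_comp_mul_left_iff
      (fun s : ℝ => s ^ (-1 - a) * (1 - Real.exp (-s))) 0 hr0).2
      (by rw [mul_zero]; exact integrableOn_stable ha ha')
    exact this
  refine ⟨IntegrableOn.congr_fun (h1.const_mul (r ^ (1 + a))) e measurableSet_Ioi, ?_⟩
  rw [← setIntegral_congr_fun measurableSet_Ioi e, integral_const_mul,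
    integral_comp_mul_left_Ioi (fun s : ℝ => s ^ (-1 - a) * (1 - Real.exp (-s))) 0 hr0, mul_zero]
  have e2 : r ^ (1 + a) * (r⁻¹ * stableConst a) = r ^ a * stableConst a := by
    rw [Real.rpow_add hr0, Real.rpow_one]; field_simp
  rw [← stableConst, smul_eq_mul, e2, hr,
    Real.mul_rpow Real.pi_pos.le (sq_nonneg x), ← Real.rpow_natCast x 2, ← Real.rpow_mul hx.le]
  push_cast
  ring

/-! ### Homogeneous Sobolev classes -/

/-- The symbol `|ξ|^s`. -/
def rad (s : ℝ) (ξ : Plane) : ℂ := (‖ξ‖ ^ s : ℝ)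

theorem realSymbol_rad (s : ℝ) : RealSymbol (rad s) :=
  ⟨Complex.measurable_ofReal.comp (measurable_norm.pow_const s), fun ξ => by simp [rad]⟩

theorem conj_rad (s : ℝ) (ξ : Plane) : (starRingEnd ℂ) (rad s ξ) = rad s ξ :=
  Complex.conj_ofReal _

theorem norm_rad (s : ℝ) (ξ : Plane) : ‖rad s ξ‖ = ‖ξ‖ ^ s := by
  rw [rad, Complex.norm_real, Real.norm_of_nonneg (Real.rpow_nonneg (norm_nonneg _) _)]

theorem rad_mul_rad {s t : ℝ} {ξ : Plane} (h : 0 < ‖ξ‖) : rad s ξ * rad t ξ = rad (s + t) ξ := by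
  simp only [rad]
  rw [← Complex.ofReal_mul, ← Real.rpow_add h]

/-- `f` has `s` derivatives in `L²`. -/
def InH (s : ℝ) (f : L2) : Prop := ∃ g, HasMult (rad s) f g

/-- `|D|^s f` (in Mathlib's frequency variable). -/
def absD (s : ℝ) (f : L2) : L2 := op (rad s) f

theorem InH.hasMult {s : ℝ} {f : L2} (h : InH s f) : HasMult (rad s) f (absD s f) := hasMult_op h

theorem inH_of_memLp {s : ℝ} {f : L2}
    (h : MemLp (fun ξ => rad s ξ * hat f ξ) 2 (volume : Measure Plane)) : InH s f :=
  exists_hasMult (realSymbol_rad s).herm h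

theorem InH.sub {s : ℝ} {f g : L2} (hf : InH s f) (hg : InH s g) : InH s (f - g) :=
  ⟨_, hf.hasMult.sub hg.hasMult⟩

/-- Symbols dominated by `A + B |ξ|^s` act on `H^s`. -/
theorem InH.exists_hasMult {s A B : ℝ} {f : L2} (hf : InH s f) {m : Plane → ℂ}
    (hm : RealSymbol m) (hA : 0 ≤ A) (hB : 0 ≤ B)
    (hb : ∀ ξ : Plane, 0 < ‖ξ‖ → ‖m ξ‖ ≤ A + B * ‖ξ‖ ^ s) :
    ∃ g, HasMult m f g ∧ ‖g‖ ≤ A * ‖f‖ + B * ‖absD s f‖ := by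
  have h1 := hf.hasMult
  have hG : MemLp (fun ξ => (A * ‖hat f ξ‖ + B * ‖hat (absD s f) ξ‖ : ℝ)) 2
      (volume : Measure Plane) :=
    ((Lp.memLp (hat f)).norm.const_mul A).add ((Lp.memLp (hat (absD s f))).norm.const_mul B)
  have hle : ∀ᵐ ξ : Plane, ‖m ξ * hat f ξ‖ ≤ A * ‖hat f ξ‖ + B * ‖hat (absD s f) ξ‖ := by
    filter_upwards [h1, ae_norm_pos] with ξ a b
    rw [a, norm_mul, norm_mul, norm_rad, ← mul_assoc, ← add_mul]
    exact mul_le_mul_of_nonneg_right (hb ξ b) (norm_nonneg _)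
  have hmem : MemLp (fun ξ => m ξ * hat f ξ) 2 (volume : Measure Plane) :=
    hG.mono' (hm.meas.aestronglyMeasurable.mul (Lp.aestronglyMeasurable _)) hle
  obtain ⟨g, hg⟩ := Boussinesq.exists_hasMult hm.herm hmem
  refine ⟨g, hg, ?_⟩
  rw [← norm_hat g, ← norm_hat f, ← norm_hat (absD s f)]
  have e1 : ‖hat g‖ ≤ ‖hG.toLp‖ := by
    refine Lp.norm_le_norm_of_ae_le ?_
    filter_upwards [hg, hle, hG.coeFn_toLp] with ξ a b c
    rw [a, c]
    exact b.trans (le_abs_self _)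
  refine e1.trans ?_
  have e2 : hG.toLp = A • ((Lp.memLp (hat f)).norm.toLp : L2) +
      B • ((Lp.memLp (hat (absD s f))).norm.toLp : L2) := rfl
  rw [e2]
  refine (norm_add_le _ _).trans (le_of_eq ?_)
  rw [norm_smul, norm_smul, Real.norm_of_nonneg hA, Real.norm_of_nonneg hB]
  congr 2 <;> · rw [Lp.norm_toLp, eLpNorm_norm]; rfl

theorem rpow_le_one_add {x s t : ℝ} (hx : 0 < x) (hs : 0 ≤ s) (hst : s ≤ t) :
    x ^ s ≤ 1 + 1 * x ^ t := by
  rw [one_mul]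
  rcases le_total x 1 with h | h
  · have := Real.rpow_le_one hx.le h hs
    have := Real.rpow_nonneg hx.le t
    linarith
  · have := Real.rpow_le_rpow_of_exponent_le h hst
    linarith

theorem InH.mono {s t : ℝ} {f : L2} (hf : InH t f) (hs : 0 ≤ s) (hst : s ≤ t) : InH s f := by
  obtain ⟨g, hg, _⟩ := hf.exists_hasMult (realSymbol_rad s) zero_le_one zero_le_one
    fun ξ hξ => by rw [norm_rad]; exact rpow_le_one_add hξ hs hst
  exact ⟨g, hg⟩

theorem InH.norm_absD_le {s t : ℝ} {f : L2} (hf : InH t f) (hs : 0 ≤ s) (hst : s ≤ t) :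
    ‖absD s f‖ ≤ ‖f‖ + ‖absD t f‖ := by
  obtain ⟨g, hg, h⟩ := hf.exists_hasMult (realSymbol_rad s) zero_le_one zero_le_one
    fun ξ hξ => by rw [norm_rad]; exact rpow_le_one_add hξ hs hst
  rw [(hf.mono hs hst).hasMult.unique hg]
  linarith

/-- Composition: a multiplier of order `r` maps `H^{s+r}` to `H^s`. -/
theorem InH.of_hasMult {s r B : ℝ} {f g : L2} {m : Plane → ℂ} (hf : InH (r + s) f)
    (hfg : HasMult m f g) (hm : RealSymbol m) (hB : 0 ≤ B)
    (hb : ∀ ξ : Plane, 0 < ‖ξ‖ → ‖m ξ‖ ≤ B * ‖ξ‖ ^ r) :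
    InH s g ∧ ‖absD s g‖ ≤ B * ‖absD (r + s) f‖ := by
  obtain ⟨h, hh, hle⟩ := hf.exists_hasMult ((realSymbol_rad s).mul hm) le_rfl hB fun ξ hξ => by
    rw [norm_mul, norm_rad, zero_add, Real.rpow_add hξ]
    have := mul_le_mul_of_nonneg_left (hb ξ hξ) (Real.rpow_nonneg hξ.le s)
    linarith
  have h2 : HasMult (rad s) g h := by
    filter_upwards [hh, hfg] with ξ a b
    rw [a, b, mul_assoc]
  have h3 : InH s g := ⟨h, h2⟩
  refine ⟨h3, ?_⟩
  rw [h3.hasMult.unique h2]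
  linarith

/-- Moving a symbol of order `r` by `InH r`. -/
theorem InH.exists_of_order {r B : ℝ} {f : L2} {m : Plane → ℂ} (hf : InH r f)
    (hm : RealSymbol m) (hB : 0 ≤ B) (hb : ∀ ξ : Plane, 0 < ‖ξ‖ → ‖m ξ‖ ≤ B * ‖ξ‖ ^ r) :
    ∃ g, HasMult m f g ∧ ‖g‖ ≤ B * ‖absD r f‖ := by
  obtain ⟨g, hg, h⟩ := hf.exists_hasMult hm le_rfl hB fun ξ hξ => by
    rw [zero_add]; exact hb ξ hξ
  exact ⟨g, hg, by linarith⟩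

/-! ### The operators of the system as multipliers -/

theorem partialD_symbol (i : Fin 2) :
    (fun ξ : Plane => Complex.I * ((((2 * Real.pi) • ξ) i : ℝ) : ℂ)) = dsym i := by
  funext ξ
  simp [dsym]; ring

/-- One derivative in `L²` makes the symbol times the transform square integrable, so the default
value 0 in `multiplierC` is not taken. The same argument applies to `fracLap` and `rieszOp`. -/
theorem hasMult_partialD (i : Fin 2) {f : L2} (hf : InH 1 f) :
    HasMult (dsym i) f (partialD i f) := by
  obtain ⟨g, hg, -⟩ := hf.exists_of_order (realSymbol_dsym i)
    (by positivity : 0 ≤ 2 * Real.pi) fun ξ _ => by rw [Real.rpow_one]; exact norm_dsym_le i ξ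
  have := hasMult_multiplier (m := fun ξ => Complex.I * (ξ i : ℂ)) (f := f)
    (fun ξ => by simp) (by
      have h := hg.memLp
      rw [← partialD_symbol] at h
      exact h)
  rw [← partialD_symbol]
  exact this

theorem norm_partialD_le (i : Fin 2) {f : L2} (hf : InH 1 f) :
    ‖partialD i f‖ ≤ 2 * Real.pi * ‖absD 1 f‖ := by
  obtain ⟨g, hg, h⟩ := hf.exists_of_order (realSymbol_dsym i)
    (by positivity : 0 ≤ 2 * Real.pi) fun ξ _ => by rw [Real.rpow_one]; exact norm_dsym_le i ξ
  rwa [(hasMult_partialD i hf).unique hg]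

/-- Symbol of `Λ^a`. -/
def lapSym (a : ℝ) (ξ : Plane) : ℂ := ((2 * Real.pi) ^ a : ℝ) * rad a ξ

theorem realSymbol_lapSym (a : ℝ) : RealSymbol (lapSym a) :=
  ⟨(realSymbol_rad a).meas.const_mul _, fun ξ => by
    rw [lapSym, lapSym, (realSymbol_rad a).herm, map_mul, Complex.conj_ofReal]⟩

theorem conj_lapSym (a : ℝ) (ξ : Plane) : (starRingEnd ℂ) (lapSym a ξ) = lapSym a ξ := by
  rw [lapSym, map_mul, Complex.conj_ofReal, conj_rad]

theorem norm_lapSym (a : ℝ) (ξ : Plane) : ‖lapSym a ξ‖ = (2 * Real.pi) ^ a * ‖ξ‖ ^ a := by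
  rw [lapSym, norm_mul, norm_rad, Complex.norm_real, Real.norm_of_nonneg (by positivity)]

theorem fracLap_symbol (a : ℝ) :
    (fun ξ : Plane => ((‖(2 * Real.pi) • ξ‖ ^ a : ℝ) : ℂ)) = lapSym a := by
  funext ξ
  rw [norm_smul, Real.norm_of_nonneg (by positivity),
    Real.mul_rpow (by positivity) (norm_nonneg _), lapSym, rad]
  push_cast; rfl

theorem hasMult_fracLap {a : ℝ} {f : L2} (hf : InH a f) :
    HasMult (lapSym a) f (fracLap a f) := by
  obtain ⟨g, hg, -⟩ := hf.exists_of_order (realSymbol_lapSym a)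
    (by positivity : 0 ≤ (2 * Real.pi) ^ a) fun ξ _ => (norm_lapSym a ξ).le
  have := hasMult_multiplier (m := fun ξ => ((‖ξ‖ ^ a : ℝ) : ℂ)) (f := f)
    (fun ξ => by simp) (by
      have h := hg.memLp
      rw [← fracLap_symbol] at h
      exact h)
  rw [← fracLap_symbol]
  exact this

/-- Symbol of `R_a = Λ^{-a} ∂₁`. -/
def rieszSym (a : ℝ) (ξ : Plane) : ℂ := lapSym (-a) ξ * dsym 0 ξ

theorem realSymbol_rieszSym (a : ℝ) : RealSymbol (rieszSym a) :=
  (realSymbol_lapSym _).mul (realSymbol_dsym 0)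

theorem conj_rieszSym (a : ℝ) (ξ : Plane) : (starRingEnd ℂ) (rieszSym a ξ) = -rieszSym a ξ := by
  rw [rieszSym, map_mul, conj_lapSym, conj_dsym]; ring

/-- Constant in the bound of the symbol of `R_a`. -/
def rieszConst (a : ℝ) : ℝ := (2 * Real.pi) ^ (-a) * (2 * Real.pi)

theorem rieszConst_nonneg (a : ℝ) : 0 ≤ rieszConst a := by unfold rieszConst; positivity

theorem norm_rieszSym_le (a : ℝ) {ξ : Plane} (hξ : 0 < ‖ξ‖) :
    ‖rieszSym a ξ‖ ≤ rieszConst a * ‖ξ‖ ^ (1 - a) := by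
  rw [rieszSym, norm_mul, norm_lapSym, rieszConst]
  have h := norm_dsym_le 0 ξ
  calc (2 * Real.pi) ^ (-a) * ‖ξ‖ ^ (-a) * ‖dsym 0 ξ‖
      ≤ (2 * Real.pi) ^ (-a) * ‖ξ‖ ^ (-a) * (2 * Real.pi * ‖ξ‖) :=
        mul_le_mul_of_nonneg_left h (by positivity)
    _ = _ := by
        rw [show 1 - a = -a + 1 by ring, Real.rpow_add_one hξ.ne']; ring

theorem riesz_symbol (a : ℝ) :
    (fun ξ : Plane => ((‖(2 * Real.pi) • ξ‖ ^ (-a) : ℝ) : ℂ) *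
      (Complex.I * ((((2 * Real.pi) • ξ) 0 : ℝ) : ℂ))) = rieszSym a := by
  funext ξ
  rw [rieszSym, ← congrFun (fracLap_symbol (-a)) ξ, ← congrFun (partialD_symbol 0) ξ]

theorem hasMult_rieszOp {a : ℝ} {f : L2} (hf : InH (1 - a) f) :
    HasMult (rieszSym a) f (rieszOp a f) := by
  obtain ⟨g, hg, -⟩ := hf.exists_of_order (realSymbol_rieszSym a)
    (rieszConst_nonneg a) fun ξ hξ => norm_rieszSym_le a hξ
  have := hasMult_multiplier
    (m := fun ξ => ((‖ξ‖ ^ (-a) : ℝ) : ℂ) * (Complex.I * (ξ 0 : ℂ))) (f := f)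
    (fun ξ => by simp) (by
      have h := hg.memLp
      rw [← riesz_symbol] at h
      exact h)
  rw [← riesz_symbol]
  exact this

/-! ### The norms of the statement -/

theorem sobolev_weight (ξ : Plane) :
    (1 + ‖(2 * Real.pi) • ξ‖ ^ 2) ^ ((2 : ℝ) / 2) = 1 + ‖(2 * Real.pi) • ξ‖ ^ 2 := by
  rw [div_self two_ne_zero, Real.rpow_one]

theorem eLpNorm_hat (f : L2) : eLpNorm (hat f) 2 volume = ENNReal.ofReal ‖f‖ := by
  rw [← norm_hat f, Lp.norm_def, ENNReal.ofReal_toReal (Lp.eLpNorm_ne_top _)]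

theorem norm_le_sobolevNorm (f : L2) : ENNReal.ofReal ‖f‖ ≤ sobolevNorm 2 f := by
  rw [← eLpNorm_hat, sobolevNorm]
  refine eLpNorm_mono_ae (.of_forall fun ξ => ?_)
  rw [norm_mul, Complex.norm_real, sobolev_weight, Real.norm_of_nonneg (by positivity)]
  exact le_mul_of_one_le_left (norm_nonneg _) (by nlinarith [sq_nonneg ‖(2 * Real.pi) • ξ‖])

theorem inH_of_sobolevNorm {f : L2} (h : sobolevNorm 2 f < ⊤) : InH 2 f ∧
    ENNReal.ofReal ‖absD 2 f‖ ≤ sobolevNorm 2 f := by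
  have hle : ∀ ξ : Plane, ‖rad 2 ξ * hat f ξ‖ ≤
      ‖(((1 + ‖(2 * Real.pi) • ξ‖ ^ 2) ^ ((2 : ℝ) / 2) : ℝ) : ℂ) * hat f ξ‖ := fun ξ => by
    rw [norm_mul, norm_mul, Complex.norm_real, sobolev_weight, Real.norm_of_nonneg (by positivity),
      norm_rad]
    refine mul_le_mul_of_nonneg_right ?_ (norm_nonneg _)
    rw [norm_smul, Real.norm_of_nonneg (by positivity), mul_pow, Real.rpow_two]
    have : 1 ≤ (2 * Real.pi) ^ 2 := by nlinarith [Real.pi_gt_three]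
    nlinarith [sq_nonneg ‖ξ‖]
  have hmono : eLpNorm (fun ξ => rad 2 ξ * hat f ξ) 2 volume ≤ sobolevNorm 2 f :=
    eLpNorm_mono_ae (.of_forall hle)
  have hi : InH 2 f := inH_of_memLp ⟨(realSymbol_rad 2).meas.aestronglyMeasurable.mul
    (Lp.aestronglyMeasurable _), hmono.trans_lt h⟩
  refine ⟨hi, ?_⟩
  rw [← eLpNorm_hat, eLpNorm_congr_ae hi.hasMult]
  exact hmono

theorem sobolevNorm_add_le (f g : L2) :
    sobolevNorm 2 (f + g) ≤ sobolevNorm 2 f + sobolevNorm 2 g := by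
  have hw : ∀ f : L2, AEStronglyMeasurable (fun ξ : Plane =>
      (((1 + ‖(2 * Real.pi) • ξ‖ ^ 2) ^ ((2 : ℝ) / 2) : ℝ) : ℂ) * hat f ξ) volume := fun f => by
    refine AEStronglyMeasurable.mul ?_ (Lp.aestronglyMeasurable _)
    exact (Complex.measurable_ofReal.comp (by fun_prop)).aestronglyMeasurable
  refine le_trans (le_of_eq ?_) (eLpNorm_add_le (hw f) (hw g) (by norm_num))
  refine eLpNorm_congr_ae ?_
  have := Lp.coeFn_add (hat f) (hat g)
  rw [← hat_add] at this
  filter_upwards [this] with ξ h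
  change _ * hat (f + g) ξ = _
  rw [h, Pi.add_apply, Pi.add_apply, mul_add]; rfl

/-- Continuity in time with values in `H²` gives uniform bounds. -/
theorem ContinuousInTime.exists_bound {S : ℝ} {f : ℝ → L2}
    (h : ContinuousInTime (sobolevNorm 2) S f) :
    ∃ B : ℝ, 0 ≤ B ∧ ∀ t ∈ Icc 0 S, sobolevNorm 2 (f t) ≤ ENNReal.ofReal B := by
  have hloc : ∀ t ∈ Icc 0 S, ∃ U ∈ 𝓝[Icc 0 S] t, ∃ B : ℝ, 0 ≤ B ∧
      ∀ τ ∈ U, sobolevNorm 2 (f τ) ≤ ENNReal.ofReal B := fun t ht => by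
    obtain ⟨h1, h2⟩ := h t ht
    refine ⟨_, h2.eventually (gt_mem_nhds zero_lt_one), (sobolevNorm 2 (f t)).toReal + 1,
      by positivity, fun τ hτ => ?_⟩
    have h3 : sobolevNorm 2 (f τ) ≤ sobolevNorm 2 (f τ - f t) + sobolevNorm 2 (f t) := by
      simpa using sobolevNorm_add_le (f τ - f t) (f t)
    refine h3.trans ?_
    rw [ENNReal.ofReal_add ENNReal.toReal_nonneg zero_le_one, ENNReal.ofReal_toReal h1.ne,
      ENNReal.ofReal_one, add_comm]
    exact add_le_add le_rfl (le_of_lt hτ)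
  -- Continuity gives a bound near each time, and compactness patches the local bounds. The
  -- resulting bound is only qualitative: it depends on the solution and does not enter the final
  -- constant.
  refine isCompact_Icc.induction_on (p := fun U => ∃ B : ℝ, 0 ≤ B ∧
      ∀ τ ∈ U, sobolevNorm 2 (f τ) ≤ ENNReal.ofReal B) ⟨0, le_rfl, by simp⟩ ?_ ?_ hloc
  · rintro s t hst ⟨B, hB, h⟩
    exact ⟨B, hB, fun τ hτ => h τ (hst hτ)⟩
  · rintro s t ⟨B, hB, h⟩ ⟨B', hB', h'⟩
    refine ⟨B + B', by positivity, fun τ hτ => ?_⟩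
    rcases hτ with hτ | hτ
    · exact (h τ hτ).trans (ENNReal.ofReal_le_ofReal (by linarith))
    · exact (h' τ hτ).trans (ENNReal.ofReal_le_ofReal (by linarith))

/-! ### Besov norms dominate Sobolev norms -/

namespace LittlewoodPaley

variable (LP : LittlewoodPaley)

theorem gen_eq_zero {κ : Plane} (h : ‖κ‖ < 1 / 2 ∨ 2 ≤ ‖κ‖) : LP.gen κ = 0 := by
  by_contra hne
  have h1 := LP.supp (subset_tsupport _ hne)
  rcases h with h | h
  · exact absurd h1.1 (not_le.2 h)
  · exact absurd h1.2 (not_lt.2 h)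

theorem norm_scaled (j : ℤ) (κ : Plane) : ‖(2 : ℝ) ^ j • κ‖ = (2 : ℝ) ^ j * ‖κ‖ := by
  rw [norm_smul, Real.norm_of_nonneg (by positivity)]

/-- For ‖κ‖ < 1 the terms with j ≥ 1 vanish by the support condition. For ‖κ‖ ≥ 1 it is the terms
with j < 0 that vanish, so the sum over j ≥ 0 is the whole partition of unity. -/
theorem blockSymbol_zero (κ : Plane) :
    LP.blockSymbol 0 κ = if ‖κ‖ < 1 then 1 - LP.gen κ else 0 := by
  change 1 - ∑' j : ℕ, LP.gen ((2 : ℝ) ^ (-(j : ℤ)) • κ) = _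
  split_ifs with h
  · rw [tsum_eq_single 0]
    · simp
    · intro j hj
      apply LP.gen_eq_zero
      left
      rw [norm_scaled, zpow_neg, zpow_natCast, inv_mul_lt_iff₀ (by positivity)]
      have : (2 : ℝ) ^ 1 ≤ 2 ^ j := pow_le_pow_right₀ one_le_two (by omega)
      linarith
  · rw [not_lt] at h
    have h0 : κ ≠ 0 := by
      rintro rfl; rw [norm_zero] at h; linarith
    have h1 := LP.sum_eq_one κ h0
    have h2 : HasSum (fun j : ℕ => LP.gen ((2 : ℝ) ^ (-(j : ℤ)) • κ)) 1 := by
      have hinj : Function.Injective (fun j : ℕ => (j : ℤ)) := Nat.cast_injective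
      refine (hinj.hasSum_iff ?_).2 h1
      intro j hj
      apply LP.gen_eq_zero
      right
      have hj' : j ≤ -1 := by
        by_contra hcon
        exact hj ⟨j.toNat, by simp; omega⟩
      rw [norm_scaled]
      have : (2 : ℝ) ^ (1 : ℤ) ≤ 2 ^ (-j) := zpow_le_zpow_right₀ one_le_two (by omega)
      rw [zpow_one] at this
      nlinarith
    rw [h2.tsum_eq, sub_self]

theorem measurable_blockSymbol (k : ℕ) : Measurable (LP.blockSymbol k) := by
  cases k with
  | zero =>
    have : LP.blockSymbol 0 = fun κ => if ‖κ‖ < 1 then 1 - LP.gen κ else 0 :=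
      funext LP.blockSymbol_zero
    rw [this]
    exact Measurable.ite (measurableSet_lt measurable_norm measurable_const)
      (measurable_const.sub LP.smooth.continuous.measurable) measurable_const
  | succ j => exact LP.smooth.continuous.measurable.comp (measurable_const_smul _)

theorem exists_bound_gen : ∃ C, ∀ κ, ‖LP.gen κ‖ ≤ C := by
  have hc : HasCompactSupport LP.gen := by
    refine HasCompactSupport.of_support_subset_isCompact (isCompact_closedBall (0 : Plane) 2) ?_
    intro κ hκ
    rw [mem_closedBall_zero_iff]
    exact (LP.supp (subset_tsupport _ hκ)).2.le
  exact LP.smooth.continuous.bounded_above_of_compact_support hc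

theorem exists_bound_blockSymbol : ∃ C, ∀ k κ, ‖LP.blockSymbol k κ‖ ≤ C := by
  obtain ⟨C, hC⟩ := LP.exists_bound_gen
  have h0 : 0 ≤ C := (norm_nonneg _).trans (hC 0)
  refine ⟨1 + C, fun k κ => ?_⟩
  cases k with
  | zero =>
    rw [blockSymbol_zero]
    split_ifs
    · exact (norm_sub_le _ _).trans (by rw [norm_one]; linarith [hC κ])
    · rw [norm_zero]; linarith
  | succ j => exact (hC _).trans (by linarith)

/-- On the support of the block of index k one has ‖κ‖ < 2^k. The constant 8 is dictated by k = 0,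
where the weight is below 2 while 2^{(k-1)·2} = 1/4. -/
theorem weight_mul_blockSymbol_le (k : ℕ) (κ : Plane) :
    (1 + ‖κ‖ ^ 2) * ‖LP.blockSymbol k κ‖ ≤
      8 * (2 : ℝ) ^ (((k : ℝ) - 1) * 2) * ‖LP.blockSymbol k κ‖ := by
  rcases eq_or_ne (LP.blockSymbol k κ) 0 with h | h
  · rw [h]; simp
  refine mul_le_mul_of_nonneg_right ?_ (norm_nonneg _)
  cases k with
  | zero =>
    have h1 : ‖κ‖ < 1 := by
      by_contra hcon
      exact h (by rw [blockSymbol_zero, if_neg hcon])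
    have h2 : (2 : ℝ) ^ (((0 : ℕ) - 1 : ℝ) * 2) = 1 / 4 := by
      rw [show (((0 : ℕ) - 1 : ℝ) * 2) = -(2 : ℕ) by norm_num, Real.rpow_neg zero_le_two,
        Real.rpow_natCast]
      norm_num
    rw [h2]
    nlinarith [norm_nonneg κ]
  | succ j =>
    have h1 : ‖κ‖ < 2 * 2 ^ j := by
      by_contra hcon
      rw [not_lt] at hcon
      apply h
      apply LP.gen_eq_zero
      right
      rw [norm_scaled, zpow_neg, zpow_natCast, le_inv_mul_iff₀ (by positivity)]
      linarith
    have h2 : (2 : ℝ) ^ ((((j + 1 : ℕ) : ℝ) - 1) * 2) = ((2 : ℝ) ^ j) ^ 2 := by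
      push_cast
      rw [add_sub_cancel_right, Real.rpow_mul zero_le_two, Real.rpow_natCast, Real.rpow_two]
    rw [h2]
    have h3 : (1 : ℝ) ≤ 2 ^ j := one_le_pow₀ one_le_two
    nlinarith [norm_nonneg κ]

theorem hasSum_blockSymbol {κ : Plane} (hκ : κ ≠ 0) :
    HasSum (fun k => LP.blockSymbol k κ) 1 := by
  have hinj : Function.Injective (fun j : ℕ => (j : ℤ)) := Nat.cast_injective
  have h1 : Summable (fun j : ℕ => LP.gen ((2 : ℝ) ^ (-(j : ℤ)) • κ)) :=
    (LP.sum_eq_one κ hκ).summable.comp_injective hinj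
  refine (hasSum_nat_add_iff' 1).1 ?_
  simp only [Finset.range_one, Finset.sum_singleton]
  have : (1 : ℂ) - LP.blockSymbol 0 κ = ∑' j : ℕ, LP.gen ((2 : ℝ) ^ (-(j : ℤ)) • κ) := by
    rw [blockSymbol]; ring
  rw [this]
  exact h1.hasSum

/-- The weight of the `H²` norm. -/
def weight (ξ : Plane) : ℂ := (((1 + ‖(2 * Real.pi) • ξ‖ ^ 2) ^ ((2 : ℝ) / 2) : ℝ) : ℂ)

theorem norm_weight (ξ : Plane) : ‖weight ξ‖ = 1 + ‖(2 * Real.pi) • ξ‖ ^ 2 := by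
  rw [weight, sobolev_weight, Complex.norm_real, Real.norm_of_nonneg (by positivity)]

theorem measurable_weight : Measurable weight :=
  Complex.measurable_ofReal.comp (by fun_prop)

theorem eLpNorm_block_le (k : ℕ) (f : L2) :
    eLpNorm (fun ξ => weight ξ * (LP.blockSymbol k ((2 * Real.pi) • ξ) * hat f ξ)) 2 volume ≤
      8 * (ENNReal.ofReal ((2 : ℝ) ^ (((k : ℝ) - 1) * 2)) *
        eLpNorm (multiplierC (LP.blockSymbol k) (complexify f)) 2 (volume : Measure Plane)) := by
  obtain ⟨C, hC⟩ := LP.exists_bound_blockSymbol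
  have hmem : MemLp (fun ξ => LP.blockSymbol k ((2 * Real.pi) • ξ) * hat f ξ) 2
      (volume : Measure Plane) :=
    (Lp.memLp (hat f)).of_le_mul
      (((LP.measurable_blockSymbol k).comp (measurable_const_smul _)).aestronglyMeasurable.mul
        (Lp.aestronglyMeasurable _))
      (.of_forall fun ξ => by
        rw [norm_mul]; exact mul_le_mul_of_nonneg_right (hC k _) (norm_nonneg _))
  have h1 : (𝓕 (multiplierC (LP.blockSymbol k) (complexify f)) : L2C) =ᵐ[volume]
      fun ξ => LP.blockSymbol k ((2 * Real.pi) • ξ) * hat f ξ := multiplierC_spec hmem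
  have h2 : eLpNorm (multiplierC (LP.blockSymbol k) (complexify f)) 2 (volume : Measure Plane) =
      eLpNorm (fun ξ => LP.blockSymbol k ((2 * Real.pi) • ξ) * hat f ξ) 2 volume := by
    rw [← eLpNorm_congr_ae h1]
    have := Lp.norm_fourier_eq (multiplierC (LP.blockSymbol k) (complexify f))
    rw [Lp.norm_def, Lp.norm_def, ENNReal.toReal_eq_toReal_iff' (Lp.eLpNorm_ne_top _)
      (Lp.eLpNorm_ne_top _)] at this
    exact this.symm
  rw [h2]
  refine (eLpNorm_le_mul_eLpNorm_of_ae_le_mul (μ := (volume : Measure Plane))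
    (f := fun ξ => weight ξ * (LP.blockSymbol k ((2 * Real.pi) • ξ) * hat f ξ))
    (g := fun ξ => LP.blockSymbol k ((2 * Real.pi) • ξ) * hat f ξ) (c := 8 * (2 : ℝ) ^ (((k : ℝ) - 1) * 2))
    (.of_forall fun ξ => ?_) 2).trans (le_of_eq ?_)
  · rw [norm_mul, norm_weight, norm_mul, ← mul_assoc, ← mul_assoc]
    exact mul_le_mul_of_nonneg_right (LP.weight_mul_blockSymbol_le k ((2 * Real.pi) • ξ))
      (norm_nonneg _)
  · rw [← mul_assoc, ENNReal.ofReal_mul (by norm_num), ENNReal.ofReal_ofNat]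

/-- The partial sums of the blocks converge to the weighted transform away from the origin; Fatou's
lemma and the triangle inequality bound the limit by the sum of the block norms. -/
theorem sobolevNorm_le_besovNorm (f : L2) : sobolevNorm 2 f ≤ 8 * LP.besovNorm 2 f := by
  set a : ℕ → Plane → ℂ := fun k ξ =>
    weight ξ * (LP.blockSymbol k ((2 * Real.pi) • ξ) * hat f ξ) with ha
  have hmeas : ∀ k, AEStronglyMeasurable (a k) volume := fun k =>
    measurable_weight.aestronglyMeasurable.mul
      (((LP.measurable_blockSymbol k).comp (measurable_const_smul _)).aestronglyMeasurable.mul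
        (Lp.aestronglyMeasurable _))
  have hlim : ∀ᵐ ξ : Plane, Tendsto (fun n => (∑ k ∈ Finset.range n, a k) ξ) atTop
      (𝓝 (weight ξ * hat f ξ)) := by
    filter_upwards [ae_norm_pos] with ξ hξ
    have h0 : (2 * Real.pi) • ξ ≠ 0 :=
      smul_ne_zero (by positivity) (norm_pos_iff.1 hξ)
    have h1 := ((LP.hasSum_blockSymbol h0).mul_right (hat f ξ)).mul_left (weight ξ)
    rw [one_mul] at h1
    refine h1.tendsto_sum_nat.congr fun n => ?_
    rw [Finset.sum_apply]
  have h1 : eLpNorm (fun ξ => weight ξ * hat f ξ) 2 volume ≤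
      liminf (fun n => eLpNorm (∑ k ∈ Finset.range n, a k) 2 volume) atTop :=
    Lp.eLpNorm_lim_le_liminf_eLpNorm
      (fun n => Finset.aestronglyMeasurable_sum _ fun k _ => hmeas k) _ hlim
  refine h1.trans ?_
  refine liminf_le_of_le (by isBoundedDefault) fun b hb => ?_
  obtain ⟨n, hn⟩ := hb.exists
  refine hn.trans ((eLpNorm_sum_le (fun k _ => hmeas k) (by norm_num)).trans ?_)
  rw [besovNorm, ← ENNReal.tsum_mul_left]
  exact (Finset.sum_le_sum fun k _ => LP.eLpNorm_block_le k f).trans (ENNReal.sum_le_tsum _)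

theorem continuousInTime_sobolevNorm {S : ℝ} {θ : ℝ → L2}
    (h : ContinuousInTime (LP.besovNorm 2) S θ) : ContinuousInTime (sobolevNorm 2) S θ := by
  intro t ht
  obtain ⟨h1, h2⟩ := h t ht
  refine ⟨(LP.sobolevNorm_le_besovNorm _).trans_lt (ENNReal.mul_lt_top (by simp) h1), ?_⟩
  have h3 := ENNReal.Tendsto.const_mul h2 (Or.inr (by simp : (8 : ENNReal) ≠ ⊤))
  rw [mul_zero] at h3
  exact tendsto_of_tendsto_of_tendsto_of_le_of_le tendsto_const_nhds h3 (fun _ => zero_le)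
    fun τ => LP.sobolevNorm_le_besovNorm _

end LittlewoodPaley

/-! ### The Fourier transform on `L¹ ∩ L²`, pointwise bounds -/

/-- Tested against smooth compactly supported functions, both transforms can be moved onto the test
function, the `L²` one through tempered distributions and the integral one by Fubini. -/
theorem fourier_coeFn {F : L2C} (hF : Integrable F) :
    (𝓕 F : L2C) =ᵐ[volume] 𝓕 (F : Plane → ℂ) := by
  have hc : Continuous (𝓕 (F : Plane → ℂ)) :=
    VectorFourier.fourierIntegral_continuous Real.continuous_fourierChar
      (by exact continuous_inner) hF
  refine ae_eq_of_integral_contDiff_smul_eq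
    ((Lp.memLp (𝓕 F : L2C)).locallyIntegrable (by norm_num)) hc.locallyIntegrable ?_
  intro g hg hgc
  set φ : SchwartzMap Plane ℂ := (hgc.comp_left (g := Complex.ofReal) rfl).toSchwartzMap
    (Complex.ofRealCLM.contDiff.comp hg) with hφ
  have hφe : ∀ x, φ x = (g x : ℂ) := fun x => rfl
  have h1 : ∫ x, φ x • (𝓕 F : L2C) x = ∫ x, (𝓕 φ) x • F x := by
    have := congrArg (fun T : TemperedDistribution Plane ℂ => T φ)
      (Lp.fourier_toTemperedDistribution_eq F)
    simp only [TemperedDistribution.fourier_apply, Lp.toTemperedDistribution_apply] at this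
    exact this.symm
  have h2 : ∫ x, (𝓕 φ) x • F x = ∫ x, φ x • 𝓕 (F : Plane → ℂ) x := by
    simpa using! VectorFourier.integral_fourierIntegral_smul_eq_flip (L := innerₗ Plane)
      (f := (φ : Plane → ℂ)) (g := (F : Plane → ℂ))
      Real.continuous_fourierChar continuous_inner φ.integrable hF
  simp only [hφe] at h1 h2
  simpa [Complex.real_smul] using h1.trans h2

theorem fourierInv_coeFn {F : L2C} (hF : Integrable F) :
    (𝓕⁻ F : L2C) =ᵐ[volume] 𝓕⁻ (F : Plane → ℂ) := by
  have h1 : (𝓕⁻ F : L2C) =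
      Lp.compMeasurePreserving (fun x : Plane => -x) measurePreserving_neg' (𝓕 F : L2C) := by
    have hd : DenseRange (SchwartzMap.toLpCLM ℝ (E := Plane) ℂ 2 volume) :=
      SchwartzMap.denseRange_toLpCLM (by norm_num)
    refine hd.induction_on (p := fun F : L2C => (𝓕⁻ F : L2C) =
      Lp.compMeasurePreserving (fun x : Plane => -x) measurePreserving_neg' (𝓕 F : L2C)) F ?_ ?_
    · exact isClosed_eq (Lp.fourierTransformₗᵢ Plane ℂ).symm.continuous
        ((Lp.isometry_compMeasurePreserving measurePreserving_neg').continuous.comp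
          (Lp.fourierTransformₗᵢ Plane ℂ).continuous)
    · intro φ
      change (𝓕⁻ (φ.toLp 2) : L2C) = Lp.compMeasurePreserving (fun x : Plane => -x)
        measurePreserving_neg' (𝓕 (φ.toLp 2) : L2C)
      have e1 : (𝓕⁻ (φ.toLp 2) : L2C) = (𝓕⁻ φ).toLp 2 := SchwartzMap.toLp_fourierInv_eq φ
      have e2 : (𝓕 (φ.toLp 2) : L2C) = (𝓕 φ).toLp 2 := SchwartzMap.toLp_fourier_eq φ
      rw [e1, e2]
      refine Lp.ext ?_
      filter_upwards [(𝓕⁻ φ).coeFn_toLp 2 volume,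
        Lp.coeFn_compMeasurePreserving ((𝓕 φ).toLp 2) measurePreserving_neg',
        measurePreserving_neg'.quasiMeasurePreserving.ae ((𝓕 φ).coeFn_toLp 2 volume)]
        with x a b c
      rw [a, b, Function.comp_apply, c]
      rw [SchwartzMap.fourierInv_coe, SchwartzMap.fourier_coe]
      exact Real.fourierInv_eq_fourier_neg (φ : Plane → ℂ) x
  rw [h1]
  filter_upwards [Lp.coeFn_compMeasurePreserving (𝓕 F : L2C) measurePreserving_neg',
    measurePreserving_neg'.quasiMeasurePreserving.ae (fourier_coeFn hF)] with x a b
  rw [a, Function.comp_apply, b, ← Real.fourierInv_eq_fourier_neg]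

theorem hat_eq_fourier {f : L2} (hf : Integrable f) :
    hat f =ᵐ[volume] 𝓕 (fun x => (f x : ℂ)) := by
  have h1 : Integrable (complexify f) := (hf.ofReal (𝕜 := ℂ)).congr (coeFn_complexify f).symm
  filter_upwards [fourier_coeFn h1] with ξ h
  rw [hat, h]
  exact Real.fourier_congr_ae (coeFn_complexify f) ξ

theorem ae_abs_le_integral_hat {f : L2} (hf : Integrable (hat f)) :
    ∀ᵐ x : Plane, |f x| ≤ ∫ ξ, ‖hat f ξ‖ := by
  have h1 : (𝓕⁻ (hat f) : L2C) = complexify f := FourierTransform.fourierInv_fourier_eq _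
  have h2 := fourierInv_coeFn hf
  rw [h1] at h2
  filter_upwards [h2, coeFn_complexify f] with x a b
  rw [b] at a
  rw [← Real.norm_eq_abs, ← Complex.norm_real, a]
  exact VectorFourier.norm_fourierIntegral_le_integral_norm _ _ _ _ _

/-- Cauchy–Schwarz. -/
theorem integral_mul_le_sqrt {a b : Plane → ℝ} (ha : MemLp a 2) (hb : MemLp b 2) :
    ∫ x, a x * b x ≤ Real.sqrt (∫ x, a x ^ 2) * Real.sqrt (∫ x, b x ^ 2) := by
  have h1 := real_inner_le_norm (ha.toLp : L2) (hb.toLp : L2)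
  have e : ∀ {c d : Plane → ℝ} (hc : MemLp c 2) (hd : MemLp d 2),
      inner ℝ (hc.toLp : L2) (hd.toLp : L2) = ∫ x, c x * d x := fun hc hd => by
    rw [inner_eq_integral]
    refine integral_congr_ae ?_
    filter_upwards [hc.coeFn_toLp, hd.coeFn_toLp] with x p q
    rw [p, q]
  rw [e ha hb] at h1
  have n : ∀ {c : Plane → ℝ} (hc : MemLp c 2), ‖(hc.toLp : L2)‖ = Real.sqrt (∫ x, c x ^ 2) :=
    fun hc => by
      rw [norm_eq_sqrt_real_inner, e hc hc]
      simp only [sq]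
  rwa [n ha, n hb] at h1

theorem sq_norm_eq_integral (f : L2) : ‖f‖ ^ 2 = ∫ x, f x ^ 2 := by
  rw [← real_inner_self_eq_norm_sq, inner_eq_integral]
  simp only [sq]

theorem sq_norm_eq_integral_hat (f : L2) : ‖f‖ ^ 2 = ∫ ξ, ‖hat f ξ‖ ^ 2 := by
  rw [← real_inner_self_eq_norm_sq, inner_eq_hat]
  have : ∀ ξ, (starRingEnd ℂ) (hat f ξ) * hat f ξ = ((‖hat f ξ‖ ^ 2 : ℝ) : ℂ) := fun ξ => by
    rw [← Complex.normSq_eq_conj_mul_self, Complex.normSq_eq_norm_sq]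
  simp only [this]
  rw [integral_complex_ofReal, Complex.ofReal_re]

theorem integrable_sq_hat (f : L2) : Integrable fun ξ => ‖hat f ξ‖ ^ 2 :=
  (Lp.memLp (hat f)).integrable_norm_pow (by norm_num)

/-- In the plane (1 + |ξ|²)⁻¹ is square integrable, so by Cauchy–Schwarz two derivatives in `L²`
make the transform integrable. -/
theorem exists_sup_bound : ∃ C : ℝ, 0 ≤ C ∧ ∀ f : L2, InH 2 f →
    ∀ᵐ x : Plane, |f x| ≤ C * (‖f‖ + ‖absD 2 f‖) := by
  have hw : MemLp (fun ξ : Plane => (1 + ‖ξ‖ ^ 2)⁻¹) 2 := by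
    rw [memLp_two_iff_integrable_sq (by fun_prop (disch := intro x; positivity))]
    have := integrable_rpow_neg_one_add_norm_sq (E := Plane) (μ := volume) (r := 4)
      (by simp; norm_num)
    refine this.congr (.of_forall fun ξ => ?_)
    have h0 : 0 ≤ 1 + ‖ξ‖ ^ 2 := by positivity
    change _ = ((1 + ‖ξ‖ ^ 2)⁻¹) ^ 2
    dsimp only
    rw [show (-4 / 2 : ℝ) = -(2 : ℕ) by norm_num, Real.rpow_neg h0, Real.rpow_natCast, inv_pow]
  refine ⟨Real.sqrt (∫ ξ : Plane, ((1 + ‖ξ‖ ^ 2)⁻¹) ^ 2), Real.sqrt_nonneg _, fun f hf => ?_⟩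
  have h1 := hf.hasMult
  have hb : MemLp (fun ξ => ‖hat f ξ‖ + ‖hat (absD 2 f) ξ‖) 2 :=
    (Lp.memLp (hat f)).norm.add (Lp.memLp _).norm
  have e : ∀ᵐ ξ : Plane, ‖hat f ξ‖ =
      (1 + ‖ξ‖ ^ 2)⁻¹ * (‖hat f ξ‖ + ‖hat (absD 2 f) ξ‖) := by
    filter_upwards [h1] with ξ h
    have h0 : 1 + ‖ξ‖ ^ 2 ≠ 0 := by positivity
    rw [h, norm_mul, norm_rad, Real.rpow_two]
    field_simp
  have hint : Integrable (hat f) := by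
    rw [← integrable_norm_iff (Lp.aestronglyMeasurable _)]
    exact (hw.integrable_mul hb).congr (e.mono fun ξ h => h.symm)
  filter_upwards [ae_abs_le_integral_hat hint] with x hx
  refine hx.trans ?_
  rw [integral_congr_ae e]
  refine (integral_mul_le_sqrt hw hb).trans ?_
  refine mul_le_mul_of_nonneg_left ?_ (Real.sqrt_nonneg _)
  have h3 : ‖(hb.toLp : L2)‖ = Real.sqrt (∫ ξ, (‖hat f ξ‖ + ‖hat (absD 2 f) ξ‖) ^ 2) := by
    rw [← Real.sqrt_sq (norm_nonneg _), sq_norm_eq_integral]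
    congr 1
    refine integral_congr_ae ?_
    filter_upwards [hb.coeFn_toLp] with ξ h
    rw [h]
  rw [← h3]
  have e2 : hb.toLp = ((Lp.memLp (hat f)).norm.toLp : L2) +
      ((Lp.memLp (hat (absD 2 f))).norm.toLp : L2) := rfl
  rw [e2]
  refine (norm_add_le _ _).trans (le_of_eq ?_)
  rw [← norm_hat f, ← norm_hat (absD 2 f)]
  congr 1 <;> · rw [Lp.norm_toLp, eLpNorm_norm]; rfl

/-! ### Ladyzhenskaya's inequality -/

/-- Sharp frequency cutoff. -/
def cut (A : ℝ) (ξ : Plane) : ℂ := if ‖ξ‖ ≤ A then 1 else 0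

theorem realSymbol_cut (A : ℝ) : RealSymbol (cut A) :=
  ⟨Measurable.ite (measurableSet_le measurable_norm measurable_const) measurable_const
    measurable_const, fun ξ => by
      unfold cut; rw [norm_neg]; split_ifs <;> simp⟩

theorem norm_cut_le (A : ℝ) (ξ : Plane) : ‖cut A ξ‖ ≤ 1 := by
  unfold cut; split_ifs <;> simp

/-- Area of the unit disc. -/
def area : ℝ := (volume (Metric.closedBall (0 : Plane) 1)).toReal

theorem area_pos : 0 < area :=
  ENNReal.toReal_pos (Metric.measure_closedBall_pos volume _ one_pos).ne'
    measure_closedBall_lt_top.ne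

theorem volume_disc {A : ℝ} (hA : 0 ≤ A) :
    volume (Metric.closedBall (0 : Plane) A) = ENNReal.ofReal (A ^ 2 * area) := by
  rw [Measure.addHaar_closedBall' volume (0 : Plane) hA, area, ENNReal.ofReal_mul (by positivity),
    ENNReal.ofReal_toReal measure_closedBall_lt_top.ne]
  simp

theorem memLp_indicator_disc (A : ℝ) :
    MemLp (fun ξ : Plane => if ‖ξ‖ ≤ A then (1 : ℝ) else 0) 2 := by
  have h := memLp_indicator_const (μ := (volume : Measure Plane)) 2
    (measurableSet_closedBall (x := (0 : Plane)) (ε := A)) (1 : ℝ)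
    (Or.inr measure_closedBall_lt_top.ne)
  refine h.congr_norm (Measurable.ite (measurableSet_le measurable_norm measurable_const)
    measurable_const measurable_const).aestronglyMeasurable (.of_forall fun ξ => ?_)
  simp only [indicator, mem_closedBall_zero_iff]

/-- Bernstein's inequality: Cauchy–Schwarz on the disc of radius A, whose area is A² `area`. -/
theorem ae_abs_low_le {A : ℝ} (hA : 0 ≤ A) {f g : L2} (h : HasMult (cut A) f g) :
    ∀ᵐ x : Plane, |g x| ≤ A * Real.sqrt area * ‖f‖ := by
  have hb : MemLp (fun ξ => ‖hat f ξ‖) 2 := (Lp.memLp (hat f)).norm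
  have hi := memLp_indicator_disc A
  have e : ∀ᵐ ξ : Plane, ‖hat g ξ‖ = (if ‖ξ‖ ≤ A then (1 : ℝ) else 0) * ‖hat f ξ‖ := by
    filter_upwards [h] with ξ hξ
    rw [hξ, norm_mul]
    unfold cut; split_ifs <;> simp
  have hint : Integrable (hat g) := by
    rw [← integrable_norm_iff (Lp.aestronglyMeasurable _)]
    exact (hi.integrable_mul hb).congr (e.mono fun ξ h => h.symm)
  filter_upwards [ae_abs_le_integral_hat hint] with x hx
  refine hx.trans ?_
  rw [integral_congr_ae e]
  refine (integral_mul_le_sqrt hi hb).trans (le_of_eq ?_)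
  rw [← sq_norm_eq_integral_hat, Real.sqrt_sq (norm_nonneg _)]
  congr 1
  have e2 : ∀ ξ : Plane, (if ‖ξ‖ ≤ A then (1 : ℝ) else 0) ^ 2 =
      (Metric.closedBall (0 : Plane) A).indicator (fun _ => (1 : ℝ)) ξ := fun ξ => by
    simp only [indicator, mem_closedBall_zero_iff]; split_ifs <;> simp
  simp only [e2]
  rw [integral_indicator measurableSet_closedBall, setIntegral_const, smul_eq_mul, mul_one,
    measureReal_def, volume_disc hA, ENNReal.toReal_ofReal (mul_nonneg (sq_nonneg A) area_pos.le),
    Real.sqrt_mul (sq_nonneg A), Real.sqrt_sq hA]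

theorem lintegral_sq_eq (f : L2) :
    ∫⁻ x, ENNReal.ofReal (f x ^ 2) = ENNReal.ofReal (‖f‖ ^ 2) := by
  rw [sq_norm_eq_integral, ofReal_integral_eq_lintegral_ofReal (Lp.memLp f).integrable_sq
    (.of_forall fun x => sq_nonneg _)]

theorem lintegral_sq_hat_eq (f : L2) :
    ∫⁻ ξ, ENNReal.ofReal (‖hat f ξ‖ ^ 2) = ENNReal.ofReal (‖f‖ ^ 2) := by
  rw [sq_norm_eq_integral_hat, ofReal_integral_eq_lintegral_ofReal (integrable_sq_hat f)
    (.of_forall fun x => sq_nonneg _)]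

/-- Distribution function of `f` controlled by its high frequencies. -/
theorem meas_abs_gt_le {f : L2} (hf : 0 < ‖f‖) {t : ℝ} (ht : 0 < t) :
    volume {x | t < |f x|} ≤ ENNReal.ofReal (4 / t ^ 2) *
      ∫⁻ ξ, if t / (2 * Real.sqrt area * ‖f‖) < ‖ξ‖ then ENNReal.ofReal (‖hat f ξ‖ ^ 2) else 0 := by
  have ha := Real.sqrt_pos.2 area_pos
  -- The cutoff for which Bernstein's inequality bounds the low frequencies by t/2, so that where
  -- |f| > t the high frequencies exceed t/2 and Chebyshev's inequality applies.
  set A := t / (2 * Real.sqrt area * ‖f‖) with hA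
  have hA0 : 0 ≤ A := by positivity
  obtain ⟨g, hg⟩ := HasMult.of_bounded (realSymbol_cut A) (norm_cut_le A) f
  have h1 : ∀ᵐ x : Plane, |g x| ≤ t / 2 := by
    filter_upwards [ae_abs_low_le hA0 hg] with x hx
    refine hx.trans (le_of_eq ?_)
    rw [hA]; field_simp
  have hhat : ∀ᵐ ξ : Plane, ENNReal.ofReal (‖hat (f - g) ξ‖ ^ 2) =
      if A < ‖ξ‖ then ENNReal.ofReal (‖hat f ξ‖ ^ 2) else 0 := by
    rw [hat_sub]
    filter_upwards [hg, Lp.coeFn_sub (hat f) (hat g)] with ξ a b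
    rw [b, Pi.sub_apply, a]
    unfold cut
    by_cases h : ‖ξ‖ ≤ A
    · rw [if_pos h, if_neg (not_lt.2 h)]; simp
    · rw [if_neg h, if_pos (not_le.1 h)]; simp
  have h2 : ∀ᵐ x : Plane, x ∈ {x | t < |f x|} →
      x ∈ {x | ENNReal.ofReal (t ^ 2 / 4) ≤ ENNReal.ofReal ((f - g) x ^ 2)} := by
    filter_upwards [h1, Lp.coeFn_sub f g] with x a b hx
    rw [b, Pi.sub_apply]
    refine ENNReal.ofReal_le_ofReal ?_
    have hx' : t < |f x| := hx
    have h3 : t / 2 ≤ |f x - g x| := by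
      have := abs_sub_abs_le_abs_sub (f x) (g x)
      linarith
    rw [← sq_abs (f x - g x)]
    nlinarith
  refine (measure_mono_ae h2).trans ?_
  have h3 : AEMeasurable (fun x => ENNReal.ofReal ((f - g) x ^ 2)) volume :=
    ((Lp.aestronglyMeasurable (f - g)).aemeasurable.pow_const 2).ennreal_ofReal
  refine (meas_ge_le_lintegral_div h3 (by
    rw [Ne, ENNReal.ofReal_eq_zero, not_le]; positivity) ENNReal.ofReal_ne_top).trans ?_
  rw [lintegral_sq_eq, ← lintegral_sq_hat_eq, lintegral_congr_ae hhat, ENNReal.div_eq_inv_mul]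
  refine mul_le_mul_left (le_of_eq ?_) _
  rw [← ENNReal.ofReal_inv_of_pos (by positivity), inv_div]

/-- Insert the bound on the distribution function into the layer-cake formula and exchange the
integrals. A frequency ξ contributes only for t < c‖ξ‖ with c proportional to ‖f‖, so integration in
t yields c²‖ξ‖²|f̂(ξ)|², that is, one derivative in `L²`. -/
theorem lintegral_pow_four_le {f : L2} (hf : InH 1 f) :
    ∫⁻ x, ENNReal.ofReal (f x ^ 4) ≤ ENNReal.ofReal (64 * area * (‖f‖ ^ 2 * ‖absD 1 f‖ ^ 2)) := by
  rcases eq_or_lt_of_le (norm_nonneg f) with h0 | h0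
  · have hz : f = 0 := norm_eq_zero.1 h0.symm
    have : ∫⁻ x, ENNReal.ofReal (f x ^ 4) = 0 := by
      rw [lintegral_eq_zero_iff' ((Lp.aestronglyMeasurable f).aemeasurable.pow_const
        4).ennreal_ofReal, hz]
      filter_upwards [Lp.coeFn_zero ℝ 2 (volume : Measure Plane)] with x hx
      rw [hx]; simp
    rw [this]; exact zero_le
  have ha := Real.sqrt_pos.2 area_pos
  set c := 2 * Real.sqrt area * ‖f‖ with hc
  have hc0 : 0 < c := by positivity
  have hlayer := lintegral_rpow_eq_lintegral_meas_lt_mul (volume : Measure Plane)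
    (f := fun x => |f x|) (.of_forall fun x => abs_nonneg _)
    ((Lp.aestronglyMeasurable f).aemeasurable.abs) (by norm_num : (0 : ℝ) < 4)
  have e4 : ∀ x, |f x| ^ (4 : ℝ) = f x ^ 4 := fun x => by
    rw [show (4 : ℝ) = (4 : ℕ) by norm_num, Real.rpow_natCast]
    exact Even.pow_abs (by decide) _
  simp only [e4] at hlayer
  rw [hlayer]
  set F : ℝ → Plane → ENNReal := fun t ξ =>
    ENNReal.ofReal (4 * t) * (if t < c * ‖ξ‖ then ENNReal.ofReal (‖hat f ξ‖ ^ 2) else 0) with hF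
  have hstep : ∫⁻ t in Ioi (0 : ℝ), volume {x | t < |f x|} * ENNReal.ofReal (t ^ ((4 : ℝ) - 1)) ≤
      ∫⁻ t in Ioi (0 : ℝ), ∫⁻ ξ, F t ξ := by
    refine setLIntegral_mono' measurableSet_Ioi fun t ht => ?_
    have ht0 : 0 < t := ht
    rw [hF, lintegral_const_mul' _ _ ENNReal.ofReal_ne_top]
    refine (mul_le_mul_left (meas_abs_gt_le h0 ht0) _).trans (le_of_eq ?_)
    have e1 : ∀ ξ : Plane, (t / c < ‖ξ‖) = (t < c * ‖ξ‖) := fun ξ => by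
      rw [div_lt_iff₀ hc0, mul_comm]
    rw [← hc]
    simp only [e1]
    rw [mul_right_comm, ← ENNReal.ofReal_mul (by positivity)]
    congr 2
    rw [show (4 : ℝ) - 1 = (3 : ℕ) by norm_num, Real.rpow_natCast]
    field_simp
  have hmeasF : AEMeasurable (Function.uncurry F) ((volume.restrict (Ioi 0)).prod volume) := by
    refine AEMeasurable.mul ?_ ?_
    · exact (ENNReal.measurable_ofReal.comp (measurable_fst.const_mul 4)).aemeasurable
    · have hs : MeasurableSet {p : ℝ × Plane | p.1 < c * ‖p.2‖} :=
        measurableSet_lt measurable_fst (measurable_snd.norm.const_mul c)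
      have h1 : AEMeasurable (fun p : ℝ × Plane => ENNReal.ofReal (‖hat f p.2‖ ^ 2))
          ((volume.restrict (Ioi 0)).prod volume) :=
        (((Lp.aestronglyMeasurable (hat f)).norm.aemeasurable.pow_const 2).ennreal_ofReal).comp_snd
      exact (h1.indicator hs).congr (.of_forall fun p => by simp [indicator])
  rw [lintegral_lintegral_swap hmeasF] at hstep
  have hin : ∀ᵐ ξ : Plane, ∫⁻ t in Ioi (0 : ℝ), F t ξ ≤
      ENNReal.ofReal (4 * c ^ 2) * ENNReal.ofReal (‖hat (absD 1 f) ξ‖ ^ 2) := by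
    filter_upwards [hf.hasMult] with ξ hξ
    set R := c * ‖ξ‖
    have hR : 0 ≤ R := by positivity
    have hle : ∀ t ∈ Ioi (0 : ℝ), F t ξ ≤ (Iio R).indicator
        (fun _ => ENNReal.ofReal (4 * R) * ENNReal.ofReal (‖hat f ξ‖ ^ 2)) t := fun t ht => by
      simp only [hF, indicator, mem_Iio]
      split_ifs with h
      · exact mul_le_mul_left (ENNReal.ofReal_le_ofReal (by linarith)) _
      · simp
    refine (setLIntegral_mono' measurableSet_Ioi hle).trans ?_
    rw [lintegral_indicator measurableSet_Iio, Measure.restrict_restrict measurableSet_Iio,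
      setLIntegral_const, Iio_inter_Ioi, Real.volume_Ioo, sub_zero, mul_right_comm,
      ← ENNReal.ofReal_mul (by positivity), ← ENNReal.ofReal_mul (by positivity),
      ← ENNReal.ofReal_mul (by positivity)]
    refine ENNReal.ofReal_le_ofReal (le_of_eq ?_)
    rw [hξ, norm_mul, norm_rad, Real.rpow_one]
    simp only [R]; ring
  have htot := hstep.trans (lintegral_mono_ae hin)
  rw [lintegral_const_mul' _ _ ENNReal.ofReal_ne_top, lintegral_sq_hat_eq,
    ← ENNReal.ofReal_mul (by positivity)] at htot
  refine (mul_le_mul_right htot _).trans (le_of_eq ?_)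
  rw [← ENNReal.ofReal_mul (by norm_num)]
  congr 1
  rw [hc, mul_pow, mul_pow, Real.sq_sqrt area_pos.le]
  ring

theorem InH.integrable_pow_four {f : L2} (hf : InH 1 f) : Integrable fun x => f x ^ 4 := by
  refine ⟨((Lp.aestronglyMeasurable f).aemeasurable.pow_const 4).aestronglyMeasurable, ?_⟩
  rw [hasFiniteIntegral_iff_ofReal (.of_forall fun x => by positivity)]
  exact (lintegral_pow_four_le hf).trans_lt ENNReal.ofReal_lt_top

theorem InH.integral_pow_four_le {f : L2} (hf : InH 1 f) :
    ∫ x, f x ^ 4 ≤ 64 * area * (‖f‖ ^ 2 * ‖absD 1 f‖ ^ 2) := by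
  have ha := area_pos
  rw [integral_eq_lintegral_of_nonneg_ae (.of_forall fun x => by positivity)
    hf.integrable_pow_four.aestronglyMeasurable]
  exact ENNReal.toReal_le_of_le_ofReal (by positivity) (lintegral_pow_four_le hf)

/-! ### Convergence of multipliers and difference quotients -/

theorem inH_zero (f : L2) : InH 0 f :=
  ⟨f, .of_forall fun ξ => by simp [rad]⟩

/-- Dominated convergence on the Fourier side, with majorant B²|ξ|^{2s}|f̂|². -/
theorem HasMult.tendsto {ι : Type*} {l : Filter ι} [l.IsCountablyGenerated] {s B : ℝ}
    {m : ι → Plane → ℂ} {n : Plane → ℂ} {f : L2} {g : ι → L2} {g₀ : L2} (hf : InH s f)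
    (hg : ∀ i, HasMult (m i) f (g i)) (hg₀ : HasMult n f g₀)
    (hb : ∀ i, ∀ ξ : Plane, 0 < ‖ξ‖ → ‖m i ξ - n ξ‖ ≤ B * ‖ξ‖ ^ s)
    (hlim : ∀ ξ : Plane, 0 < ‖ξ‖ → Tendsto (fun i => m i ξ) l (𝓝 (n ξ))) :
    Tendsto g l (𝓝 g₀) := by
  rw [tendsto_iff_norm_sub_tendsto_zero]
  have h1 : ∀ i, hat (g i - g₀) =ᵐ[volume] fun ξ => (m i ξ - n ξ) * hat f ξ := fun i => by
    rw [hat_sub]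
    filter_upwards [hg i, hg₀, Lp.coeFn_sub (hat (g i)) (hat g₀)] with ξ a b c
    rw [c, Pi.sub_apply, a, b, sub_mul]
  have e1 : ∀ i, ‖g i - g₀‖ ^ 2 = ∫ ξ, ‖(m i ξ - n ξ) * hat f ξ‖ ^ 2 := fun i => by
    rw [sq_norm_eq_integral_hat]
    exact integral_congr_ae ((h1 i).mono fun ξ h => by simp only [h])
  have h2 : Tendsto (fun i => ∫ ξ, ‖(m i ξ - n ξ) * hat f ξ‖ ^ 2) l
      (𝓝 (∫ _ : Plane, (0 : ℝ))) := by
    refine tendsto_integral_filter_of_dominated_convergence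
      (fun ξ => B ^ 2 * ‖hat (absD s f) ξ‖ ^ 2) (.of_forall fun i =>
        (integrable_sq_hat (g i - g₀)).aestronglyMeasurable.congr
          ((h1 i).mono fun ξ h => by simp only [h])) (.of_forall fun i => ?_)
      ((integrable_sq_hat _).const_mul _) ?_
    · filter_upwards [hf.hasMult, ae_norm_pos] with ξ b c
      rw [norm_pow, norm_norm, b, norm_mul, norm_mul, norm_rad, mul_pow, mul_pow, ← mul_assoc,
        ← mul_pow B]
      have := pow_le_pow_left₀ (norm_nonneg _) (hb i ξ c) 2
      exact mul_le_mul_of_nonneg_right this (sq_nonneg _)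
    · filter_upwards [ae_norm_pos] with ξ hξ
      have h3 := (((hlim ξ hξ).sub_const (n ξ)).mul_const (hat f ξ)).norm.pow 2
      simpa using h3
  have h3 : Tendsto (fun i => Real.sqrt (‖g i - g₀‖ ^ 2)) l (𝓝 0) := by
    simp only [e1]
    simpa using h2.sqrt
  simpa only [Real.sqrt_sq (norm_nonneg _)] using h3

/-! ### Translations and difference quotients -/

theorem norm_chr_sub_one_le (z ξ : Plane) : ‖chr z ξ - 1‖ ≤ 2 * Real.pi * (‖z‖ * ‖ξ‖) := by
  have h : chr z ξ = Complex.exp (Complex.I * ((-(2 * Real.pi * inner ℝ z ξ) : ℝ) : ℂ)) := by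
    rw [chr, Real.fourierChar_apply]; congr 1; push_cast; ring
  rw [h]
  refine Real.norm_exp_I_mul_ofReal_sub_one_le.trans ?_
  rw [norm_neg, norm_mul, norm_mul, Real.norm_two, Real.norm_of_nonneg Real.pi_pos.le]
  exact mul_le_mul_of_nonneg_left (norm_inner_le_norm z ξ) (by positivity)

theorem norm_trans_sub_le {f : L2} (hf : InH 1 f) (z : Plane) :
    ‖trans z f - f‖ ≤ 2 * Real.pi * ‖z‖ * ‖absD 1 f‖ := by
  have h : HasMult (fun ξ => chr z ξ - 1) f (trans z f - f) := by
    rw [HasMult, hat_sub]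
    filter_upwards [hasMult_trans z f, Lp.coeFn_sub (hat (trans z f)) (hat f)] with ξ a b
    rw [b, Pi.sub_apply, a]; ring
  rw [← norm_hat (trans z f - f), ← norm_hat (absD 1 f)]
  refine Lp.norm_le_mul_norm_of_ae_le_mul ?_
  filter_upwards [h, hf.hasMult] with ξ a b
  rw [a, b, norm_mul, norm_mul, norm_rad, Real.rpow_one, ← mul_assoc]
  refine mul_le_mul_of_nonneg_right ((norm_chr_sub_one_le z ξ).trans (le_of_eq (by ring)))
    (norm_nonneg _)

/-- The step `h eⱼ`. -/
def step (j : Fin 2) (h : ℝ) : Plane := h • EuclideanSpace.single j 1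

theorem norm_step (j : Fin 2) (h : ℝ) : ‖step j h‖ = |h| := by
  simp [step, norm_smul]

theorem chr_step (j : Fin 2) (h : ℝ) (ξ : Plane) :
    chr (step j h) ξ = Complex.exp (-(h : ℂ) * dsym j ξ) := by
  rw [chr, Real.fourierChar_apply, step, inner_smul_left, inner_single, dsym]
  congr 1; push_cast
  simp; ring

/-- Difference quotient. -/
def dq (j : Fin 2) (h : ℝ) (f : L2) : L2 := h⁻¹ • (f - trans (step j h) f)

theorem hasMult_dq (j : Fin 2) (h : ℝ) (f : L2) :
    HasMult (fun ξ => (h : ℂ)⁻¹ * (1 - chr (step j h) ξ)) f (dq j h f) := by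
  rw [HasMult, dq, hat_smul, hat_sub]
  filter_upwards [hasMult_trans (step j h) f, Lp.coeFn_sub (hat f) (hat (trans (step j h) f)),
    Lp.coeFn_smul ((h⁻¹ : ℝ) : ℂ) (hat f - hat (trans (step j h) f))] with ξ a b c
  rw [c, Pi.smul_apply, b, Pi.sub_apply, a, smul_eq_mul]
  push_cast; ring

theorem norm_dq_symbol_le (j : Fin 2) (h : ℝ) (ξ : Plane) :
    ‖(h : ℂ)⁻¹ * (1 - chr (step j h) ξ)‖ ≤ 2 * Real.pi * ‖ξ‖ := by
  rw [norm_mul, norm_inv, Complex.norm_real, norm_sub_rev]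
  rcases eq_or_ne h 0 with rfl | hh
  · simp; positivity
  · rw [inv_mul_le_iff₀ (norm_pos_iff.2 hh)]
    refine (norm_chr_sub_one_le _ _).trans (le_of_eq ?_)
    rw [norm_step, Real.norm_eq_abs]; ring

theorem tendsto_dq_symbol (j : Fin 2) (ξ : Plane) :
    Tendsto (fun h : ℝ => (h : ℂ)⁻¹ * (1 - chr (step j h) ξ)) (𝓝[≠] 0) (𝓝 (dsym j ξ)) := by
  have h1 : HasDerivAt (fun h : ℝ => Complex.exp (-(h : ℂ) * dsym j ξ)) (-dsym j ξ) 0 := by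
    have h2 : HasDerivAt (fun h : ℝ => -(h : ℂ) * dsym j ξ) (-1 * dsym j ξ) 0 :=
      (Complex.ofRealCLM.hasDerivAt (x := (0 : ℝ))).neg.mul_const _
    simpa using h2.cexp
  have h3 := h1.tendsto_slope_zero.neg
  rw [neg_neg] at h3
  refine h3.congr fun h => ?_
  rw [chr_step]
  simp
  ring

theorem tendsto_dq (j : Fin 2) {f : L2} (hf : InH 1 f) :
    Tendsto (fun h => dq j h f) (𝓝[≠] 0) (𝓝 (partialD j f)) := by
  refine HasMult.tendsto (B := 4 * Real.pi) hf (fun h => hasMult_dq j h f) (hasMult_partialD j hf)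
    (fun h ξ _ => ?_) fun ξ _ => tendsto_dq_symbol j ξ
  rw [Real.rpow_one]
  refine (norm_sub_le _ _).trans ?_
  have := norm_dq_symbol_le j h ξ
  have := norm_dsym_le j ξ
  linarith

theorem tendsto_trans (j : Fin 2) (f : L2) :
    Tendsto (fun h => trans (step j h) f) (𝓝[≠] 0) (𝓝 f) := by
  refine HasMult.tendsto (B := 2) (inH_zero f) (fun h => hasMult_trans (step j h) f)
    (n := fun _ => 1) (.of_forall fun ξ => by simp) (fun h ξ _ => ?_) fun ξ _ => ?_
  · refine (norm_sub_le _ _).trans ?_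
    rw [norm_chr, norm_one, Real.rpow_zero]; norm_num
  · have h1 : Continuous fun h : ℝ => chr (step j h) ξ := by
      simp only [chr_step]; fun_prop
    have h2 := h1.tendsto 0
    simp only [chr_step] at h2 ⊢
    simpa using h2.mono_left nhdsWithin_le_nhds

theorem dq_eq_ae (j : Fin 2) (h : ℝ) (f : L2) :
    ∀ᵐ x : Plane, dq j h f x = h⁻¹ * (f x - f (x - step j h)) := by
  filter_upwards [Lp.coeFn_smul h⁻¹ (f - trans (step j h) f),
    Lp.coeFn_sub f (trans (step j h) f), coeFn_trans (step j h) f] with x a b c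
  rw [dq, a, Pi.smul_apply, b, Pi.sub_apply, c, smul_eq_mul]

/-! ### Differentiability from Lipschitz continuity of translations -/

/-- Fatou's lemma for the transforms of the difference quotients. The factor 2 comes from adding the
two directions, |ξ|² being at most the sum of the squared symbols of the partial derivatives. -/
theorem inH_one_of_dq {f : L2} {M : ℝ}
    (h : ∀ j, ∀ᶠ t in 𝓝[≠] (0 : ℝ), ‖dq j t f‖ ≤ M) :
    InH 1 f ∧ (∀ j, ‖partialD j f‖ ≤ M) ∧ ‖absD 1 f‖ ^ 2 ≤ 2 * M ^ 2 := by
  have hM : 0 ≤ M := by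
    obtain ⟨t, ht⟩ := (h 0).exists
    exact (norm_nonneg _).trans ht
  have key : ∀ j, ∫⁻ ξ, ENNReal.ofReal (‖dsym j ξ * hat f ξ‖ ^ 2) ≤ ENNReal.ofReal (M ^ 2) := by
    intro j
    have hF : ∀ t : ℝ, AEMeasurable (fun ξ => ENNReal.ofReal
        (‖(t : ℂ)⁻¹ * (1 - chr (step j t) ξ) * hat f ξ‖ ^ 2)) volume := fun t => by
      refine AEMeasurable.ennreal_ofReal (AEMeasurable.pow_const (AEMeasurable.norm ?_) 2)
      exact (Lp.aestronglyMeasurable (hat (dq j t f))).aemeasurable.congr (hasMult_dq j t f)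
    have h1 := lintegral_liminf_le' (u := 𝓝[≠] (0 : ℝ)) hF
    have h2 : ∀ ξ, liminf (fun t : ℝ => ENNReal.ofReal
        (‖(t : ℂ)⁻¹ * (1 - chr (step j t) ξ) * hat f ξ‖ ^ 2)) (𝓝[≠] (0 : ℝ)) =
        ENNReal.ofReal (‖dsym j ξ * hat f ξ‖ ^ 2) := fun ξ =>
      (ENNReal.tendsto_ofReal
        (((tendsto_dq_symbol j ξ).mul_const (hat f ξ)).norm.pow 2)).liminf_eq
    simp only [h2] at h1
    refine h1.trans ?_
    refine liminf_le_of_le (by isBoundedDefault) fun b hb => ?_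
    obtain ⟨t, ht1, ht2⟩ := (hb.and (h j)).exists
    refine ht1.trans ?_
    have h3 : ∫⁻ ξ, ENNReal.ofReal (‖(t : ℂ)⁻¹ * (1 - chr (step j t) ξ) * hat f ξ‖ ^ 2) =
        ∫⁻ ξ, ENNReal.ofReal (‖hat (dq j t f) ξ‖ ^ 2) :=
      lintegral_congr_ae ((hasMult_dq j t f).mono fun ξ hξ => by simp only [hξ])
    rw [h3, lintegral_sq_hat_eq]
    exact ENNReal.ofReal_le_ofReal (pow_le_pow_left₀ (norm_nonneg _) ht2 2)
  have hsum : ∀ ξ : Plane, ENNReal.ofReal (‖rad 1 ξ * hat f ξ‖ ^ 2) ≤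
      ENNReal.ofReal (‖dsym 0 ξ * hat f ξ‖ ^ 2) + ENNReal.ofReal (‖dsym 1 ξ * hat f ξ‖ ^ 2) := by
    intro ξ
    rw [← ENNReal.ofReal_add (by positivity) (by positivity)]
    refine ENNReal.ofReal_le_ofReal ?_
    have e : ∀ j, ‖dsym j ξ‖ ^ 2 = (2 * Real.pi) ^ 2 * (ξ j) ^ 2 := fun j => by
      rw [dsym]; simp [mul_pow, abs_of_pos Real.pi_pos]
    have e2 : ‖ξ‖ ^ 2 = ξ 0 ^ 2 + ξ 1 ^ 2 := by
      rw [EuclideanSpace.real_norm_sq_eq, Fin.sum_univ_two]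
    rw [norm_mul, norm_mul, norm_mul, mul_pow, mul_pow, mul_pow, e, e, norm_rad, Real.rpow_one, e2]
    have h1 : 1 ≤ (2 * Real.pi) ^ 2 := by nlinarith [Real.pi_gt_three]
    rw [← add_mul, ← mul_add]
    refine mul_le_mul_of_nonneg_right ?_ (sq_nonneg _)
    nlinarith [sq_nonneg (ξ 0), sq_nonneg (ξ 1)]
  have htot : ∫⁻ ξ, ENNReal.ofReal (‖rad 1 ξ * hat f ξ‖ ^ 2) ≤ ENNReal.ofReal (2 * M ^ 2) := by
    refine (lintegral_mono hsum).trans ?_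
    rw [lintegral_add_left']
    · refine (add_le_add (key 0) (key 1)).trans (le_of_eq ?_)
      rw [← ENNReal.ofReal_add (by positivity) (by positivity)]; congr 1; ring
    · exact (((realSymbol_dsym 0).meas.aemeasurable.mul
        (Lp.aestronglyMeasurable (hat f)).aemeasurable).norm.pow_const 2).ennreal_ofReal
  have hmeas : AEStronglyMeasurable (fun ξ => rad 1 ξ * hat f ξ) volume :=
    (realSymbol_rad 1).meas.aestronglyMeasurable.mul (Lp.aestronglyMeasurable _)
  have hin : InH 1 f := by
    refine inH_of_memLp ((memLp_two_iff_integrable_sq_norm hmeas).2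
      ⟨(hmeas.norm.aemeasurable.pow_const 2).aestronglyMeasurable, ?_⟩)
    rw [hasFiniteIntegral_iff_ofReal (.of_forall fun x => by positivity)]
    exact htot.trans_lt ENNReal.ofReal_lt_top
  refine ⟨hin, fun j => ?_, ?_⟩
  · have h1 := lintegral_sq_hat_eq (partialD j f)
    have h2 : ∫⁻ ξ, ENNReal.ofReal (‖hat (partialD j f) ξ‖ ^ 2) =
        ∫⁻ ξ, ENNReal.ofReal (‖dsym j ξ * hat f ξ‖ ^ 2) :=
      lintegral_congr_ae ((hasMult_partialD j hin).mono fun ξ hξ => by simp only [hξ])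
    rw [h2] at h1
    have h3 := key j
    rw [h1, ENNReal.ofReal_le_ofReal_iff (by positivity)] at h3
    exact (abs_le_of_sq_le_sq' h3 hM).2
  · have h1 := lintegral_sq_hat_eq (absD 1 f)
    have h2 : ∫⁻ ξ, ENNReal.ofReal (‖hat (absD 1 f) ξ‖ ^ 2) =
        ∫⁻ ξ, ENNReal.ofReal (‖rad 1 ξ * hat f ξ‖ ^ 2) :=
      lintegral_congr_ae (hin.hasMult.mono fun ξ hξ => by simp only [hξ])
    rw [h2] at h1
    rwa [h1, ENNReal.ofReal_le_ofReal_iff (by positivity)] at htot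

/-! ### Products -/

/-- The product of two functions, when it is square integrable. -/
def mulL (a b : L2) : L2 :=
  open Classical in if h : MemLp (fun x => a x * b x) 2 (volume : Measure Plane) then h.toLp else 0

theorem coeFn_mulL {a b : L2} (h : MemLp (fun x => a x * b x) 2 (volume : Measure Plane)) :
    mulL a b =ᵐ[volume] fun x => a x * b x := by
  rw [mulL, dif_pos h]; exact h.coeFn_toLp

theorem memLp_mul_of_bdd {a b : L2} {K : ℝ} (hK : ∀ᵐ x : Plane, |b x| ≤ K) :
    MemLp (fun x => a x * b x) 2 (volume : Measure Plane) :=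
  (Lp.memLp a).of_le_mul (c := K)
    ((Lp.aestronglyMeasurable _).mul (Lp.aestronglyMeasurable _)) (by
      filter_upwards [hK] with x h
      rw [norm_mul, mul_comm]
      exact mul_le_mul_of_nonneg_right h (norm_nonneg _))

theorem memLp_mul_of_inH {a b : L2} (ha : InH 1 a) (hb : InH 1 b) :
    MemLp (fun x => a x * b x) 2 (volume : Measure Plane) := by
  have hm : AEStronglyMeasurable (fun x => a x * b x) volume :=
    (Lp.aestronglyMeasurable a).mul (Lp.aestronglyMeasurable b)
  rw [memLp_two_iff_integrable_sq hm]
  refine (ha.integrable_pow_four.add hb.integrable_pow_four).mono' (hm.pow 2)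
    (.of_forall fun x => ?_)
  rw [Real.norm_of_nonneg (sq_nonneg _)]
  simp only [Pi.add_apply]
  nlinarith [sq_nonneg (a x ^ 2 - b x ^ 2), sq_nonneg (a x ^ 2), sq_nonneg (b x ^ 2)]

theorem norm_mulL_le {a b : L2} {K : ℝ} (hK : ∀ᵐ x : Plane, |b x| ≤ K) :
    ‖mulL a b‖ ≤ K * ‖a‖ := by
  refine Lp.norm_le_mul_norm_of_ae_le_mul ?_
  filter_upwards [coeFn_mulL (memLp_mul_of_bdd (a := a) hK), hK] with x h1 h2
  rw [h1, norm_mul, mul_comm]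
  exact mul_le_mul_of_nonneg_right h2 (norm_nonneg _)

theorem mulL_sub_left {a a' b : L2} {K : ℝ} (hK : ∀ᵐ x : Plane, |b x| ≤ K) :
    mulL (a - a') b = mulL a b - mulL a' b := by
  refine Lp.ext ?_
  filter_upwards [coeFn_mulL (memLp_mul_of_bdd (a := a) hK),
    coeFn_mulL (memLp_mul_of_bdd (a := a') hK), coeFn_mulL (memLp_mul_of_bdd (a := a - a') hK),
    Lp.coeFn_sub a a', Lp.coeFn_sub (mulL a b) (mulL a' b)] with x h1 h2 h3 h4 h5
  rw [h3, h5, Pi.sub_apply, h1, h2, h4, Pi.sub_apply, sub_mul]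

theorem tendsto_mulL {ι : Type*} {l : Filter ι} {g : ι → L2} {a b : L2} {K : ℝ}
    (hK : ∀ᵐ x : Plane, |b x| ≤ K) (h : Tendsto g l (𝓝 a)) :
    Tendsto (fun i => mulL (g i) b) l (𝓝 (mulL a b)) := by
  rw [tendsto_iff_norm_sub_tendsto_zero] at h ⊢
  refine squeeze_zero (fun _ => norm_nonneg _) (fun i => ?_) (by simpa using h.const_mul K)
  rw [← mulL_sub_left hK]
  exact norm_mulL_le hK

theorem integrable_mul_L2 (f g : L2) : Integrable fun x => f x * g x :=
  (Lp.memLp f).integrable_mul (Lp.memLp g)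

theorem integrable_fun_add {f g : Plane → ℝ} (hf : Integrable f) (hg : Integrable g) :
    Integrable fun x => f x + g x := hf.add hg

theorem integrable_fun_sub {f g : Plane → ℝ} (hf : Integrable f) (hg : Integrable g) :
    Integrable fun x => f x - g x := hf.sub hg

theorem integral_comp_sub (P : Plane → ℝ) (z : Plane) : ∫ x, P (x - z) = ∫ x, P x :=
  integral_sub_right_eq_self P z

/-! ### Integration by parts -/

/-- `∫ ∂(abc) = 0`. -/
theorem inner_partialD_triple (j : Fin 2) {a b c : L2} {K : ℝ} (ha : InH 1 a) (hb : InH 1 b)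
    (hc : InH 1 c) (hK : ∀ᵐ x : Plane, |c x| ≤ K) :
    inner ℝ (partialD j a) (mulL b c) + inner ℝ (partialD j b) (mulL a c) +
      inner ℝ (partialD j c) (mulL a b) = 0 := by
  -- The translations are placed so that the three discrete terms telescope exactly to the
  -- difference quotient of abc, whose integral is 0 for every h.
  have hlim : Tendsto (fun h => inner ℝ (dq j h a) (mulL b c) +
      inner ℝ (dq j h b) (mulL (trans (step j h) a) c) +
      inner ℝ (dq j h c) (trans (step j h) (mulL a b))) (𝓝[≠] 0)
      (𝓝 (inner ℝ (partialD j a) (mulL b c) + inner ℝ (partialD j b) (mulL a c) +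
      inner ℝ (partialD j c) (mulL a b))) :=
    (((tendsto_dq j ha).inner tendsto_const_nhds).add
      ((tendsto_dq j hb).inner (tendsto_mulL hK (tendsto_trans j a)))).add
      ((tendsto_dq j hc).inner (tendsto_trans j _))
  refine tendsto_nhds_unique hlim (tendsto_const_nhds.congr fun h => ?_)
  set z := step j h
  have hbc := coeFn_mulL (memLp_mul_of_bdd (a := b) hK)
  have hP : Integrable fun x => a x * (b x * c x) :=
    (integrable_mul_L2 a (mulL b c)).congr (hbc.mono fun x h => by simp only [h])
  rw [inner_eq_integral, inner_eq_integral, inner_eq_integral,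
    ← integral_add (integrable_mul_L2 _ _) (integrable_mul_L2 _ _),
    ← integral_add (integrable_fun_add (integrable_mul_L2 _ _) (integrable_mul_L2 _ _))
      (integrable_mul_L2 _ _)]
  have h0 : ∫ x, h⁻¹ * (a x * (b x * c x) - a (x - z) * (b (x - z) * c (x - z))) = 0 := by
    rw [integral_const_mul, integral_sub hP (hP.comp_sub_right z),
      integral_comp_sub (fun x => a x * (b x * c x)) z, sub_self, mul_zero]
  rw [← h0]
  refine integral_congr_ae ?_
  filter_upwards [dq_eq_ae j h a, dq_eq_ae j h b, dq_eq_ae j h c, hbc,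
    coeFn_mulL (memLp_mul_of_bdd (a := trans z a) hK), coeFn_trans z (mulL a b), coeFn_trans z a,
    ae_sub z (coeFn_mulL (memLp_mul_of_inH ha hb))] with x h1 h2 h3 h4 h5 h6 h7 h8
  rw [h1, h2, h3, h4, h5, h6, h7, h8]
  ring

/-! ### Convex nonlinearities -/

/-- `Φ` is a convex function with Lipschitz derivative `φ`, vanishing to second order at `0`. -/
structure Nonlin (Φ φ : ℝ → ℝ) (L : ℝ) : Prop where
  deriv : ∀ x, HasDerivAt Φ (φ x) x
  lip : ∀ a b, |φ a - φ b| ≤ L * |a - b|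
  zero : Φ 0 = 0
  zero' : φ 0 = 0
  mono : Monotone φ

namespace Nonlin

variable {Φ φ : ℝ → ℝ} {L : ℝ}

theorem nonneg (N : Nonlin Φ φ L) : 0 ≤ L := by
  have := N.lip 1 0
  simp at this
  exact (abs_nonneg _).trans this

theorem abs_taylor_le (N : Nonlin Φ φ L) (a b : ℝ) :
    |Φ b - Φ a - φ a * (b - a)| ≤ L * (b - a) ^ 2 := by
  have h := (convex_uIcc a b).norm_image_sub_le_of_norm_hasDerivWithin_le (x := a) (y := b)
    (f := fun x => Φ x - φ a * x) (f' := fun x => φ x - φ a) (C := L * |b - a|)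
    (fun x _ => ((N.deriv x).sub (by simpa using (hasDerivAt_id x).const_mul (φ a))).hasDerivWithinAt)
    (fun x hx => (N.lip x a).trans
      (mul_le_mul_of_nonneg_left (abs_sub_left_of_mem_uIcc hx) N.nonneg))
    left_mem_uIcc right_mem_uIcc
  rw [Real.norm_eq_abs, Real.norm_eq_abs, mul_assoc, abs_mul_abs_self, ← sq] at h
  refine le_trans (le_of_eq ?_) h
  congr 1; ring

theorem abs_le_sq (N : Nonlin Φ φ L) (x : ℝ) : |Φ x| ≤ L * x ^ 2 := by
  simpa [N.zero, N.zero'] using N.abs_taylor_le 0 x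

theorem mul_sub_le (N : Nonlin Φ φ L) (a b : ℝ) : φ a * (b - a) ≤ Φ b - Φ a := by
  rcases lt_trichotomy a b with h | h | h
  · obtain ⟨c, hc, he⟩ := exists_hasDerivAt_eq_slope Φ φ h
      (fun x _ => (N.deriv x).continuousAt.continuousWithinAt) fun x _ => N.deriv x
    rw [eq_div_iff (sub_pos.2 h).ne'] at he
    rw [← he]
    exact mul_le_mul_of_nonneg_right (N.mono hc.1.le) (sub_pos.2 h).le
  · rw [h]; simp
  · obtain ⟨c, hc, he⟩ := exists_hasDerivAt_eq_slope Φ φ h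
      (fun x _ => (N.deriv x).continuousAt.continuousWithinAt) fun x _ => N.deriv x
    rw [eq_div_iff (sub_pos.2 h).ne'] at he
    have := mul_le_mul_of_nonneg_right (N.mono hc.2.le) (sub_pos.2 h).le
    linarith

theorem nonneg_apply (N : Nonlin Φ φ L) (x : ℝ) : 0 ≤ Φ x := by
  simpa [N.zero, N.zero'] using N.mul_sub_le 0 x

theorem continuous (N : Nonlin Φ φ L) : Continuous Φ :=
  continuous_iff_continuousAt.2 fun x => (N.deriv x).continuousAt

theorem lipschitz (N : Nonlin Φ φ L) : LipschitzWith L.toNNReal φ :=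
  LipschitzWith.of_dist_le_mul fun a b => by
    rw [Real.dist_eq, Real.dist_eq, Real.coe_toNNReal _ N.nonneg]; exact N.lip a b

/-- The function `φ ∘ w`. -/
def app (N : Nonlin Φ φ L) (w : L2) : L2 := N.lipschitz.compLp N.zero' w

theorem coeFn_app (N : Nonlin Φ φ L) (w : L2) : N.app w =ᵐ[volume] fun x => φ (w x) :=
  N.lipschitz.coeFn_compLp N.zero' w

theorem continuous_app (N : Nonlin Φ φ L) : Continuous N.app := N.lipschitz.continuous_compLp N.zero'

theorem norm_app_sub_le (N : Nonlin Φ φ L) (v w : L2) : ‖N.app v - N.app w‖ ≤ L * ‖v - w‖ := by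
  have := N.lipschitz.norm_compLp_sub_le N.zero' v w
  rwa [Real.coe_toNNReal _ N.nonneg] at this

theorem app_trans (N : Nonlin Φ φ L) (z : Plane) (w : L2) : N.app (trans z w) = trans z (N.app w) := by
  refine Lp.ext ?_
  filter_upwards [N.coeFn_app (trans z w), coeFn_trans z w, coeFn_trans z (N.app w),
    ae_sub z (N.coeFn_app w)] with x h1 h2 h3 h4
  rw [h1, h2, h3, h4]

theorem norm_dq_app_le (N : Nonlin Φ φ L) {w : L2} (hw : InH 1 w) (j : Fin 2) (h : ℝ) :
    ‖dq j h (N.app w)‖ ≤ L * (2 * Real.pi * ‖absD 1 w‖) := by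
  have h1 := N.norm_app_sub_le w (trans (step j h) w)
  rw [N.app_trans] at h1
  rw [dq, norm_smul]
  rcases eq_or_ne h 0 with rfl | hh
  · have := N.nonneg
    simp; positivity
  · rw [norm_inv, inv_mul_le_iff₀ (norm_pos_iff.2 hh)]
    refine h1.trans ?_
    have h2 := norm_trans_sub_le hw (step j h)
    rw [norm_step, norm_sub_rev] at h2
    calc _ ≤ L * (2 * Real.pi * |h| * ‖absD 1 w‖) := mul_le_mul_of_nonneg_left h2 N.nonneg
      _ = _ := by rw [Real.norm_eq_abs]; ring

/-- A Lipschitz map commutes with translations and enlarges increments by at most the factor L, so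
the difference quotients of φ(w) stay bounded in `L²`. No pointwise chain rule for φ is needed. -/
theorem inH_app (N : Nonlin Φ φ L) {w : L2} (hw : InH 1 w) : InH 1 (N.app w) ∧
    (∀ j, ‖partialD j (N.app w)‖ ≤ L * (2 * Real.pi * ‖absD 1 w‖)) ∧
      ‖absD 1 (N.app w)‖ ^ 2 ≤ 2 * (L * (2 * Real.pi * ‖absD 1 w‖)) ^ 2 :=
  inH_one_of_dq fun j => .of_forall fun t => N.norm_dq_app_le hw j t

theorem memLp_comp (N : Nonlin Φ φ L) {w : L2} (hw : InH 1 w) :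
    MemLp (fun x => Φ (w x)) 2 (volume : Measure Plane) := by
  have hm : AEStronglyMeasurable (fun x => Φ (w x)) volume :=
    N.continuous.comp_aestronglyMeasurable (Lp.aestronglyMeasurable w)
  rw [memLp_two_iff_integrable_sq hm]
  refine (hw.integrable_pow_four.const_mul (L ^ 2)).mono' (hm.pow 2) (.of_forall fun x => ?_)
  rw [norm_pow, Real.norm_eq_abs]
  calc |Φ (w x)| ^ 2 ≤ (L * w x ^ 2) ^ 2 := pow_le_pow_left₀ (abs_nonneg _) (N.abs_le_sq _) 2
    _ = L ^ 2 * w x ^ 4 := by ring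

theorem integrable_comp (N : Nonlin Φ φ L) (w : L2) : Integrable fun x => Φ (w x) :=
  ((Lp.memLp w).integrable_sq.const_mul L).mono'
    (N.continuous.comp_aestronglyMeasurable (Lp.aestronglyMeasurable w))
    (.of_forall fun _ => N.abs_le_sq _)

/-- Chain rule. -/
theorem inner_app_partialD (N : Nonlin Φ φ L) (j : Fin 2) {w u P : L2} {K : ℝ} (hw : InH 1 w)
    (hu : InH 1 u) (hK : ∀ᵐ x : Plane, |u x| ≤ K) (hP : P =ᵐ[volume] fun x => Φ (w x)) :
    inner ℝ (partialD j w) (mulL (N.app w) u) + inner ℝ (partialD j u) P = 0 := by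
  have hK0 : 0 ≤ K := by
    obtain ⟨x, hx⟩ := hK.exists
    exact (abs_nonneg _).trans hx
  have hL := N.nonneg
  have hlim : Tendsto (fun h => inner ℝ (dq j h w) (mulL (N.app w) u) +
      inner ℝ (dq j h u) (trans (step j h) P)) (𝓝[≠] 0)
      (𝓝 (inner ℝ (partialD j w) (mulL (N.app w) u) + inner ℝ (partialD j u) P)) :=
    ((tendsto_dq j hw).inner tendsto_const_nhds).add ((tendsto_dq j hu).inner (tendsto_trans j _))
  refine tendsto_nhds_unique hlim ?_
  -- The discrete chain rule fails only by the second-order Taylor remainder of Φ. Divided by h it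
  -- is at most K L |h| times the square of the difference quotient of w, which tends to 0.
  have hb : Tendsto (fun h : ℝ => K * L * (|h| * ‖dq j h w‖ ^ 2)) (𝓝[≠] 0) (𝓝 0) := by
    have h1 : Tendsto (fun h : ℝ => |h|) (𝓝[≠] 0) (𝓝 0) := by
      simpa using (continuous_abs.tendsto (0 : ℝ)).mono_left nhdsWithin_le_nhds
    simpa using (h1.mul ((tendsto_dq j hw).norm.pow 2)).const_mul (K * L)
  refine squeeze_zero_norm' ?_ hb
  filter_upwards [self_mem_nhdsWithin] with h hh
  have hh0 : h ≠ 0 := hh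
  set z := step j h
  have hau := coeFn_mulL (memLp_mul_of_bdd (a := N.app w) hK)
  have hPu : Integrable fun x => P x * u x := integrable_mul_L2 P u
  rw [inner_eq_integral, inner_eq_integral,
    ← integral_add (integrable_mul_L2 _ _) (integrable_mul_L2 _ _)]
  have h0 : ∫ x, h⁻¹ * (P x * u x - P (x - z) * u (x - z)) = 0 := by
    rw [integral_const_mul, integral_sub hPu (hPu.comp_sub_right z),
      integral_comp_sub (fun x => P x * u x) z, sub_self, mul_zero]
  rw [← sub_zero (∫ x, _), ← h0, ← integral_sub
    (integrable_fun_add (integrable_mul_L2 _ _) (integrable_mul_L2 _ _))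
    ((integrable_fun_sub hPu (hPu.comp_sub_right z)).const_mul _)]
  have e : K * L * (|h| * ‖dq j h w‖ ^ 2) = ∫ x, K * L * (|h| * dq j h w x ^ 2) := by
    rw [integral_const_mul, integral_const_mul, sq_norm_eq_integral]
  rw [e]
  refine norm_integral_le_of_norm_le
    (((Lp.memLp (dq j h w)).integrable_sq.const_mul _).const_mul _) ?_
  filter_upwards [dq_eq_ae j h w, dq_eq_ae j h u, hau, coeFn_trans z P, N.coeFn_app w, hP,
    ae_sub z hP, hK] with x h1 h2 h3 h4 h5 h6 h7 h8
  rw [h1, h2, h3, h4, h5, h7, h6]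
  have ht := N.abs_taylor_le (w x) (w (x - z))
  have e2 : h⁻¹ * (w x - w (x - z)) * (φ (w x) * u x) + h⁻¹ * (u x - u (x - z)) * Φ (w (x - z)) -
      h⁻¹ * (Φ (w x) * u x - Φ (w (x - z)) * u (x - z)) =
      h⁻¹ * u x * (Φ (w (x - z)) - Φ (w x) - φ (w x) * (w (x - z) - w x)) := by ring
  rw [e2, Real.norm_eq_abs, abs_mul, abs_mul, abs_inv]
  calc |h|⁻¹ * |u x| * |Φ (w (x - z)) - Φ (w x) - φ (w x) * (w (x - z) - w x)|
      ≤ |h|⁻¹ * K * (L * (w (x - z) - w x) ^ 2) := by gcongr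
    _ = K * L * (|h| * (h⁻¹ * (w x - w (x - z))) ^ 2) := by
        rw [mul_pow, inv_pow, ← sq_abs h]
        field_simp
        ring

end Nonlin

/-! ### Derivatives -/

theorem InH.one {f : L2} (hf : InH 2 f) : InH 1 f := hf.mono zero_le_one one_le_two

theorem inH_partialD (i : Fin 2) {f : L2} (hf : InH 2 f) :
    InH 1 (partialD i f) ∧ ‖absD 1 (partialD i f)‖ ≤ 2 * Real.pi * ‖absD 2 f‖ := by
  have h : InH (1 + 1) f := by norm_num; exact hf
  have := h.of_hasMult (hasMult_partialD i hf.one) (realSymbol_dsym i)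
    (by positivity : 0 ≤ 2 * Real.pi) fun ξ _ => by rw [Real.rpow_one]; exact norm_dsym_le i ξ
  norm_num at this
  exact this

theorem partialD_sub (i : Fin 2) {f g : L2} (hf : InH 1 f) (hg : InH 1 g) :
    partialD i (f - g) = partialD i f - partialD i g :=
  (hasMult_partialD i (hf.sub hg)).unique ((hasMult_partialD i hf).sub (hasMult_partialD i hg))

theorem partialD_comm (i j : Fin 2) {f : L2} (hf : InH 2 f) :
    partialD i (partialD j f) = partialD j (partialD i f) := by
  have h1 := (hasMult_partialD j hf.one).comp (hasMult_partialD i (inH_partialD j hf).1)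
  have h2 := (hasMult_partialD i hf.one).comp (hasMult_partialD j (inH_partialD i hf).1)
  exact h1.unique (h2.congr (.of_forall fun ξ => mul_comm _ _))

theorem inner_mulL_swap {a b c : L2} {K : ℝ} (hK : ∀ᵐ x : Plane, |c x| ≤ K) :
    inner ℝ a (mulL b c) = inner ℝ b (mulL a c) := by
  rw [inner_eq_integral, inner_eq_integral]
  refine integral_congr_ae ?_
  filter_upwards [coeFn_mulL (memLp_mul_of_bdd (a := b) hK),
    coeFn_mulL (memLp_mul_of_bdd (a := a) hK)] with x h1 h2
  rw [h1, h2]; ring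

/-! ### Transport by a divergence free field -/

/-- A bounded divergence free `H²` vector field. -/
structure Solenoidal (u : Fin 2 → L2) (K : ℝ) : Prop where
  inH : ∀ i, InH 2 (u i)
  bdd : ∀ i, ∀ᵐ x : Plane, |u i x| ≤ K
  div : partialD 0 (u 0) + partialD 1 (u 1) = 0

/-- The transport term `u·∇w`. -/
def adv (u : Fin 2 → L2) (w : L2) : L2 := mulL (partialD 0 w) (u 0) + mulL (partialD 1 w) (u 1)

namespace Solenoidal

variable {u : Fin 2 → L2} {K : ℝ}

theorem coeFn_adv (h : Solenoidal u K) (w : L2) :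
    adv u w =ᵐ[volume] fun x => ∑ j, u j x * partialD j w x := by
  filter_upwards [Lp.coeFn_add (mulL (partialD 0 w) (u 0)) (mulL (partialD 1 w) (u 1)),
    coeFn_mulL (memLp_mul_of_bdd (a := partialD 0 w) (h.bdd 0)),
    coeFn_mulL (memLp_mul_of_bdd (a := partialD 1 w) (h.bdd 1))] with x h1 h2 h3
  rw [adv, h1, Pi.add_apply, h2, h3, Fin.sum_univ_two]; ring

/-- The integrand φ(w) u·∇w is u·∇Φ(w), and integration by parts leaves (div u) Φ(w) = 0. The
function Φ(w) is in `L²` because Φ grows quadratically and w is in L⁴. -/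
theorem inner_app_adv (h : Solenoidal u K) {Φ φ : ℝ → ℝ} {L : ℝ} (N : Nonlin Φ φ L) {w : L2}
    (hw : InH 1 w) : inner ℝ (N.app w) (adv u w) = 0 := by
  have hm := N.memLp_comp hw
  have h0 := N.inner_app_partialD 0 hw (h.inH 0).one (h.bdd 0) hm.coeFn_toLp
  have h1 := N.inner_app_partialD 1 hw (h.inH 1).one (h.bdd 1) hm.coeFn_toLp
  have h2 : inner ℝ (partialD 0 (u 0)) (hm.toLp : L2) + inner ℝ (partialD 1 (u 1)) (hm.toLp : L2)
      = 0 := by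
    rw [← inner_add_left, h.div, inner_zero_left]
  rw [adv, inner_add_right, inner_mulL_swap (h.bdd 0), inner_mulL_swap (h.bdd 1)]
  linarith

/-- Transport by a divergence free field is skew-adjoint: the leftover of the integration by parts
is ∫ (div u) a b. -/
theorem inner_adv (h : Solenoidal u K) {a b : L2} (ha : InH 1 a) (hb : InH 1 b) :
    inner ℝ a (adv u b) = -inner ℝ b (adv u a) := by
  have h0 := inner_partialD_triple 0 ha hb (h.inH 0).one (h.bdd 0)
  have h1 := inner_partialD_triple 1 ha hb (h.inH 1).one (h.bdd 1)
  have h2 : inner ℝ (partialD 0 (u 0)) (mulL a b) + inner ℝ (partialD 1 (u 1)) (mulL a b) = 0 := by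
    rw [← inner_add_left, h.div, inner_zero_left]
  rw [adv, adv, inner_add_right, inner_add_right, inner_mulL_swap (a := a) (h.bdd 0),
    inner_mulL_swap (a := a) (h.bdd 1), inner_mulL_swap (a := b) (h.bdd 0),
    inner_mulL_swap (a := b) (h.bdd 1)]
  linarith

theorem inner_self_adv (h : Solenoidal u K) {a : L2} (ha : InH 1 a) : inner ℝ a (adv u a) = 0 := by
  have := h.inner_adv ha ha
  linarith

theorem inH_vorticity (h : Solenoidal u K) : InH 1 (vorticity u) :=
  (inH_partialD 0 (h.inH 1)).1.sub (inH_partialD 1 (h.inH 0)).1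

/-- Weak form of `curl (u·∇u) = u·∇ω`. -/
theorem inner_curl_adv (h : Solenoidal u K) {f : L2} (hf : InH 1 f) :
    -inner ℝ (partialD 0 f) (adv u (u 1)) + inner ℝ (partialD 1 f) (adv u (u 0)) =
      inner ℝ f (adv u (vorticity u)) := by
  have hd : ∀ i j, InH 1 (partialD i (u j)) := fun i j => (inH_partialD i (h.inH j)).1
  have t := fun i j l => inner_partialD_triple i hf (hd j l) (h.inH j).one (h.bdd j)
  have e : ∀ j, partialD j (vorticity u) =
      partialD 0 (partialD j (u 1)) - partialD 1 (partialD j (u 0)) := fun j => by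
    rw [vorticity, partialD_sub j (hd 0 1) (hd 1 0), partialD_comm j 0 (h.inH 1),
      partialD_comm j 1 (h.inH 0)]
  -- The terms quadratic in ∇u left by the integrations by parts combine to f ω div u.
  have hrem : inner ℝ (partialD 0 (u 0)) (mulL f (partialD 0 (u 1))) +
      inner ℝ (partialD 0 (u 1)) (mulL f (partialD 1 (u 1))) =
      inner ℝ (partialD 1 (u 0)) (mulL f (partialD 0 (u 0))) +
      inner ℝ (partialD 1 (u 1)) (mulL f (partialD 1 (u 0))) := by
    simp only [inner_eq_integral]
    rw [← integral_add (integrable_mul_L2 _ _) (integrable_mul_L2 _ _),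
      ← integral_add (integrable_mul_L2 _ _) (integrable_mul_L2 _ _)]
    refine integral_congr_ae ?_
    have hdiv : ∀ᵐ x : Plane, partialD 0 (u 0) x + partialD 1 (u 1) x = 0 := by
      filter_upwards [Lp.coeFn_add (partialD 0 (u 0)) (partialD 1 (u 1)),
        Lp.coeFn_zero ℝ 2 (volume : Measure Plane)] with x h1 h2
      rw [h.div, h2] at h1
      exact h1.symm
    filter_upwards [hdiv, coeFn_mulL (memLp_mul_of_inH hf (hd 0 1)),
      coeFn_mulL (memLp_mul_of_inH hf (hd 1 1)), coeFn_mulL (memLp_mul_of_inH hf (hd 0 0)),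
      coeFn_mulL (memLp_mul_of_inH hf (hd 1 0))] with x h0 h1 h2 h3 h4
    rw [h1, h2, h3, h4]
    linear_combination (f x * (partialD 0 (u 1) x - partialD 1 (u 0) x)) * h0
  have e2 : ∀ j, inner ℝ f (mulL (partialD j (vorticity u)) (u j)) =
      inner ℝ (partialD 0 (partialD j (u 1))) (mulL f (u j)) -
        inner ℝ (partialD 1 (partialD j (u 0))) (mulL f (u j)) := fun j => by
    rw [inner_mulL_swap (h.bdd j), e, inner_sub_left]
  simp only [adv, inner_add_right, e2]
  have t1 := t 0 0 1
  have t2 := t 0 1 1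
  have t3 := t 1 0 0
  have t4 := t 1 1 0
  linarith

end Solenoidal

/-! ### The pressure -/

theorem realSymbol_fourier {k : Plane → ℝ} (hk : Integrable k) :
    RealSymbol (𝓕 (fun z => (k z : ℂ))) := by
  refine ⟨(VectorFourier.fourierIntegral_continuous Real.continuous_fourierChar
    (by exact continuous_inner) hk.ofReal).measurable, fun ξ => ?_⟩
  rw [fourier_eq_chr, fourier_eq_chr, ← integral_conj]
  refine integral_congr_ae (.of_forall fun z => ?_)
  simp only [map_mul, Complex.conj_ofReal]
  congr 1
  simp only [chr, inner_neg_right, neg_neg, Real.fourierChar_apply, ← Complex.exp_conj]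
  congr 1
  simp [map_ofNat]

theorem RealSymbol.conj {m : Plane → ℂ} (h : RealSymbol m) :
    RealSymbol fun ξ => (starRingEnd ℂ) (m ξ) :=
  ⟨Complex.continuous_conj.measurable.comp h.meas, fun ξ => by rw [h.herm]⟩

theorem norm_fourier_le (k : Plane → ℝ) (ξ : Plane) :
    ‖𝓕 (fun z => (k z : ℂ)) ξ‖ ≤ ∫ z, |k z| := by
  refine (VectorFourier.norm_fourierIntegral_le_integral_norm _ _ _ _ _).trans (le_of_eq ?_)
  simp only [Complex.norm_real, Real.norm_eq_abs]

theorem eq_of_inner_eq {a b : L2}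
    (h : ∀ k : L2, Integrable k → inner ℝ a k = inner ℝ b k) : a = b := by
  rw [← sub_eq_zero]
  refine Lp.ext ((Lp.ae_eq_zero_of_forall_setIntegral_eq_zero (a - b) two_ne_zero
    ENNReal.ofNat_ne_top (fun s _ hμ => ?_) fun s hs hμ => ?_).trans
    (Lp.coeFn_zero ℝ 2 (volume : Measure Plane)).symm)
  · exact integrableOn_Lp_of_measure_ne_top _ (by norm_num) hμ.ne
  · have h1 := L2.inner_indicatorConstLp_one (𝕜 := ℝ) hs hμ.ne (a - b)
    rw [← h1, real_inner_comm, inner_sub_left, sub_eq_zero]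
    refine h _ ?_
    rw [integrable_congr indicatorConstLp_coeFn]
    exact (integrable_indicator_iff hs).2 (integrableOn_const hμ.ne)

theorem GaussKernel.of_compactSupport {F : Plane → ℝ} (hF : ContDiff ℝ ∞ F)
    (hc : HasCompactSupport F) : ∃ C, GaussKernel F C := by
  have hw : Continuous fun z : Plane => (wide z)⁻¹ := by
    unfold wide
    exact Continuous.inv₀ (by fun_prop) fun z => (Real.exp_pos _).ne'
  obtain ⟨C, hC⟩ := (hF.continuous.mul hw).bounded_above_of_compact_support hc.mul_right
  obtain ⟨C', hC'⟩ := ((hF.continuous_fderiv (by simp)).norm.mul hw).bounded_above_of_compact_support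
    (hc.fderiv (𝕜 := ℝ)).norm.mul_right
  have hpos : ∀ z : Plane, 0 < wide z := fun z => Real.exp_pos _
  refine ⟨max C C', hF.of_le (by simp), fun z => ?_, fun z => ?_⟩
  · have := hC z
    rw [Pi.mul_apply, norm_mul, norm_inv, Real.norm_of_nonneg (hpos z).le, mul_inv_le_iff₀ (hpos z)] at this
    exact this.trans (mul_le_mul_of_nonneg_right (le_max_left _ _) (hpos z).le)
  · have := hC' z
    rw [Pi.mul_apply, norm_mul, norm_norm, norm_inv, Real.norm_of_nonneg (hpos z).le,
      mul_inv_le_iff₀ (hpos z)] at this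
    exact this.trans (mul_le_mul_of_nonneg_right (le_max_right _ _) (hpos z).le)

/-- Weak gradients are curl free against test functions. -/
theorem IsWeakPartial.integral_symm {p d₀ d₁ : Plane → ℝ} (h₀ : IsWeakPartial 0 p d₀)
    (h₁ : IsWeakPartial 1 p d₁) {ψ : Plane → ℝ} (hψ : ContDiff ℝ ∞ ψ)
    (hc : HasCompactSupport ψ) :
    ∫ x, d₁ x * fderiv ℝ ψ x (EuclideanSpace.single 0 1) =
      ∫ x, d₀ x * fderiv ℝ ψ x (EuclideanSpace.single 1 1) := by
  have hs : ∀ v : Plane, ContDiff ℝ ∞ fun x => fderiv ℝ ψ x v := fun v =>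
    (hψ.fderiv_right (m := ∞) (by simp)).clm_apply contDiff_const
  have hcs : ∀ v : Plane, HasCompactSupport fun x => fderiv ℝ ψ x v := fun v =>
    hc.fderiv_apply (𝕜 := ℝ) v
  have e1 := h₁.2.2 _ (hs (EuclideanSpace.single 0 1)) (hcs _)
  have e0 := h₀.2.2 _ (hs (EuclideanSpace.single 1 1)) (hcs _)
  have hdd : ∀ x, DifferentiableAt ℝ (fderiv ℝ ψ) x := fun x =>
    (hψ.fderiv_right (m := ∞) (by simp)).differentiable (by simp) x
  have hsym : ∀ x (v w : Plane), fderiv ℝ (fun y => fderiv ℝ ψ y v) x w =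
      fderiv ℝ (fun y => fderiv ℝ ψ y w) x v := fun x v w => by
    rw [fderiv_clm_apply (hdd x) (differentiableAt_const v),
      fderiv_clm_apply (hdd x) (differentiableAt_const w)]
    have := (hψ.contDiffAt (x := x)).isSymmSndFDerivAt (by
      rw [minSmoothness_of_isRCLikeNormedField]; exact WithTop.coe_le_coe.2 (le_top (a := (2 : ℕ∞))))
    simpa using this.eq w v
  simp only [hsym _ (EuclideanSpace.single (0 : Fin 2) (1 : ℝ))] at e1
  rw [e0] at e1
  linarith

/-- The function p is only locally integrable, so its own transform is not available. The curl
condition is tested against all translates of a test function ψ, which gives an identity between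
convolutions and hence between multipliers of D₀ and D₁. It remains to divide by the transform of ψ,
choosing ψ so that this transform has no zero in a given disc. -/
theorem IsWeakPartial.hat_eq {p d₀ d₁ : Plane → ℝ} (h₀ : IsWeakPartial 0 p d₀)
    (h₁ : IsWeakPartial 1 p d₁) {D₀ D₁ : L2} (e₀ : D₀ =ᵐ[volume] d₀) (e₁ : D₁ =ᵐ[volume] d₁) :
    ∀ᵐ ξ : Plane, dsym 0 ξ * hat D₁ ξ = dsym 1 ξ * hat D₀ ξ := by
  have key : ∀ ψ : Plane → ℝ, ContDiff ℝ ∞ ψ → HasCompactSupport ψ →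
      ∀ᵐ ξ : Plane, (starRingEnd ℂ) (𝓕 (fun z => (ψ z : ℂ)) ξ) *
        (dsym 0 ξ * hat D₁ ξ - dsym 1 ξ * hat D₀ ξ) = 0 := by
    intro ψ hψ hc
    obtain ⟨C, hG⟩ := GaussKernel.of_compactSupport hψ hc
    set e : Fin 2 → Plane := fun j => EuclideanSpace.single j 1
    set dψ : Fin 2 → Plane → ℝ := fun j x => fderiv ℝ ψ x (e j)
    have hcont : ∀ j, Continuous (dψ j) := fun j =>
      (hψ.continuous_fderiv (by simp)).clm_apply continuous_const
    have hcs : ∀ j, HasCompactSupport (dψ j) := fun j => hc.fderiv_apply (𝕜 := ℝ) (e j)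
    have hint : ∀ j, Integrable (dψ j) := fun j => (hcont j).integrable_of_hasCompactSupport (hcs j)
    have hmem : ∀ j, MemLp (dψ j) 2 (volume : Measure Plane) := fun j =>
      (hcont j).memLp_of_hasCompactSupport (hcs j)
    set A : Fin 2 → L2 := fun j => (hmem j).toLp
    have hA : ∀ j, A j =ᵐ[volume] dψ j := fun j => (hmem j).coeFn_toLp
    have hm : ∀ j, RealSymbol (𝓕 (fun z => (dψ j z : ℂ))) := fun j => realSymbol_fourier (hint j)
    have hmA : ∀ j, hat (A j) =ᵐ[volume] 𝓕 (fun z => (dψ j z : ℂ)) := fun j => by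
      filter_upwards [hat_eq_fourier ((hint j).congr (hA j).symm)] with ξ h
      rw [h]
      exact Real.fourier_congr_ae ((hA j).mono fun x hx => by simp only [hx]) ξ
    have hmd : ∀ j ξ, 𝓕 (fun z => (dψ j z : ℂ)) ξ = dsym j ξ * 𝓕 (fun z => (ψ z : ℂ)) ξ :=
      fun j ξ => by
        have := hG.fourier_fderiv_apply (e j) ξ
        rw [inner_single] at this
        exact this
    have hB : ∀ (j : Fin 2) (D : L2),
        ∃ B, HasMult (fun ξ => (starRingEnd ℂ) (𝓕 (fun z => (dψ j z : ℂ)) ξ)) D B := fun j D =>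
      HasMult.of_bounded (hm j).conj (C := ∫ z, |dψ j z|) (fun ξ => by
        rw [RCLike.norm_conj]; exact norm_fourier_le _ ξ) D
    obtain ⟨B₁, hB₁⟩ := hB 0 D₁
    obtain ⟨B₀, hB₀⟩ := hB 1 D₀
    -- Symmetry of second derivatives, applied to the translated test function.
    have htr : ∀ z, inner ℝ D₁ (trans z (A 0)) = inner ℝ D₀ (trans z (A 1)) := fun z => by
      have h1 := h₀.integral_symm h₁ (ψ := fun x => ψ (x - z)) (hψ.comp (contDiff_id.sub
        contDiff_const)) (hc.comp_homeomorph (Homeomorph.subRight z))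
      simp only [fderiv_comp_sub] at h1
      rw [inner_trans_eq_integral, inner_trans_eq_integral]
      refine Eq.trans ?_ (h1.trans ?_)
      · refine integral_congr_ae ?_
        filter_upwards [e₁, ae_sub z (hA 0)] with x a b
        rw [a, b]
      · refine integral_congr_ae ?_
        filter_upwards [e₀, ae_sub z (hA 1)] with x a b
        rw [a, b]
    have hBk : ∀ (j : Fin 2) (D B : L2),
        HasMult (fun ξ => (starRingEnd ℂ) (𝓕 (fun z => (dψ j z : ℂ)) ξ)) D B →
        ∀ k : L2, Integrable k → inner ℝ B k = ∫ z, k z * inner ℝ D (trans z (A j)) := by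
      intro j D B h k hk
      rw [integral_kernel hk, inner_eq_hat]
      congr 1
      refine integral_congr_ae ?_
      filter_upwards [h, hmA j, hat_eq_fourier hk] with ξ a b c
      rw [a, b, c, map_mul, Complex.conj_conj]; ring
    have hBB : B₁ = B₀ := eq_of_inner_eq fun k hk => by
      rw [hBk 0 D₁ B₁ hB₁ k hk, hBk 1 D₀ B₀ hB₀ k hk]
      simp only [htr]
    rw [hBB] at hB₁
    filter_upwards [hB₁, hB₀] with ξ a b
    rw [a] at b
    simp only [hmd, map_mul, conj_dsym] at b
    linear_combination -b
  have hbump : ∀ n : ℕ, ∀ᵐ ξ : Plane, ‖ξ‖ < n → dsym 0 ξ * hat D₁ ξ = dsym 1 ξ * hat D₀ ξ := by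
    intro n
    -- On a bump supported in radius r the characters with ‖ξ‖ < n differ from 1 by less than 1, so
    -- the transform of this nonnegative bump cannot vanish at ξ.
    set r : ℝ := (2 * Real.pi * (n + 1))⁻¹ with hr
    have hr0 : 0 < r := by positivity
    let χ : ContDiffBump (0 : Plane) := ⟨r / 2, r, by positivity, by linarith⟩
    filter_upwards [key χ χ.contDiff χ.hasCompactSupport] with ξ h hξ
    rcases mul_eq_zero.1 h with h | h
    · exfalso
      rw [map_eq_zero, fourier_eq_chr] at h
      have hχ : Integrable (χ : Plane → ℝ) := χ.integrable
      have hI : 0 < ∫ z, χ z := χ.integral_pos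
      have h1 : ((∫ z, χ z : ℝ) : ℂ) = ∫ z, (1 - chr z ξ) * (χ z : ℂ) := by
        have h2 : Integrable fun z => chr z ξ * (χ z : ℂ) :=
          hχ.ofReal.bdd_mul (c := 1) (continuous_chr.comp (by fun_prop :
            Continuous fun z : Plane => (z, ξ))).aestronglyMeasurable
            (.of_forall fun z => (norm_chr z ξ).le)
        have h3 : Integrable fun z => (χ z : ℂ) := hχ.ofReal
        simp only [sub_mul, one_mul]
        rw [integral_sub h3 h2, h, sub_zero, integral_complex_ofReal]
      have h2 : ‖((∫ z, χ z : ℝ) : ℂ)‖ ≤ ∫ z, (2 * Real.pi * (r * ‖ξ‖)) * χ z := by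
        rw [h1]
        refine norm_integral_le_of_norm_le (hχ.const_mul _) (.of_forall fun z => ?_)
        rw [norm_mul, Complex.norm_real, Real.norm_of_nonneg χ.nonneg]
        by_cases hz : χ z = 0
        · rw [hz]; simp
        refine mul_le_mul_of_nonneg_right ?_ χ.nonneg
        rw [norm_sub_rev]
        refine (norm_chr_sub_one_le z ξ).trans ?_
        have hz' : z ∈ Metric.ball (0 : Plane) r := by
          rw [← χ.support_eq]; exact hz
        rw [mem_ball_zero_iff] at hz'
        gcongr
      rw [integral_const_mul, Complex.norm_real, Real.norm_of_nonneg hI.le] at h2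
      have h3 : 2 * Real.pi * (r * ‖ξ‖) < 1 := by
        have : 2 * Real.pi * (r * ‖ξ‖) = ‖ξ‖ / (n + 1) := by rw [hr]; field_simp
        rw [this, div_lt_one (by positivity)]
        linarith
      nlinarith
    · exact sub_eq_zero.1 h
  filter_upwards [ae_all_iff.2 hbump] with ξ h
  obtain ⟨n, hn⟩ := exists_nat_gt ‖ξ‖
  exact h n hn

/-! ### Positivity of the fractional Laplacian -/

/-- `⟨f, (1 - P_s) w⟩` for the heat semigroup `P_s`. -/
def dirich (s : ℝ) (f w : L2) : ℝ :=
  (∫ ξ, (starRingEnd ℂ) (hat f ξ) * ((1 - heat s ξ) * hat w ξ)).re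

theorem integral_gauss : ∫ z : Plane, gauss z = 1 := by
  have h := fourier_gauss 0
  rw [fourier_eq_chr] at h
  simp only [chr, inner_zero_right, neg_zero, AddChar.map_zero_eq_one, Circle.coe_one, one_mul] at h
  rw [integral_complex_ofReal] at h
  have : gauss 0 = 1 := by simp [gauss]
  rw [this] at h
  exact_mod_cast h

theorem integrable_gauss : Integrable gauss := by
  obtain ⟨C, hC⟩ := gaussKernel_gauss
  exact hC.integrable

theorem integral_dil (F : Plane → ℝ) {s : ℝ} (hs : 0 < s) : ∫ z, dil F s z = ∫ z, F z := by
  simpa using integral_dil_mul F hs (fun _ => (1 : ℝ))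

theorem dil_gauss_nonneg {s : ℝ} (hs : 0 < s) (z : Plane) : 0 ≤ dil gauss s z :=
  mul_nonneg (inv_nonneg.2 hs.le) (gauss_nonneg _)

/-- The increment `f - f(· - z)`. -/
def incr (z : Plane) (f : L2) : L2 := f - trans z f

theorem coeFn_incr (z : Plane) (f : L2) : incr z f =ᵐ[volume] fun x => f x - f (x - z) := by
  filter_upwards [Lp.coeFn_sub f (trans z f), coeFn_trans z f] with x a b
  rw [incr, a, Pi.sub_apply, b]

theorem integrable_conj_mul (f g : L2) : Integrable fun ξ => (starRingEnd ℂ) (hat f ξ) * hat g ξ := by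
  have := integrable_conj_mul_hat (f := f) (g := g) (m := fun _ => 1)
    (by simpa using Lp.memLp (hat g))
  simpa using this

theorem integrable_conj_heat_mul {s : ℝ} (hs : 0 ≤ s) (f g : L2) :
    Integrable fun ξ => (starRingEnd ℂ) (hat f ξ) * (heat s ξ * hat g ξ) :=
  integrable_conj_mul_hat <| (Lp.memLp (hat g)).of_le
    ((realSymbol_heat s).meas.aestronglyMeasurable.mul (Lp.aestronglyMeasurable _))
    (.of_forall fun ξ => by
      rw [norm_mul]
      exact mul_le_of_le_one_left (norm_nonneg _) (norm_heat_le hs ξ))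

theorem conj_heat (s : ℝ) (ξ : Plane) : (starRingEnd ℂ) (heat s ξ) = heat s ξ :=
  Complex.conj_ofReal _

theorem heat_form_symm (s : ℝ) (f w : L2) :
    (∫ ξ, (starRingEnd ℂ) (hat f ξ) * (heat s ξ * hat w ξ)).re =
      (∫ ξ, (starRingEnd ℂ) (hat w ξ) * (heat s ξ * hat f ξ)).re := by
  rw [← Complex.conj_re, ← integral_conj]
  congr 2
  funext ξ
  simp only [map_mul, Complex.conj_conj, conj_heat]; ring

theorem dirich_eq {s : ℝ} (hs : 0 ≤ s) (f w : L2) : dirich s f w = inner ℝ f w -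
    (∫ ξ, (starRingEnd ℂ) (hat f ξ) * (heat s ξ * hat w ξ)).re := by
  rw [dirich, inner_eq_hat, ← Complex.sub_re, ← integral_sub (integrable_conj_mul f w)
    (integrable_conj_heat_mul hs f w)]
  congr 2
  funext ξ; ring

theorem integrable_dil_gauss_incr {s : ℝ} (hs : 0 < s) (f w : L2) :
    Integrable fun z => dil gauss s z * inner ℝ (incr z f) (incr z w) := by
  have hg := integrable_dil integrable_gauss hs
  have h1 := integrable_kernel hg f w
  have h2 := integrable_kernel hg w f
  refine (((hg.mul_const (2 * inner ℝ f w)).sub h1).sub h2).congr (.of_forall fun z => ?_)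
  have h3 : inner ℝ (trans z f) (trans z w) = inner ℝ f w := by
    simp only [inner_eq_integral]
    rw [← integral_comp_sub (fun x => f x * w x) z]
    refine integral_congr_ae ?_
    filter_upwards [coeFn_trans z f, coeFn_trans z w] with x a b
    rw [a, b]
  simp only [Pi.sub_apply, incr, inner_sub_left, inner_sub_right, h3,
    real_inner_comm (trans z f) w]
  ring

/-- Expand the product of increments: the kernel has mass 1, translations preserve inner products,
and the two cross terms agree because the heat form is symmetric. The spectral form thereby becomes
an average of increments against a positive kernel. -/
theorem dirich_eq_integral {s : ℝ} (hs : 0 < s) (f w : L2) :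
    dirich s f w = 1 / 2 * ∫ z, dil gauss s z * inner ℝ (incr z f) (incr z w) := by
  have hg := integrable_dil integrable_gauss hs
  have h1 := integrable_kernel hg f w
  have h2 := integrable_kernel hg w f
  have h0 : ∫ z, dil gauss s z * inner ℝ (incr z f) (incr z w) =
      ∫ z, (dil gauss s z * (2 * inner ℝ f w) - dil gauss s z * inner ℝ f (trans z w) -
        dil gauss s z * inner ℝ w (trans z f)) := by
    refine integral_congr_ae (.of_forall fun z => ?_)
    have h3 : inner ℝ (trans z f) (trans z w) = inner ℝ f w := by
      simp only [inner_eq_integral]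
      rw [← integral_comp_sub (fun x => f x * w x) z]
      refine integral_congr_ae ?_
      filter_upwards [coeFn_trans z f, coeFn_trans z w] with x a b
      rw [a, b]
    simp only [incr, inner_sub_left, inner_sub_right, h3, real_inner_comm (trans z f) w]
    ring
  rw [h0, integral_sub (integrable_fun_sub (hg.mul_const _) h1) h2,
    integral_sub (hg.mul_const _) h1, integral_mul_const, integral_dil gauss hs, integral_gauss,
    ← heat_pairing hs, ← heat_pairing hs, heat_form_symm s w f, dirich_eq hs.le]
  ring

/-- Normalisation constant of the fractional Laplacian. -/
def lapConst (a : ℝ) : ℝ := (2 * Real.pi) ^ a / (stableConst (a / 2) * Real.pi ^ (a / 2))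

theorem lapConst_pos {a : ℝ} (ha : 0 < a) (ha' : a < 2) : 0 < lapConst a := by
  have := stableConst_pos (a := a / 2) (by linarith) (by linarith)
  unfold lapConst; positivity

/-- Subordination: |ξ|^a is a constant times the integral of s^{-1-a/2}(1 - e^{-πs|ξ|²}) over s > 0.
The integrand is kept explicit because later it is compared with the other terms separately at each
s. -/
theorem inner_fracLap {a : ℝ} (ha : 0 < a) (ha' : a < 2) (f : L2) {w : L2} (hw : InH a w) :
    IntegrableOn (fun s : ℝ => s ^ (-1 - a / 2) * dirich s f w) (Ioi 0) ∧
      inner ℝ f (fracLap a w) =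
        lapConst a * ∫ s in Ioi (0 : ℝ), s ^ (-1 - a / 2) * dirich s f w := by
  set C := stableConst (a / 2) * Real.pi ^ (a / 2) with hC
  have hC0 : 0 < C := by
    have := stableConst_pos (a := a / 2) (by linarith) (by linarith)
    positivity
  set H : Plane → ℂ := fun ξ => (starRingEnd ℂ) (hat f ξ) * hat w ξ with hH
  have hsup := superposition (w := fun s => s ^ (-1 - a / 2))
    (φ := fun s ξ => 1 - Real.exp (-Real.pi * s * ‖ξ‖ ^ 2)) (m := fun ξ => C * ‖ξ‖ ^ a) (H := H)
    (by fun_prop) (by fun_prop) (fun s hs => Real.rpow_nonneg (le_of_lt hs) _)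
    (fun s hs ξ => by
      have : 0 ≤ Real.pi * s * ‖ξ‖ ^ 2 :=
        mul_nonneg (mul_nonneg Real.pi_pos.le (le_of_lt hs)) (sq_nonneg _)
      have h2 := one_sub_exp_nonneg this
      rwa [neg_mul, neg_mul])
    (ae_norm_pos.mono fun ξ hξ => (stable_integral (by linarith) (by linarith) hξ).1)
    (ae_norm_pos.mono fun ξ hξ => by
      rw [(stable_integral (by linarith) (by linarith) hξ).2]
      rw [mul_div_cancel₀ a two_ne_zero])
    (integrable_conj_mul f w).aestronglyMeasurable
    (by
      have := (integrable_conj_mul_hat (f := f) (g := w) hw.hasMult.memLp).const_mul (C : ℂ)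
      refine this.congr (.of_forall fun ξ => ?_)
      simp only [hH, rad]; push_cast; ring)
  have hd : ∀ s, (((s ^ (-1 - a / 2) : ℝ) : ℂ) *
      ∫ ξ, ((1 - Real.exp (-Real.pi * s * ‖ξ‖ ^ 2) : ℝ) : ℂ) * H ξ).re =
      s ^ (-1 - a / 2) * dirich s f w := fun s => by
    rw [Complex.re_ofReal_mul, dirich]
    congr 3
    funext ξ
    simp only [hH, heat]; push_cast; ring
  have hint := hsup.1.re
  have hre := congrArg Complex.re hsup.2
  rw [← RCLike.re_eq_complex_re, ← integral_re hsup.1] at hre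
  simp only [RCLike.re_eq_complex_re, hd] at hint hre
  refine ⟨hint, ?_⟩
  rw [hre, inner_eq_hat, lapConst, ← hC]
  have e : ∫ ξ, (starRingEnd ℂ) (hat f ξ) * hat (fracLap a w) ξ =
      (((2 * Real.pi) ^ a / C : ℝ) : ℂ) * ∫ ξ, ((C * ‖ξ‖ ^ a : ℝ) : ℂ) * H ξ := by
    rw [← integral_const_mul]
    refine integral_congr_ae ?_
    filter_upwards [hasMult_fracLap hw] with ξ h
    rw [h, lapSym, rad]
    simp only [hH]
    push_cast
    have : (C : ℂ) ≠ 0 := Complex.ofReal_ne_zero.2 hC0.ne'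
    field_simp
  rw [e, Complex.re_ofReal_mul]

namespace Nonlin

variable {Φ φ : ℝ → ℝ} {L : ℝ}

theorem inner_incr_nonneg (N : Nonlin Φ φ L) (w : L2) (z : Plane) :
    0 ≤ inner ℝ (incr z (N.app w)) (incr z w) := by
  rw [inner_eq_integral]
  refine integral_nonneg_of_ae ?_
  filter_upwards [coeFn_incr z (N.app w), coeFn_incr z w, N.coeFn_app w,
    ae_sub z (N.coeFn_app w)] with x a b c d
  rw [a, b, c, d, Pi.zero_apply]
  rcases le_total (w x) (w (x - z)) with h | h
  · exact mul_nonneg_of_nonpos_of_nonpos (sub_nonpos.2 (N.mono h)) (sub_nonpos.2 h)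
  · exact mul_nonneg (sub_nonneg.2 (N.mono h)) (sub_nonneg.2 h)

theorem dirich_nonneg (N : Nonlin Φ φ L) (w : L2) {s : ℝ} (hs : 0 < s) :
    0 ≤ dirich s (N.app w) w := by
  rw [dirich_eq_integral hs]
  exact mul_nonneg (by norm_num) (integral_nonneg fun z =>
    mul_nonneg (dil_gauss_nonneg hs z) (N.inner_incr_nonneg w z))

/-- An integrated Córdoba–Córdoba inequality: φ is monotone, so increments of φ(w) and of w have the
same sign. -/
theorem inner_fracLap_nonneg (N : Nonlin Φ φ L) {a : ℝ} (ha : 0 < a) (ha' : a < 2) {w : L2}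
    (hw : InH a w) : 0 ≤ inner ℝ (N.app w) (fracLap a w) := by
  rw [(inner_fracLap ha ha' _ hw).2]
  exact mul_nonneg (lapConst_pos ha ha').le (setIntegral_nonneg measurableSet_Ioi fun s hs =>
    mul_nonneg (Real.rpow_nonneg (le_of_lt hs) _) (N.dirich_nonneg w hs))

/-! ### Energies -/

/-- The integral `∫ Φ(w)`. -/
def energy (_ : Nonlin Φ φ L) (w : L2) : ℝ := ∫ x, Φ (w x)

theorem energy_nonneg (N : Nonlin Φ φ L) (w : L2) : 0 ≤ N.energy w :=
  integral_nonneg fun _ => N.nonneg_apply _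

/-- The tangent inequality for the convex Φ, integrated. Used at both endpoints of a time step, it
encloses the difference quotient of the energy without differentiating `w` in `L²`. -/
theorem inner_le_energy_sub (N : Nonlin Φ φ L) (v w : L2) :
    inner ℝ (N.app v) (w - v) ≤ N.energy w - N.energy v := by
  rw [energy, energy, ← integral_sub (N.integrable_comp w) (N.integrable_comp v),
    inner_eq_integral]
  refine integral_mono_ae (integrable_mul_L2 _ _)
    (integrable_fun_sub (N.integrable_comp w) (N.integrable_comp v)) ?_
  filter_upwards [N.coeFn_app v, Lp.coeFn_sub w v] with x a b
  rw [a, b, Pi.sub_apply]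
  exact N.mul_sub_le _ _

theorem hasFDerivAt_energy (N : Nonlin Φ φ L) (w : L2) :
    HasFDerivAt N.energy (innerSL ℝ (N.app w)) w := by
  rw [hasFDerivAt_iff_isLittleO]
  have h : ∀ v, ‖N.energy v - N.energy w - innerSL ℝ (N.app w) (v - w)‖ ≤ L * ‖v - w‖ ^ 2 := by
    intro v
    rw [innerSL_apply_apply, energy, energy,
      ← integral_sub (N.integrable_comp v) (N.integrable_comp w), inner_eq_integral,
      ← integral_sub (integrable_fun_sub (N.integrable_comp v) (N.integrable_comp w))
        (integrable_mul_L2 _ _), sq_norm_eq_integral, ← integral_const_mul]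
    refine norm_integral_le_of_norm_le ((Lp.memLp (v - w)).integrable_sq.const_mul _) ?_
    filter_upwards [N.coeFn_app w, Lp.coeFn_sub v w] with x a b
    rw [a, b, Pi.sub_apply]
    exact N.abs_taylor_le _ _
  refine Asymptotics.IsBigO.trans_isLittleO (g := fun v => ‖v - w‖ ^ 2)
    (Asymptotics.IsBigO.of_bound L (.of_forall fun v => by
      rw [norm_pow, norm_norm]; exact h v)) ?_
  simp only [sq]
  have h1 : (fun v : L2 => ‖v - w‖) =o[𝓝 w] fun _ => (1 : ℝ) := by
    rw [Asymptotics.isLittleO_one_iff]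
    exact tendsto_iff_norm_sub_tendsto_zero.1 tendsto_id
  have h2 : (fun v : L2 => ‖v - w‖) =O[𝓝 w] fun v => v - w :=
    (Asymptotics.isBigO_refl _ _).norm_left
  have h3 := h1.mul_isBigO h2.norm_right
  simpa using h3

theorem continuous_energy (N : Nonlin Φ φ L) : Continuous N.energy :=
  continuous_iff_continuousAt.2 fun w => (N.hasFDerivAt_energy w).continuousAt

theorem hasDerivAt_energy (N : Nonlin Φ φ L) {g : ℝ → L2} {g' : L2} {t : ℝ}
    (h : HasDerivAt g g' t) :
    HasDerivAt (fun τ => N.energy (g τ)) (inner ℝ (N.app (g t)) g') t :=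
  (N.hasFDerivAt_energy (g t)).comp_hasDerivAt t h

/-- Primitives of monotone Lipschitz functions. -/
theorem of_lip (hL : ∀ a b, |φ a - φ b| ≤ L * |a - b|) (h0 : φ 0 = 0) (hm : Monotone φ) :
    Nonlin (fun x => ∫ t in (0 : ℝ)..x, φ t) φ L := by
  have hL0 : 0 ≤ L := by
    have := (abs_nonneg _).trans (hL 1 0)
    simpa using this
  have hc : Continuous φ := by
    have : LipschitzWith L.toNNReal φ := LipschitzWith.of_dist_le_mul fun a b => by
      rw [Real.dist_eq, Real.dist_eq, Real.coe_toNNReal _ hL0]; exact hL a b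
    exact this.continuous
  exact ⟨fun x => intervalIntegral.integral_hasDerivAt_right (hc.intervalIntegrable _ _)
    (hc.stronglyMeasurableAtFilter _ _) hc.continuousAt, hL, by simp, h0, hm⟩

end Nonlin

/-! ### Solutions in the energy space -/

/-- What is used of a solution: regularity, and the equations in `L²`. -/
structure Regular (α β S K B : ℝ) (u : ℝ → Fin 2 → L2) (θ : ℝ → L2) : Prop where
  sol : ∀ t ∈ Icc 0 S, Solenoidal (u t) K
  temp_inH : ∀ t ∈ Icc 0 S, InH 2 (θ t)
  cont_vel : ∀ i, ContinuousOn (fun t => u t i) (Icc 0 S)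
  cont_temp : ContinuousOn θ (Icc 0 S)
  cont_combined : ContinuousOn (fun t => combined α (u t) (θ t)) (Icc 0 S)
  bound_vel : ∀ t ∈ Icc 0 S, ∀ i, ‖u t i‖ ≤ B ∧ ‖absD 2 (u t i)‖ ≤ B
  bound_temp : ∀ t ∈ Icc 0 S, ‖θ t‖ ≤ B ∧ ‖absD 2 (θ t)‖ ≤ B
  vel_eq : ∀ t ∈ Ioo 0 S, ∃ du D : Fin 2 → L2, (∀ i, HasDerivAt (fun τ => u τ i) (du i) t) ∧
    (∀ᵐ ξ : Plane, dsym 0 ξ * hat (D 1) ξ = dsym 1 ξ * hat (D 0) ξ) ∧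
    ∀ i, du i = -adv (u t) (u t i) - fracLap α (u t i) - D i + (if i = 1 then θ t else 0)
  temp_eq : ∀ t ∈ Ioo 0 S, ∃ dθ : L2, HasDerivAt θ dθ t ∧
    dθ = -adv (u t) (θ t) - fracLap β (θ t)

theorem ContinuousInTime.continuousOn {S : ℝ} {f : ℝ → L2}
    (h : ContinuousInTime (sobolevNorm 2) S f) : ContinuousOn f (Icc 0 S) := by
  intro t ht
  rw [ContinuousWithinAt, tendsto_iff_norm_sub_tendsto_zero]
  have h1 := (h t ht).2
  have h2 : Tendsto (fun τ => ENNReal.ofReal ‖f τ - f t‖) (𝓝[Icc 0 S] t) (𝓝 0) :=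
    tendsto_of_tendsto_of_tendsto_of_le_of_le tendsto_const_nhds h1 (fun _ => zero_le)
      fun τ => norm_le_sobolevNorm _
  have h3 := (ENNReal.tendsto_toReal (ENNReal.zero_ne_top)).comp h2
  refine h3.congr fun τ => ?_
  simp

theorem norm_bounds_of_sobolevNorm {f : L2} {B : ℝ} (hB : 0 ≤ B)
    (h : sobolevNorm 2 f ≤ ENNReal.ofReal B) : InH 2 f ∧ ‖f‖ ≤ B ∧ ‖absD 2 f‖ ≤ B := by
  have h1 := inH_of_sobolevNorm (h.trans_lt ENNReal.ofReal_lt_top)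
  exact ⟨h1.1, (ENNReal.ofReal_le_ofReal_iff hB).1 ((norm_le_sobolevNorm f).trans h),
    (ENNReal.ofReal_le_ofReal_iff hB).1 (h1.2.trans h)⟩

theorem ContinuousInTime.continuousOn_hasMult {S : ℝ} {f g : ℝ → L2}
    (h : ContinuousInTime (sobolevNorm 2) S f) {m : Plane → ℂ} (hm : RealSymbol m) {C : ℝ}
    (hC : 0 ≤ C) (hb : ∀ ξ : Plane, 0 < ‖ξ‖ → ‖m ξ‖ ≤ C + C * ‖ξ‖ ^ (2 : ℝ))
    (hg : ∀ t ∈ Icc 0 S, HasMult m (f t) (g t)) : ContinuousOn g (Icc 0 S) := by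
  intro t ht
  rw [ContinuousWithinAt, tendsto_iff_norm_sub_tendsto_zero]
  obtain ⟨h0, h1⟩ := h t ht
  have h2 : Tendsto (fun τ => C * ((sobolevNorm 2 (f τ - f t)).toReal +
      (sobolevNorm 2 (f τ - f t)).toReal)) (𝓝[Icc 0 S] t) (𝓝 0) := by
    have h3 := (ENNReal.tendsto_toReal (ENNReal.zero_ne_top)).comp h1
    simpa using (h3.add h3).const_mul C
  refine squeeze_zero' (.of_forall fun _ => norm_nonneg _) ?_ h2
  filter_upwards [self_mem_nhdsWithin, h1.eventually (gt_mem_nhds zero_lt_one)] with τ hτ hτ1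
  have hfin : sobolevNorm 2 (f τ - f t) ≠ ⊤ := (hτ1.trans ENNReal.one_lt_top).ne
  obtain ⟨a, b⟩ := inH_of_sobolevNorm hfin.lt_top
  obtain ⟨k, hk, hle⟩ := a.exists_hasMult hm hC hC hb
  rw [((hg τ hτ).sub (hg t ht)).unique hk]
  refine hle.trans ?_
  rw [← mul_add]
  exact mul_le_mul_of_nonneg_left (add_le_add
    ((ENNReal.ofReal_le_iff_le_toReal hfin).1 (norm_le_sobolevNorm _))
    ((ENNReal.ofReal_le_iff_le_toReal hfin).1 b)) hC

/-- The pressure gradient is recovered as an `L²` field D from the equation itself, all other terms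
being square integrable, and its curl vanishes by `IsWeakPartial.hat_eq`. The numbers K and B may
depend on the solution; they serve only to justify limits and to know that quantities are finite. -/
theorem IsSolution.regular {LP : LittlewoodPaley} {α β S : ℝ} {u₀ : Fin 2 → L2} {θ₀ : L2}
    {u : ℝ → Fin 2 → L2} {p : ℝ → Plane → ℝ} {θ : ℝ → L2}
    (h : IsSolution LP α β S u₀ θ₀ u p θ) (hα : 0 < α) (hα' : α < 1) : ∃ K B, 0 ≤ B ∧ Regular α β S K B u θ := by
  have hθ := LP.continuousInTime_sobolevNorm h.temperature_cont
  obtain ⟨Bθ, hBθ, hθB⟩ := hθ.exists_bound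
  obtain ⟨B0, hB0, hB0'⟩ := (h.velocity_cont 0).exists_bound
  obtain ⟨B1, hB1, hB1'⟩ := (h.velocity_cont 1).exists_bound
  set B := Bθ + B0 + B1 with hB
  have hBn : 0 ≤ B := by positivity
  have hu : ∀ t ∈ Icc 0 S, ∀ i, sobolevNorm 2 (u t i) ≤ ENNReal.ofReal B := fun t ht i => by
    fin_cases i
    · exact (hB0' t ht).trans (ENNReal.ofReal_le_ofReal (by linarith))
    · exact (hB1' t ht).trans (ENNReal.ofReal_le_ofReal (by linarith))
  obtain ⟨C, hC, hsup⟩ := exists_sup_bound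
  have hsol : ∀ t ∈ Icc 0 S, Solenoidal (u t) (C * (B + B)) := fun t ht =>
    ⟨fun i => (norm_bounds_of_sobolevNorm hBn (hu t ht i)).1, fun i => by
      obtain ⟨h1, h2, h3⟩ := norm_bounds_of_sobolevNorm hBn (hu t ht i)
      filter_upwards [hsup _ h1] with x hx
      exact hx.trans (mul_le_mul_of_nonneg_left (add_le_add h2 h3) hC), h.div_free t ht⟩
  have hθ2 : ∀ t ∈ Icc 0 S, InH 2 (θ t) ∧ ‖θ t‖ ≤ B ∧ ‖absD 2 (θ t)‖ ≤ B := fun t ht =>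
    norm_bounds_of_sobolevNorm hBn ((hθB t ht).trans (ENNReal.ofReal_le_ofReal (by linarith)))
  have hpow : ∀ (ξ : Plane) (r : ℝ), 0 < ‖ξ‖ → 0 ≤ r → r ≤ 2 → ‖ξ‖ ^ r ≤ 1 + ‖ξ‖ ^ (2 : ℝ) :=
    fun ξ r hξ h0 h2 => by simpa using rpow_le_one_add hξ h0 h2
  have hpd : ∀ i j, ContinuousOn (fun t => partialD i (u t j)) (Icc 0 S) := fun i j =>
    (h.velocity_cont j).continuousOn_hasMult (realSymbol_dsym i) (C := 2 * Real.pi) (by positivity)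
      (fun ξ hξ => by
        have h1 := hpow ξ 1 hξ zero_le_one one_le_two
        rw [Real.rpow_one] at h1
        have h2 := norm_dsym_le i ξ
        nlinarith [Real.pi_pos])
      fun t ht => hasMult_partialD i (norm_bounds_of_sobolevNorm hBn (hu t ht j)).1.one
  have hR : ContinuousOn (fun t => rieszOp α (θ t)) (Icc 0 S) :=
    hθ.continuousOn_hasMult (realSymbol_rieszSym α) (rieszConst_nonneg α)
      (fun ξ hξ => by
        have h1 := hpow ξ (1 - α) hξ (by linarith) (by linarith)
        have h2 := norm_rieszSym_le α hξ
        nlinarith [rieszConst_nonneg α])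
      fun t ht => hasMult_rieszOp ((hθ2 t ht).1.mono (by linarith) (by linarith))
  refine ⟨C * (B + B), B, hBn, hsol, fun t ht => (hθ2 t ht).1, fun i => (h.velocity_cont i).continuousOn,
    hθ.continuousOn, ((hpd 0 1).sub (hpd 1 0)).sub hR, fun t ht i => (norm_bounds_of_sobolevNorm hBn (hu t ht i)).2,
    fun t ht => (hθ2 t ht).2, fun t ht => ?_, fun t ht => ?_⟩
  · have htc := Ioo_subset_Icc_self ht
    choose du dp h1 h2 h3 using h.velocity_eq t ht
    set D : Fin 2 → L2 := fun i =>
      -adv (u t) (u t i) - fracLap α (u t i) - du i + (if i = 1 then θ t else 0) with hD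
    have hDe : ∀ i, D i =ᵐ[volume] dp i := fun i => by
      have hif : (if i = 1 then θ t else 0 : L2) =ᵐ[volume] fun x => if i = 1 then θ t x else 0 := by
        split_ifs
        · exact .rfl
        · exact Lp.coeFn_zero ℝ 2 (volume : Measure Plane)
      filter_upwards [h3 i, (hsol t htc).coeFn_adv (u t i), hif,
        Lp.coeFn_add (-adv (u t) (u t i) - fracLap α (u t i) - du i) (if i = 1 then θ t else 0 : L2),
        Lp.coeFn_sub (-adv (u t) (u t i) - fracLap α (u t i)) (du i),
        Lp.coeFn_sub (-adv (u t) (u t i)) (fracLap α (u t i)),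
        Lp.coeFn_neg (adv (u t) (u t i))] with x a b c d e f g
      rw [hD]
      dsimp only
      rw [d, Pi.add_apply, e, Pi.sub_apply, f, Pi.sub_apply, g, Pi.neg_apply, b, c]
      linarith
    refine ⟨du, D, h1, (h2 0).hat_eq (h2 1) (hDe 0) (hDe 1), fun i => ?_⟩
    rw [hD]
    dsimp only
    abel
  · have htc := Ioo_subset_Icc_self ht
    obtain ⟨dθ, h1, h2⟩ := h.temperature_eq t ht
    refine ⟨dθ, h1, Lp.ext ?_⟩
    filter_upwards [h2, (hsol t htc).coeFn_adv (θ t),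
        Lp.coeFn_sub (-adv (u t) (θ t)) (fracLap β (θ t)),
        Lp.coeFn_neg (adv (u t) (θ t))] with x a b f g
    rw [f, Pi.sub_apply, g, Pi.neg_apply, b]
    linarith

/-- Gradients are orthogonal to divergence free fields. -/
theorem inner_gradient_eq_zero {u D : Fin 2 → L2} (hu : ∀ i, InH 1 (u i))
    (hdiv : partialD 0 (u 0) + partialD 1 (u 1) = 0)
    (hD : ∀ᵐ ξ : Plane, dsym 0 ξ * hat (D 1) ξ = dsym 1 ξ * hat (D 0) ξ) :
    inner ℝ (u 0) (D 0) + inner ℝ (u 1) (D 1) = 0 := by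
  rw [inner_eq_hat, inner_eq_hat, ← Complex.add_re,
    ← integral_add (integrable_conj_mul _ _) (integrable_conj_mul _ _)]
  have h0 : hat (partialD 0 (u 0)) + hat (partialD 1 (u 1)) = 0 := by
    rw [← hat_add, hdiv, hat, complexify]
    have : (0 : L2) = (0 : ℝ) • (0 : L2) := by simp
    have h1 := hat_smul 0 (0 : L2)
    rw [← this] at h1
    simpa [hat, complexify] using h1
  have : ∫ ξ, ((starRingEnd ℂ) (hat (u 0) ξ) * hat (D 0) ξ +
      (starRingEnd ℂ) (hat (u 1) ξ) * hat (D 1) ξ) = 0 := by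
    refine integral_eq_zero_of_ae ?_
    have h2 := Lp.coeFn_add (hat (partialD 0 (u 0))) (hat (partialD 1 (u 1)))
    rw [h0] at h2
    filter_upwards [h2, Lp.coeFn_zero ℂ 2 (volume : Measure Plane), hasMult_partialD 0 (hu 0),
      hasMult_partialD 1 (hu 1), hD, ae_norm_pos] with ξ a b c d e f
    rw [b, Pi.add_apply, c, d] at a
    have hpi : (2 * Real.pi * Complex.I : ℂ) ≠ 0 := by
      simp [Real.pi_ne_zero]
    have a' : (ξ 0 : ℂ) * hat (u 0) ξ + (ξ 1 : ℂ) * hat (u 1) ξ = 0 := by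
      apply mul_left_cancel₀ hpi
      simp only [dsym, Pi.zero_apply] at a
      linear_combination -a
    have a'' : (ξ 0 : ℂ) * (starRingEnd ℂ) (hat (u 0) ξ) +
        (ξ 1 : ℂ) * (starRingEnd ℂ) (hat (u 1) ξ) = 0 := by
      have := congrArg (starRingEnd ℂ) a'
      simpa using this
    have e' : (ξ 0 : ℂ) * hat (D 1) ξ = (ξ 1 : ℂ) * hat (D 0) ξ := by
      apply mul_left_cancel₀ hpi
      simp only [dsym] at e
      linear_combination e
    have hn : ((ξ 0 : ℂ) ^ 2 + (ξ 1 : ℂ) ^ 2) ≠ 0 := by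
      have e2 : ‖ξ‖ ^ 2 = ξ 0 ^ 2 + ξ 1 ^ 2 := by
        rw [EuclideanSpace.real_norm_sq_eq, Fin.sum_univ_two]
      have : ((ξ 0 : ℂ) ^ 2 + (ξ 1 : ℂ) ^ 2) = ((‖ξ‖ ^ 2 : ℝ) : ℂ) := by rw [e2]; push_cast; rfl
      rw [this]
      exact Complex.ofReal_ne_zero.2 (by positivity)
    -- Multiplied by |ξ|², the product ū·D splits into (ξ·ū)(ξ·D) + (ξ^⊥·ū)(ξ^⊥·D). The first term
    -- vanishes by incompressibility, the second because D is a gradient.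
    apply mul_left_cancel₀ hn
    simp only [Pi.zero_apply, mul_zero]
    linear_combination ((ξ 0 : ℂ) * hat (D 0) ξ + (ξ 1 : ℂ) * hat (D 1) ξ) * a'' +
      ((starRingEnd ℂ) (hat (u 0) ξ) * (-(ξ 1 : ℂ)) + (starRingEnd ℂ) (hat (u 1) ξ) * (ξ 0 : ℂ)) * e'
  rw [this, Complex.zero_re]

/-- The quadratic nonlinearity. -/
theorem nonlin_sq : Nonlin (fun x => x ^ 2 / 2) (fun x => x) 1 :=
  ⟨fun x => by simpa using ((hasDerivAt_pow 2 x).div_const 2), fun a b => by simp, by simp, rfl,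
    monotone_id⟩

theorem nonlin_sq_app (w : L2) : nonlin_sq.app w = w :=
  Lp.ext (nonlin_sq.coeFn_app w)

theorem nonlin_sq_energy (w : L2) : nonlin_sq.energy w = ‖w‖ ^ 2 / 2 := by
  rw [Nonlin.energy, integral_div, sq_norm_eq_integral]

/-- The nonlinearity of the maximum principle. -/
theorem exists_nonlin_excess {k : ℝ} (hk : 0 ≤ k) :
    ∃ Φ φ, Nonlin Φ φ 1 ∧ (∀ x, |x| ≤ k → Φ x = 0) ∧ ∀ x, Φ x = 0 → |x| ≤ k := by
  -- The distance of x to [-k, k], with sign; its primitive Φ is half the square of that distance.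
  set φ : ℝ → ℝ := fun x => x - max (-k) (min x k) with hφ
  have hzero : ∀ x, |x| ≤ k → φ x = 0 := fun x hx => by
    rw [abs_le] at hx
    simp only [hφ]
    rw [min_eq_left hx.2, max_eq_right hx.1, sub_self]
  have hmono : ∀ a b, a ≤ b → φ a ≤ φ b ∧ φ b - φ a ≤ b - a := fun a b hab => by
    simp only [hφ]
    rcases le_total a k with h1 | h1 <;> rcases le_total b k with h2 | h2 <;>
    rcases le_total (-k) a with h3 | h3 <;> rcases le_total (-k) b with h4 | h4 <;>
    simp only [min_eq_left, min_eq_right, max_eq_left, max_eq_right, h1, h2, h3, h4,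
      neg_le_self hk] <;> constructor <;> linarith
  have hlip : ∀ a b, |φ a - φ b| ≤ 1 * |a - b| := fun a b => by
    rw [one_mul]
    rcases le_total a b with h | h
    · obtain ⟨h1, h2⟩ := hmono a b h
      rw [abs_sub_comm, abs_sub_comm a b, abs_of_nonneg (sub_nonneg.2 h1),
        abs_of_nonneg (sub_nonneg.2 h)]
      exact h2
    · obtain ⟨h1, h2⟩ := hmono b a h
      rw [abs_of_nonneg (sub_nonneg.2 h1), abs_of_nonneg (sub_nonneg.2 h)]
      exact h2
  have N := Nonlin.of_lip hlip (hzero 0 (by simpa using hk)) fun a b h => (hmono a b h).1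
  refine ⟨_, _, N, fun x hx => ?_, fun x hx => ?_⟩
  · have : ∫ t in (0 : ℝ)..x, φ t = ∫ t in (0 : ℝ)..x, (0 : ℝ) := by
      refine intervalIntegral.integral_congr fun t ht => hzero t ?_
      rw [abs_le] at hx ⊢
      rcases le_total 0 x with h | h
      · rw [uIcc_of_le h] at ht; exact ⟨by linarith [ht.1], ht.2.trans hx.2⟩
      · rw [uIcc_of_ge h] at ht; exact ⟨hx.1.trans ht.1, by linarith [ht.2]⟩
    rw [this]; simp
  · by_contra hcon
    rw [not_le, lt_abs] at hcon
    rcases hcon with h | h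
    · have h1 := N.mul_sub_le ((k + x) / 2) x
      have h2 := N.nonneg_apply ((k + x) / 2)
      have h3 : φ ((k + x) / 2) = (k + x) / 2 - k := by
        simp only [hφ]
        rw [min_eq_right (by linarith), max_eq_right (by linarith)]
      rw [h3, hx] at h1
      nlinarith
    · have h1 := N.mul_sub_le ((x - k) / 2) x
      have h2 := N.nonneg_apply ((x - k) / 2)
      have h3 : φ ((x - k) / 2) = (x - k) / 2 + k := by
        simp only [hφ]
        rw [min_eq_left (by linarith), max_eq_left (by linarith)]
        ring
      rw [h3, hx] at h1
      nlinarith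

/-! ### A priori bounds: maximum principle for θ and energy inequality for u -/

namespace Regular

variable {α β S K B : ℝ} {u : ℝ → Fin 2 → L2} {θ : ℝ → L2}

/-- In the derivative of ∫ Φ(θ) transport contributes 0 and diffusion a nonpositive term. -/
theorem energy_temp_le (h : Regular α β S K B u θ) (hβ : 0 < β) (hβ' : β < 2) {Φ φ : ℝ → ℝ} {L : ℝ}
    (N : Nonlin Φ φ L) {t : ℝ} (ht : t ∈ Icc 0 S) : N.energy (θ t) ≤ N.energy (θ 0) := by
  have hanti : AntitoneOn (fun τ => N.energy (θ τ)) (Icc 0 S) := by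
    have hd : ∀ t ∈ Ioo 0 S, ∃ d, HasDerivAt (fun τ => N.energy (θ τ)) d t ∧ d ≤ 0 := by
      intro t ht
      obtain ⟨dθ, h1, h2⟩ := h.temp_eq t ht
      have htc := Ioo_subset_Icc_self ht
      have hH := h.temp_inH t htc
      refine ⟨_, N.hasDerivAt_energy h1, ?_⟩
      rw [h2, inner_sub_right, inner_neg_right, (h.sol t htc).inner_app_adv N hH.one]
      have := N.inner_fracLap_nonneg hβ hβ' (hH.mono hβ.le hβ'.le)
      linarith
    refine antitoneOn_of_deriv_nonpos (convex_Icc 0 S)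
      (N.continuous_energy.comp_continuousOn h.cont_temp) ?_ ?_
    · rw [interior_Icc]
      intro t ht
      obtain ⟨d, h1, -⟩ := hd t ht
      exact h1.differentiableAt.differentiableWithinAt
    · rw [interior_Icc]
      intro t ht
      obtain ⟨d, h1, h2⟩ := hd t ht
      rwa [h1.deriv]
  exact hanti ⟨le_rfl, ht.1.trans ht.2⟩ ht ht.1

theorem norm_temp_le (h : Regular α β S K B u θ) (hβ : 0 < β) (hβ' : β < 2) {t : ℝ}
    (ht : t ∈ Icc 0 S) : ‖θ t‖ ≤ ‖θ 0‖ := by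
  have := h.energy_temp_le hβ hβ' nonlin_sq ht
  rw [nonlin_sq_energy, nonlin_sq_energy] at this
  exact le_of_sq_le_sq (by linarith) (norm_nonneg _)

/-- With Φ vanishing exactly on [-k, k], the energy is zero initially, hence at all later times. -/
theorem ae_abs_temp_le (h : Regular α β S K B u θ) (hβ : 0 < β) (hβ' : β < 2) {k : ℝ} (hk : 0 ≤ k)
    (h0 : ∀ᵐ x : Plane, |θ 0 x| ≤ k) {t : ℝ} (ht : t ∈ Icc 0 S) :
    ∀ᵐ x : Plane, |θ t x| ≤ k := by
  obtain ⟨Φ, φ, N, h1, h2⟩ := exists_nonlin_excess hk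
  have h3 := h.energy_temp_le hβ hβ' N ht
  have h4 : N.energy (θ 0) = 0 :=
    integral_eq_zero_of_ae (h0.mono fun x hx => h1 _ hx)
  have h5 : N.energy (θ t) = 0 := le_antisymm (h4 ▸ h3) (N.energy_nonneg _)
  have h6 := (integral_eq_zero_iff_of_nonneg (fun x => N.nonneg_apply _)
    (N.integrable_comp (θ t))).1 h5
  filter_upwards [h6] with x hx using h2 _ hx

/-- The pressure is orthogonal to u, transport vanishes and dissipation has a sign. Only 2⟨u₂, θ⟩
remains, and it is at most ‖u₂‖² + ‖θ(0)‖²; including ‖θ(0)‖² in the energy turns this into E' ≤ E.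
-/
theorem sq_norm_vel_le (h : Regular α β S K B u θ) (hα : 0 < α) (hα' : α < 2) (hβ : 0 < β)
    (hβ' : β < 2) {t : ℝ} (ht : t ∈ Icc 0 S) :
    ‖u t 0‖ ^ 2 + ‖u t 1‖ ^ 2 ≤ Real.exp t * (‖u 0 0‖ ^ 2 + ‖u 0 1‖ ^ 2 + ‖θ 0‖ ^ 2) := by
  set E : ℝ → ℝ := fun τ => 2 * nonlin_sq.energy (u τ 0) + 2 * nonlin_sq.energy (u τ 1) + ‖θ 0‖ ^ 2
    with hE
  have hEe : ∀ τ, E τ = ‖u τ 0‖ ^ 2 + ‖u τ 1‖ ^ 2 + ‖θ 0‖ ^ 2 := fun τ => by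
    simp only [hE, nonlin_sq_energy]; ring
  have hanti : AntitoneOn (fun τ => E τ * Real.exp (-τ)) (Icc 0 S) := by
    have hd : ∀ t ∈ Ioo 0 S, ∃ d, HasDerivAt (fun τ => E τ * Real.exp (-τ)) d t ∧ d ≤ 0 := by
      intro t ht
      obtain ⟨du, D, h1, h2, h3⟩ := h.vel_eq t ht
      have htc := Ioo_subset_Icc_self ht
      have hs := h.sol t htc
      have hdE := (((nonlin_sq.hasDerivAt_energy (h1 0)).const_mul 2).add
        ((nonlin_sq.hasDerivAt_energy (h1 1)).const_mul 2)).add_const (‖θ 0‖ ^ 2)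
      refine ⟨_, hdE.mul ((hasDerivAt_neg t).exp), ?_⟩
      have hp := inner_gradient_eq_zero (fun i => (hs.inH i).one) hs.div h2
      have e0 := h3 0
      have e1 := h3 1
      rw [if_neg (by decide), add_zero] at e0
      rw [if_pos rfl] at e1
      have p0 := nonlin_sq.inner_fracLap_nonneg hα hα' ((hs.inH 0).mono hα.le hα'.le)
      have p1 := nonlin_sq.inner_fracLap_nonneg hα hα' ((hs.inH 1).mono hα.le hα'.le)
      have hθ : inner ℝ (u t 1) (θ t) ≤ (‖u t 1‖ ^ 2 + ‖θ 0‖ ^ 2) / 2 := by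
        have h4 := real_inner_le_norm (u t 1) (θ t)
        have h5 := h.norm_temp_le hβ hβ' htc
        nlinarith [sq_nonneg (‖u t 1‖ - ‖θ t‖), norm_nonneg (θ t), norm_nonneg (u t 1)]
      simp only [nonlin_sq_app] at p0 p1 ⊢
      rw [e0, e1]
      simp only [inner_add_right, inner_sub_right, inner_neg_right,
        hs.inner_self_adv (hs.inH 0).one, hs.inner_self_adv (hs.inH 1).one]
      have hEt := hEe t
      simp only [hE] at hEt
      simp only [Pi.add_apply]
      rw [hEt]
      have hx := Real.exp_pos (-t)
      have : 2 * (-0 - inner ℝ (u t 0) (fracLap α (u t 0)) - inner ℝ (u t 0) (D 0)) +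
          2 * (-0 - inner ℝ (u t 1) (fracLap α (u t 1)) - inner ℝ (u t 1) (D 1) +
            inner ℝ (u t 1) (θ t)) ≤ ‖u t 0‖ ^ 2 + ‖u t 1‖ ^ 2 + ‖θ 0‖ ^ 2 := by
        nlinarith [sq_nonneg ‖u t 0‖]
      nlinarith
    refine antitoneOn_of_deriv_nonpos (convex_Icc 0 S) ?_ ?_ ?_
    · refine ContinuousOn.mul ?_ (by fun_prop)
      exact (((nonlin_sq.continuous_energy.comp_continuousOn (h.cont_vel 0)).const_smul
        (2 : ℝ)).add ((nonlin_sq.continuous_energy.comp_continuousOn (h.cont_vel 1)).const_smul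
        (2 : ℝ))).add continuousOn_const
    · rw [interior_Icc]
      intro t ht
      obtain ⟨d, h1, -⟩ := hd t ht
      exact h1.differentiableAt.differentiableWithinAt
    · rw [interior_Icc]
      intro t ht
      obtain ⟨d, h1, h2⟩ := hd t ht
      rwa [h1.deriv]
  have h1 := hanti ⟨le_rfl, ht.1.trans ht.2⟩ ht ht.1
  simp only [neg_zero, Real.exp_zero, mul_one, hEe] at h1
  rw [Real.exp_neg, ← div_eq_mul_inv, div_le_iff₀ (Real.exp_pos t)] at h1
  nlinarith [sq_nonneg ‖θ 0‖]

end Regular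

/-! ### Weak limits -/

theorem exists_inH_near (e : L2) {ε : ℝ} (hε : 0 < ε) : ∃ e', InH 1 e' ∧ ‖e - e'‖ < ε := by
  choose g hg using fun n : ℕ => HasMult.of_bounded (realSymbol_cut n) (norm_cut_le n) e
  have hlim : Tendsto g atTop (𝓝 e) := by
    refine HasMult.tendsto (B := 2) (inH_zero e) hg (n := fun _ => 1)
      (.of_forall fun ξ => by simp) (fun n ξ _ => ?_) fun ξ _ => ?_
    · refine (norm_sub_le _ _).trans ?_
      have := norm_cut_le n ξ
      rw [norm_one, Real.rpow_zero]; linarith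
    · refine tendsto_const_nhds.congr' ?_
      obtain ⟨N, hN⟩ := exists_nat_ge ‖ξ‖
      filter_upwards [eventually_ge_atTop N] with n hn
      have : ‖ξ‖ ≤ n := hN.trans (by exact_mod_cast hn)
      rw [cut, if_pos this]
  obtain ⟨n, hn⟩ := ((tendsto_iff_norm_sub_tendsto_zero.1 hlim).eventually (gt_mem_nhds hε)).exists
  refine ⟨g n, ?_, by rwa [norm_sub_rev]⟩
  refine inH_of_memLp ((Lp.memLp (hat e)).of_le_mul (c := n)
    ((realSymbol_rad 1).meas.aestronglyMeasurable.mul (Lp.aestronglyMeasurable _)) ?_)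
  filter_upwards [hg n] with ξ h
  rw [norm_mul, h, norm_mul, ← mul_assoc, norm_rad, Real.rpow_one]
  refine mul_le_mul_of_nonneg_right ?_ (norm_nonneg _)
  unfold cut
  split_ifs with hξ
  · simpa using hξ
  · simp

/-- If f converges strongly in `L²` and its images under a skew-adjoint operator stay bounded, the
images converge weakly. Weak convergence is checked on the dense set of H¹ functions, on which the
operator moves to the other side, and then paired with a strongly convergent factor. -/
theorem tendsto_inner_hasMult {ι : Type*} {l : Filter ι} {m : Plane → ℂ} (hm : RealSymbol m)
    (hanti : ∀ ξ, (starRingEnd ℂ) (m ξ) = -m ξ) {C M : ℝ} (hC : 0 ≤ C) (hM : 0 ≤ M)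
    (hb : ∀ ξ : Plane, 0 < ‖ξ‖ → ‖m ξ‖ ≤ C + C * ‖ξ‖ ^ (1 : ℝ)) {f Xf e : ι → L2} {f₀ Xf₀ e₀ : L2}
    (hX : ∀ᶠ i in l, HasMult m (f i) (Xf i)) (hX₀ : HasMult m f₀ Xf₀) (hf : Tendsto f l (𝓝 f₀))
    (hbd : ∀ᶠ i in l, ‖Xf i‖ ≤ M) (he : Tendsto e l (𝓝 e₀)) :
    Tendsto (fun i => inner ℝ (Xf i) (e i)) l (𝓝 (inner ℝ Xf₀ e₀)) := by
  rw [Metric.tendsto_nhds]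
  intro ε hε
  set M' := M + ‖Xf₀‖ + 1 with hM'
  have hM'0 : 0 < M' := by positivity
  obtain ⟨e', he', hee⟩ := exists_inH_near e₀ (by positivity : 0 < ε / (3 * M'))
  obtain ⟨Y, hY, -⟩ := he'.exists_hasMult hm hC hC hb
  have h1 : Tendsto (fun i => M' * ‖e i - e₀‖) l (𝓝 0) := by
    simpa using (tendsto_iff_norm_sub_tendsto_zero.1 he).const_mul M'
  have h2 : Tendsto (fun i => ‖f i - f₀‖ * ‖Y‖) l (𝓝 0) := by
    simpa using (tendsto_iff_norm_sub_tendsto_zero.1 hf).mul_const ‖Y‖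
  filter_upwards [hX, hbd, h1.eventually (gt_mem_nhds (by positivity : 0 < ε / 3)),
    h2.eventually (gt_mem_nhds (by positivity : 0 < ε / 3))] with i a b c d
  rw [Real.dist_eq]
  have e1 : inner ℝ (Xf i - Xf₀) e' = -inner ℝ (f i - f₀) Y := (a.sub hX₀).inner_eq_neg hY hanti
  have e2 : inner ℝ (Xf i) (e i) - inner ℝ Xf₀ e₀ = inner ℝ (Xf i) (e i - e₀) +
      inner ℝ (Xf i - Xf₀) (e₀ - e') + inner ℝ (Xf i - Xf₀) e' := by
    simp only [inner_sub_left, inner_sub_right]; ring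
  rw [e2, e1]
  have i1 := abs_real_inner_le_norm (Xf i) (e i - e₀)
  have i2 := abs_real_inner_le_norm (Xf i - Xf₀) (e₀ - e')
  have i3 := abs_real_inner_le_norm (f i - f₀) Y
  have n1 : ‖Xf i‖ ≤ M' := by rw [hM']; linarith [norm_nonneg Xf₀]
  have n2 : ‖Xf i - Xf₀‖ ≤ M' := (norm_sub_le _ _).trans (by rw [hM']; linarith)
  have j1 : ‖Xf i‖ * ‖e i - e₀‖ ≤ M' * ‖e i - e₀‖ := mul_le_mul_of_nonneg_right n1 (norm_nonneg _)
  have j2 : ‖Xf i - Xf₀‖ * ‖e₀ - e'‖ ≤ M' * (ε / (3 * M')) :=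
    mul_le_mul n2 hee.le (norm_nonneg _) hM'0.le
  have j3 : M' * (ε / (3 * M')) = ε / 3 := by field_simp
  rw [abs_lt]
  rw [abs_le] at i1 i2 i3
  constructor <;> linarith [i1.1, i1.2, i2.1, i2.2, i3.1, i3.2]

/-! ### The evolution of `G` -/

theorem lapSym_mul_lapSym {a b : ℝ} {ξ : Plane} (h : 0 < ‖ξ‖) :
    lapSym a ξ * lapSym b ξ = lapSym (a + b) ξ := by
  rw [lapSym, lapSym, lapSym, ← rad_mul_rad h, Real.rpow_add (by positivity)]
  push_cast; ring

theorem lapSym_zero (ξ : Plane) : lapSym 0 ξ = 1 := by simp [lapSym, rad]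

theorem HasMult.commute {m n : Plane → ℂ} {f g h k : L2} (hg : HasMult m f g) (hh : HasMult n f h)
    (hk : HasMult n g k) : HasMult m h k := by
  filter_upwards [hg, hh, hk] with ξ a b c
  rw [c, a, b]; ring

theorem inH_rieszOp {a : ℝ} {f : L2} (ha : 0 ≤ a) (ha' : a ≤ 1) (hf : InH 2 f) :
    InH 1 (rieszOp a f) ∧ ‖absD 1 (rieszOp a f)‖ ≤ rieszConst a * (‖f‖ + ‖absD 2 f‖) := by
  have h := (hf.mono (s := 1 - a + 1) (by linarith) (by linarith)).of_hasMult
    (hasMult_rieszOp (hf.mono (by linarith) (by linarith))) (realSymbol_rieszSym a)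
    (rieszConst_nonneg a) fun ξ hξ => norm_rieszSym_le a hξ
  exact ⟨h.1, h.2.trans (mul_le_mul_of_nonneg_left (hf.norm_absD_le (by linarith) (by linarith))
    (rieszConst_nonneg a))⟩

theorem Solenoidal.inH_combined {u : Fin 2 → L2} {K α : ℝ} (h : Solenoidal u K) {θ : L2}
    (hθ : InH 2 θ) (hα : 0 ≤ α) (hα' : α ≤ 1) : InH 1 (combined α u θ) :=
  h.inH_vorticity.sub (inH_rieszOp hα hα' hθ).1

/-- The nonlinear term in the balance of `∫ Φ(G)`. -/
def commTerm (α : ℝ) (u : Fin 2 → L2) (θ f : L2) : ℝ :=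
  -inner ℝ (rieszOp α f) (adv u θ) - inner ℝ f (adv u (rieszOp α θ))

/-- The equation of G in weak form: all derivatives fall on the test function f = φ(G), so the left
side involves only the `L²` time derivatives of u and θ. The curl removes the pressure, Λ^α R_α = ∂₁
cancels the buoyancy, and α + β = 1 turns Λ^β R_α into R_{2α-1}. -/
theorem Solenoidal.balance {u : Fin 2 → L2} {K α β : ℝ} (h : Solenoidal u K) {θ : L2}
    (hθ : InH 2 θ) (hα : 1 / 2 < α) (hα' : α < 1) (hαβ : α + β = 1) {Φ φ : ℝ → ℝ} {L : ℝ}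
    (N : Nonlin Φ φ L) {du D : Fin 2 → L2} {dθ : L2}
    (hD : ∀ᵐ ξ : Plane, dsym 0 ξ * hat (D 1) ξ = dsym 1 ξ * hat (D 0) ξ)
    (hdu : ∀ i, du i = -adv u (u i) - fracLap α (u i) - D i + (if i = 1 then θ else 0))
    (hdθ : dθ = -adv u θ - fracLap β θ) :
    -inner ℝ (partialD 0 (N.app (combined α u θ))) (du 1) +
      inner ℝ (partialD 1 (N.app (combined α u θ))) (du 0) +
      inner ℝ (rieszOp α (N.app (combined α u θ))) dθ =
      -inner ℝ (N.app (combined α u θ)) (fracLap α (combined α u θ)) +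
        commTerm α u θ (N.app (combined α u θ)) +
        inner ℝ (N.app (combined α u θ)) (rieszOp (2 * α - 1) θ) := by
  set G := combined α u θ with hG
  set f := N.app G with hf
  have hGH : InH 1 G := h.inH_combined hθ (by linarith) hα'.le
  have hfH : InH 1 f := (N.inH_app hGH).1
  have hRH := (inH_rieszOp (a := α) (by linarith) hα'.le hθ).1
  have hRf := hasMult_rieszOp (a := α) (hfH.mono (by linarith) (by linarith))
  -- the pressure
  have hp : inner ℝ (partialD 0 f) (D 1) = inner ℝ (partialD 1 f) (D 0) := by
    rw [inner_eq_hat, inner_eq_hat]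
    congr 1
    refine integral_congr_ae ?_
    filter_upwards [hD, hasMult_partialD 0 hfH, hasMult_partialD 1 hfH] with ξ a b c
    rw [b, c, map_mul, map_mul, conj_dsym, conj_dsym]
    linear_combination -(starRingEnd ℂ) (hat f ξ) * a
  -- the dissipation
  have hlap : ∀ i j, inner ℝ (partialD i f) (fracLap α (u j)) =
      -inner ℝ f (fracLap α (partialD i (u j))) := fun i j => by
    have h1 := hasMult_fracLap ((h.inH j).mono (s := α) (by linarith) (by linarith))
    have h2 := hasMult_partialD i (h.inH j).one
    have h3 := hasMult_fracLap ((inH_partialD i (h.inH j)).1.mono (s := α) (by linarith) hα'.le)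
    exact (hasMult_partialD i hfH).inner_eq_neg (h2.commute h1 h3) (conj_dsym i)
  have hlapω : fracLap α (partialD 0 (u 1)) - fracLap α (partialD 1 (u 0)) =
      fracLap α G + partialD 0 θ := by
    have h1 := hasMult_fracLap ((inH_partialD 0 (h.inH 1)).1.mono (s := α) (by linarith) hα'.le)
    have h2 := hasMult_fracLap ((inH_partialD 1 (h.inH 0)).1.mono (s := α) (by linarith) hα'.le)
    have h3 := hasMult_fracLap (hGH.mono (s := α) (by linarith) hα'.le)
    have h4 := hasMult_rieszOp (a := α) (hθ.mono (by linarith) (by linarith))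
    have h5 : HasMult (lapSym α) (rieszOp α θ) (partialD 0 θ) := by
      filter_upwards [h4, hasMult_partialD 0 hθ.one, ae_norm_pos] with ξ a b c
      rw [a, b, rieszSym, ← mul_assoc, ← mul_assoc, lapSym_mul_lapSym c, add_neg_cancel,
        lapSym_zero, one_mul]
    have e : partialD 0 (u 1) - partialD 1 (u 0) = G + rieszOp α θ := by
      rw [hG, combined, vorticity]; abel
    have h6 := h1.sub h2
    rw [e] at h6
    exact h6.unique (h3.add h5)
  have hθ0 : inner ℝ (partialD 0 f) θ = -inner ℝ f (partialD 0 θ) :=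
    (hasMult_partialD 0 hfH).inner_eq_neg (hasMult_partialD 0 hθ.one) (conj_dsym 0)
  have hRβ : inner ℝ (rieszOp α f) (fracLap β θ) = -inner ℝ f (rieszOp (2 * α - 1) θ) := by
    refine hRf.inner_eq_neg ?_ (conj_rieszSym α)
    filter_upwards [hasMult_fracLap (hθ.mono (s := β) (by linarith) (by linarith)),
      hasMult_rieszOp (a := 2 * α - 1) (hθ.mono (by linarith) (by linarith)), ae_norm_pos]
      with ξ a b c
    rw [a, b, rieszSym, rieszSym, show -(2 * α - 1) = -α + β by linarith, ← lapSym_mul_lapSym c]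
    ring
  -- the transport
  have hadv := h.inner_curl_adv hfH
  have hω : inner ℝ f (adv u (vorticity u)) = inner ℝ f (adv u (rieszOp α θ)) := by
    have h1 : inner ℝ f (adv u G) = 0 := h.inner_app_adv N hGH
    have e : adv u G = adv u (vorticity u) - adv u (rieszOp α θ) := by
      have ed : ∀ j, partialD j G = partialD j (vorticity u) - partialD j (rieszOp α θ) := fun j =>
        partialD_sub j h.inH_vorticity hRH
      rw [adv, adv, adv, ed, ed, mulL_sub_left (h.bdd 0), mulL_sub_left (h.bdd 1)]
      abel
    rw [e, inner_sub_right] at h1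
    linarith
  have hl2 : inner ℝ f (fracLap α (partialD 0 (u 1))) - inner ℝ f (fracLap α (partialD 1 (u 0))) =
      inner ℝ f (fracLap α G) + inner ℝ f (partialD 0 θ) := by
    rw [← inner_sub_right, hlapω, inner_add_right]
  have d1 := hdu 1
  have d0 := hdu 0
  rw [if_pos rfl] at d1
  rw [if_neg (by decide), add_zero] at d0
  rw [d1, d0, hdθ, commTerm]
  simp only [inner_add_right, inner_sub_right, inner_neg_right, hlap, hθ0, hRβ, hp]
  linarith

/-- G involves derivatives of u and θ, so it need not be differentiable in time with values in `L²`.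
By convexity the slope of the energy lies between ⟨φ(G(t)), ·⟩ and ⟨φ(G(τ)), ·⟩ applied to the
difference quotient of G. Moving the derivatives onto φ(G), which is bounded in H¹ and converges in
`L²`, shows that both have the same limit. -/
theorem Regular.hasDerivAt_energy {α β S K B : ℝ} {u : ℝ → Fin 2 → L2} {θ : ℝ → L2}
    (h : Regular α β S K B u θ) (hα : 1 / 2 < α) (hα' : α < 1) (hαβ : α + β = 1) {Φ φ : ℝ → ℝ} {L : ℝ}
    (N : Nonlin Φ φ L) {t : ℝ} (ht : t ∈ Ioo 0 S) :
    HasDerivAt (fun τ => N.energy (combined α (u τ) (θ τ)))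
      (-inner ℝ (N.app (combined α (u t) (θ t))) (fracLap α (combined α (u t) (θ t))) +
        commTerm α (u t) (θ t) (N.app (combined α (u t) (θ t))) +
        inner ℝ (N.app (combined α (u t) (θ t))) (rieszOp (2 * α - 1) (θ t))) t := by
  obtain ⟨du, D, hdu, hD, hdu'⟩ := h.vel_eq t ht
  obtain ⟨dθ, hdθ, hdθ'⟩ := h.temp_eq t ht
  have htc := Ioo_subset_Icc_self ht
  rw [← (h.sol t htc).balance (h.temp_inH t htc) hα hα' hαβ N hD hdu' hdθ']
  set G : ℝ → L2 := fun τ => combined α (u τ) (θ τ) with hG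
  change HasDerivAt (fun τ => N.energy (G τ)) (-inner ℝ (partialD 0 (N.app (G t))) (du 1) +
      inner ℝ (partialD 1 (N.app (G t))) (du 0) + inner ℝ (rieszOp α (N.app (G t))) dθ) t
  have hB : 0 ≤ B := (norm_nonneg _).trans (h.bound_temp t htc).1
  -- A bound for the H¹ seminorm of G that is uniform in time; only its finiteness matters.
  set M₀ := 2 * Real.pi * B + 2 * Real.pi * B + rieszConst α * (B + B) with hM₀
  have hGH : ∀ τ ∈ Icc 0 S, InH 1 (G τ) := fun τ hτ =>
    (h.sol τ hτ).inH_combined (h.temp_inH τ hτ) (by linarith) hα'.le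
  have hGb : ∀ τ ∈ Icc 0 S, ‖absD 1 (G τ)‖ ≤ M₀ := fun τ hτ => by
    have hs := h.sol τ hτ
    have h1 := inH_partialD 0 (hs.inH 1)
    have h2 := inH_partialD 1 (hs.inH 0)
    have h3 := inH_rieszOp (a := α) (by linarith) hα'.le (h.temp_inH τ hτ)
    have e : absD 1 (G τ) = absD 1 (partialD 0 (u τ 1)) - absD 1 (partialD 1 (u τ 0)) -
        absD 1 (rieszOp α (θ τ)) :=
      (hGH τ hτ).hasMult.unique ((h1.1.hasMult.sub h2.1.hasMult).sub h3.1.hasMult)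
    rw [e]
    refine (norm_sub_le _ _).trans (add_le_add ((norm_sub_le _ _).trans (add_le_add ?_ ?_)) ?_)
    · exact h1.2.trans (mul_le_mul_of_nonneg_left (h.bound_vel τ hτ 1).2 (by positivity))
    · exact h2.2.trans (mul_le_mul_of_nonneg_left (h.bound_vel τ hτ 0).2 (by positivity))
    · exact h3.2.trans (mul_le_mul_of_nonneg_left
        (add_le_add (h.bound_temp τ hτ).1 (h.bound_temp τ hτ).2) (rieszConst_nonneg α))
  have hM₀0 : 0 ≤ M₀ := (norm_nonneg _).trans (hGb t htc)
  have hnear : ∀ᶠ τ in 𝓝[≠] t, τ ∈ Icc 0 S :=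
    nhdsWithin_le_nhds (Icc_mem_nhds ht.1 ht.2)
  -- difference quotients of the unknowns
  set q : (ℝ → L2) → ℝ → L2 := fun g τ => (τ - t)⁻¹ • (g τ - g t) with hq
  have hqu : ∀ i, Tendsto (q fun τ => u τ i) (𝓝[≠] t) (𝓝 (du i)) := fun i =>
    hasDerivAt_iff_tendsto_slope.1 (hdu i)
  have hqθ : Tendsto (q θ) (𝓝[≠] t) (𝓝 dθ) := hasDerivAt_iff_tendsto_slope.1 hdθ
  have hJ : ∀ f, InH 1 f → ∀ τ ∈ Icc 0 S, inner ℝ f (q G τ) =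
      -inner ℝ (partialD 0 f) (q (fun τ => u τ 1) τ) +
        inner ℝ (partialD 1 f) (q (fun τ => u τ 0) τ) + inner ℝ (rieszOp α f) (q θ τ) := by
    intro f hf τ hτ
    have hs := h.sol τ hτ
    have hs' := h.sol t htc
    have p : ∀ i j, inner ℝ (partialD i f) (u τ j - u t j) =
        -inner ℝ f (partialD i (u τ j) - partialD i (u t j)) := fun i j =>
      (hasMult_partialD i hf).inner_eq_neg ((hasMult_partialD i (hs.inH j).one).sub
        (hasMult_partialD i (hs'.inH j).one)) (conj_dsym i)
    have r : inner ℝ (rieszOp α f) (θ τ - θ t) =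
        -inner ℝ f (rieszOp α (θ τ) - rieszOp α (θ t)) :=
      (hasMult_rieszOp (hf.mono (by linarith) (by linarith))).inner_eq_neg
        ((hasMult_rieszOp ((h.temp_inH τ hτ).mono (by linarith) (by linarith))).sub
        (hasMult_rieszOp ((h.temp_inH t htc).mono (by linarith) (by linarith)))) (conj_rieszSym α)
    simp only [hq, inner_smul_right, p, r, hG, combined, vorticity, inner_sub_right]
    ring
  -- the limit
  have hlim : ∀ f : ℝ → L2, Tendsto f (𝓝[≠] t) (𝓝 (N.app (G t))) →
      (∀ᶠ τ in 𝓝[≠] t, InH 1 (f τ) ∧ (∀ j, ‖partialD j (f τ)‖ ≤ L * (2 * Real.pi * M₀)) ∧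
        ‖absD 1 (f τ)‖ ^ 2 ≤ 2 * (L * (2 * Real.pi * M₀)) ^ 2 ∧ ‖f τ‖ ≤ ‖N.app (G t)‖ + 1) →
      Tendsto (fun τ => inner ℝ (f τ) (q G τ)) (𝓝[≠] t)
        (𝓝 (-inner ℝ (partialD 0 (N.app (G t))) (du 1) +
          inner ℝ (partialD 1 (N.app (G t))) (du 0) + inner ℝ (rieszOp α (N.app (G t))) dθ)) := by
    intro f hf hev
    have hL := N.nonneg
    have hfH : InH 1 (N.app (G t)) := (N.inH_app (hGH t htc)).1
    have t1 : ∀ j i, Tendsto (fun τ => inner ℝ (partialD j (f τ)) (q (fun τ => u τ i) τ)) (𝓝[≠] t)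
        (𝓝 (inner ℝ (partialD j (N.app (G t))) (du i))) := fun j i =>
      tendsto_inner_hasMult (realSymbol_dsym j) (conj_dsym j) (C := 2 * Real.pi)
        (M := L * (2 * Real.pi * M₀)) (by positivity) (by positivity)
        (fun ξ _ => by
          rw [Real.rpow_one]
          have := norm_dsym_le j ξ
          have := Real.pi_pos
          linarith)
        (hev.mono fun τ hτ => hasMult_partialD j hτ.1) (hasMult_partialD j hfH) hf
        (hev.mono fun τ hτ => hτ.2.1 j) (hqu i)
    have t2 : Tendsto (fun τ => inner ℝ (rieszOp α (f τ)) (q θ τ)) (𝓝[≠] t)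
        (𝓝 (inner ℝ (rieszOp α (N.app (G t))) dθ)) := by
      refine tendsto_inner_hasMult (realSymbol_rieszSym α) (conj_rieszSym α) (C := rieszConst α)
        (M := rieszConst α * (‖N.app (G t)‖ + 1 + 2 * (L * (2 * Real.pi * M₀))))
        (rieszConst_nonneg α)
        (mul_nonneg (rieszConst_nonneg α) (by positivity))
        (fun ξ hξ => (norm_rieszSym_le α hξ).trans ?_)
        (hev.mono fun τ hτ => hasMult_rieszOp (hτ.1.mono (by linarith) (by linarith)))
        (hasMult_rieszOp (hfH.mono (by linarith) (by linarith))) hf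
        (hev.mono fun τ hτ => ?_) hqθ
      · rw [← mul_one_add]
        refine mul_le_mul_of_nonneg_left ?_ (rieszConst_nonneg α)
        simpa using rpow_le_one_add hξ (by linarith : 0 ≤ 1 - α) (by linarith : 1 - α ≤ 1)
      · obtain ⟨h1, -, h3, h4⟩ := hτ
        have h1' := h1.mono (s := 1 - α) (by linarith) (by linarith)
        obtain ⟨g, hg, hle⟩ := h1'.exists_of_order (realSymbol_rieszSym α) (rieszConst_nonneg α)
          fun ξ hξ => norm_rieszSym_le α hξ
        rw [(hasMult_rieszOp h1').unique hg]
        refine hle.trans (mul_le_mul_of_nonneg_left ?_ (rieszConst_nonneg α))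
        have h5 := h1.norm_absD_le (s := 1 - α) (by linarith) (by linarith)
        have h6 : ‖absD 1 (f τ)‖ ≤ 2 * (L * (2 * Real.pi * M₀)) := by
          refine le_of_sq_le_sq (h3.trans ?_) (by positivity)
          nlinarith [sq_nonneg (L * (2 * Real.pi * M₀))]
        linarith
    refine (((t1 0 1).neg.add (t1 1 0)).add t2).congr' ?_
    filter_upwards [hev, hnear] with τ h1 h2
    exact (hJ _ h1.1 τ h2).symm
  have hGt : Tendsto G (𝓝[≠] t) (𝓝 (G t)) :=
    ((h.cont_combined.continuousAt (Icc_mem_nhds ht.1 ht.2)).tendsto).mono_left nhdsWithin_le_nhds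
  have happ : Tendsto (fun τ => N.app (G τ)) (𝓝[≠] t) (𝓝 (N.app (G t))) :=
    (N.continuous_app.tendsto _).comp hGt
  have hbounds : ∀ τ ∈ Icc 0 S, InH 1 (N.app (G τ)) ∧
      (∀ j, ‖partialD j (N.app (G τ))‖ ≤ L * (2 * Real.pi * M₀)) ∧
        ‖absD 1 (N.app (G τ))‖ ^ 2 ≤ 2 * (L * (2 * Real.pi * M₀)) ^ 2 := fun τ hτ => by
    obtain ⟨h1, h2, h3⟩ := N.inH_app (hGH τ hτ)
    have hL := N.nonneg
    have h4 : L * (2 * Real.pi * ‖absD 1 (G τ)‖) ≤ L * (2 * Real.pi * M₀) := by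
      have := hGb τ hτ
      gcongr
    exact ⟨h1, fun j => (h2 j).trans h4, h3.trans (by gcongr)⟩
  have hA := hlim (fun _ => N.app (G t)) tendsto_const_nhds (.of_forall fun _ =>
    ⟨(hbounds t htc).1, (hbounds t htc).2.1, (hbounds t htc).2.2, by linarith⟩)
  have hBt := hlim (fun τ => N.app (G τ)) happ (by
    have h1 := happ.norm.eventually (gt_mem_nhds (lt_add_one ‖N.app (G t)‖))
    filter_upwards [hnear, h1] with τ h2 h3
    exact ⟨(hbounds τ h2).1, (hbounds τ h2).2.1, (hbounds τ h2).2.2, h3.le⟩)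
  rw [hasDerivAt_iff_tendsto_slope]
  -- The two tangent inequalities bound the slope on both sides; which is the upper bound depends on
  -- the sign of τ - t.
  have key : ∀ τ, τ ≠ t → (inner ℝ (N.app (G t)) (q G τ) ≤ slope (fun τ => N.energy (G τ)) t τ ∧
      slope (fun τ => N.energy (G τ)) t τ ≤ inner ℝ (N.app (G τ)) (q G τ)) ∨
      (inner ℝ (N.app (G τ)) (q G τ) ≤ slope (fun τ => N.energy (G τ)) t τ ∧
      slope (fun τ => N.energy (G τ)) t τ ≤ inner ℝ (N.app (G t)) (q G τ)) := by
    intro τ hτ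
    have h1 := N.inner_le_energy_sub (G t) (G τ)
    have h2 := N.inner_le_energy_sub (G τ) (G t)
    have h3 : inner ℝ (N.app (G τ)) (G t - G τ) = -inner ℝ (N.app (G τ)) (G τ - G t) := by
      rw [← inner_neg_right, neg_sub]
    rw [h3] at h2
    simp only [hq, inner_smul_right, slope_def_field, div_eq_inv_mul]
    rcases lt_or_gt_of_ne hτ with hlt | hgt
    · right
      have hn : (τ - t)⁻¹ ≤ 0 := inv_nonpos.2 (by linarith)
      exact ⟨mul_le_mul_of_nonpos_left (by linarith) hn, mul_le_mul_of_nonpos_left h1 hn⟩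
    · left
      have hn : 0 ≤ (τ - t)⁻¹ := inv_nonneg.2 (by linarith)
      exact ⟨mul_le_mul_of_nonneg_left h1 hn, mul_le_mul_of_nonneg_left (by linarith) hn⟩
  refine tendsto_of_tendsto_of_tendsto_of_le_of_le' (by simpa only [min_self] using hA.min hBt)
    (by simpa only [max_self] using hA.max hBt) ?_ ?_
  · filter_upwards [self_mem_nhdsWithin] with τ hτ
    rcases key τ hτ with h | h
    · exact (min_le_left _ _).trans h.1
    · exact (min_le_right _ _).trans h.1
  · filter_upwards [self_mem_nhdsWithin] with τ hτ
    rcases key τ hτ with h | h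
    · exact h.2.trans (le_max_right _ _)
    · exact h.2.trans (le_max_left _ _)

/-! ### Increments of convolutions with Gaussian kernels -/

theorem trans_trans (y z : Plane) (f : L2) : trans y (trans z f) = trans (y + z) f := by
  refine Lp.ext ?_
  filter_upwards [coeFn_trans y (trans z f), ae_sub y (coeFn_trans z f), coeFn_trans (y + z) f]
    with x h1 h2 h3
  rw [h1, h2, h3, sub_sub]

theorem trans_sub (z : Plane) (f g : L2) : trans z (f - g) = trans z f - trans z g := by
  refine Lp.ext ?_
  filter_upwards [coeFn_trans z (f - g), ae_sub z (Lp.coeFn_sub f g), coeFn_trans z f,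
    coeFn_trans z g, Lp.coeFn_sub (trans z f) (trans z g)] with x h1 h2 h3 h4 h5
  rw [h1, h2, h5]
  simp only [Pi.sub_apply, h3, h4]

theorem hasMult_incr (z : Plane) (f : L2) : HasMult (fun ξ => 1 - chr z ξ) f (incr z f) := by
  have h1 := hasMult_trans z f
  unfold HasMult incr at *
  rw [hat_sub]
  filter_upwards [h1, Lp.coeFn_sub (hat f) (hat (trans z f))] with ξ h1 h2
  rw [h2, Pi.sub_apply, h1]
  ring

theorem integral_abs_dil_sub {F : Plane → ℝ} {s : ℝ} (hs : 0 < s) (z : Plane) :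
    ∫ y, |dil F s (y - z) - dil F s y| =
      ∫ y, |F (y - (Real.sqrt s)⁻¹ • z) - F y| := by
  rw [← integral_dil (fun y => |F (y - (Real.sqrt s)⁻¹ • z) - F y|) hs]
  refine integral_congr_ae (.of_forall fun y => ?_)
  simp only [dil]
  rw [← mul_sub, abs_mul, abs_of_pos (inv_pos.2 hs), smul_sub]

/-- A change of variables moves the increment from g to the kernel, and the `L¹` modulus of
continuity of a kernel at scale √s is at most K(‖z‖/√s)^γ. -/
theorem GaussKernel.exists_abs_integral_incr_le {F : Plane → ℝ} {C : ℝ} (hF : GaussKernel F C) :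
    ∃ K : ℝ, 0 ≤ K ∧ ∀ γ : ℝ, 0 ≤ γ → γ ≤ 1 → ∀ s : ℝ, 0 < s → ∀ (a g : L2) (M : ℝ),
      (∀ y, |inner ℝ a (trans y g)| ≤ M) → ∀ z,
      |∫ y, dil F s y * inner ℝ a (trans y (incr z g))| ≤ K * ‖z‖ ^ γ * s ^ (-γ / 2) * M := by
  obtain ⟨K, hK, h⟩ := hF.exists_integral_sub_le
  refine ⟨K, hK, fun γ hγ hγ' s hs a g M hM z => ?_⟩
  have hd := integrable_dil hF.integrable hs
  have hdz : Integrable fun y => dil F s (y - z) := hd.comp_sub_right z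
  have e : ∫ y, dil F s y * inner ℝ a (trans y (incr z g)) =
      ∫ y, (dil F s y - dil F s (y - z)) * inner ℝ a (trans y g) := by
    have h1 : ∫ y, dil F s y * inner ℝ a (trans (y + z) g) =
        ∫ y, dil F s (y - z) * inner ℝ a (trans y g) := by
      rw [← integral_comp_sub (fun y => dil F s y * inner ℝ a (trans (y + z) g)) z]
      simp only [sub_add_cancel]
    have i1 := integrable_kernel hd a g
    have i2 := integrable_kernel hdz a g
    have i3 : Integrable fun y => dil F s y * inner ℝ a (trans (y + z) g) := by
      have := i2.comp_add_right z
      simpa only [add_sub_cancel_right] using this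
    calc ∫ y, dil F s y * inner ℝ a (trans y (incr z g))
        = ∫ y, (dil F s y * inner ℝ a (trans y g) - dil F s y * inner ℝ a (trans (y + z) g)) := by
          refine integral_congr_ae (.of_forall fun y => ?_)
          simp only [incr, trans_sub, trans_trans, inner_sub_right]
          ring
      _ = _ := by
          rw [integral_sub i1 i3, h1, ← integral_sub i1 i2]
          refine integral_congr_ae (.of_forall fun y => ?_)
          simp only
          ring
  have hM0 : 0 ≤ M := (abs_nonneg _).trans (hM 0)
  rw [e]
  calc |∫ y, (dil F s y - dil F s (y - z)) * inner ℝ a (trans y g)|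
      ≤ ∫ y, |(dil F s y - dil F s (y - z)) * inner ℝ a (trans y g)| := abs_integral_le_integral_abs
    _ ≤ ∫ y, |dil F s (y - z) - dil F s y| * M := by
        refine integral_mono (integrable_kernel (hd.sub hdz) a g).abs
          ((hdz.sub hd).abs.mul_const M) fun y => ?_
        simp only
        rw [abs_mul, abs_sub_comm]
        gcongr
        exact hM y
    _ = (∫ y, |F (y - (Real.sqrt s)⁻¹ • z) - F y|) * M := by
        rw [integral_mul_const, integral_abs_dil_sub hs]
    _ ≤ K * ‖(Real.sqrt s)⁻¹ • z‖ ^ γ * M := by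
        gcongr
        exact h γ hγ hγ' _
    _ = _ := by
        rw [norm_smul, norm_inv, Real.norm_of_nonneg (Real.sqrt_nonneg s),
          Real.mul_rpow (by positivity) (norm_nonneg z), Real.sqrt_eq_rpow, ← Real.rpow_neg hs.le,
          ← Real.rpow_mul hs.le]
        ring_nf

/-- Write m as a superposition of heat symbols with weight w and estimate each scale separately. The
exponent -p - γ/2 combines the cost s^{-p} of the derivatives in σ with the factor s^{-γ/2} of the
increment. The hypothesis on a and g is the form in which an `L^q` bound of g enters by duality. -/
theorem exists_abs_inner_incr_le {F : Plane → ℝ} {C p : ℝ} {σ : Plane → ℂ} (hF : GaussKernel F C)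
    (hσ : Measurable σ)
    (hpair : ∀ s : ℝ, 0 < s → ∀ a b : L2,
      (∫ ξ, (starRingEnd ℂ) (hat a ξ) * (σ ξ * heat s ξ * hat b ξ)).re =
        s ^ (-p) * ∫ z, dil F s z * inner ℝ a (trans z b)) :
    ∃ K : ℝ, 0 ≤ K ∧ ∀ γ : ℝ, 0 ≤ γ → γ ≤ 1 → ∀ (w : ℝ → ℝ) (m : Plane → ℝ), Measurable w →
      (∀ s ∈ Ioi (0 : ℝ), 0 ≤ w s) →
      (∀ ξ : Plane, 0 < ‖ξ‖ →
        IntegrableOn (fun s => w s * Real.exp (-Real.pi * s * ‖ξ‖ ^ 2)) (Ioi 0) ∧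
        ∫ s in Ioi 0, w s * Real.exp (-Real.pi * s * ‖ξ‖ ^ 2) = m ξ) →
      IntegrableOn (fun s => w s * s ^ (-p - γ / 2)) (Ioi 0) →
      ∀ (a g h : L2) (M : ℝ), HasMult (fun ξ => m ξ * σ ξ) g h →
      (∀ y, |inner ℝ a (trans y g)| ≤ M) → ∀ z,
      |inner ℝ a (incr z h)| ≤
        K * (∫ s in Ioi 0, w s * s ^ (-p - γ / 2)) * ‖z‖ ^ γ * M := by
  obtain ⟨K, hK, hb⟩ := hF.exists_abs_integral_incr_le
  refine ⟨K, hK, fun γ hγ hγ' w m hw hw0 hm hI a g h M hh hM z => ?_⟩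
  set H : Plane → ℂ := fun ξ => (starRingEnd ℂ) (hat a ξ) * (σ ξ * hat (incr z g) ξ) with hH
  have hmH : (fun ξ => (m ξ : ℂ) * H ξ) =ᵐ[volume]
      fun ξ => (starRingEnd ℂ) (hat a ξ) * hat (incr z h) ξ := by
    filter_upwards [hh, hasMult_incr z g, hasMult_incr z h] with ξ h1 h2 h3
    simp only [hH]
    rw [h2, h3, h1]
    ring
  have hHs : AEStronglyMeasurable H :=
    (Complex.continuous_conj.comp_aestronglyMeasurable (Lp.aestronglyMeasurable (hat a))).mul
      (hσ.aestronglyMeasurable.mul (Lp.aestronglyMeasurable _))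
  obtain ⟨i1, i2⟩ := superposition (φ := fun s ξ => Real.exp (-Real.pi * s * ‖ξ‖ ^ 2)) (m := m)
    hw (by fun_prop) hw0 (fun s _ ξ => by positivity)
    (ae_norm_pos.mono fun ξ hξ => (hm ξ hξ).1) (ae_norm_pos.mono fun ξ hξ => (hm ξ hξ).2)
    hHs ((integrable_conj_mul a (incr z h)).congr hmH.symm)
  have e1 : inner ℝ a (incr z h) = ∫ s in Ioi 0,
      ((w s : ℂ) * ∫ ξ, ((Real.exp (-Real.pi * s * ‖ξ‖ ^ 2) : ℝ) : ℂ) * H ξ).re := by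
    rw [inner_eq_hat, ← integral_congr_ae hmH, ← i2]
    exact (integral_re i1).symm
  have e2 : ∀ s ∈ Ioi (0 : ℝ),
      |((w s : ℂ) * ∫ ξ, ((Real.exp (-Real.pi * s * ‖ξ‖ ^ 2) : ℝ) : ℂ) * H ξ).re| ≤
        w s * s ^ (-p - γ / 2) * (K * ‖z‖ ^ γ * M) := by
    intro s hs
    have hs' : 0 < s := hs
    have h1 : (∫ ξ, ((Real.exp (-Real.pi * s * ‖ξ‖ ^ 2) : ℝ) : ℂ) * H ξ).re =
        s ^ (-p) * ∫ y, dil F s y * inner ℝ a (trans y (incr z g)) := by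
      rw [← hpair s hs]
      congr 1
      refine integral_congr_ae (.of_forall fun ξ => ?_)
      simp only [hH, heat_eq]
      ring
    rw [Complex.re_ofReal_mul, h1, abs_mul, abs_mul, abs_of_nonneg (hw0 s hs),
      abs_of_nonneg (Real.rpow_nonneg hs'.le _)]
    have h2 := hb γ hγ hγ' s hs a g M hM z
    have h3 : s ^ (-p - γ / 2) = s ^ (-p) * s ^ (-γ / 2) := by
      rw [← Real.rpow_add hs']
      ring_nf
    rw [h3]
    calc w s * (s ^ (-p) * |∫ y, dil F s y * inner ℝ a (trans y (incr z g))|)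
        ≤ w s * (s ^ (-p) * (K * ‖z‖ ^ γ * s ^ (-γ / 2) * M)) := by
          have := hw0 s hs
          gcongr
      _ = _ := by ring
  rw [e1]
  calc |∫ s in Ioi 0, ((w s : ℂ) * ∫ ξ, ((Real.exp (-Real.pi * s * ‖ξ‖ ^ 2) : ℝ) : ℂ) * H ξ).re|
      ≤ ∫ s in Ioi 0, |((w s : ℂ) *
          ∫ ξ, ((Real.exp (-Real.pi * s * ‖ξ‖ ^ 2) : ℝ) : ℂ) * H ξ).re| :=
        abs_integral_le_integral_abs
    _ ≤ ∫ s in Ioi 0, w s * s ^ (-p - γ / 2) * (K * ‖z‖ ^ γ * M) :=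
        setIntegral_mono_on i1.re.abs (hI.mul_const _) measurableSet_Ioi e2
    _ = _ := by
        rw [integral_mul_const]
        ring

/-! ### Weights whose Laplace transforms are truncated Riesz potentials -/

theorem one_weight {x : ℝ} (hx : 0 < x) :
    IntegrableOn (fun s => (Ioc (0 : ℝ) 1).indicator (fun _ => (1 : ℝ)) s *
      Real.exp (-Real.pi * s * x ^ 2)) (Ioi 0) ∧
    ∫ s in Ioi 0, (Ioc (0 : ℝ) 1).indicator (fun _ => (1 : ℝ)) s * Real.exp (-Real.pi * s * x ^ 2) =
      (Real.pi * x ^ 2)⁻¹ * (1 - Real.exp (-Real.pi * x ^ 2)) := by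
  have hc : Continuous fun s : ℝ => Real.exp (-Real.pi * s * x ^ 2) := by fun_prop
  have e : (fun s => (Ioc (0 : ℝ) 1).indicator (fun _ => (1 : ℝ)) s *
      Real.exp (-Real.pi * s * x ^ 2)) =
      (Ioc (0 : ℝ) 1).indicator fun s => Real.exp (-Real.pi * s * x ^ 2) := by
    ext s
    by_cases h : s ∈ Ioc (0 : ℝ) 1 <;> simp [h]
  have hpos : 0 < Real.pi * x ^ 2 := by positivity
  rw [e]
  refine ⟨((hc.integrableOn_Icc.mono_set Ioc_subset_Icc_self).integrable_indicator
    measurableSet_Ioc).integrableOn, ?_⟩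
  rw [setIntegral_indicator measurableSet_Ioc,
    inter_eq_self_of_subset_right (Ioc_subset_Ioi_self), ← intervalIntegral.integral_of_le zero_le_one]
  have hd : ∀ s ∈ uIcc (0 : ℝ) 1, HasDerivAt
      (fun s => -(Real.pi * x ^ 2)⁻¹ * Real.exp (-Real.pi * s * x ^ 2))
      (Real.exp (-Real.pi * s * x ^ 2)) s := by
    intro s _
    have h1 : HasDerivAt (fun s : ℝ => -Real.pi * s * x ^ 2) (-Real.pi * x ^ 2) s := by
      simpa using ((hasDerivAt_id s).const_mul (-Real.pi)).mul_const (x ^ 2)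
    refine (h1.exp.const_mul (-(Real.pi * x ^ 2)⁻¹)).congr_deriv ?_
    field_simp
  rw [intervalIntegral.integral_eq_sub_of_hasDerivAt hd (hc.intervalIntegrable _ _)]
  simp
  ring

/-- `r^a - (r-1)₊^a`, whose Laplace transform is that of `r^a` times `1 - e^{-·}`. -/
def diffWeight (a r : ℝ) : ℝ := r ^ a - (max (r - 1) 0) ^ a

theorem diffWeight_nonneg {a r : ℝ} (ha : 0 ≤ a) (hr : 0 < r) : 0 ≤ diffWeight a r := by
  refine sub_nonneg.2 (Real.rpow_le_rpow (le_max_right _ _) ?_ ha)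
  exact max_le (by linarith) hr.le

/-- The difference gains one power at infinity over r^a: by concavity (1 - r⁻¹)^a ≥ 1 - r⁻¹ for a ≤
1. -/
theorem diffWeight_le {a r : ℝ} (ha : 0 ≤ a) (ha' : a ≤ 1) (hr : 1 ≤ r) :
    diffWeight a r ≤ r ^ (a - 1) := by
  have h1 : r ^ a * (1 - r⁻¹) ≤ (r - 1) ^ a := by
    have e : r - 1 = r * (1 - r⁻¹) := by field_simp
    have h0 : 0 ≤ 1 - r⁻¹ := sub_nonneg.2 (inv_le_one_of_one_le₀ hr)
    rw [e, Real.mul_rpow (by linarith) h0]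
    gcongr
    have h2 : 1 - r⁻¹ ≤ 1 := by
      have : 0 ≤ r⁻¹ := inv_nonneg.2 (by linarith)
      linarith
    simpa using Real.rpow_le_rpow_of_exponent_ge' h0 h2 ha ha'
  rw [diffWeight, max_eq_left (by linarith), Real.rpow_sub_one (by linarith)]
  have : r ^ a * (1 - r⁻¹) = r ^ a - r ^ a / r := by ring
  linarith

theorem measurable_diffWeight (a : ℝ) : Measurable (diffWeight a) := by
  unfold diffWeight
  fun_prop

/-- Near 0 the integrand is at most s^{a-1-γ/2}, so γ/2 < a is needed; with a = α/2 this is the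
restriction γ < α on the Hölder exponent of the velocity. At infinity the gain of `diffWeight_le` is
used. -/
theorem integrableOn_diffWeight {a γ : ℝ} (ha : 0 < a) (ha' : a < 1) (hγ : 0 ≤ γ) (hγa : γ / 2 < a) :
    IntegrableOn (fun s => diffWeight a s * s ^ (-1 - γ / 2)) (Ioi 0) := by
  have hm : Measurable fun s => diffWeight a s * s ^ (-1 - γ / 2) :=
    (measurable_diffWeight a).mul (by fun_prop)
  rw [← Ioc_union_Ioi_eq_Ioi zero_le_one]
  refine IntegrableOn.union ?_ ?_
  · have h1 : IntegrableOn (fun s : ℝ => s ^ (a - 1 - γ / 2)) (Ioc 0 1) := by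
      rw [← intervalIntegrable_iff_integrableOn_Ioc_of_le zero_le_one]
      exact intervalIntegral.intervalIntegrable_rpow' (by linarith)
    refine h1.mono' hm.aestronglyMeasurable.restrict ?_
    filter_upwards [ae_restrict_mem measurableSet_Ioc] with s hs
    have h2 := diffWeight_nonneg ha.le hs.1
    rw [Real.norm_of_nonneg (mul_nonneg h2 (Real.rpow_nonneg hs.1.le _))]
    have h3 : diffWeight a s ≤ s ^ a := sub_le_self _ (Real.rpow_nonneg (le_max_right _ _) _)
    have e : s ^ (a - 1 - γ / 2) = s ^ a * s ^ (-1 - γ / 2) := by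
      rw [← Real.rpow_add hs.1]
      ring_nf
    rw [e]
    exact mul_le_mul_of_nonneg_right h3 (Real.rpow_nonneg hs.1.le _)
  · refine (integrableOn_Ioi_rpow_of_lt (a := a - 1 - 1 - γ / 2) (by linarith) zero_lt_one).mono'
      hm.aestronglyMeasurable.restrict ?_
    filter_upwards [ae_restrict_mem measurableSet_Ioi] with s hs
    have hs1 : (1 : ℝ) < s := hs
    have hs0 : 0 < s := by linarith
    have h2 := diffWeight_nonneg ha.le hs0
    rw [Real.norm_of_nonneg (mul_nonneg h2 (Real.rpow_nonneg hs0.le _))]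
    have e : s ^ (a - 1 - 1 - γ / 2) = s ^ (a - 1) * s ^ (-1 - γ / 2) := by
      rw [← Real.rpow_add hs0]
      ring_nf
    rw [e]
    exact mul_le_mul_of_nonneg_right (diffWeight_le ha.le ha'.le hs1.le) (Real.rpow_nonneg hs0.le _)

/-- Shifting r^a by 1 multiplies its Laplace transform by e^{-πx²}, so the difference produces the
factor that suppresses low frequencies. -/
theorem diffWeight_laplace {a x : ℝ} (ha : 0 < a) (hx : 0 < x) :
    IntegrableOn (fun s => diffWeight a s * Real.exp (-Real.pi * s * x ^ 2)) (Ioi 0) ∧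
    ∫ s in Ioi 0, diffWeight a s * Real.exp (-Real.pi * s * x ^ 2) =
      Real.Gamma (a + 1) * Real.pi ^ (-(a + 1)) * x ^ (-(2 * (a + 1))) *
        (1 - Real.exp (-Real.pi * x ^ 2)) := by
  obtain ⟨i1, i2⟩ := gamma_integral (a := a + 1) (by linarith) hx
  rw [add_sub_cancel_right] at i1 i2
  set g : ℝ → ℝ := (Ioi (0 : ℝ)).indicator fun s => s ^ a * Real.exp (-Real.pi * s * x ^ 2) with hg
  have hgi : Integrable g := i1.integrable_indicator measurableSet_Ioi
  have hgI : ∫ s, g s = _ := (integral_indicator measurableSet_Ioi).trans i2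
  have e : ∀ s : ℝ, (Ioi (0 : ℝ)).indicator
      (fun s => diffWeight a s * Real.exp (-Real.pi * s * x ^ 2)) s =
      g s - Real.exp (-Real.pi * x ^ 2) * g (s - 1) := by
    intro s
    have h2 : Real.exp (-Real.pi * s * x ^ 2) =
        Real.exp (-Real.pi * x ^ 2) * Real.exp (-Real.pi * (s - 1) * x ^ 2) := by
      rw [← Real.exp_add]
      ring_nf
    by_cases hs : 0 < s
    · have h0 : g s = s ^ a * Real.exp (-Real.pi * s * x ^ 2) := indicator_of_mem hs _
      rw [indicator_of_mem (show s ∈ Ioi (0 : ℝ) from hs), h0, diffWeight]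
      by_cases hs1 : 0 < s - 1
      · have h1 : g (s - 1) = (s - 1) ^ a * Real.exp (-Real.pi * (s - 1) * x ^ 2) :=
          indicator_of_mem hs1 _
        rw [h1, max_eq_left hs1.le, h2]
        ring
      · have h1 : g (s - 1) = 0 := indicator_of_notMem hs1 _
        rw [h1, max_eq_right (not_lt.1 hs1), Real.zero_rpow ha.ne']
        ring
    · have h0 : g s = 0 := indicator_of_notMem hs _
      have h1 : g (s - 1) = 0 := indicator_of_notMem (fun h => hs (by
        have : 0 < s - 1 := h
        linarith)) _
      rw [indicator_of_notMem (show s ∉ Ioi (0 : ℝ) from hs), h0, h1]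
      ring
  have hgi1 : Integrable fun s => g (s - 1) := hgi.comp_sub_right 1
  have hi : Integrable fun s => g s - Real.exp (-Real.pi * x ^ 2) * g (s - 1) :=
    hgi.sub (hgi1.const_mul _)
  refine ⟨(integrable_indicator_iff measurableSet_Ioi).1 (hi.congr (.of_forall fun s => (e s).symm)), ?_⟩
  rw [← integral_indicator measurableSet_Ioi]
  simp_rw [e]
  rw [integral_sub hgi (hgi1.const_mul _), integral_const_mul,
    integral_sub_right_eq_self g 1, hgI]
  ring

/-! ### Truncated powers -/

/-- The truncated power `min(|x|, n)^p x`. -/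
def powTrunc (p n x : ℝ) : ℝ := (min |x| n) ^ p * x

theorem one_sub_rpow_mul_le {p x : ℝ} (hp : 0 ≤ p) (hx : 0 ≤ x) : (1 - x ^ p) * x ≤ p * (1 - x) := by
  have h := one_add_mul_self_le_rpow_one_add (s := x - 1) (by linarith) (by linarith : 1 ≤ p + 1)
  rw [add_sub_cancel] at h
  rcases hx.eq_or_lt with rfl | hx
  · simpa using hp
  · rw [Real.rpow_add_one hx.ne'] at h
    linarith

/-- For |b| ≤ |a|, vary the linear factor and the power separately. The power part vanishes if |b| ≥
n and is otherwise handled by Bernoulli's inequality. The Lipschitz factor contains the truncated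
values rather than n, so later estimates are uniform in n. -/
theorem abs_powTrunc_sub_le {p n : ℝ} (hp : 0 ≤ p) (hn : 0 ≤ n) (a b : ℝ) :
    |powTrunc p n a - powTrunc p n b| ≤
      (p + 1) * (max (min |a| n) (min |b| n)) ^ p * |a - b| := by
  wlog hab : |b| ≤ |a| generalizing a b
  · rw [abs_sub_comm, abs_sub_comm a b, max_comm]
    exact this b a (le_of_not_ge hab)
  set x := min |a| n with hx
  set y := min |b| n with hy
  have hy0 : 0 ≤ y := le_min (abs_nonneg b) hn
  have hyx : y ≤ x := min_le_min_right n hab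
  rw [max_eq_left hyx]
  have hx0 : 0 ≤ x := hy0.trans hyx
  have e : powTrunc p n a - powTrunc p n b = x ^ p * (a - b) + (x ^ p - y ^ p) * b := by
    simp only [powTrunc, ← hx, ← hy]
    ring
  have hpow : y ^ p ≤ x ^ p := Real.rpow_le_rpow hy0 hyx hp
  have key : (x ^ p - y ^ p) * |b| ≤ p * x ^ p * |a - b| := by
    rcases le_total n |b| with h | h
    · have : x = y := by rw [hx, hy, min_eq_right h, min_eq_right (h.trans hab)]
      rw [this, sub_self, zero_mul]
      positivity
    · have hyb : y = |b| := min_eq_left h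
      have hxy : x - y ≤ |a - b| := by
        have h1 : x ≤ |a| := min_le_left _ _
        have h2 := abs_sub_abs_le_abs_sub a b
        linarith
      rw [← hyb]
      rcases hx0.eq_or_lt with h0 | h0
      · have : y = 0 := le_antisymm (hyx.trans h0.ge) hy0
        rw [this, mul_zero]
        positivity
      · have h3 := one_sub_rpow_mul_le hp (div_nonneg hy0 hx0)
        rw [Real.div_rpow hy0 hx0] at h3
        have h4 : (x ^ p - y ^ p) * y = x ^ p * x * ((1 - y ^ p / x ^ p) * (y / x)) := by
          have := (Real.rpow_pos_of_pos h0 p).ne'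
          field_simp
        calc (x ^ p - y ^ p) * y = x ^ p * x * ((1 - y ^ p / x ^ p) * (y / x)) := h4
          _ ≤ x ^ p * x * (p * (1 - y / x)) := by gcongr
          _ = p * x ^ p * (x - y) := by field_simp
          _ ≤ _ := by gcongr
  rw [e]
  calc |x ^ p * (a - b) + (x ^ p - y ^ p) * b| ≤ x ^ p * |a - b| + (x ^ p - y ^ p) * |b| := by
        refine (abs_add_le _ _).trans_eq ?_
        rw [abs_mul, abs_mul, abs_of_nonneg (Real.rpow_nonneg hx0 p), abs_of_nonneg (sub_nonneg.2 hpow)]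
    _ ≤ _ := by linarith

theorem powTrunc_neg (p n x : ℝ) : powTrunc p n (-x) = -powTrunc p n x := by
  simp [powTrunc]

theorem monotone_powTrunc {p n : ℝ} (hp : 0 ≤ p) (hn : 0 ≤ n) : Monotone (powTrunc p n) := by
  have hnn : ∀ x, 0 ≤ x → 0 ≤ powTrunc p n x := fun x hx =>
    mul_nonneg (Real.rpow_nonneg (le_min (abs_nonneg x) hn) p) hx
  have hpos : ∀ a b, 0 ≤ a → a ≤ b → powTrunc p n a ≤ powTrunc p n b := by
    intro a b ha hab
    simp only [powTrunc, abs_of_nonneg ha, abs_of_nonneg (ha.trans hab)]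
    have h1 : 0 ≤ min a n := le_min ha hn
    have h2 : 0 ≤ min b n := le_min (ha.trans hab) hn
    gcongr
  intro a b hab
  rcases le_total 0 a with ha | ha
  · exact hpos a b ha hab
  · rcases le_total 0 b with hb | hb
    · have := hnn (-a) (by linarith)
      rw [powTrunc_neg] at this
      linarith [hnn b hb]
    · have := hpos (-b) (-a) (by linarith) (by linarith)
      rw [powTrunc_neg, powTrunc_neg] at this
      linarith

/-- The primitive of `powTrunc`. -/
def powPrim (p n x : ℝ) : ℝ := ∫ t in (0 : ℝ)..x, powTrunc p n t

theorem nonlin_powTrunc {p n : ℝ} (hp : 0 ≤ p) (hn : 0 ≤ n) :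
    Nonlin (powPrim p n) (powTrunc p n) ((p + 1) * n ^ p) :=
  Nonlin.of_lip (fun a b => (abs_powTrunc_sub_le hp hn a b).trans (by
    have h1 : max (min |a| n) (min |b| n) ≤ n := max_le (min_le_right _ _) (min_le_right _ _)
    have h2 : 0 ≤ max (min |a| n) (min |b| n) := le_max_of_le_left (le_min (abs_nonneg a) hn)
    gcongr)) (by simp [powTrunc]) (monotone_powTrunc hp hn)

theorem abs_powTrunc_le {p n : ℝ} (hp : 0 ≤ p) (hn : 0 ≤ n) (x : ℝ) :
    |powTrunc p n x| ≤ |x| ^ p * |x| := by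
  have h0 : 0 ≤ min |x| n := le_min (abs_nonneg x) hn
  rw [powTrunc, abs_mul, abs_of_nonneg (Real.rpow_nonneg h0 p)]
  have := min_le_left |x| n
  gcongr

/-! ### Powers of square integrable functions -/

theorem rpow_le_sq_add_pow_four {x q : ℝ} (hx : 0 ≤ x) (hq : 2 ≤ q) (hq' : q ≤ 4) :
    x ^ q ≤ x ^ 2 + x ^ 4 := by
  rcases le_total x 1 with h | h
  · have := Real.rpow_le_rpow_of_exponent_ge' hx h (by norm_num : (0 : ℝ) ≤ 2) hq
    rw [Real.rpow_two] at this
    linarith [pow_nonneg hx 4]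
  · have := Real.rpow_le_rpow_of_exponent_le h hq'
    have e : x ^ (4 : ℝ) = x ^ 4 := by exact_mod_cast Real.rpow_natCast x 4
    rw [e] at this
    linarith [pow_nonneg hx 2]

theorem integrable_sq (f : L2) : Integrable fun x => f x ^ 2 := by
  simpa only [sq] using integrable_mul_L2 f f

theorem measurable_abs_rpow (f : L2) (q : ℝ) :
    AEStronglyMeasurable (fun x => |f x| ^ q) (volume : Measure Plane) :=
  (((Lp.aestronglyMeasurable f).aemeasurable.abs).pow_const q).aestronglyMeasurable

theorem InH.integrable_rpow {f : L2} (hf : InH 1 f) {q : ℝ} (hq : 2 ≤ q) (hq' : q ≤ 4) :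
    Integrable fun x => |f x| ^ q := by
  refine ((integrable_sq f).add hf.integrable_pow_four).mono' (measurable_abs_rpow f q)
    (.of_forall fun x => ?_)
  rw [Real.norm_of_nonneg (by positivity)]
  have := rpow_le_sq_add_pow_four (abs_nonneg (f x)) hq hq'
  simpa [sq_abs, Even.pow_abs (show Even 4 by decide)] using this

/-- Interpolation between L² and L⁴ applied to f/l. The exact power l^q is kept because l will be
‖z‖^γ, and the bound must scale like an increment. -/
theorem InH.integral_rpow_le {f : L2} (hf : InH 1 f) {q l R : ℝ} (hq : 2 ≤ q) (hq' : q ≤ 4)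
    (hl : 0 < l) (h1 : ‖f‖ ≤ l * R) (h2 : ‖absD 1 f‖ ≤ l * R) :
    ∫ x, |f x| ^ q ≤ (R ^ 2 + 64 * area * R ^ 4) * l ^ q := by
  have hp : ∀ x, |f x| ^ q ≤ l ^ q * ((l⁻¹) ^ 2 * f x ^ 2 + (l⁻¹) ^ 4 * f x ^ 4) := by
    intro x
    have h3 := rpow_le_sq_add_pow_four (x := l⁻¹ * |f x|) (by positivity) hq hq'
    have h4 : |f x| ^ q = l ^ q * (l⁻¹ * |f x|) ^ q := by
      rw [← Real.mul_rpow hl.le (by positivity), mul_inv_cancel_left₀ hl.ne']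
    rw [h4]
    refine mul_le_mul_of_nonneg_left (h3.trans_eq ?_) (by positivity)
    rw [mul_pow, mul_pow, sq_abs, Even.pow_abs (show Even 4 by decide)]
  have i2 := (integrable_sq f).const_mul ((l⁻¹) ^ 2)
  have i4 := hf.integrable_pow_four.const_mul ((l⁻¹) ^ 4)
  have h5 := hf.integral_pow_four_le
  have h6 : ‖f‖ ^ 2 ≤ (l * R) ^ 2 := by gcongr
  have h7 : ‖absD 1 f‖ ^ 2 ≤ (l * R) ^ 2 := by gcongr
  have ha := area_pos
  calc ∫ x, |f x| ^ q ≤ ∫ x, l ^ q * ((l⁻¹) ^ 2 * f x ^ 2 + (l⁻¹) ^ 4 * f x ^ 4) :=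
        integral_mono (hf.integrable_rpow hq hq') ((i2.add i4).const_mul _) hp
    _ = l ^ q * ((l⁻¹) ^ 2 * ‖f‖ ^ 2 + (l⁻¹) ^ 4 * ∫ x, f x ^ 4) := by
        rw [integral_const_mul, integral_add i2 i4, integral_const_mul, integral_const_mul,
          sq_norm_eq_integral]
    _ ≤ l ^ q * ((l⁻¹) ^ 2 * (l * R) ^ 2 + (l⁻¹) ^ 4 * (64 * area * ((l * R) ^ 2 * (l * R) ^ 2))) := by
        have h8 : ∫ x, f x ^ 4 ≤ 64 * area * ((l * R) ^ 2 * (l * R) ^ 2) := h5.trans (by gcongr)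
        gcongr
    _ = _ := by
        field_simp

theorem integrable_rpow_of_bdd {f : L2} {R q : ℝ} (hR : ∀ᵐ x : Plane, |f x| ≤ R) (hq : 2 ≤ q) :
    Integrable (fun x => |f x| ^ q) ∧ ∫ x, |f x| ^ q ≤ R ^ (q - 2) * ‖f‖ ^ 2 := by
  have hp : ∀ᵐ x : Plane, |f x| ^ q ≤ R ^ (q - 2) * f x ^ 2 := by
    filter_upwards [hR] with x hx
    have e : |f x| ^ q = |f x| ^ (q - 2) * |f x| ^ 2 := by
      rw [← Real.rpow_two, ← Real.rpow_add' (abs_nonneg _) (by linarith)]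
      ring_nf
    rw [e, sq_abs]
    gcongr
  have i2 := (integrable_sq f).const_mul (R ^ (q - 2))
  have i1 : Integrable fun x => |f x| ^ q := by
    refine i2.mono' (measurable_abs_rpow f q) (hp.mono fun x hx => ?_)
    rwa [Real.norm_of_nonneg (by positivity)]
  refine ⟨i1, (integral_mono_ae i1 i2 hp).trans_eq ?_⟩
  rw [integral_const_mul, sq_norm_eq_integral]

theorem memLp_of_integrable_rpow {f : L2} {q : ℝ} (hq : 0 < q)
    (h : Integrable fun x => |f x| ^ q) : MemLp (fun x => |f x|) (ENNReal.ofReal q) := by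
  have h0 : ENNReal.ofReal q ≠ 0 := by simpa using hq
  refine (integrable_norm_rpow_iff ((Lp.aestronglyMeasurable f).norm) h0
    ENNReal.ofReal_ne_top).1 ?_
  simpa [ENNReal.toReal_ofReal hq.le] using h

theorem integral_abs_rpow_trans (y : Plane) (f : L2) (q : ℝ) :
    ∫ x, |trans y f x| ^ q = ∫ x, |f x| ^ q := by
  rw [← integral_comp_sub (fun x => |f x| ^ q) y]
  exact integral_congr_ae ((coeFn_trans y f).mono fun x hx => by simp only [hx])

theorem integrable_abs_rpow_trans (y : Plane) {f : L2} {q : ℝ} (h : Integrable fun x => |f x| ^ q) :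
    Integrable fun x => |trans y f x| ^ q :=
  (h.comp_sub_right y).congr ((coeFn_trans y f).mono fun x hx => by simp only [hx])

theorem abs_inner_le_integral (a b : L2) : |inner ℝ a b| ≤ ∫ x, |a x| * |b x| := by
  rw [inner_eq_integral]
  refine abs_integral_le_integral_abs.trans_eq ?_
  simp only [abs_mul]

theorem abs_inner_trans_le_rpow {a g : L2} {q q' : ℝ} (hqq : q'.HolderConjugate q)
    (ha : Integrable fun x => |a x| ^ q') (hg : Integrable fun x => |g x| ^ q) (y : Plane) :
    |inner ℝ a (trans y g)| ≤ (∫ x, |a x| ^ q') ^ (1 / q') * (∫ x, |g x| ^ q) ^ (1 / q) := by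
  rw [← integral_abs_rpow_trans y g q]
  exact (abs_inner_le_integral _ _).trans (integral_mul_le_Lp_mul_Lq_of_nonneg hqq
    (.of_forall fun x => abs_nonneg _) (.of_forall fun x => abs_nonneg _)
    (memLp_of_integrable_rpow hqq.pos ha)
    (memLp_of_integrable_rpow hqq.symm.pos (integrable_abs_rpow_trans y hg)))

/-- The converse of Hölder's inequality, with test function |b|^{q-2} b. It is the truncated power
of b at level n, the truncation being inactive as |b| ≤ n; hence it lies in `L²`, and n does not
enter the bound. -/
theorem integral_rpow_le_of_duality {b : L2} {q q' n Λ : ℝ} (hqq : q'.HolderConjugate q) (hq : 2 ≤ q)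
    (hn : 0 ≤ n) (hb : ∀ᵐ x : Plane, |b x| ≤ n) (hΛ : 0 ≤ Λ)
    (h : ∀ a : L2, Integrable (fun x => |a x| ^ q') →
      |inner ℝ a b| ≤ Λ * (∫ x, |a x| ^ q') ^ (1 / q')) : ∫ x, |b x| ^ q ≤ Λ ^ q := by
  have N := nonlin_powTrunc (p := q - 2) (by linarith) hn
  have hi := (integrable_rpow_of_bdd hb hq).1
  have hval : ∀ᵐ x : Plane, |N.app b x| ^ q' = |b x| ^ q ∧ N.app b x * b x = |b x| ^ q := by
    filter_upwards [N.coeFn_app b, hb] with x h1 h2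
    have e1 : |b x| ^ (q - 2) * |b x| = |b x| ^ (q - 1) := by
      have : (q - 2) + 1 = q - 1 := by ring
      rw [← this, Real.rpow_add_one' (abs_nonneg _) (by linarith)]
    have e2 : |b x| ^ (q - 1) * |b x| = |b x| ^ q := by
      rw [← Real.rpow_add_one' (abs_nonneg _) (by linarith), sub_add_cancel]
    rw [h1, powTrunc, min_eq_left h2]
    constructor
    · rw [abs_mul, abs_of_nonneg (Real.rpow_nonneg (abs_nonneg _) _), e1,
        ← Real.rpow_mul (abs_nonneg _), hqq.symm.sub_one_mul_conj]
    · rw [mul_assoc, ← abs_mul_abs_self (b x), ← mul_assoc, e1, e2]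
  have e : ∫ x, |N.app b x| ^ q' = ∫ x, |b x| ^ q := integral_congr_ae (hval.mono fun x hx => hx.1)
  have e' : inner ℝ (N.app b) b = ∫ x, |b x| ^ q := by
    rw [inner_eq_integral]
    exact integral_congr_ae (hval.mono fun x hx => hx.2)
  have h1 := h (N.app b) (hi.congr (hval.mono fun x hx => hx.1.symm))
  rw [e, e'] at h1
  set W := ∫ x, |b x| ^ q with hW
  have hW0 : 0 ≤ W := integral_nonneg fun x => by positivity
  have h1' := (le_abs_self W).trans h1
  rcases hW0.eq_or_lt with h0 | h0
  · rw [← h0]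
    positivity
  · have h2 : W ^ (1 / q) ≤ Λ := by
      have e3 : W = W ^ (1 / q) * W ^ (1 / q') := by
        rw [← Real.rpow_add h0]
        have := hqq.inv_add_inv_eq_one
        rw [one_div, one_div, add_comm, this, Real.rpow_one]
      have h4 : 0 < W ^ (1 / q') := Real.rpow_pos_of_pos h0 _
      have h5 : W ^ (1 / q) * W ^ (1 / q') ≤ Λ * W ^ (1 / q') := e3 ▸ h1'
      exact le_of_mul_le_mul_right h5 h4
    calc W = (W ^ (1 / q)) ^ q := by
          rw [← Real.rpow_mul hW0, one_div, inv_mul_cancel₀ (by linarith), Real.rpow_one]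
      _ ≤ Λ ^ q := Real.rpow_le_rpow (by positivity) h2 (by linarith)

/-! ### Increments of the velocity -/

/-- -Δu₁ = ∂₂ω and -Δu₂ = -∂₁ω, by combining the definition of ω with div u = 0 on the Fourier side.
-/
theorem Solenoidal.biot_savart {u : Fin 2 → L2} {K : ℝ} (h : Solenoidal u K) :
    (∀ᵐ ξ : Plane, ((4 * Real.pi ^ 2 * ‖ξ‖ ^ 2 : ℝ) : ℂ) * hat (u 0) ξ =
      (1 : ℝ) * (dsym 1 ξ * hat (vorticity u) ξ)) ∧
    ∀ᵐ ξ : Plane, ((4 * Real.pi ^ 2 * ‖ξ‖ ^ 2 : ℝ) : ℂ) * hat (u 1) ξ =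
      ((-1 : ℝ) : ℂ) * (dsym 0 ξ * hat (vorticity u) ξ) := by
  have hn : ∀ ξ : Plane, ((4 * Real.pi ^ 2 * ‖ξ‖ ^ 2 : ℝ) : ℂ) =
      -(dsym 0 ξ * dsym 0 ξ) - dsym 1 ξ * dsym 1 ξ := by
    intro ξ
    rw [EuclideanSpace.real_norm_sq_eq, Fin.sum_univ_two]
    simp only [dsym]
    push_cast
    ring_nf
    rw [Complex.I_sq]
    ring
  have hdiv : ∀ᵐ ξ : Plane, dsym 0 ξ * hat (u 0) ξ + dsym 1 ξ * hat (u 1) ξ = 0 := by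
    have h0 : hat (partialD 0 (u 0)) + hat (partialD 1 (u 1)) = 0 := by
      rw [← hat_add, h.div]
      simpa using hat_sub (0 : L2) 0
    filter_upwards [hasMult_partialD 0 (h.inH 0).one, hasMult_partialD 1 (h.inH 1).one,
      Lp.coeFn_add (hat (partialD 0 (u 0))) (hat (partialD 1 (u 1))),
      Lp.coeFn_zero ℂ 2 (volume : Measure Plane)] with ξ h1 h2 h3 h4
    rw [h0, h4, Pi.add_apply, h1, h2] at h3
    exact h3.symm
  have hω : ∀ᵐ ξ : Plane, hat (vorticity u) ξ = dsym 0 ξ * hat (u 1) ξ - dsym 1 ξ * hat (u 0) ξ := by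
    rw [vorticity, hat_sub]
    filter_upwards [hasMult_partialD 0 (h.inH 1).one, hasMult_partialD 1 (h.inH 0).one,
      Lp.coeFn_sub (hat (partialD 0 (u 1))) (hat (partialD 1 (u 0)))] with ξ h1 h2 h3
    rw [h3, Pi.sub_apply, h1, h2]
  constructor
  · filter_upwards [hdiv, hω] with ξ h1 h2
    rw [hn, h2]
    push_cast
    linear_combination (-dsym 0 ξ) * h1
  · filter_upwards [hdiv, hω] with ξ h1 h2
    rw [hn, h2]
    push_cast
    linear_combination (-dsym 1 ξ) * h1

/-! ### Increments of the high frequencies of the velocity -/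

/-- The symbol of `(1 - e^{Δ/4π}) (-Δ)^{-1-a}`. -/
def highSym (a : ℝ) (ξ : Plane) : ℝ :=
  (2 * Real.pi) ^ (-2 - 2 * a) * (‖ξ‖ ^ (-2 - 2 * a) * (1 - Real.exp (-Real.pi * ‖ξ‖ ^ 2)))

theorem one_sub_exp_le {x : ℝ} : 1 - Real.exp (-Real.pi * x ^ 2) ≤ Real.pi * x ^ 2 := by
  have := Real.add_one_le_exp (-Real.pi * x ^ 2)
  linarith

theorem one_sub_exp_sq_nonneg {x : ℝ} : 0 ≤ 1 - Real.exp (-Real.pi * x ^ 2) := by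
  have : Real.exp (-Real.pi * x ^ 2) ≤ 1 := by
    rw [Real.exp_le_one_iff]
    have := Real.pi_pos
    nlinarith [mul_nonneg this.le (sq_nonneg x)]
  linarith

theorem measurable_highSym (a : ℝ) : Measurable (highSym a) := by
  unfold highSym
  fun_prop

theorem realSymbol_highSym (a : ℝ) : RealSymbol fun ξ => (highSym a ξ : ℂ) where
  meas := Complex.measurable_ofReal.comp (measurable_highSym a)
  herm ξ := by simp only [highSym, norm_neg, Complex.conj_ofReal]

/-- The high frequencies of (-Δ)⁻¹∂ᵢω are split according to ω = (ω - R_α θ) + R_α θ. The first part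
has a kernel of order -1. The second equals an operator of order -α applied to θ itself, so only
`L^q` information on θ is needed; this part imposes γ < α. The sign ε distinguishes the two velocity
components. -/
theorem exists_inner_incr_high_le {α γ : ℝ} (hα : 0 < α) (hα' : α < 1) (hγ : 0 ≤ γ) (hγα : γ < α)
    (i : Fin 2) : ∃ A : ℝ, 0 ≤ A ∧ ∀ (v w θ h : L2) (ε : ℝ), InH 2 θ → ε * ε = 1 →
      (∀ᵐ ξ : Plane, ((4 * Real.pi ^ 2 * ‖ξ‖ ^ 2 : ℝ) : ℂ) * hat v ξ =
        (ε : ℂ) * (dsym i ξ * hat w ξ)) →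
      HasMult (fun ξ => 1 - heat 1 ξ) v h → ∀ (a : L2) (M : ℝ),
      (∀ y, |inner ℝ a (trans y (w - rieszOp α θ))| ≤ M) → (∀ y, |inner ℝ a (trans y θ)| ≤ M) →
      ∀ z, |inner ℝ a (incr z h)| ≤ A * ‖z‖ ^ γ * M := by
  obtain ⟨C₁, g₁⟩ := gaussKernel_gauss₁ i
  obtain ⟨C₂, g₂⟩ := gaussKernel_gauss₂ 0 i
  obtain ⟨K₁, hK₁, b₁⟩ := exists_abs_inner_incr_le (p := 1 / 2) (σ := dsym i) g₁
    (continuous_dsym i).measurable fun s hs a b => by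
      rw [heat_pairing₁ hs, Real.sqrt_eq_rpow, Real.rpow_neg hs.le]
  obtain ⟨K₂, hK₂, b₂⟩ := exists_abs_inner_incr_le (p := 1) (σ := fun ξ => dsym i ξ * dsym 0 ξ) g₂
    ((continuous_dsym i).mul (continuous_dsym 0)).measurable fun s hs a b => by
      rw [heat_pairing₂ hs, Real.rpow_neg_one]
  have hpi := Real.pi_pos
  -- Chosen so that c₁ (π x²)⁻¹ = (2π x)⁻².
  set c₁ : ℝ := (4 * Real.pi)⁻¹ with hc₁
  set w₁ : ℝ → ℝ := fun s => c₁ * (Ioc (0 : ℝ) 1).indicator (fun _ => (1 : ℝ)) s with hw₁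
  set Γ' : ℝ := Real.Gamma (α / 2 + 1) * Real.pi ^ (-(α / 2 + 1)) with hΓ
  have hΓ0 : 0 < Γ' := mul_pos (Real.Gamma_pos_of_pos (by linarith)) (by positivity)
  set c₂ : ℝ := (2 * Real.pi) ^ (-2 - 2 * (α / 2)) / Γ' with hc₂
  have hc₂0 : 0 ≤ c₂ := by positivity
  set w₂ : ℝ → ℝ := fun s => c₂ * diffWeight (α / 2) s with hw₂
  have B₁ := b₁ γ hγ (by linarith) w₁ (highSym 0)
    (((measurable_const).indicator measurableSet_Ioc).const_mul _)
    (fun s _ => mul_nonneg (by positivity) (indicator_nonneg (fun _ _ => zero_le_one) s))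
    (fun ξ hξ => by
      obtain ⟨h1, h2⟩ := one_weight hξ
      simp only [hw₁, mul_assoc] at h1 h2 ⊢
      refine ⟨h1.const_mul c₁, ?_⟩
      rw [integral_const_mul, h2, highSym]
      have e : ∀ x : ℝ, 0 < x → x ^ (-2 - 2 * (0 : ℝ)) = (x ^ 2)⁻¹ := fun x hx => by
        rw [mul_zero, sub_zero, Real.rpow_neg hx.le, Real.rpow_two]
      rw [e _ hξ, e _ (by positivity), hc₁]
      field_simp
      ring_nf)
    (by
      have h1 : IntegrableOn (fun s : ℝ => s ^ (-(1 / 2) - γ / 2)) (Ioc 0 1) := by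
        rw [← intervalIntegrable_iff_integrableOn_Ioc_of_le zero_le_one]
        exact intervalIntegral.intervalIntegrable_rpow' (by linarith)
      refine ((h1.integrable_indicator measurableSet_Ioc).const_mul c₁).integrableOn.congr_fun
        (fun s _ => ?_) measurableSet_Ioi
      by_cases h : s ∈ Ioc (0 : ℝ) 1 <;> simp [hw₁, h])
  have B₂ := b₂ γ hγ (by linarith) w₂ (highSym (α / 2)) ((measurable_diffWeight _).const_mul _)
    (fun s hs => mul_nonneg hc₂0 (diffWeight_nonneg (by linarith) hs))
    (fun ξ hξ => by
      obtain ⟨h1, h2⟩ := diffWeight_laplace (a := α / 2) (by linarith) hξ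
      simp only [hw₂, mul_assoc] at h1 h2 ⊢
      refine ⟨h1.const_mul c₂, ?_⟩
      rw [integral_const_mul, h2, highSym, hc₂, hΓ]
      have e : -(2 * (α / 2 + 1)) = -2 - 2 * (α / 2) := by ring
      have e0 : Real.Gamma (α / 2 + 1) ≠ 0 := (Real.Gamma_pos_of_pos (by linarith)).ne'
      rw [e]
      field_simp)
    (by
      have h1 := (integrableOn_diffWeight (a := α / 2) (by linarith) (by linarith) hγ
        (by linarith)).const_mul c₂
      simpa only [hw₂, mul_assoc, IntegrableOn] using h1)
  set I₁ := ∫ s in Ioi 0, w₁ s * s ^ (-(1 / 2) - γ / 2) with hI₁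
  set I₂ := ∫ s in Ioi 0, w₂ s * s ^ (-1 - γ / 2) with hI₂
  have hI₁0 : 0 ≤ I₁ := setIntegral_nonneg measurableSet_Ioi fun s hs => mul_nonneg
    (mul_nonneg (by positivity) (indicator_nonneg (fun _ _ => zero_le_one) s))
    (Real.rpow_nonneg (le_of_lt hs) _)
  have hI₂0 : 0 ≤ I₂ := setIntegral_nonneg measurableSet_Ioi fun s hs => mul_nonneg
    (mul_nonneg hc₂0 (diffWeight_nonneg (by linarith) hs)) (Real.rpow_nonneg (le_of_lt hs) _)
  refine ⟨K₁ * I₁ + K₂ * I₂, by positivity, fun v w θ h ε hθ hε hv hh a M hG hθM z => ?_⟩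
  -- the temperature part
  have hsym : RealSymbol fun ξ => (highSym (α / 2) ξ : ℂ) * (dsym i ξ * dsym 0 ξ) :=
    (realSymbol_highSym _).mul ((realSymbol_dsym i).mul (realSymbol_dsym 0))
  obtain ⟨k, hk, -⟩ := (hθ.mono (s := 2 - α) (by linarith) (by linarith)).exists_of_order hsym
    (B := (2 * Real.pi) ^ (-2 - 2 * (α / 2)) * Real.pi * (2 * Real.pi) ^ 2) (by positivity)
    fun ξ hξ => by
      rw [norm_mul, norm_mul, Complex.norm_real, highSym, Real.norm_of_nonneg (mul_nonneg
        (by positivity) (mul_nonneg (by positivity) one_sub_exp_sq_nonneg))]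
      have h1 := one_sub_exp_le (x := ‖ξ‖)
      have h2 := norm_dsym_le i ξ
      have h3 := norm_dsym_le 0 ξ
      have e : ‖ξ‖ ^ (2 - α) = ‖ξ‖ ^ (-2 - 2 * (α / 2)) * ‖ξ‖ ^ 2 * ‖ξ‖ ^ 2 := by
        rw [← Real.rpow_two, ← Real.rpow_add hξ, ← Real.rpow_add hξ]
        ring_nf
      rw [e]
      calc (2 * Real.pi) ^ (-2 - 2 * (α / 2)) * (‖ξ‖ ^ (-2 - 2 * (α / 2)) *
            (1 - Real.exp (-Real.pi * ‖ξ‖ ^ 2))) * (‖dsym i ξ‖ * ‖dsym 0 ξ‖)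
          ≤ (2 * Real.pi) ^ (-2 - 2 * (α / 2)) * (‖ξ‖ ^ (-2 - 2 * (α / 2)) * (Real.pi * ‖ξ‖ ^ 2)) *
            ((2 * Real.pi * ‖ξ‖) * (2 * Real.pi * ‖ξ‖)) := by gcongr
        _ = _ := by ring
  -- the rest
  have hR := hasMult_rieszOp (hθ.mono (s := 1 - α) (by linarith) (by linarith))
  have hk' : HasMult (fun ξ => (highSym 0 ξ : ℂ) * dsym i ξ) (rieszOp α θ) k := by
    filter_upwards [hk, hR, ae_norm_pos] with ξ h1 h2 h3
    have e : highSym (α / 2) ξ = highSym 0 ξ * ((2 * Real.pi) ^ (-α) * ‖ξ‖ ^ (-α)) := by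
      have e1 : ∀ x : ℝ, 0 < x → x ^ (-2 - 2 * (α / 2)) = x ^ (-2 - 2 * (0 : ℝ)) * x ^ (-α) :=
        fun x hx => by
          rw [← Real.rpow_add hx]
          ring_nf
      rw [highSym, highSym, e1 _ h3, e1 _ (by positivity)]
      ring
    rw [h1, h2, e, rieszSym, lapSym, rad]
    push_cast
    ring
  have hωh : HasMult (fun ξ => (highSym 0 ξ : ℂ) * dsym i ξ) w (ε • h) := by
    have h1 := hh.smul ε
    filter_upwards [h1, hv, ae_norm_pos, (by
      rw [hat_smul]; exact Lp.coeFn_smul (ε : ℂ) (hat v) :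
        ⇑(hat (ε • v)) =ᵐ[volume] (ε : ℂ) • ⇑(hat v))] with ξ h1 h2 h3 h4
    rw [h1, h4, Pi.smul_apply, smul_eq_mul]
    have e : (1 : ℂ) - heat 1 ξ = (highSym 0 ξ : ℂ) * ((4 * Real.pi ^ 2 * ‖ξ‖ ^ 2 : ℝ) : ℂ) := by
      have e1 : ∀ x : ℝ, 0 < x → x ^ (-2 - 2 * (0 : ℝ)) = (x ^ 2)⁻¹ := fun x hx => by
        rw [mul_zero, sub_zero, Real.rpow_neg hx.le, Real.rpow_two]
      rw [heat_eq, ← Complex.ofReal_one, ← Complex.ofReal_sub, ← Complex.ofReal_mul, highSym,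
        e1 _ h3, e1 _ (by positivity), mul_one]
      congr 1
      field_simp
      norm_num
    have hε' : (ε : ℂ) * ε = 1 := by exact_mod_cast hε
    rw [e]
    linear_combination (highSym 0 ξ * ε : ℂ) * h2 + (highSym 0 ξ : ℂ) * dsym i ξ * hat w ξ * hε'
  have t₁ := B₁ a (w - rieszOp α θ) (ε • h - k) M (hωh.sub hk') hG z
  have t₂ := B₂ a θ k M hk hθM z
  have e : inner ℝ a (incr z h) =
      ε * (inner ℝ a (incr z (ε • h - k)) + inner ℝ a (incr z k)) := by
    have e1 : incr z (ε • h - k) = ε • incr z h - incr z k := by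
      refine (hasMult_incr z (ε • h - k)).unique ?_
      exact ((hasMult_incr z h).smul ε).sub (hasMult_incr z k)
    rw [e1, inner_sub_right, inner_smul_right, sub_add_cancel, ← mul_assoc, hε, one_mul]
  have hε1 : |ε| = 1 := by
    have : |ε| * |ε| = 1 := by rw [← abs_mul, hε, abs_one]
    nlinarith [abs_nonneg ε]
  rw [e, abs_mul, hε1, one_mul]
  calc |inner ℝ a (incr z (ε • h - k)) + inner ℝ a (incr z k)|
      ≤ K₁ * I₁ * ‖z‖ ^ γ * M + K₂ * I₂ * ‖z‖ ^ γ * M := (abs_add_le _ _).trans (add_le_add t₁ t₂)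
    _ = _ := by ring

/-! ### Increments of the low frequencies, and the bound for the full velocity -/

theorem realSymbol_one_sub_chr (z : Plane) : RealSymbol fun ξ => 1 - chr z ξ where
  meas := by
    unfold chr
    fun_prop
  herm ξ := by
    rw [map_sub, map_one, chr, chr, inner_neg_right, ← Circle.coe_inv_eq_conj,
      ← AddChar.map_neg_eq_inv]

theorem norm_one_sub_chr_le {γ : ℝ} (hγ : 0 ≤ γ) (hγ' : γ ≤ 1) (z : Plane) {ξ : Plane} :
    ‖1 - chr z ξ‖ ≤ 2 * Real.pi * (‖z‖ ^ γ * ‖ξ‖ ^ γ) := by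
  rw [← Real.mul_rpow (norm_nonneg z) (norm_nonneg ξ), norm_sub_rev]
  have h0 : 0 ≤ ‖z‖ * ‖ξ‖ := by positivity
  have hpi := Real.pi_gt_three
  rcases le_total (‖z‖ * ‖ξ‖) 1 with h | h
  · refine (norm_chr_sub_one_le z ξ).trans ?_
    have : ‖z‖ * ‖ξ‖ ≤ (‖z‖ * ‖ξ‖) ^ γ := by
      simpa using Real.rpow_le_rpow_of_exponent_ge' h0 h hγ hγ'
    gcongr
  · have h1 : ‖chr z ξ - 1‖ ≤ 2 := (norm_sub_le _ _).trans (by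
      rw [norm_chr, norm_one]; norm_num)
    have h2 : 1 ≤ (‖z‖ * ‖ξ‖) ^ γ := Real.one_le_rpow h hγ
    nlinarith

theorem rpow_mul_exp_le {x s : ℝ} (hx : 0 < x) (hs : 0 ≤ s) (hs' : s ≤ 2) :
    x ^ s * Real.exp (-Real.pi * x ^ 2) ≤ 1 := by
  have h1 := rpow_le_one_add hx hs hs'
  have h2 := Real.add_one_le_exp (x ^ 2)
  have h3 : x ^ s ≤ Real.exp (Real.pi * x ^ 2) := by
    have h4 : Real.exp (x ^ 2) ≤ Real.exp (Real.pi * x ^ 2) := by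
      have := Real.pi_gt_three
      gcongr
      nlinarith [sq_nonneg x]
    rw [one_mul, Real.rpow_two] at h1
    linarith
  calc x ^ s * Real.exp (-Real.pi * x ^ 2) ≤
        Real.exp (Real.pi * x ^ 2) * Real.exp (-Real.pi * x ^ 2) := by gcongr
    _ = 1 := by
        rw [← Real.exp_add]
        simp

/-- The increment costs ‖z‖^γ|ξ|^γ and the H¹ seminorm at most one more power of |ξ|; the Gaussian
cutoff absorbs both since the total order is at most 2. Low frequencies thus need only the `L²` norm
of the velocity. -/
theorem incr_low_bound {γ : ℝ} (hγ : 0 ≤ γ) (hγ' : γ ≤ 1) {v l : L2} (h : HasMult (heat 1) v l)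
    (z : Plane) : InH 1 (incr z l) ∧ ‖incr z l‖ ≤ 2 * Real.pi * ‖z‖ ^ γ * ‖v‖ ∧
      ‖absD 1 (incr z l)‖ ≤ 2 * Real.pi * ‖z‖ ^ γ * ‖v‖ := by
  have hz : HasMult (fun ξ => (1 - chr z ξ) * heat 1 ξ) v (incr z l) := h.comp (hasMult_incr z l)
  have hb : ∀ r : ℝ, 0 ≤ r → r ≤ 1 → ∀ ξ : Plane, 0 < ‖ξ‖ →
      ‖rad r ξ * ((1 - chr z ξ) * heat 1 ξ)‖ ≤ 2 * Real.pi * ‖z‖ ^ γ := by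
    intro r hr hr' ξ hξ
    have h1 := norm_one_sub_chr_le hγ hγ' z (ξ := ξ)
    have h2 := rpow_mul_exp_le hξ (by linarith : 0 ≤ r + γ) (by linarith)
    have h3 : ‖heat 1 ξ‖ = Real.exp (-Real.pi * ‖ξ‖ ^ 2) := by
      rw [heat_eq, Complex.norm_real, Real.norm_of_nonneg (Real.exp_nonneg _), mul_one]
    rw [norm_mul, norm_mul, norm_rad, h3]
    calc ‖ξ‖ ^ r * (‖1 - chr z ξ‖ * Real.exp (-Real.pi * ‖ξ‖ ^ 2))
        ≤ ‖ξ‖ ^ r * (2 * Real.pi * (‖z‖ ^ γ * ‖ξ‖ ^ γ) * Real.exp (-Real.pi * ‖ξ‖ ^ 2)) := by gcongr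
      _ = 2 * Real.pi * ‖z‖ ^ γ * (‖ξ‖ ^ (r + γ) * Real.exp (-Real.pi * ‖ξ‖ ^ 2)) := by
          rw [Real.rpow_add hξ]
          ring
      _ ≤ 2 * Real.pi * ‖z‖ ^ γ * 1 := by gcongr
      _ = _ := mul_one _
  have hle : ∀ r : ℝ, 0 ≤ r → r ≤ 1 → ∀ g : L2,
      HasMult (fun ξ => rad r ξ * ((1 - chr z ξ) * heat 1 ξ)) v g →
      ‖g‖ ≤ 2 * Real.pi * ‖z‖ ^ γ * ‖v‖ := by
    intro r hr hr' g hg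
    have h1 : HasMult (fun ξ => if 0 < ‖ξ‖ then rad r ξ * ((1 - chr z ξ) * heat 1 ξ) else 0) v g :=
      hg.congr (ae_norm_pos.mono fun ξ hξ => by rw [if_pos hξ])
    refine h1.norm_le fun ξ => ?_
    split_ifs with hξ
    · exact hb r hr hr' ξ hξ
    · rw [norm_zero]
      have := Real.pi_pos
      positivity
  have hsym : RealSymbol fun ξ => (1 - chr z ξ) * heat 1 ξ :=
    (realSymbol_one_sub_chr z).mul (realSymbol_heat 1)
  have hm1 : RealSymbol fun ξ => if 0 < ‖ξ‖ then rad 1 ξ * ((1 - chr z ξ) * heat 1 ξ) else 0 :=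
    ⟨Measurable.ite (measurableSet_lt measurable_const measurable_norm)
      ((realSymbol_rad 1).mul hsym).meas measurable_const, fun ξ => by
      have := ((realSymbol_rad 1).mul hsym).herm ξ
      simp only [norm_neg]
      split_ifs
      · exact this
      · simp⟩
  obtain ⟨g, hg⟩ := HasMult.of_bounded hm1 (C := 2 * Real.pi * ‖z‖ ^ γ) (fun ξ => by
    split_ifs with hξ
    · exact hb 1 zero_le_one le_rfl ξ hξ
    · rw [norm_zero]
      have := Real.pi_pos
      positivity) v
  have hg' : HasMult (fun ξ => rad 1 ξ * ((1 - chr z ξ) * heat 1 ξ)) v g :=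
    hg.congr (ae_norm_pos.mono fun ξ hξ => by simp only [if_pos hξ])
  have hInH : InH 1 (incr z l) := ⟨g, by
    filter_upwards [hg', hz] with ξ h1 h2
    rw [h1, h2]
    ring⟩
  refine ⟨hInH, ?_, hle 1 zero_le_one le_rfl _ (hz.comp hInH.hasMult)⟩
  refine hle 0 le_rfl zero_le_one _ (hz.congr (.of_forall fun ξ => ?_))
  simp [rad]

theorem InH.of_bounded_mult {s : ℝ} {f g : L2} {m : Plane → ℂ} {C : ℝ} (hf : InH s f)
    (hfg : HasMult m f g) (hm : RealSymbol m) (hC : 0 ≤ C) (hb : ∀ ξ : Plane, ‖m ξ‖ ≤ C) :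
    InH s g :=
  (InH.of_hasMult (r := 0) (B := C) (by rwa [zero_add]) hfg hm hC fun ξ _ => by
    simpa using hb ξ).1

theorem InH.incr {s : ℝ} {f : L2} (hf : InH s f) (z : Plane) : InH s (incr z f) :=
  hf.of_bounded_mult (hasMult_incr z f) (realSymbol_one_sub_chr z) (C := 2) (by norm_num)
    fun ξ => (norm_sub_le _ _).trans (by rw [norm_chr, norm_one]; norm_num)

theorem incr_add (z : Plane) (f g : L2) : incr z (f + g) = incr z f + incr z g :=
  (hasMult_incr z (f + g)).unique ((hasMult_incr z f).add (hasMult_incr z g))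

theorem abs_add_rpow_le {q : ℝ} (hq : 0 ≤ q) (x y : ℝ) :
    |x + y| ^ q ≤ 2 ^ q * (|x| ^ q + |y| ^ q) := by
  have h : |x + y| ≤ 2 * max |x| |y| := by
    have h1 := le_max_left |x| |y|
    have h2 := le_max_right |x| |y|
    linarith [abs_add_le x y]
  have hm : (max |x| |y|) ^ q ≤ |x| ^ q + |y| ^ q := by
    have hx : 0 ≤ |x| ^ q := by positivity
    have hy : 0 ≤ |y| ^ q := by positivity
    rcases max_choice |x| |y| with h | h <;> rw [h] <;> linarith
  calc |x + y| ^ q ≤ (2 * max |x| |y|) ^ q := by gcongr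
    _ = 2 ^ q * (max |x| |y|) ^ q := Real.mul_rpow (by norm_num) (by positivity)
    _ ≤ _ := by gcongr

/-- The increments of the velocity are controlled in `L^q` by those of the combined quantity. -/
theorem exists_increment_bound {α γ q : ℝ} (hα : 0 < α) (hα' : α < 1) (hγ : 0 ≤ γ) (hγα : γ < α)
    (hq : 2 < q) (hq' : q ≤ 4) (R : ℝ) : ∃ A : ℝ, 0 ≤ A ∧
    ∀ (u : Fin 2 → L2) (K : ℝ) (θ : L2), Solenoidal u K → InH 2 θ → (∀ i, ‖u i‖ ≤ R) → ‖θ‖ ≤ R →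
      (∀ᵐ x : Plane, |θ x| ≤ R) → ∀ (j : Fin 2) (z : Plane),
        Integrable (fun x => |incr z (u j) x| ^ q) ∧
        ∫ x, |incr z (u j) x| ^ q ≤
          A * (1 + ∫ x, |combined α u θ x| ^ q) * (‖z‖ ^ γ) ^ q := by
  have hpi := Real.pi_pos
  have har := area_pos
  have hγ1 : γ ≤ 1 := by linarith
  choose A hA hAb using fun i => exists_inner_incr_high_le hα hα' hγ hγα i
  set R' := 2 * Real.pi * R with hR'
  set D : ℝ := max (A 0) (A 1) with hD
  have hD0 : 0 ≤ D := (hA 0).trans (le_max_left _ _)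
  set B : ℝ := max 0 R ^ q with hB
  have hB0 : 0 ≤ B := Real.rpow_nonneg (le_max_left _ _) _
  refine ⟨2 ^ q * ((R' ^ 2 + 64 * area * R' ^ 4) + D ^ q * (1 + B)), by positivity,
    fun u K θ hu hθ huR hθR hθb j z => ?_⟩
  have hui : InH 1 (incr z (u j)) := (hu.inH j).one.incr z
  refine ⟨hui.integrable_rpow hq.le hq', ?_⟩
  set G := combined α u θ with hG
  have hGH : InH 1 G := hu.inH_combined hθ hα.le hα'.le
  have hGi := hGH.integrable_rpow hq.le hq'
  set E := ∫ x, |G x| ^ q with hE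
  have hE0 : 0 ≤ E := integral_nonneg fun x => by positivity
  have hR0 : 0 ≤ R := (norm_nonneg _).trans hθR
  -- the temperature
  obtain ⟨hθi, hθq⟩ := integrable_rpow_of_bdd hθb hq.le
  set Eθ := ∫ x, |θ x| ^ q with hEθ
  have hEθ0 : 0 ≤ Eθ := integral_nonneg fun x => by positivity
  have hEθB : Eθ ≤ B := by
    refine hθq.trans ?_
    rw [hB, max_eq_right hR0]
    have e : R ^ q = R ^ (q - 2) * R ^ 2 := by
      rw [← Real.rpow_two, ← Real.rpow_add' hR0 (by linarith)]
      ring_nf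
    rw [e]
    gcongr
  rcases eq_or_ne z 0 with rfl | hz
  · have h0 : ∀ᵐ x : Plane, |incr 0 (u j) x| ^ q = 0 := by
      filter_upwards [coeFn_incr 0 (u j)] with x hx
      rw [hx, sub_zero, sub_self, abs_zero, Real.zero_rpow (by linarith)]
    rw [integral_congr_ae h0, integral_zero]
    positivity
  have hl : 0 < ‖z‖ ^ γ := Real.rpow_pos_of_pos (norm_pos_iff.2 hz) _
  -- splitting
  obtain ⟨l, hlow⟩ := HasMult.of_bounded (realSymbol_heat 1) (C := 1)
    (fun ξ => norm_heat_le zero_le_one ξ) (u j)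
  obtain ⟨w1, w2, w3⟩ := incr_low_bound hγ hγ1 hlow z
  have hlow_le : ∫ x, |incr z l x| ^ q ≤ (R' ^ 2 + 64 * area * R' ^ 4) * (‖z‖ ^ γ) ^ q := by
    have h1 : 2 * Real.pi * ‖z‖ ^ γ * ‖u j‖ ≤ ‖z‖ ^ γ * R' := by
      rw [hR', show ‖z‖ ^ γ * (2 * Real.pi * R) = 2 * Real.pi * ‖z‖ ^ γ * R by ring]
      gcongr
      exact huR j
    exact w1.integral_rpow_le hq.le hq' hl (w2.trans h1) (w3.trans h1)
  set h := u j - l with hh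
  have hhigh : HasMult (fun ξ => 1 - heat 1 ξ) (u j) h := by
    unfold HasMult
    rw [hh, hat_sub]
    filter_upwards [hlow, Lp.coeFn_sub (hat (u j)) (hat l)] with ξ h1 h2
    rw [h2, Pi.sub_apply, h1]
    ring
  have hsym : RealSymbol fun ξ => 1 - heat 1 ξ :=
    ⟨measurable_const.sub (realSymbol_heat 1).meas, fun ξ => by
      rw [map_sub, map_one, (realSymbol_heat 1).herm]⟩
  have hhH : InH 2 h := (hu.inH j).of_bounded_mult hhigh hsym (C := 2) zero_le_two
    fun ξ => (norm_sub_le _ _).trans (by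
      have := norm_heat_le zero_le_one ξ
      rw [norm_one]
      linarith)
  have hbH : InH 2 (incr z h) := hhH.incr z
  obtain ⟨C, hC, hCb⟩ := exists_sup_bound
  have hqq : (q / (q - 1)).HolderConjugate q := (Real.HolderConjugate.conjExponent (by linarith)).symm
  -- The pointwise bound of the increment required by the duality argument is the H² ⊂ L^∞ bound;
  -- its size is irrelevant.
  have hhigh_le : ∫ x, |incr z h x| ^ q ≤ (D * ‖z‖ ^ γ * (E + Eθ) ^ (1 / q)) ^ q := by
    refine integral_rpow_le_of_duality hqq hq.le (by positivity) (hCb _ hbH) (by positivity)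
      fun a ha => ?_
    set W := (∫ x, |a x| ^ (q / (q - 1))) ^ (1 / (q / (q - 1))) with hW
    have hW0 : 0 ≤ W := Real.rpow_nonneg (integral_nonneg fun x => by positivity) _
    have hq1 : 0 ≤ 1 / q := by positivity
    have m1 : ∀ y, |inner ℝ a (trans y (vorticity u - rieszOp α θ))| ≤ W * (E + Eθ) ^ (1 / q) :=
      fun y => (abs_inner_trans_le_rpow hqq ha hGi y).trans (by gcongr; linarith)
    have m2 : ∀ y, |inner ℝ a (trans y θ)| ≤ W * (E + Eθ) ^ (1 / q) :=
      fun y => (abs_inner_trans_le_rpow hqq ha hθi y).trans (by gcongr; linarith)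
    have hM : 0 ≤ W * (E + Eθ) ^ (1 / q) := by positivity
    obtain ⟨i, hi⟩ : ∃ i, |inner ℝ a (incr z h)| ≤ A i * ‖z‖ ^ γ * (W * (E + Eθ) ^ (1 / q)) := by
      obtain ⟨b0, b1⟩ := hu.biot_savart
      fin_cases j
      · exact ⟨1, hAb 1 _ _ θ h 1 hθ (by norm_num) b0 hhigh a _ m1 m2 z⟩
      · exact ⟨0, hAb 0 _ _ θ h (-1) hθ (by norm_num) b1 hhigh a _ m1 m2 z⟩
    have hAD : A i ≤ D := by
      fin_cases i
      · exact le_max_left _ _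
      · exact le_max_right _ _
    calc |inner ℝ a (incr z h)| ≤ A i * ‖z‖ ^ γ * (W * (E + Eθ) ^ (1 / q)) := hi
      _ ≤ D * ‖z‖ ^ γ * (W * (E + Eθ) ^ (1 / q)) := by gcongr
      _ = _ := by ring
  have hpow : (D * ‖z‖ ^ γ * (E + Eθ) ^ (1 / q)) ^ q = D ^ q * (‖z‖ ^ γ) ^ q * (E + Eθ) := by
    have e1 : ((E + Eθ) ^ (1 / q)) ^ q = E + Eθ := by
      rw [← Real.rpow_mul (by positivity), one_div, inv_mul_cancel₀ (by linarith), Real.rpow_one]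
    rw [Real.mul_rpow (by positivity) (by positivity), Real.mul_rpow hD0 hl.le, e1]
  rw [hpow] at hhigh_le
  have e : incr z (u j) = incr z l + incr z h := by
    rw [← incr_add, hh, add_sub_cancel]
  have i1 := w1.integrable_rpow hq.le hq'
  have i2 := hbH.one.integrable_rpow hq.le hq'
  have hsum : ∫ x, |incr z (u j) x| ^ q ≤
      2 ^ q * ((∫ x, |incr z l x| ^ q) + ∫ x, |incr z h x| ^ q) := by
    rw [← integral_add i1 i2, ← integral_const_mul]
    refine integral_mono_ae (hui.integrable_rpow hq.le hq') ((i1.add i2).const_mul _) ?_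
    filter_upwards [Lp.coeFn_add (incr z l) (incr z h)] with x hx
    rw [e, hx, Pi.add_apply]
    exact abs_add_rpow_le (by linarith) _ _
  refine hsum.trans ?_
  have hlq : 0 ≤ (‖z‖ ^ γ) ^ q := by positivity
  have hEB : E + Eθ ≤ (1 + B) * (1 + E) := by nlinarith
  have s1 : (R' ^ 2 + 64 * area * R' ^ 4) * (‖z‖ ^ γ) ^ q ≤
      (R' ^ 2 + 64 * area * R' ^ 4) * (1 + E) * (‖z‖ ^ γ) ^ q := by
    have h1 : (R' ^ 2 + 64 * area * R' ^ 4) ≤ (R' ^ 2 + 64 * area * R' ^ 4) * (1 + E) :=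
      le_mul_of_one_le_right (by positivity) (by linarith)
    gcongr
  have s2 : D ^ q * (‖z‖ ^ γ) ^ q * (E + Eθ) ≤ D ^ q * (‖z‖ ^ γ) ^ q * ((1 + B) * (1 + E)) := by
    gcongr
  calc 2 ^ q * ((∫ x, |incr z l x| ^ q) + ∫ x, |incr z h x| ^ q)
      ≤ 2 ^ q * ((R' ^ 2 + 64 * area * R' ^ 4) * (1 + E) * (‖z‖ ^ γ) ^ q +
          D ^ q * (‖z‖ ^ γ) ^ q * ((1 + B) * (1 + E))) := by
        gcongr
        · exact hlow_le.trans s1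
        · exact hhigh_le.trans s2
    _ = _ := by ring

/-! ### Heat kernel representation of the commutator and of the linear term -/

/-- The constant in the representation of `Λ^{-a}` as a superposition of heat operators. -/
def potConst (a : ℝ) : ℝ := (2 * Real.pi) ^ (-a) / (Real.Gamma (a / 2) * Real.pi ^ (-(a / 2)))

theorem potConst_pos {a : ℝ} (ha : 0 < a) : 0 < potConst a := by
  have := Real.Gamma_pos_of_pos (half_pos ha)
  have := Real.pi_pos
  unfold potConst
  positivity

/-- Negative powers |ξ|^{-a} are superpositions of heat symbols with weight s^{a/2-1}, by the Gamma
integral. -/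
theorem potential_superposition {a : ℝ} (ha : 0 < a) {H : Plane → ℂ} (hH : AEStronglyMeasurable H)
    (hi : Integrable fun ξ => lapSym (-a) ξ * H ξ) :
    IntegrableOn (fun s : ℝ => s ^ (a / 2 - 1) * (∫ ξ, heat s ξ * H ξ).re) (Ioi 0) ∧
      (∫ ξ, lapSym (-a) ξ * H ξ).re =
        potConst a * ∫ s in Ioi (0 : ℝ), s ^ (a / 2 - 1) * (∫ ξ, heat s ξ * H ξ).re := by
  set g := Real.Gamma (a / 2) * Real.pi ^ (-(a / 2)) with hg
  have hg0 : 0 < g := mul_pos (Real.Gamma_pos_of_pos (half_pos ha))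
    (Real.rpow_pos_of_pos Real.pi_pos _)
  have hc0 := potConst_pos ha
  have hm : ∀ ξ : Plane, ((g * ‖ξ‖ ^ (-a) : ℝ) : ℂ) * H ξ =
      ((potConst a)⁻¹ : ℝ) * (lapSym (-a) ξ * H ξ) := by
    intro ξ
    have : (0 : ℝ) < (2 * Real.pi) ^ (-a) := Real.rpow_pos_of_pos (by positivity) _
    have e : g * ‖ξ‖ ^ (-a) = (potConst a)⁻¹ * ((2 * Real.pi) ^ (-a) * ‖ξ‖ ^ (-a)) := by
      rw [potConst, ← hg]
      field_simp
    rw [e, lapSym, rad]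
    push_cast
    ring
  have hgam := fun (ξ : Plane) (hξ : 0 < ‖ξ‖) => gamma_integral (half_pos ha) hξ
  obtain ⟨i1, i2⟩ := superposition (w := fun s => s ^ (a / 2 - 1))
    (φ := fun s ξ => Real.exp (-Real.pi * s * ‖ξ‖ ^ 2)) (m := fun ξ => g * ‖ξ‖ ^ (-a))
    (by fun_prop) (by fun_prop) (fun s hs => Real.rpow_nonneg (le_of_lt hs) _)
    (fun s _ ξ => by positivity) (ae_norm_pos.mono fun ξ hξ => (hgam ξ hξ).1)
    (ae_norm_pos.mono fun ξ hξ => by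
      rw [(hgam ξ hξ).2, mul_div_cancel₀ _ (two_ne_zero' ℝ)])
    hH ((hi.const_mul _).congr (.of_forall fun ξ => (hm ξ).symm))
  have e : ∀ s : ℝ, (((s ^ (a / 2 - 1) : ℝ) : ℂ) *
      ∫ ξ, ((Real.exp (-Real.pi * s * ‖ξ‖ ^ 2) : ℝ) : ℂ) * H ξ).re =
      s ^ (a / 2 - 1) * (∫ ξ, heat s ξ * H ξ).re := fun s => by
    rw [Complex.re_ofReal_mul]
    rfl
  have i1' : IntegrableOn (fun s : ℝ => s ^ (a / 2 - 1) * (∫ ξ, heat s ξ * H ξ).re) (Ioi 0) :=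
    i1.re.congr (.of_forall e)
  refine ⟨i1', ?_⟩
  have h1 := integral_re i1
  rw [i2] at h1
  simp_rw [hm] at h1
  rw [integral_const_mul] at h1
  have h2 : ∫ s in Ioi (0 : ℝ), s ^ (a / 2 - 1) * (∫ ξ, heat s ξ * H ξ).re =
      (potConst a)⁻¹ * (∫ ξ, lapSym (-a) ξ * H ξ).re := by
    refine Eq.trans ?_ (h1.trans (Complex.re_ofReal_mul _ _))
    exact integral_congr_ae (.of_forall fun s => (e s).symm)
  rw [h2, mul_inv_cancel_left₀ hc0.ne']

theorem norm_heat_mul_dsym_le {s : ℝ} (hs : 0 < s) (i : Fin 2) (ξ : Plane) :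
    ‖heat s ξ * dsym i ξ‖ ≤ 2 * Real.pi * (Real.sqrt s)⁻¹ := by
  have hr : 0 < Real.sqrt s := Real.sqrt_pos.2 hs
  rcases (norm_nonneg ξ).eq_or_lt with h0 | h0
  · have := norm_dsym_le i ξ
    rw [← h0, mul_zero] at this
    rw [norm_mul, le_antisymm this (norm_nonneg _), mul_zero]
    have := Real.pi_pos
    positivity
  · have h1 := rpow_mul_exp_le (mul_pos hr h0) zero_le_one one_le_two
    rw [Real.rpow_one, mul_pow, Real.sq_sqrt hs.le] at h1
    have h2 : ‖heat s ξ‖ = Real.exp (-Real.pi * (s * ‖ξ‖ ^ 2)) := by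
      rw [heat_eq, Complex.norm_real, Real.norm_of_nonneg (Real.exp_nonneg _), mul_assoc]
    have hpi := Real.pi_pos
    rw [norm_mul, h2]
    calc Real.exp (-Real.pi * (s * ‖ξ‖ ^ 2)) * ‖dsym i ξ‖
        ≤ Real.exp (-Real.pi * (s * ‖ξ‖ ^ 2)) * (2 * Real.pi * ‖ξ‖) := by
          gcongr
          exact norm_dsym_le i ξ
      _ = 2 * Real.pi * (Real.sqrt s)⁻¹ *
          (Real.sqrt s * ‖ξ‖ * Real.exp (-Real.pi * (s * ‖ξ‖ ^ 2))) := by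
          field_simp
      _ ≤ 2 * Real.pi * (Real.sqrt s)⁻¹ * 1 := by gcongr
      _ = _ := mul_one _

theorem exists_heat_deriv {s : ℝ} (hs : 0 < s) (i : Fin 2) {f : L2} (hf : InH 1 f) :
    ∃ F, HasMult (fun ξ => heat s ξ * dsym i ξ) f F ∧ InH 1 F := by
  have hsym : RealSymbol fun ξ => heat s ξ * dsym i ξ := (realSymbol_heat s).mul (realSymbol_dsym i)
  have hb := norm_heat_mul_dsym_le hs i
  obtain ⟨F, hF⟩ := HasMult.of_bounded hsym hb f
  exact ⟨F, hF, hf.of_bounded_mult hF hsym ((norm_nonneg _).trans (hb 0)) hb⟩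

theorem inner_rieszOp_eq {a : ℝ} (ha : 0 < a) {b : L2} (hb : InH 1 b) (ha' : a ≤ 1) (e : L2)
    {B : ℝ → L2} (hB : ∀ s, 0 < s → HasMult (fun ξ => heat s ξ * dsym 0 ξ) b (B s)) :
    IntegrableOn (fun s : ℝ => s ^ (a / 2 - 1) * inner ℝ (B s) e) (Ioi 0) ∧
      inner ℝ (rieszOp a b) e =
        potConst a * ∫ s in Ioi (0 : ℝ), s ^ (a / 2 - 1) * inner ℝ (B s) e := by
  have hR := hasMult_rieszOp (hb.mono (s := 1 - a) (by linarith) (by linarith))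
  set H : Plane → ℂ := fun ξ => (starRingEnd ℂ) (dsym 0 ξ * hat b ξ) * hat e ξ with hH
  have hm : (fun ξ => (starRingEnd ℂ) (hat (rieszOp a b) ξ) * hat e ξ) =ᵐ[volume]
      fun ξ => lapSym (-a) ξ * H ξ := by
    filter_upwards [hR] with ξ h1
    rw [h1, rieszSym, map_mul, map_mul, conj_lapSym]
    simp only [hH, map_mul]
    ring
  have hHm : AEStronglyMeasurable H :=
    (Complex.continuous_conj.comp_aestronglyMeasurable
      ((continuous_dsym 0).aestronglyMeasurable.mul (Lp.aestronglyMeasurable (hat b)))).mul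
      (Lp.aestronglyMeasurable (hat e))
  obtain ⟨i1, i2⟩ := potential_superposition ha hHm ((integrable_conj_mul _ _).congr hm)
  have hs : ∀ s ∈ Ioi (0 : ℝ), s ^ (a / 2 - 1) * (∫ ξ, heat s ξ * H ξ).re =
      s ^ (a / 2 - 1) * inner ℝ (B s) e := by
    intro s hs
    rw [inner_eq_hat]
    congr 2
    refine integral_congr_ae ?_
    filter_upwards [hB s hs] with ξ h1
    simp only [hH, h1, map_mul, conj_heat]
    ring
  refine ⟨i1.congr_fun hs measurableSet_Ioi, ?_⟩
  rw [inner_eq_hat, integral_congr_ae hm, i2, setIntegral_congr_fun measurableSet_Ioi hs]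

theorem integral_gauss₁ (i : Fin 2) : ∫ z, gauss₁ i z = 0 := by
  have h := fourier_gauss₁ i 0
  rw [Real.fourier_eq] at h
  simp only [inner_zero_right, neg_zero, AddChar.map_zero_eq_one, one_smul] at h
  rw [integral_complex_ofReal] at h
  simpa [dsym] using h

theorem integral_gauss₂ (i j : Fin 2) : ∫ z, gauss₂ i j z = 0 := by
  have h := fourier_gauss₂ i j 0
  rw [Real.fourier_eq] at h
  simp only [inner_zero_right, neg_zero, AddChar.map_zero_eq_one, one_smul] at h
  rw [integral_complex_ofReal] at h
  simpa [dsym] using h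

theorem inner_trans_trans (z : Plane) (a b : L2) : inner ℝ (trans z a) (trans z b) = inner ℝ a b := by
  rw [inner_eq_integral, inner_eq_integral, ← integral_comp_sub (fun x => a x * b x) z]
  refine integral_congr_ae ?_
  filter_upwards [coeFn_trans z a, coeFn_trans z b] with x h1 h2
  rw [h1, h2]

/-- The kernel has mean zero, so f may be replaced by its increment. The form with the increment is
used at small s, where dissipation must absorb it; the plain form gives a direct bound at large s.
-/
theorem inner_rieszOp_linear {a : ℝ} (ha : 0 < a) (ha' : a ≤ 1) {θ : L2} (hθ : InH 1 θ) (f : L2) :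
    ∃ ρ : ℝ → ℝ, IntegrableOn (fun s : ℝ => s ^ (a / 2 - 1) * ρ s) (Ioi 0) ∧
      inner ℝ f (rieszOp a θ) = potConst a * ∫ s in Ioi (0 : ℝ), s ^ (a / 2 - 1) * ρ s ∧
      ∀ s, 0 < s → ρ s = (Real.sqrt s)⁻¹ * ∫ z, dil (gauss₁ 0) s z * inner ℝ f (trans z θ) ∧
        ρ s = (Real.sqrt s)⁻¹ * ∫ z, dil (gauss₁ 0) s z * inner ℝ (incr z f) (trans z θ) := by
  obtain ⟨C, hC⟩ := gaussKernel_gauss₁ 0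
  choose B hB using fun s : {s : ℝ // 0 < s} => exists_heat_deriv s.2 0 hθ
  set B' : ℝ → L2 := fun s => if h : 0 < s then B ⟨s, h⟩ else 0 with hB'
  have hBm : ∀ s, 0 < s → HasMult (fun ξ => heat s ξ * dsym 0 ξ) θ (B' s) := fun s hs => by
    simp only [hB', dif_pos hs]
    exact (hB ⟨s, hs⟩).1
  obtain ⟨i1, i2⟩ := inner_rieszOp_eq ha hθ ha' f hBm
  refine ⟨fun s => inner ℝ (B' s) f, i1, by rw [real_inner_comm, i2], fun s hs => ?_⟩
  have h1 : inner ℝ (B' s) f =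
      (Real.sqrt s)⁻¹ * ∫ z, dil (gauss₁ 0) s z * inner ℝ f (trans z θ) := by
    rw [real_inner_comm, inner_eq_hat, ← heat_pairing₁ hs]
    congr 1
    refine integral_congr_ae ?_
    filter_upwards [hBm s hs] with ξ h1
    rw [h1]
    ring
  refine ⟨h1, h1.trans ?_⟩
  have hd := integrable_dil hC.integrable hs
  have e : ∀ z, dil (gauss₁ 0) s z * inner ℝ (incr z f) (trans z θ) =
      dil (gauss₁ 0) s z * inner ℝ f (trans z θ) - dil (gauss₁ 0) s z * inner ℝ f θ := fun z => by
    rw [incr, inner_sub_left, inner_trans_trans]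
    ring
  simp_rw [e]
  rw [integral_sub (integrable_kernel hd f θ) (hd.mul_const _), integral_mul_const,
    integral_dil _ hs, integral_gauss₁, zero_mul, sub_zero]

theorem inner_heat_deriv₂ {s : ℝ} (hs : 0 < s) (j : Fin 2) {f F : L2}
    (hF : HasMult (fun ξ => heat s ξ * dsym 0 ξ) f F) (hF1 : InH 1 F) (b : L2) :
    inner ℝ b (partialD j F) = s⁻¹ * ∫ z, dil (gauss₂ 0 j) s z * inner ℝ b (trans z f) := by
  rw [inner_eq_hat, ← heat_pairing₂ hs]
  congr 1
  refine integral_congr_ae ?_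
  filter_upwards [hF, hasMult_partialD j hF1] with ξ h1 h2
  rw [h2, h1]
  ring

theorem heat_pairing₂_symm {s : ℝ} (hs : 0 < s) (i j : Fin 2) (a b : L2) :
    ∫ z, dil (gauss₂ i j) s z * inner ℝ a (trans z b) =
      ∫ z, dil (gauss₂ i j) s z * inner ℝ b (trans z a) := by
  have h : s⁻¹ * ∫ z, dil (gauss₂ i j) s z * inner ℝ a (trans z b) =
      s⁻¹ * ∫ z, dil (gauss₂ i j) s z * inner ℝ b (trans z a) := by
    rw [← heat_pairing₂ hs, ← heat_pairing₂ hs, ← Complex.conj_re, ← integral_conj]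
    congr 1
    refine integral_congr_ae (.of_forall fun ξ => ?_)
    simp only [map_mul, conj_dsym, conj_heat, Complex.conj_conj]
    ring
  exact mul_left_cancel₀ (inv_ne_zero hs.ne') h

theorem coeFn_mulL_bdd {a b : L2} {K : ℝ} (hK : ∀ᵐ x : Plane, |b x| ≤ K) :
    mulL a b =ᵐ[volume] fun x => a x * b x := coeFn_mulL (memLp_mul_of_bdd hK)

namespace Solenoidal

variable {u : Fin 2 → L2} {K : ℝ}

theorem inner_adv_eq (h : Solenoidal u K) (a w : L2) :
    inner ℝ a (adv u w) = inner ℝ (mulL a (u 0)) (partialD 0 w) +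
      inner ℝ (mulL a (u 1)) (partialD 1 w) := by
  rw [adv, inner_add_right, inner_mulL_swap (h.bdd 0), inner_mulL_swap (h.bdd 1),
    real_inner_comm, real_inner_comm (mulL a (u 1))]

/-- The second index of the kernel is a derivative that can be moved onto u_j, and the sum over j is
the divergence. -/
theorem sum_heat_eq_zero (h : Solenoidal u K) {s : ℝ} (hs : 0 < s) (b : L2) :
    (∫ z, dil (gauss₂ 0 0) s z * inner ℝ (u 0) (trans z b)) +
      ∫ z, dil (gauss₂ 0 1) s z * inner ℝ (u 1) (trans z b) = 0 := by
  obtain ⟨B, hB⟩ := HasMult.of_bounded ((realSymbol_heat s).mul (realSymbol_dsym 0))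
    (norm_heat_mul_dsym_le hs 0) b
  have key : ∀ j, s⁻¹ * ∫ z, dil (gauss₂ 0 j) s z * inner ℝ (u j) (trans z b) =
      -inner ℝ (partialD j (u j)) B := by
    intro j
    rw [← heat_pairing₂ hs, inner_eq_hat, ← Complex.neg_re, ← integral_neg]
    congr 1
    refine integral_congr_ae ?_
    filter_upwards [hB, hasMult_partialD j (h.inH j).one] with ξ h1 h2
    rw [h1, h2, map_mul, conj_dsym]
    ring
  have h0 : s⁻¹ * ((∫ z, dil (gauss₂ 0 0) s z * inner ℝ (u 0) (trans z b)) +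
      ∫ z, dil (gauss₂ 0 1) s z * inner ℝ (u 1) (trans z b)) = 0 := by
    rw [mul_add, key 0, key 1, ← neg_add, ← inner_add_left, h.div, inner_zero_left, neg_zero]
  exact (mul_eq_zero.1 h0).resolve_left (inv_ne_zero hs.ne')

end Solenoidal

/-- The trilinear form of the commutator. -/
def commForm (f u θ : L2) (z : Plane) : ℝ := ∫ x, incr z f x * incr z u x * trans z θ x

theorem commForm_eq {f u θ : L2} {K k : ℝ} (hu : ∀ᵐ x : Plane, |u x| ≤ K)
    (hθ : ∀ᵐ x : Plane, |θ x| ≤ k) (z : Plane) :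
    commForm f u θ z = inner ℝ (mulL f u) (trans z θ) - inner ℝ f (trans z (mulL θ u)) -
      inner ℝ u (trans z (mulL f θ)) + inner ℝ f (mulL θ u) := by
  have e4 : inner ℝ f (mulL θ u) = inner ℝ (trans z f) (trans z (mulL θ u)) :=
    (inner_trans_trans z _ _).symm
  rw [e4, inner_eq_integral, inner_eq_integral, inner_eq_integral, inner_eq_integral, commForm,
    ← integral_sub (integrable_mul_L2 _ _) (integrable_mul_L2 _ _),
    ← integral_sub (integrable_fun_sub (integrable_mul_L2 _ _) (integrable_mul_L2 _ _))
      (integrable_mul_L2 _ _),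
    ← integral_add (integrable_fun_sub (integrable_fun_sub (integrable_mul_L2 _ _)
      (integrable_mul_L2 _ _)) (integrable_mul_L2 _ _)) (integrable_mul_L2 _ _)]
  refine integral_congr_ae ?_
  filter_upwards [coeFn_incr z f, coeFn_incr z u, coeFn_trans z θ, coeFn_trans z f,
    coeFn_trans z (mulL θ u), coeFn_trans z (mulL f θ), coeFn_mulL_bdd (a := f) hu,
    ae_sub z (coeFn_mulL_bdd (a := θ) hu), ae_sub z (coeFn_mulL_bdd (a := f) hθ)]
    with x h1 h2 h3 h4 h5 h6 h7 h8 h9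
  rw [h1, h2, h3, h4, h5, h6, h7, h8, h9]
  ring

/-- Write R_α as a superposition of the operators ∂₁e^{sΔ/4π} and use skew-adjointness of transport
to put one more derivative on the kernel. The two resulting pairings are two of the four terms in
the expansion of `commForm`. The other two vanish: one after summation over j since div u = 0, the
other because second derivatives of the Gaussian have mean zero. In this way the commutator acquires
an increment on both f and u. -/
theorem commTerm_eq {u : Fin 2 → L2} {K k α : ℝ} (h : Solenoidal u K) (hα : 0 < α) (hα' : α ≤ 1)
    {θ f : L2} (hθ : InH 2 θ) (hθk : ∀ᵐ x : Plane, |θ x| ≤ k) (hf : InH 1 f) :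
    ∃ τ : ℝ → ℝ, IntegrableOn (fun s : ℝ => s ^ (α / 2 - 1) * τ s) (Ioi 0) ∧
      commTerm α u θ f = potConst α * ∫ s in Ioi (0 : ℝ), s ^ (α / 2 - 1) * τ s ∧
      ∀ s, 0 < s → (∀ j, Integrable fun z => dil (gauss₂ 0 j) s z * commForm f (u j) θ z) ∧
        τ s = -s⁻¹ * ((∫ z, dil (gauss₂ 0 0) s z * commForm f (u 0) θ z) +
          ∫ z, dil (gauss₂ 0 1) s z * commForm f (u 1) θ z) := by
  choose F hF using fun s : {s : ℝ // 0 < s} => exists_heat_deriv s.2 0 hf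
  choose B hB using fun s : {s : ℝ // 0 < s} => exists_heat_deriv s.2 0 hθ.one
  set F' : ℝ → L2 := fun s => if h : 0 < s then F ⟨s, h⟩ else 0 with hF'
  set B' : ℝ → L2 := fun s => if h : 0 < s then B ⟨s, h⟩ else 0 with hB'
  have hFm : ∀ s, 0 < s → HasMult (fun ξ => heat s ξ * dsym 0 ξ) f (F' s) ∧ InH 1 (F' s) :=
    fun s hs => by
      simp only [hF', dif_pos hs]
      exact hF ⟨s, hs⟩
  have hBm : ∀ s, 0 < s → HasMult (fun ξ => heat s ξ * dsym 0 ξ) θ (B' s) ∧ InH 1 (B' s) :=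
    fun s hs => by
      simp only [hB', dif_pos hs]
      exact hB ⟨s, hs⟩
  obtain ⟨i1, i2⟩ := inner_rieszOp_eq hα hf hα' (adv u θ) fun s hs => (hFm s hs).1
  obtain ⟨j1, j2⟩ := inner_rieszOp_eq hα hθ.one hα' (adv u f) fun s hs => (hBm s hs).1
  refine ⟨fun s => inner ℝ (B' s) (adv u f) - inner ℝ (F' s) (adv u θ), ?_, ?_, fun s hs => ?_⟩
  · refine (j1.sub i1).congr (.of_forall fun s => ?_)
    simp only [Pi.sub_apply]
    ring
  · rw [commTerm, h.inner_adv hf (inH_rieszOp hα.le hα' hθ).1, i2, j2, neg_sub_neg,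
      ← mul_sub, ← integral_sub j1 i1]
    simp only [mul_sub]
  · have hk : ∀ j, ∃ C, GaussKernel (gauss₂ 0 j) C := fun j => gaussKernel_gauss₂ 0 j
    have hd : ∀ j, Integrable (dil (gauss₂ 0 j) s) := fun j =>
      integrable_dil (hk j).choose_spec.integrable hs
    have e : ∀ j z, dil (gauss₂ 0 j) s z * commForm f (u j) θ z =
        dil (gauss₂ 0 j) s z * inner ℝ (mulL f (u j)) (trans z θ) -
        dil (gauss₂ 0 j) s z * inner ℝ f (trans z (mulL θ (u j))) -
        dil (gauss₂ 0 j) s z * inner ℝ (u j) (trans z (mulL f θ)) +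
        dil (gauss₂ 0 j) s z * inner ℝ f (mulL θ (u j)) := fun j z => by
      rw [commForm_eq (h.bdd j) hθk]
      ring
    have k1 := fun j => integrable_kernel (hd j) (mulL f (u j)) θ
    have k2 := fun j => integrable_kernel (hd j) f (mulL θ (u j))
    have k3 := fun j => integrable_kernel (hd j) (u j) (mulL f θ)
    have k4 := fun j => (hd j).mul_const (inner ℝ f (mulL θ (u j)))
    have k12 := fun j => integrable_fun_sub (k1 j) (k2 j)
    have k123 := fun j => integrable_fun_sub (k12 j) (k3 j)
    have hval : ∀ j, ∫ z, dil (gauss₂ 0 j) s z * commForm f (u j) θ z =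
        (∫ z, dil (gauss₂ 0 j) s z * inner ℝ (mulL f (u j)) (trans z θ)) -
        (∫ z, dil (gauss₂ 0 j) s z * inner ℝ (mulL θ (u j)) (trans z f)) -
        ∫ z, dil (gauss₂ 0 j) s z * inner ℝ (u j) (trans z (mulL f θ)) := fun j => by
      simp_rw [e]
      rw [integral_add (k123 j) (k4 j), integral_sub (k12 j) (k3 j), integral_sub (k1 j) (k2 j),
        integral_mul_const, integral_dil _ hs, integral_gauss₂, zero_mul, add_zero,
        heat_pairing₂_symm hs 0 j f]
    refine ⟨fun j => ?_, ?_⟩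
    · simp_rw [e]
      exact integrable_fun_add (k123 j) (k4 j)
    · have hz := h.sum_heat_eq_zero hs (mulL f θ)
      have t1 := h.inner_adv (hFm s hs).2 hθ.one
      have t2 := h.inner_adv (hBm s hs).2 hf
      rw [h.inner_adv_eq θ, inner_heat_deriv₂ hs 0 (hFm s hs).1 (hFm s hs).2,
        inner_heat_deriv₂ hs 1 (hFm s hs).1 (hFm s hs).2] at t1
      rw [h.inner_adv_eq f, inner_heat_deriv₂ hs 0 (hBm s hs).1 (hBm s hs).2,
        inner_heat_deriv₂ hs 1 (hBm s hs).1 (hBm s hs).2] at t2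
      rw [hval 0, hval 1]
      simp only
      rw [t1, t2]
      linear_combination (-s⁻¹) * hz

/-! ### Absorption by the dissipation -/

/-- With d = |φ(a) - φ(b)| and m the larger truncated value, d² ≤ (p+1) m^p d|a - b|, so Young's
inequality yields η d|a - b| plus (p+1) m^p h²/(4η). The last product is bounded by the three powers
of order p + 2. The constant does not depend on n. -/
theorem abs_powTrunc_sub_mul_le {p n η : ℝ} (hp : 0 ≤ p) (hn : 0 ≤ n) (hη : 0 < η) (a b h : ℝ) :
    |powTrunc p n a - powTrunc p n b| * |h| ≤
      η * ((powTrunc p n a - powTrunc p n b) * (a - b)) +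
        (p + 1) / (4 * η) * (|a| ^ (p + 2) + |b| ^ (p + 2) + |h| ^ (p + 2)) := by
  set m := max (min |a| n) (min |b| n) with hm
  set d := |powTrunc p n a - powTrunc p n b| with hd
  have hm0 : 0 ≤ m := le_max_of_le_left (le_min (abs_nonneg a) hn)
  have h1 : d ≤ (p + 1) * m ^ p * |a - b| := abs_powTrunc_sub_le hp hn a b
  have h2 : (powTrunc p n a - powTrunc p n b) * (a - b) = d * |a - b| := by
    rw [hd, ← abs_mul, abs_of_nonneg]
    rcases le_total a b with h | h
    · exact mul_nonneg_of_nonpos_of_nonpos (sub_nonpos.2 (monotone_powTrunc hp hn h))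
        (sub_nonpos.2 h)
    · exact mul_nonneg (sub_nonneg.2 (monotone_powTrunc hp hn h)) (sub_nonneg.2 h)
  have h3 : m ^ p * h ^ 2 ≤ |a| ^ (p + 2) + |b| ^ (p + 2) + |h| ^ (p + 2) := by
    have ha : 0 ≤ |a| ^ (p + 2) := by positivity
    have hb : 0 ≤ |b| ^ (p + 2) := by positivity
    have hh : 0 ≤ |h| ^ (p + 2) := by positivity
    have hadd : ∀ x : ℝ, 0 ≤ x → x ^ (p + 2) = x ^ p * x ^ 2 := fun x hx => by
      rw [Real.rpow_add' hx (by linarith), Real.rpow_two]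
    rw [← sq_abs h]
    rcases le_total m |h| with hmh | hmh
    · have : m ^ p * |h| ^ 2 ≤ |h| ^ (p + 2) := by
        rw [hadd _ (abs_nonneg h)]
        gcongr
      linarith
    · have h4 : m ^ p * |h| ^ 2 ≤ m ^ (p + 2) := by
        rw [hadd _ hm0]
        gcongr
      have h5 : m ^ (p + 2) ≤ |a| ^ (p + 2) + |b| ^ (p + 2) := by
        have hle : m ≤ max |a| |b| := max_le_max (min_le_left _ _) (min_le_left _ _)
        refine (Real.rpow_le_rpow hm0 hle (by linarith)).trans ?_
        rcases max_choice |a| |b| with h | h <;> rw [h] <;> linarith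
      linarith
  have hd0 : 0 ≤ d := abs_nonneg _
  have hmp : 0 ≤ m ^ p := Real.rpow_nonneg hm0 _
  have h6 : d * |h| ≤ η * (d * |a - b|) + (p + 1) / (4 * η) * (m ^ p * h ^ 2) := by
    rcases (abs_nonneg (a - b)).eq_or_lt with h0 | h0
    · have : d = 0 := le_antisymm (by rw [← h0, mul_zero] at h1; exact h1) hd0
      rw [this]
      have : 0 ≤ (p + 1) / (4 * η) * (m ^ p * h ^ 2) := by positivity
      linarith
    · have h7 : d ^ 2 ≤ (p + 1) * m ^ p * (d * |a - b|) := by nlinarith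
      have hA : 0 ≤ d * |a - b| := by positivity
      rcases hA.eq_or_lt with hA0 | hA0
      · have : d = 0 := (mul_eq_zero.1 hA0.symm).resolve_right h0.ne'
        rw [this]
        have : 0 ≤ (p + 1) / (4 * η) * (m ^ p * h ^ 2) := by positivity
        linarith
      · set A := d * |a - b| with hAdef
        have h8 : (d * |h|) ^ 2 ≤ (p + 1) * (m ^ p * h ^ 2) * A := by
          rw [mul_pow, sq_abs h]
          nlinarith [mul_le_mul_of_nonneg_right h7 (sq_nonneg h)]
        set B := (p + 1) * (m ^ p * h ^ 2) with hB
        have e : (p + 1) / (4 * η) * (m ^ p * h ^ 2) = B / (4 * η) := by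
          rw [hB]
          ring
        have hB0 : 0 ≤ B := by positivity
        rw [e]
        refine le_of_sq_le_sq (h8.trans ?_) (by positivity)
        have e2 : (η * A + B / (4 * η)) ^ 2 = (η * A - B / (4 * η)) ^ 2 + B * A := by
          field_simp
          ring
        rw [e2]
        nlinarith [sq_nonneg (η * A - B / (4 * η))]
  rw [h2]
  refine h6.trans ?_
  have : 0 ≤ (p + 1) / (4 * η) := by positivity
  gcongr

/-- The pointwise inequality is applied to h/l, with l the natural size of h, so that all three
powers have integrals of order 1 + ∫ |G|^{p+2} and the factor l stands in front. -/
theorem integral_incr_mul_le {p n : ℝ} (hp : 0 ≤ p) (hn : 0 ≤ n) {G h : L2} {l X : ℝ}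
    (hG : Integrable fun x => |G x| ^ (p + 2)) (hh : Integrable fun x => |h x| ^ (p + 2))
    (hl : 0 < l) (hX : ∫ x, |h x| ^ (p + 2) ≤ X * l ^ (p + 2)) (z : Plane) {η : ℝ} (hη : 0 < η) :
    ∫ x, |incr z ((nonlin_powTrunc hp hn).app G) x| * |h x| ≤
      l * (η * inner ℝ (incr z ((nonlin_powTrunc hp hn).app G)) (incr z G) +
        (p + 1) / (4 * η) * (2 * (∫ x, |G x| ^ (p + 2)) + X)) := by
  set N := nonlin_powTrunc hp hn
  set f := N.app G with hf
  have hGz : Integrable fun x => |trans z G x| ^ (p + 2) := integrable_abs_rpow_trans z hG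
  have hpt : ∀ᵐ x : Plane, |incr z f x| * |h x| ≤ l * (η * (incr z f x * incr z G x) +
      (p + 1) / (4 * η) * (|G x| ^ (p + 2) + |trans z G x| ^ (p + 2) +
        (l ^ (p + 2))⁻¹ * |h x| ^ (p + 2))) := by
    filter_upwards [coeFn_incr z f, coeFn_incr z G, N.coeFn_app G, ae_sub z (N.coeFn_app G),
      coeFn_trans z G] with x h1 h2 h3 h4 h5
    rw [h1, h2, h5, hf, h3, h4]
    have h6 := abs_powTrunc_sub_mul_le hp hn hη (G x) (G (x - z)) (l⁻¹ * h x)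
    rw [abs_mul, abs_of_pos (inv_pos.2 hl), Real.mul_rpow (by positivity) (abs_nonneg _),
      Real.inv_rpow hl.le] at h6
    calc |powTrunc p n (G x) - powTrunc p n (G (x - z))| * |h x|
        = l * (|powTrunc p n (G x) - powTrunc p n (G (x - z))| * (l⁻¹ * |h x|)) := by
          field_simp
      _ ≤ _ := by gcongr
  have j1 := integrable_mul_L2 (incr z f) (incr z G)
  have j2 : Integrable fun x => |G x| ^ (p + 2) + |trans z G x| ^ (p + 2) +
      (l ^ (p + 2))⁻¹ * |h x| ^ (p + 2) :=
    integrable_fun_add (integrable_fun_add hG hGz) (hh.const_mul _)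
  have j3 : Integrable fun x => l * (η * (incr z f x * incr z G x) +
      (p + 1) / (4 * η) * (|G x| ^ (p + 2) + |trans z G x| ^ (p + 2) +
        (l ^ (p + 2))⁻¹ * |h x| ^ (p + 2))) :=
    (integrable_fun_add (j1.const_mul η) (j2.const_mul _)).const_mul l
  have hint : Integrable fun x => |incr z f x| * |h x| := by
    simpa only [abs_mul] using (integrable_mul_L2 (incr z f) h).abs
  have hlp : 0 < l ^ (p + 2) := Real.rpow_pos_of_pos hl _
  calc ∫ x, |incr z f x| * |h x| ≤ ∫ x, l * (η * (incr z f x * incr z G x) +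
        (p + 1) / (4 * η) * (|G x| ^ (p + 2) + |trans z G x| ^ (p + 2) +
        (l ^ (p + 2))⁻¹ * |h x| ^ (p + 2))) := integral_mono_ae hint j3 hpt
    _ = l * (η * inner ℝ (incr z f) (incr z G) + (p + 1) / (4 * η) *
        (2 * (∫ x, |G x| ^ (p + 2)) + (l ^ (p + 2))⁻¹ * ∫ x, |h x| ^ (p + 2))) := by
        rw [integral_const_mul, integral_add (j1.const_mul η) (j2.const_mul _), integral_const_mul,
          integral_const_mul, integral_add (integrable_fun_add hG hGz) (hh.const_mul _),
          integral_add hG hGz, integral_const_mul, integral_abs_rpow_trans, inner_eq_integral]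
        ring
    _ ≤ _ := by
        have h7 : (l ^ (p + 2))⁻¹ * ∫ x, |h x| ^ (p + 2) ≤ X := by
          rw [inv_mul_le_iff₀ hlp]
          linarith
        gcongr

/-! ### Absorption at a fixed scale -/

/-- A Gaussian with polynomial growth. -/
def heavy (z : Plane) : ℝ := (1 + ‖z‖) ^ 6 * gauss z

theorem integrable_heavy : Integrable heavy := by
  have hpi := Real.pi_gt_d2
  have hc : Continuous heavy := by
    unfold heavy gauss
    fun_prop
  refine ((integrable_exp_neg_sq (b := Real.pi - 3 / 2) (by linarith)).const_mul 64).mono'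
    hc.aestronglyMeasurable (.of_forall fun z => ?_)
  have hg := gauss_nonneg z
  rw [Real.norm_of_nonneg (by unfold heavy; positivity), heavy]
  have h1 : 1 + ‖z‖ ≤ 2 * Real.exp (‖z‖ ^ 2 / 4) := by
    have := Real.add_one_le_exp (‖z‖ ^ 2 / 4)
    nlinarith [sq_nonneg (‖z‖ - 1)]
  calc (1 + ‖z‖) ^ 6 * gauss z ≤ (2 * Real.exp (‖z‖ ^ 2 / 4)) ^ 6 * gauss z := by gcongr
    _ = 64 * Real.exp (-(Real.pi - 3 / 2) * ‖z‖ ^ 2) := by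
        rw [mul_pow, ← Real.exp_nat_mul, gauss, mul_assoc, ← Real.exp_add]
        push_cast
        ring_nf

theorem heavy_nonneg (z : Plane) : 0 ≤ heavy z := by
  have := gauss_nonneg z
  unfold heavy
  positivity

/-- The hypothesis on P holds for every η, so η may depend on s and on z. It is chosen to turn the
first term into the plain Gaussian average of N, which is the dissipation density; the polynomial
factors of the kernel then move to the remainder, where `heavy` makes them integrable. -/
theorem rpow_mul_abs_integral_dil_le {F P N : Plane → ℝ} {C γ b : ℝ} (hC : 0 < C)
    (hF : ∀ y, |F y| ≤ C * ((1 + ‖y‖) ^ 2 * gauss y)) (hγ : 0 ≤ γ) (hγ' : γ ≤ 1) (hb : 0 ≤ b)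
    (hN : ∀ z, 0 ≤ N z)
    (hP : ∀ᵐ z : Plane, ∀ η : ℝ, 0 < η → |P z| ≤ ‖z‖ ^ γ * (η * N z + b / η)) {s : ℝ} (hs : 0 < s)
    (hNi : Integrable fun z => dil gauss s z * N z) (e r : ℝ) {η : ℝ} (hη : 0 < η) :
    s ^ e * |∫ z, dil F s z * P z| ≤ η * (s ^ r * ∫ z, dil gauss s z * N z) +
      C ^ 2 * (∫ y, heavy y) * b / η * s ^ (2 * e + γ - r) := by
  have hi : Integrable fun z => η * s ^ r * (dil gauss s z * N z) +
      C ^ 2 * b / η * s ^ (2 * e + γ - r) * dil heavy s z :=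
    integrable_fun_add (hNi.const_mul _) ((integrable_dil integrable_heavy hs).const_mul _)
  have hse : 0 < s ^ e := Real.rpow_pos_of_pos hs e
  have hpt : ∀ᵐ z : Plane, ‖s ^ e * (dil F s z * P z)‖ ≤ η * s ^ r * (dil gauss s z * N z) +
      C ^ 2 * b / η * s ^ (2 * e + γ - r) * dil heavy s z := by
    filter_upwards [hP] with z hPz
    set y := (Real.sqrt s)⁻¹ • z with hy
    set κ := 1 + ‖y‖ with hκ
    have hκ1 : 1 ≤ κ := le_add_of_nonneg_right (norm_nonneg y)
    have hκ0 : 0 < κ := by linarith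
    have hg := gauss_nonneg y
    have hz : ‖z‖ ^ γ ≤ s ^ (γ / 2) * κ := by
      have h1 : ‖z‖ = Real.sqrt s * ‖y‖ := by
        have : 0 < Real.sqrt s := Real.sqrt_pos.2 hs
        rw [hy, norm_smul, norm_inv, Real.norm_of_nonneg this.le, mul_inv_cancel_left₀ this.ne']
      rw [h1, Real.mul_rpow (Real.sqrt_nonneg s) (norm_nonneg y), Real.sqrt_eq_rpow,
        ← Real.rpow_mul hs.le]
      have h2 : ‖y‖ ^ γ ≤ κ := (Real.rpow_le_rpow (norm_nonneg y)
        (show ‖y‖ ≤ κ by linarith) hγ).trans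
        (by simpa using Real.rpow_le_rpow_of_exponent_le hκ1 hγ')
      have h3 : s ^ (1 / 2 * γ) = s ^ (γ / 2) := by ring_nf
      rw [h3]
      gcongr
    -- Of the factor κ³, two powers come from the growth of the kernel and one from ‖z‖^γ ≤
    -- s^{γ/2}κ. The remainder carries the inverse of t, hence κ⁶ in total.
    set t := η * s ^ (r - e - γ / 2) / (C * κ ^ 3) with ht
    have hts : 0 < s ^ (r - e - γ / 2) := Real.rpow_pos_of_pos hs _
    have ht0 : 0 < t := by positivity
    have h3 := hPz t ht0
    have hNz := hN z
    have hb' : 0 ≤ t * N z + b / t := by positivity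
    have hdF : |dil F s z| ≤ s⁻¹ * (C * (κ ^ 2 * gauss y)) := by
      rw [dil, abs_mul, abs_of_pos (inv_pos.2 hs)]
      gcongr
      exact hF y
    have hγs : 0 ≤ s ^ (γ / 2) := by positivity
    have e1 : s ^ e * s ^ (γ / 2) * s ^ (r - e - γ / 2) = s ^ r := by
      rw [← Real.rpow_add hs, ← Real.rpow_add hs]
      ring_nf
    have e2 : s ^ e * s ^ (γ / 2) * (s ^ (r - e - γ / 2))⁻¹ = s ^ (2 * e + γ - r) := by
      rw [← Real.rpow_neg hs.le, ← Real.rpow_add hs, ← Real.rpow_add hs]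
      ring_nf
    rw [norm_mul, norm_mul, Real.norm_of_nonneg hse.le, Real.norm_eq_abs, Real.norm_eq_abs]
    calc s ^ e * (|dil F s z| * |P z|)
        ≤ s ^ e * ((s⁻¹ * (C * (κ ^ 2 * gauss y))) * (s ^ (γ / 2) * κ * (t * N z + b / t))) := by
          have h4 : |P z| ≤ s ^ (γ / 2) * κ * (t * N z + b / t) := h3.trans (by gcongr)
          gcongr
      _ = η * (s ^ e * s ^ (γ / 2) * s ^ (r - e - γ / 2)) * (s⁻¹ * gauss y * N z) +
          C ^ 2 * b / η * (s ^ e * s ^ (γ / 2) * (s ^ (r - e - γ / 2))⁻¹) *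
            (s⁻¹ * (κ ^ 6 * gauss y)) := by
          rw [ht]
          field_simp
      _ = _ := by
          rw [e1, e2]
          rfl
  calc s ^ e * |∫ z, dil F s z * P z| = ‖∫ z, s ^ e * (dil F s z * P z)‖ := by
        rw [integral_const_mul, norm_mul, Real.norm_of_nonneg hse.le, Real.norm_eq_abs]
    _ ≤ ∫ z, (η * s ^ r * (dil gauss s z * N z) +
        C ^ 2 * b / η * s ^ (2 * e + γ - r) * dil heavy s z) := norm_integral_le_of_norm_le hi hpt
    _ = _ := by
        rw [integral_add (hNi.const_mul _) ((integrable_dil integrable_heavy hs).const_mul _),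
          integral_const_mul, integral_const_mul, integral_dil _ hs]
        ring

theorem abs_gauss₁_le (i : Fin 2) (y : Plane) :
    |gauss₁ i y| ≤ (2 * Real.pi * (1 + 2 * Real.pi)) * ((1 + ‖y‖) ^ 2 * gauss y) := by
  have hpi := Real.pi_pos
  have hg := gauss_nonneg y
  have h1 := abs_coord_le i y
  have hy := norm_nonneg y
  rw [gauss₁, abs_mul, abs_mul, abs_mul, abs_of_nonneg hg, abs_of_pos hpi]
  have h2 : |(-2 : ℝ)| = 2 := by norm_num
  rw [h2]
  have h3 : |y i| ≤ (1 + 2 * Real.pi) * (1 + ‖y‖) ^ 2 := by nlinarith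
  calc 2 * Real.pi * (|y i| * gauss y) ≤
        2 * Real.pi * ((1 + 2 * Real.pi) * (1 + ‖y‖) ^ 2 * gauss y) := by gcongr
    _ = _ := by ring

theorem abs_gauss₂_le (i j : Fin 2) (y : Plane) :
    |gauss₂ i j y| ≤ (2 * Real.pi * (1 + 2 * Real.pi)) * ((1 + ‖y‖) ^ 2 * gauss y) := by
  have hpi := Real.pi_pos
  have hg := gauss_nonneg y
  have h1 := abs_coord_le i y
  have h1' := abs_coord_le j y
  have hy := norm_nonneg y
  have h2 : |(-2 : ℝ)| = 2 := by norm_num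
  have h3 : |(if i = j then (1 : ℝ) else 0) + -2 * Real.pi * (y i * y j)| ≤
      (1 + 2 * Real.pi) * (1 + ‖y‖) ^ 2 := by
    have h4 : |(if i = j then (1 : ℝ) else 0)| ≤ 1 := by split_ifs <;> simp
    have h5 : |y i * y j| ≤ ‖y‖ * ‖y‖ := by
      rw [abs_mul]
      gcongr
    refine (abs_add_le _ _).trans ?_
    rw [abs_mul, abs_mul, h2, abs_of_pos hpi]
    have h6 : 2 * Real.pi * |y i * y j| ≤ 2 * Real.pi * (‖y‖ * ‖y‖) := by gcongr
    nlinarith [mul_nonneg hpi.le hy]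
  rw [gauss₂, abs_mul, abs_mul, abs_mul, abs_of_nonneg hg, abs_of_pos hpi, h2]
  calc 2 * Real.pi * |(if i = j then (1 : ℝ) else 0) + -2 * Real.pi * (y i * y j)| * gauss y ≤
        2 * Real.pi * ((1 + 2 * Real.pi) * (1 + ‖y‖) ^ 2) * gauss y := by gcongr
    _ = _ := by ring

/-! ### The growth of the truncated energy -/

/-- The constant in the pointwise bounds of the derivatives of the Gaussian. -/
def kerConst : ℝ := 2 * Real.pi * (1 + 2 * Real.pi)

theorem kerConst_pos : 0 < kerConst := by
  have := Real.pi_pos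
  unfold kerConst
  positivity

theorem integral_heavy_nonneg : 0 ≤ ∫ y, heavy y := integral_nonneg heavy_nonneg

theorem two_mul_dirich {s : ℝ} (hs : 0 < s) (f w : L2) :
    ∫ z, dil gauss s z * inner ℝ (incr z f) (incr z w) = 2 * dirich s f w := by
  rw [dirich_eq_integral hs]
  ring

theorem abs_commForm_le {f u θ : L2} {k : ℝ} (hθ : ∀ᵐ x : Plane, |θ x| ≤ k) (z : Plane) :
    |commForm f u θ z| ≤ k * ∫ x, |incr z f x| * |incr z u x| := by
  have hi : Integrable fun x => |incr z f x| * |incr z u x| := by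
    simpa only [abs_mul] using (integrable_mul_L2 (incr z f) (incr z u)).abs
  rw [← integral_const_mul, ← Real.norm_eq_abs]
  refine norm_integral_le_of_norm_le (hi.const_mul k) ?_
  filter_upwards [coeFn_trans z θ, ae_sub z hθ] with x h1 h2
  rw [Real.norm_eq_abs, abs_mul, abs_mul, h1, mul_comm]
  gcongr

section Absorb

variable {p n : ℝ} (hp : 0 ≤ p) (hn : 0 ≤ n) {G : L2}

/-- The increment of the velocity plays the role of h with l = ‖z‖^γ, and θ is bounded by k. The
remaining exponent is 2(α/2 - 2) + γ + 1 + α/2. -/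
theorem comm_absorb {α γ A k η : ℝ} (hγ : 0 ≤ γ) (hγ' : γ ≤ 1) (hA : 0 ≤ A) (hk : 0 < k)
    (hη : 0 < η) (hG : Integrable fun x => |G x| ^ (p + 2)) {u θ : L2}
    (hθ : ∀ᵐ x : Plane, |θ x| ≤ k)
    (hu : ∀ z, Integrable (fun x => |incr z u x| ^ (p + 2)) ∧
      ∫ x, |incr z u x| ^ (p + 2) ≤ A * (1 + ∫ x, |G x| ^ (p + 2)) * (‖z‖ ^ γ) ^ (p + 2))
    (j : Fin 2) {s : ℝ} (hs : 0 < s) :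
    s ^ (α / 2 - 2) * |∫ z, dil (gauss₂ 0 j) s z *
        commForm ((nonlin_powTrunc hp hn).app G) u θ z| ≤
      2 * η * (s ^ (-1 - α / 2) * dirich s ((nonlin_powTrunc hp hn).app G) G) +
        kerConst ^ 2 * (∫ y, heavy y) * (k ^ 2 * (p + 1) / 4 * (2 + A)) / η *
          (1 + ∫ x, |G x| ^ (p + 2)) * s ^ (3 * α / 2 - 3 + γ) := by
  set f := (nonlin_powTrunc hp hn).app G with hf
  set E := ∫ x, |G x| ^ (p + 2) with hE
  have hE0 : 0 ≤ E := integral_nonneg fun x => by positivity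
  have h := rpow_mul_abs_integral_dil_le (F := gauss₂ 0 j) (P := commForm f u θ)
    (N := fun z => inner ℝ (incr z f) (incr z G)) (γ := γ)
    (b := k ^ 2 * (p + 1) / 4 * (2 + A) * (1 + E)) kerConst_pos (abs_gauss₂_le 0 j) hγ hγ'
    (by positivity) (fun z => (nonlin_powTrunc hp hn).inner_incr_nonneg G z)
    (ae_norm_pos.mono fun z hz t ht => ?_) hs (integrable_dil_gauss_incr hs f G)
    (α / 2 - 2) (-1 - α / 2) hη
  · rw [two_mul_dirich hs] at h
    refine h.trans_eq ?_
    have e : 2 * (α / 2 - 2) + γ - (-1 - α / 2) = 3 * α / 2 - 3 + γ := by ring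
    rw [e]
    ring
  · have hl : 0 < ‖z‖ ^ γ := Real.rpow_pos_of_pos hz _
    -- The parameter t/k compensates the factor k coming from θ, leaving t in front of the
    -- dissipation and k²/t in the remainder.
    have h1 := integral_incr_mul_le hp hn hG (hu z).1 hl (hu z).2 z (div_pos ht hk)
    refine (abs_commForm_le hθ z).trans ((mul_le_mul_of_nonneg_left h1 hk.le).trans ?_)
    have h2 : 2 * E + A * (1 + E) ≤ (2 + A) * (1 + E) := by linarith
    calc k * (‖z‖ ^ γ * (t / k * inner ℝ (incr z f) (incr z G) +
          (p + 1) / (4 * (t / k)) * (2 * E + A * (1 + E))))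
        ≤ k * (‖z‖ ^ γ * (t / k * inner ℝ (incr z f) (incr z G) +
          (p + 1) / (4 * (t / k)) * ((2 + A) * (1 + E)))) := by gcongr
      _ = _ := by
        field_simp

/-- The same mechanism with θ(· - z) in place of the velocity increment. It carries no power of ‖z‖,
so γ = 0. -/
theorem lin_absorb {α A η : ℝ} (hA : 0 ≤ A) (hη : 0 < η)
    (hG : Integrable fun x => |G x| ^ (p + 2)) {θ : L2}
    (hθ : Integrable fun x => |θ x| ^ (p + 2)) (hθA : ∫ x, |θ x| ^ (p + 2) ≤ A)
    {s : ℝ} (hs : 0 < s) :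
    s ^ (α - 2) * |∫ z, dil (gauss₁ 0) s z *
        inner ℝ (incr z ((nonlin_powTrunc hp hn).app G)) (trans z θ)| ≤
      2 * η * (s ^ (-1 - α / 2) * dirich s ((nonlin_powTrunc hp hn).app G) G) +
        kerConst ^ 2 * (∫ y, heavy y) * ((p + 1) / 4 * (2 + A)) / η *
          (1 + ∫ x, |G x| ^ (p + 2)) * s ^ (5 * α / 2 - 3) := by
  set f := (nonlin_powTrunc hp hn).app G with hf
  set E := ∫ x, |G x| ^ (p + 2) with hE
  have hE0 : 0 ≤ E := integral_nonneg fun x => by positivity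
  have h := rpow_mul_abs_integral_dil_le (F := gauss₁ 0)
    (P := fun z => inner ℝ (incr z f) (trans z θ))
    (N := fun z => inner ℝ (incr z f) (incr z G)) (γ := 0)
    (b := (p + 1) / 4 * (2 + A) * (1 + E)) kerConst_pos (abs_gauss₁_le 0) le_rfl zero_le_one
    (by positivity) (fun z => (nonlin_powTrunc hp hn).inner_incr_nonneg G z)
    (.of_forall fun z t ht => ?_) hs (integrable_dil_gauss_incr hs f G)
    (α - 2) (-1 - α / 2) hη
  · rw [two_mul_dirich hs] at h
    refine h.trans_eq ?_
    have e : 2 * (α - 2) + 0 - (-1 - α / 2) = 5 * α / 2 - 3 := by ring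
    rw [e]
    ring
  · have h1 := integral_incr_mul_le hp hn hG (integrable_abs_rpow_trans z hθ) zero_lt_one
      (X := A) (by rw [integral_abs_rpow_trans, Real.one_rpow, mul_one]; exact hθA) z ht
    refine (abs_inner_le_integral _ _).trans (h1.trans ?_)
    have h2 : 2 * E + A ≤ (2 + A) * (1 + E) := by nlinarith
    rw [Real.rpow_zero]
    calc 1 * (t * inner ℝ (incr z f) (incr z G) + (p + 1) / (4 * t) * (2 * E + A))
        ≤ 1 * (t * inner ℝ (incr z f) (incr z G) +
          (p + 1) / (4 * t) * ((2 + A) * (1 + E))) := by gcongr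
      _ = _ := by
        field_simp

/-- Hölder-type bound without dissipation: |G|^{p+1}|θ| is at most |G|^{p+2} + |θ|^{p+2}, and the
`L¹` norm of the dilated kernel does not depend on s. -/
theorem lin_crude {A : ℝ} (hA : 0 ≤ A) (hG : Integrable fun x => |G x| ^ (p + 2)) {θ : L2}
    (hθ : Integrable fun x => |θ x| ^ (p + 2)) (hθA : ∫ x, |θ x| ^ (p + 2) ≤ A)
    {s : ℝ} (hs : 0 < s) :
    |∫ z, dil (gauss₁ 0) s z * inner ℝ ((nonlin_powTrunc hp hn).app G) (trans z θ)| ≤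
      (∫ y, |gauss₁ 0 y|) * (1 + A) * (1 + ∫ x, |G x| ^ (p + 2)) := by
  set f := (nonlin_powTrunc hp hn).app G with hf
  set E := ∫ x, |G x| ^ (p + 2) with hE
  have hE0 : 0 ≤ E := integral_nonneg fun x => by positivity
  obtain ⟨C, hC⟩ := gaussKernel_gauss₁ 0
  have hb : ∀ z, |inner ℝ f (trans z θ)| ≤ (1 + A) * (1 + E) := by
    intro z
    have hθz := integrable_abs_rpow_trans z hθ
    have hi : Integrable fun x => |f x| * |trans z θ x| := by
      simpa only [abs_mul] using (integrable_mul_L2 f (trans z θ)).abs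
    have hpt : ∀ᵐ x : Plane, |f x| * |trans z θ x| ≤ |G x| ^ (p + 2) + |trans z θ x| ^ (p + 2) := by
      filter_upwards [(nonlin_powTrunc hp hn).coeFn_app G] with x h1
      rw [hf, h1]
      have h2 := abs_powTrunc_le hp hn (G x)
      set a := |G x|
      set b := |trans z θ x|
      have ha : 0 ≤ a := abs_nonneg _
      have hb : 0 ≤ b := abs_nonneg _
      have hadd : ∀ x : ℝ, 0 ≤ x → x ^ (p + 2) = x ^ p * x * x := fun x hx => by
        rw [Real.rpow_add' hx (by linarith), Real.rpow_two]
        ring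
      have hap : 0 ≤ a ^ (p + 2) := by positivity
      have hbp : 0 ≤ b ^ (p + 2) := by positivity
      have h3 : a ^ p * a * b ≤ a ^ (p + 2) + b ^ (p + 2) := by
        rcases le_total a b with hab | hab
        · have : a ^ p * a * b ≤ b ^ (p + 2) := by
            rw [hadd b hb]
            gcongr
          linarith
        · have : a ^ p * a * b ≤ a ^ (p + 2) := by
            rw [hadd a ha]
            gcongr
          linarith
      exact (mul_le_mul_of_nonneg_right h2 hb).trans h3
    refine (abs_inner_le_integral _ _).trans ((integral_mono_ae hi
      (integrable_fun_add hG hθz) hpt).trans ?_)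
    rw [integral_add hG hθz, integral_abs_rpow_trans]
    nlinarith
  rw [← Real.norm_eq_abs]
  have hd := integrable_dil hC.integrable hs
  have h := norm_integral_le_of_norm_le (f := fun z => dil (gauss₁ 0) s z * inner ℝ f (trans z θ))
    (hd.abs.mul_const ((1 + A) * (1 + E))) (.of_forall fun z => by
      rw [norm_mul, Real.norm_eq_abs, Real.norm_eq_abs]
      gcongr
      exact hb z)
  refine h.trans_eq ?_
  have e : ∫ z, |dil (gauss₁ 0) s z| = ∫ y, |gauss₁ 0 y| := by
    rw [← integral_dil (fun y => |gauss₁ 0 y|) hs]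
    refine integral_congr_ae (.of_forall fun z => ?_)
    simp only [dil]
    rw [abs_mul, abs_of_pos (inv_pos.2 hs)]
  rw [integral_mul_const, e, mul_assoc]

end Absorb

/-- The majorant of the time scales. -/
def scaleBound (α s : ℝ) : ℝ :=
  if s ≤ 1 then s ^ (5 * α / 4 - 2) + s ^ (5 * α / 2 - 3) else s ^ (3 * α / 2 - 3) + s ^ (α - 2)

/-- At s = 0 each of the exponents 5α/4 - 2 and 5α/2 - 3 exceeds -1 precisely when α > 4/5. At
infinity the exponents 3α/2 - 3 and α - 2 are below -1 because α < 1. -/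
theorem integrableOn_scaleBound {α : ℝ} (hα : 4 / 5 < α) (hα' : α < 1) :
    IntegrableOn (scaleBound α) (Ioi 0) := by
  rw [← Ioc_union_Ioi_eq_Ioi zero_le_one]
  refine IntegrableOn.union ?_ ?_
  · have h : ∀ r : ℝ, -1 < r → IntegrableOn (fun s : ℝ => s ^ r) (Ioc 0 1) := fun r hr => by
      rw [← intervalIntegrable_iff_integrableOn_Ioc_of_le zero_le_one]
      exact intervalIntegral.intervalIntegrable_rpow' hr
    refine ((h (5 * α / 4 - 2) (by linarith)).add (h (5 * α / 2 - 3) (by linarith))).congr_fun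
      (fun s hs => ?_) measurableSet_Ioc
    simp only [scaleBound, if_pos hs.2, Pi.add_apply]
  · refine ((integrableOn_Ioi_rpow_of_lt (a := 3 * α / 2 - 3) (by linarith) zero_lt_one).add
      (integrableOn_Ioi_rpow_of_lt (a := α - 2) (by linarith) zero_lt_one)).congr_fun
      (fun s hs => ?_) measurableSet_Ioi
    simp only [scaleBound, if_neg (not_le.2 (show (1 : ℝ) < s from hs)), Pi.add_apply]

theorem scaleBound_nonneg (α : ℝ) {s : ℝ} (hs : 0 < s) : 0 ≤ scaleBound α s := by
  unfold scaleBound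
  split_ifs <;> positivity

-- Dissipation, commutator and linear term are written as integrals over the same variable s and
-- compared at each s. The dissipation density absorbs its share, and (1 + E) times a constant
-- multiple of `scaleBound` remains. The constant depends on R but not on the truncation level n or
-- on K.
set_option maxHeartbeats 1000000 in
theorem exists_growth_bound {α p : ℝ} (hα : 4 / 5 < α) (hα' : α < 1) (hp : 0 < p) (hp' : p ≤ 2)
    (R : ℝ) : ∃ C : ℝ, 0 ≤ C ∧
    ∀ (u : Fin 2 → L2) (K : ℝ) (θ : L2), Solenoidal u K → InH 2 θ → (∀ i, ‖u i‖ ≤ R) → ‖θ‖ ≤ R →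
      (∀ᵐ x : Plane, |θ x| ≤ R) → ∀ (n : ℝ) (hn : 0 ≤ n),
      -inner ℝ ((nonlin_powTrunc hp.le hn).app (combined α u θ)) (fracLap α (combined α u θ)) +
          commTerm α u θ ((nonlin_powTrunc hp.le hn).app (combined α u θ)) +
          inner ℝ ((nonlin_powTrunc hp.le hn).app (combined α u θ)) (rieszOp (2 * α - 1) θ) ≤
        C * (1 + ∫ x, |combined α u θ x| ^ (p + 2)) := by
  -- The exponent γ = 1 - α/4 lies between 2 - 3α/2 and α, both inequalities being equivalent to α >
  -- 4/5; it serves for s ≤ 1. The choice γ = 0 below serves for s > 1, where decay in s is needed.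
  obtain ⟨A₀, hA₀, b₀⟩ := exists_increment_bound (α := α) (γ := 1 - α / 4) (q := p + 2)
    (by linarith) hα' (by linarith) (by linarith) (by linarith) (by linarith) R
  obtain ⟨A₁, hA₁, b₁⟩ := exists_increment_bound (α := α) (γ := 0) (q := p + 2)
    (by linarith) hα' le_rfl (by linarith) (by linarith) (by linarith) R
  -- The added 1 keeps k positive, since the absorption divides by it.
  set k := |R| + 1 with hk
  have hk0 : 0 < k := by positivity
  have hL := lapConst_pos (a := α) (by linarith) (by linarith)
  have hc₁ := potConst_pos (a := α) (by linarith)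
  have hc₂ := potConst_pos (a := 2 * α - 1) (by linarith)
  set L := lapConst α
  set c₁ := potConst α
  set c₂ := potConst (2 * α - 1)
  -- For s ≤ 1 each of the two commutator components uses a quarter of the dissipation and the
  -- linear term, through η₂, the remaining half.
  set η₁ := L / (8 * c₁) with hη₁
  set η₂ := L / (4 * c₂) with hη₂
  have hη₁0 : 0 < η₁ := by positivity
  have hη₂0 : 0 < η₂ := by positivity
  set B := |R| ^ p * |R| ^ 2 with hB
  have hB0 : 0 ≤ B := by positivity
  have hheavy := integral_heavy_nonneg
  have hker := kerConst_pos
  set m₀ := kerConst ^ 2 * (∫ y, heavy y) * (k ^ 2 * (p + 1) / 4 * (2 + A₀)) / η₁ with hm₀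
  set m₁ := kerConst ^ 2 * (∫ y, heavy y) * (k ^ 2 * (p + 1) / 4 * (2 + A₁)) / η₁ with hm₁
  set m₂ := kerConst ^ 2 * (∫ y, heavy y) * ((p + 1) / 4 * (2 + B)) / η₂ with hm₂
  set m₃ := (∫ y, |gauss₁ 0 y|) * (1 + B) with hm₃
  have hm₀0 : 0 ≤ m₀ := by positivity
  have hm₁0 : 0 ≤ m₁ := by positivity
  have hm₂0 : 0 ≤ m₂ := by positivity
  have hm₃0 : 0 ≤ m₃ := mul_nonneg (integral_nonneg fun y => abs_nonneg _) (by positivity)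
  set m := 2 * c₁ * m₀ + 2 * c₁ * m₁ + c₂ * m₂ + c₂ * m₃ with hm
  have hS := integrableOn_scaleBound hα hα'
  have hS0 : 0 ≤ ∫ s in Ioi (0 : ℝ), scaleBound α s :=
    setIntegral_nonneg measurableSet_Ioi fun s hs => scaleBound_nonneg α hs
  refine ⟨m * ∫ s in Ioi (0 : ℝ), scaleBound α s, by positivity,
    fun u K θ hu hθ huR hθR hθb n hn => ?_⟩
  set G := combined α u θ with hGdef
  have hGH : InH 1 G := hu.inH_combined hθ (by linarith) hα'.le
  have hGi : Integrable fun x => |G x| ^ (p + 2) := hGH.integrable_rpow (by linarith) (by linarith)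
  set N := nonlin_powTrunc hp.le hn
  set f := N.app G with hf
  have hfH : InH 1 f := (N.inH_app hGH).1
  have hR0 : 0 ≤ R := (norm_nonneg _).trans hθR
  have hθk : ∀ᵐ x : Plane, |θ x| ≤ k := hθb.mono fun x hx => by
    have := le_abs_self R
    linarith
  obtain ⟨hθi, hθq⟩ := integrable_rpow_of_bdd hθb (q := p + 2) (by linarith)
  have hθB : ∫ x, |θ x| ^ (p + 2) ≤ B := by
    refine hθq.trans ?_
    rw [add_sub_cancel_right, hB, abs_of_nonneg hR0]
    gcongr
  set E := ∫ x, |G x| ^ (p + 2) with hE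
  have hE0 : 0 ≤ E := integral_nonneg fun x => by positivity
  obtain ⟨d1, d2⟩ := inner_fracLap (a := α) (by linarith) (by linarith) f
    (hGH.mono (s := α) (by linarith) hα'.le)
  obtain ⟨τ, t1, t2, t3⟩ := commTerm_eq hu (by linarith) hα'.le hθ hθk hfH
  obtain ⟨ρ, r1, r2, r3⟩ := inner_rieszOp_linear (a := 2 * α - 1) (by linarith) (by linarith)
    hθ.one f
  rw [d2, t2, r2]
  have hsum : IntegrableOn (fun s : ℝ => -L * (s ^ (-1 - α / 2) * dirich s f G) +
      c₁ * (s ^ (α / 2 - 1) * τ s)) (Ioi 0) := (d1.const_mul (-L)).add (t1.const_mul c₁)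
  have htot : -(L * ∫ s in Ioi (0 : ℝ), s ^ (-1 - α / 2) * dirich s f G) +
      c₁ * (∫ s in Ioi (0 : ℝ), s ^ (α / 2 - 1) * τ s) +
      c₂ * (∫ s in Ioi (0 : ℝ), s ^ ((2 * α - 1) / 2 - 1) * ρ s) =
      ∫ s in Ioi (0 : ℝ), (-L * (s ^ (-1 - α / 2) * dirich s f G) + c₁ * (s ^ (α / 2 - 1) * τ s) +
        c₂ * (s ^ ((2 * α - 1) / 2 - 1) * ρ s)) := by
    rw [integral_add hsum (r1.const_mul c₂), integral_add (d1.const_mul (-L)) (t1.const_mul c₁), integral_const_mul, integral_const_mul,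
      integral_const_mul]
    ring
  rw [htot, mul_assoc, mul_comm _ (1 + E), ← mul_assoc, ← integral_const_mul]
  refine setIntegral_mono_on (hsum.add (r1.const_mul c₂))
    (hS.const_mul _) measurableSet_Ioi fun s hs => ?_
  have hs' : 0 < s := hs
  obtain ⟨-, hτ⟩ := t3 s hs
  obtain ⟨hρ, hρ'⟩ := r3 s hs
  set I₀ := ∫ z, dil (gauss₂ 0 0) s z * commForm f (u 0) θ z
  set I₁ := ∫ z, dil (gauss₂ 0 1) s z * commForm f (u 1) θ z
  set D := s ^ (-1 - α / 2) * dirich s f G with hD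
  have hcomm : c₁ * (s ^ (α / 2 - 1) * τ s) ≤
      c₁ * (s ^ (α / 2 - 2) * |I₀| + s ^ (α / 2 - 2) * |I₁|) := by
    have e : s ^ (α / 2 - 1) * τ s = s ^ (α / 2 - 2) * (-I₀ + -I₁) := by
      have e1 : s ^ (α / 2 - 2) = s ^ (α / 2 - 1) * s⁻¹ := by
        rw [← Real.rpow_neg_one, ← Real.rpow_add hs']
        ring_nf
      rw [hτ, e1]
      ring
    have h1 := neg_le_abs I₀
    have h2 := neg_le_abs I₁
    rw [e, ← mul_add]
    gcongr
  have hlin : ∀ J : ℝ, ρ s = (Real.sqrt s)⁻¹ * J →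
      c₂ * (s ^ ((2 * α - 1) / 2 - 1) * ρ s) ≤ c₂ * (s ^ (α - 2) * |J|) := by
    intro J hJ
    have e1 : s ^ (α - 2) = s ^ ((2 * α - 1) / 2 - 1) * (Real.sqrt s)⁻¹ := by
      rw [Real.sqrt_eq_rpow, ← Real.rpow_neg hs'.le, ← Real.rpow_add hs']
      ring_nf
    have h1 := le_abs_self J
    rw [hJ, ← mul_assoc (s ^ ((2 * α - 1) / 2 - 1)), ← e1]
    gcongr
  have e₁ : c₁ * (2 * η₁ * D) = L / 4 * D := by
    rw [hη₁]
    field_simp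
    ring
  have e₂ : c₂ * (2 * η₂ * D) = L / 2 * D := by
    rw [hη₂]
    field_simp
    ring
  have hD0 : 0 ≤ D := mul_nonneg (by positivity) (N.dirich_nonneg G hs)
  have hLD : 0 ≤ L * D := by positivity
  rcases le_or_gt s 1 with hs1 | hs1
  · have q₀ := comm_absorb (α := α) hp.le hn (by linarith) (by linarith) hA₀ hk0 hη₁0 hGi hθk
      (fun z => b₀ u K θ hu hθ huR hθR hθb 0 z) 0 hs'
    have q₁ := comm_absorb (α := α) hp.le hn (by linarith) (by linarith) hA₀ hk0 hη₁0 hGi hθk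
      (fun z => b₀ u K θ hu hθ huR hθR hθb 1 z) 1 hs'
    have q₂ := lin_absorb (α := α) hp.le hn hB0 hη₂0 hGi hθi hθB hs'
    have h₀ := mul_le_mul_of_nonneg_left q₀ hc₁.le
    have h₁ := mul_le_mul_of_nonneg_left q₁ hc₁.le
    have h₂ := (hlin _ hρ').trans (mul_le_mul_of_nonneg_left q₂ hc₂.le)
    rw [mul_add, e₁] at h₀ h₁
    rw [mul_add, e₂] at h₂
    have ee : 3 * α / 2 - 3 + (1 - α / 4) = 5 * α / 4 - 2 := by ring
    rw [ee] at h₀ h₁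
    rw [scaleBound, if_pos hs1]
    set x := s ^ (5 * α / 4 - 2)
    set y := s ^ (5 * α / 2 - 3)
    have hx : 0 ≤ x := by positivity
    have hy : 0 ≤ y := by positivity
    have w1 : 2 * (c₁ * (m₀ * (1 + E) * x)) + c₂ * (m₂ * (1 + E) * y) ≤
        m * (1 + E) * (x + y) := by
      have : m * (1 + E) * (x + y) - (2 * (c₁ * (m₀ * (1 + E) * x)) + c₂ * (m₂ * (1 + E) * y)) =
          (2 * c₁ * m₁ + c₂ * m₃) * (1 + E) * (x + y) + 2 * c₁ * m₀ * (1 + E) * y +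
            c₂ * m₂ * (1 + E) * x := by
        rw [hm]
        ring
      have : 0 ≤ (2 * c₁ * m₁ + c₂ * m₃) * (1 + E) * (x + y) + 2 * c₁ * m₀ * (1 + E) * y +
            c₂ * m₂ * (1 + E) * x := by positivity
      linarith
    linarith
  · have q₀ := comm_absorb (α := α) hp.le hn le_rfl zero_le_one hA₁ hk0 hη₁0 hGi hθk
      (fun z => b₁ u K θ hu hθ huR hθR hθb 0 z) 0 hs'
    have q₁ := comm_absorb (α := α) hp.le hn le_rfl zero_le_one hA₁ hk0 hη₁0 hGi hθk
      (fun z => b₁ u K θ hu hθ huR hθR hθb 1 z) 1 hs'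
    have q₂ := lin_crude hp.le hn hB0 hGi hθi hθB hs'
    have h₀ := mul_le_mul_of_nonneg_left q₀ hc₁.le
    have h₁ := mul_le_mul_of_nonneg_left q₁ hc₁.le
    set y := s ^ (α - 2) with hy
    have hy0 : 0 ≤ y := by positivity
    have h₂ := (hlin _ hρ).trans
      (mul_le_mul_of_nonneg_left (mul_le_mul_of_nonneg_left q₂ hy0) hc₂.le)
    rw [mul_add, e₁, add_zero] at h₀ h₁
    rw [scaleBound, if_neg (not_le.2 hs1)]
    set x := s ^ (3 * α / 2 - 3)
    have hx : 0 ≤ x := by positivity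
    have w1 : 2 * (c₁ * (m₁ * (1 + E) * x)) + c₂ * (y * (m₃ * (1 + E))) ≤
        m * (1 + E) * (x + y) := by
      have : m * (1 + E) * (x + y) - (2 * (c₁ * (m₁ * (1 + E) * x)) + c₂ * (y * (m₃ * (1 + E)))) =
          (2 * c₁ * m₀ + c₂ * m₂) * (1 + E) * (x + y) + 2 * c₁ * m₁ * (1 + E) * y +
            c₂ * m₃ * (1 + E) * x := by
        rw [hm]
        ring
      have : 0 ≤ (2 * c₁ * m₀ + c₂ * m₂) * (1 + E) * (x + y) + 2 * c₁ * m₁ * (1 + E) * y +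
            c₂ * m₃ * (1 + E) * x := by positivity
      linarith
    linarith

/-! ### Conclusion by Gronwall's inequality -/

theorem Solenoidal.norm_combined_le {u : Fin 2 → L2} {K α B : ℝ} (h : Solenoidal u K) (hα : 0 ≤ α)
    (hα' : α ≤ 1) {θ : L2} (hθ : InH 2 θ) (hu : ∀ i, ‖u i‖ ≤ B ∧ ‖absD 2 (u i)‖ ≤ B)
    (hθB : ‖θ‖ ≤ B ∧ ‖absD 2 θ‖ ≤ B) :
    ‖combined α u θ‖ ≤ (8 * Real.pi + 2 * rieszConst α) * B ∧
      ‖absD 1 (combined α u θ)‖ ≤ (8 * Real.pi + 2 * rieszConst α) * B := by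
  have hpi := Real.pi_pos
  have hr := rieszConst_nonneg α
  have hB : 0 ≤ B := (norm_nonneg _).trans hθB.1
  have h1 := inH_partialD 0 (h.inH 1)
  have h2 := inH_partialD 1 (h.inH 0)
  have h3 := inH_rieszOp hα hα' hθ
  constructor
  · have hp : ∀ i j, ‖partialD i (u j)‖ ≤ 2 * Real.pi * (B + B) := fun i j => by
      have h4 := (h.inH j).norm_absD_le zero_le_one one_le_two
      have h5 := norm_partialD_le i (h.inH j).one
      have h6 : ‖absD 1 (u j)‖ ≤ B + B := h4.trans (add_le_add (hu j).1 (hu j).2)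
      exact h5.trans (by gcongr)
    have hR : ‖rieszOp α θ‖ ≤ rieszConst α * (B + B) := by
      have h7 := hθ.mono (s := 1 - α) (by linarith) (by linarith)
      obtain ⟨g, hg, hle⟩ := h7.exists_of_order (realSymbol_rieszSym α) hr
        fun ξ hξ => norm_rieszSym_le α hξ
      rw [(hasMult_rieszOp h7).unique hg]
      have h8 := hθ.norm_absD_le (s := 1 - α) (by linarith) (by linarith)
      exact hle.trans (mul_le_mul_of_nonneg_left
        (h8.trans (add_le_add hθB.1 hθB.2)) hr)
    have h9 : ‖combined α u θ‖ ≤ ‖partialD 0 (u 1)‖ + ‖partialD 1 (u 0)‖ + ‖rieszOp α θ‖ :=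
      (norm_sub_le _ _).trans (add_le_add (norm_sub_le _ _) le_rfl)
    linarith [hp 0 1, hp 1 0]
  · have e : absD 1 (combined α u θ) = absD 1 (partialD 0 (u 1)) - absD 1 (partialD 1 (u 0)) -
        absD 1 (rieszOp α θ) :=
      (h.inH_combined hθ hα hα').hasMult.unique
        ((h1.1.hasMult.sub h2.1.hasMult).sub h3.1.hasMult)
    have h4 : ‖absD 1 (partialD 0 (u 1))‖ ≤ 2 * Real.pi * B :=
      h1.2.trans (mul_le_mul_of_nonneg_left (hu 1).2 (by positivity))
    have h5 : ‖absD 1 (partialD 1 (u 0))‖ ≤ 2 * Real.pi * B :=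
      h2.2.trans (mul_le_mul_of_nonneg_left (hu 0).2 (by positivity))
    have h6 : ‖absD 1 (rieszOp α θ)‖ ≤ rieszConst α * (B + B) :=
      h3.2.trans (mul_le_mul_of_nonneg_left (add_le_add hθB.1 hθB.2) hr)
    have h7 : 0 ≤ Real.pi * B := by positivity
    rw [e]
    linarith [(norm_sub_le (absD 1 (partialD 0 (u 1)) - absD 1 (partialD 1 (u 0)))
      (absD 1 (rieszOp α θ))), norm_sub_le (absD 1 (partialD 0 (u 1))) (absD 1 (partialD 1 (u 0)))]

theorem powPrim_le {p n : ℝ} (hp : 0 ≤ p) (hn : 0 ≤ n) (x : ℝ) : powPrim p n x ≤ |x| ^ (p + 2) := by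
  have N := nonlin_powTrunc hp hn
  have h1 := N.mul_sub_le x 0
  rw [N.zero, zero_sub, zero_sub] at h1
  have h2 : powTrunc p n x * x ≤ |powTrunc p n x| * |x| := by
    rw [← abs_mul]
    exact le_abs_self _
  have h3 := mul_le_mul_of_nonneg_right (abs_powTrunc_le hp hn x) (abs_nonneg x)
  have h4 : |x| ^ (p + 2) = |x| ^ p * |x| * |x| := by
    rw [Real.rpow_add' (abs_nonneg x) (by linarith), Real.rpow_two]
    ring
  linarith

/-- The tangent of Φ at x/2 gives this lower bound without computing the primitive in closed form;
the price is the factor 2^{p+2} in `integral_rpow_le_of_energy_le`. -/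
theorem le_powPrim {p n : ℝ} (hp : 0 ≤ p) (hn : 0 ≤ n) (x : ℝ) :
    powTrunc p n (x / 2) * (x / 2) ≤ powPrim p n x := by
  have N := nonlin_powTrunc hp hn
  have h1 := N.mul_sub_le (x / 2) x
  have h2 := N.nonneg_apply (x / 2)
  have h3 : x - x / 2 = x / 2 := by ring
  rw [h3] at h1
  linarith

theorem energy_powTrunc_le {p n : ℝ} (hp : 0 ≤ p) (hn : 0 ≤ n) {G : L2}
    (hG : Integrable fun x => |G x| ^ (p + 2)) :
    (nonlin_powTrunc hp hn).energy G ≤ ∫ x, |G x| ^ (p + 2) :=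
  integral_mono ((nonlin_powTrunc hp hn).integrable_comp G) hG fun x => powPrim_le hp hn (G x)

/-- As n → ∞ the truncation at G/2 becomes inactive at each point, and dominated convergence passes
to the limit in the lower bound of `le_powPrim`. -/
theorem integral_rpow_le_of_energy_le {p M : ℝ} (hp : 0 ≤ p) {G : L2}
    (hG : Integrable fun x => |G x| ^ (p + 2))
    (h : ∀ n : ℕ, (nonlin_powTrunc hp n.cast_nonneg).energy G ≤ M) :
    ∫ x, |G x| ^ (p + 2) ≤ 2 ^ (p + 2) * M := by
  have hval : ∀ x : ℝ, |x / 2| ^ p * (x / 2) * (x / 2) = (2 ^ (p + 2))⁻¹ * |x| ^ (p + 2) := by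
    intro x
    have e : |x / 2| ^ p * (x / 2) * (x / 2) = |x / 2| ^ (p + 2) := by
      rw [Real.rpow_add' (abs_nonneg _) (by linarith), Real.rpow_two, sq_abs]
      ring
    rw [e, abs_div, abs_two, Real.div_rpow (abs_nonneg x) zero_le_two]
    ring
  have hm : ∀ n : ℕ, AEStronglyMeasurable (fun x => powTrunc p n (G x / 2) * (G x / 2))
      (volume : Measure Plane) := fun n => by
    have h1 : Measurable fun y : ℝ => powTrunc p n (y / 2) * (y / 2) :=
      ((monotone_powTrunc hp n.cast_nonneg).measurable.comp (measurable_id.div_const 2)).mul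
        (measurable_id.div_const 2)
    exact (h1.comp_aemeasurable (Lp.aestronglyMeasurable G).aemeasurable).aestronglyMeasurable
  have hbd : ∀ (n : ℕ) (x : Plane), ‖powTrunc p n (G x / 2) * (G x / 2)‖ ≤
      (2 ^ (p + 2))⁻¹ * |G x| ^ (p + 2) := fun n x => by
    rw [norm_mul, Real.norm_eq_abs, Real.norm_eq_abs, ← hval]
    have h1 := mul_le_mul_of_nonneg_right (abs_powTrunc_le hp n.cast_nonneg (G x / 2))
      (abs_nonneg (G x / 2))
    refine h1.trans_eq ?_
    rw [mul_assoc, mul_assoc, abs_mul_abs_self]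
  have hlim : Tendsto (fun n : ℕ => ∫ x, powTrunc p n (G x / 2) * (G x / 2)) atTop
      (𝓝 (∫ x, (2 ^ (p + 2))⁻¹ * |G x| ^ (p + 2))) := by
    refine tendsto_integral_of_dominated_convergence _ hm (hG.const_mul _)
      (fun n => .of_forall (hbd n)) (.of_forall fun x => ?_)
    refine tendsto_const_nhds.congr' ?_
    filter_upwards [eventually_ge_atTop ⌈|G x / 2|⌉₊] with n hn
    rw [powTrunc, min_eq_left (Nat.ceil_le.1 hn), hval]
  have hle : ∫ x, (2 ^ (p + 2))⁻¹ * |G x| ^ (p + 2) ≤ M := by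
    refine le_of_tendsto hlim (.of_forall fun n => ?_)
    refine le_trans ?_ (h n)
    refine integral_mono ((hG.const_mul _).mono' (hm n) (.of_forall (hbd n)))
      ((nonlin_powTrunc hp n.cast_nonneg).integrable_comp G) fun x => le_powPrim hp n.cast_nonneg _
  rw [integral_const_mul, inv_mul_le_iff₀ (by positivity)] at hle
  exact hle

/-- The derivative of each truncated energy is controlled by the full E, so no single inequality
closes. With w the supremum of e^{-lt}(1 + E(t)), integration of each inequality and the limit in n
give E(t) ≤ Q E(0) + (QCw/l) e^{lt}. For l large this becomes w ≤ 1 + Q E(0) + w/2. The bound W only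
guarantees that w is finite, and no regularity of E in time is needed. -/
theorem gronwall_of_truncations {t₁ C Q W : ℝ} (ht₁ : 0 ≤ t₁) (hC : 0 ≤ C) (hQ : 0 ≤ Q) {E : ℝ → ℝ}
    (hE0 : ∀ t ∈ Icc 0 t₁, 0 ≤ E t) (hEW : ∀ t ∈ Icc 0 t₁, E t ≤ W) {e : ℕ → ℝ → ℝ}
    (hcont : ∀ n, ContinuousOn (e n) (Icc 0 t₁))
    (hderiv : ∀ n, ∀ t ∈ Ioo 0 t₁, ∃ d, HasDerivAt (e n) d t ∧ d ≤ C * (1 + E t))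
    (hinit : ∀ n, e n 0 ≤ E 0)
    (hlim : ∀ t ∈ Icc 0 t₁, ∀ M, (∀ n, e n t ≤ M) → E t ≤ Q * M) :
    E t₁ ≤ 2 * (1 + Q * E 0) * Real.exp ((2 * Q * C + 1) * t₁) := by
  -- This makes QC/l ≤ 1/2; the added 1 keeps l positive when QC = 0.
  set l := 2 * Q * C + 1 with hl
  have hl0 : 0 < l := by positivity
  set v : ℝ → ℝ := fun t => (1 + E t) * Real.exp (-l * t) with hv
  have h0 : (0 : ℝ) ∈ Icc 0 t₁ := ⟨le_rfl, ht₁⟩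
  have hexp1 : ∀ t ∈ Icc 0 t₁, Real.exp (-l * t) ≤ 1 := fun t ht => by
    rw [Real.exp_le_one_iff]
    have := mul_nonneg hl0.le ht.1
    linarith
  have hbdd : BddAbove (v '' Icc 0 t₁) := by
    refine ⟨1 + W, ?_⟩
    rintro _ ⟨t, ht, rfl⟩
    have h1 := hE0 t ht
    have h2 := hEW t ht
    calc (1 + E t) * Real.exp (-l * t) ≤ (1 + E t) * 1 := by
          gcongr
          exact hexp1 t ht
      _ ≤ 1 + W := by linarith
  set w := sSup (v '' Icc 0 t₁) with hw
  have hle : ∀ t ∈ Icc 0 t₁, v t ≤ w := fun t ht => le_csSup hbdd ⟨t, ht, rfl⟩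
  have hw0 : 0 ≤ w := le_trans (by
    have := hE0 0 h0
    simp only [hv]
    positivity) (hle 0 h0)
  have hEw : ∀ t ∈ Icc 0 t₁, 1 + E t ≤ w * Real.exp (l * t) := fun t ht => by
    have h1 := mul_le_mul_of_nonneg_right (hle t ht) (Real.exp_pos (l * t)).le
    simp only [hv] at h1
    rwa [mul_assoc, ← Real.exp_add, neg_mul, neg_add_cancel, Real.exp_zero, mul_one] at h1
  have hanti : ∀ n, AntitoneOn (fun t => e n t - C * w / l * Real.exp (l * t)) (Icc 0 t₁) := by
    intro n
    have hd : ∀ t ∈ Ioo 0 t₁, ∃ d, HasDerivAt (fun t => e n t - C * w / l * Real.exp (l * t)) d t ∧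
        d ≤ 0 := by
      intro t ht
      obtain ⟨d, hd, hdC⟩ := hderiv n t ht
      have h1 : HasDerivAt (fun t : ℝ => l * t) l t := by
        simpa using (hasDerivAt_id t).const_mul l
      refine ⟨_, hd.sub (h1.exp.const_mul (C * w / l)), ?_⟩
      have h2 := mul_le_mul_of_nonneg_left (hEw t (Ioo_subset_Icc_self ht)) hC
      have h3 : C * w / l * (Real.exp (l * t) * l) = C * (w * Real.exp (l * t)) := by
        field_simp
      rw [h3]
      linarith
    refine antitoneOn_of_deriv_nonpos (convex_Icc 0 t₁) ((hcont n).sub (by fun_prop)) ?_ ?_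
    · rw [interior_Icc]
      intro t ht
      obtain ⟨d, hd, -⟩ := hd t ht
      exact hd.differentiableAt.differentiableWithinAt
    · rw [interior_Icc]
      intro t ht
      obtain ⟨d, hd, hd0⟩ := hd t ht
      rwa [hd.deriv]
  have hEt : ∀ t ∈ Icc 0 t₁, E t ≤ Q * E 0 + w / 2 * Real.exp (l * t) := by
    intro t ht
    have h1 := hlim t ht (E 0 + C * w / l * Real.exp (l * t)) fun n => by
      have h2 := hanti n h0 ht ht.1
      simp only [mul_zero, Real.exp_zero, mul_one] at h2
      have h3 := hinit n
      have h4 : 0 ≤ C * w / l := by positivity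
      linarith
    have h5 : Q * (C * w / l) ≤ w / 2 := by
      have h6 : Q * (C * w / l) = Q * C / l * w := by ring
      have h7 : Q * C / l ≤ 1 / 2 := by
        rw [div_le_iff₀ hl0]
        linarith
      rw [h6]
      nlinarith
    have h8 := mul_le_mul_of_nonneg_right h5 (Real.exp_pos (l * t)).le
    linarith
  have hv2 : ∀ t ∈ Icc 0 t₁, v t ≤ 1 + Q * E 0 + w / 2 := by
    intro t ht
    have h1 : 1 + E t ≤ (1 + Q * E 0) + w / 2 * Real.exp (l * t) := by linarith [hEt t ht]
    have h2 := mul_le_mul_of_nonneg_right h1 (Real.exp_pos (-l * t)).le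
    have h3 : w / 2 * Real.exp (l * t) * Real.exp (-l * t) = w / 2 := by
      rw [mul_assoc, ← Real.exp_add, neg_mul, add_neg_cancel, Real.exp_zero, mul_one]
    rw [add_mul (1 + Q * E 0), h3] at h2
    have h4 : (1 + Q * E 0) * Real.exp (-l * t) ≤ (1 + Q * E 0) * 1 := by
      have := hE0 0 h0
      gcongr
      exact hexp1 t ht
    simp only [hv]
    linarith
  have hw2 : w ≤ 1 + Q * E 0 + w / 2 := by
    refine csSup_le ((nonempty_of_mem h0).image v) ?_
    rintro _ ⟨t, ht, rfl⟩
    exact hv2 t ht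
  have h1 := hEw t₁ ⟨ht₁, le_rfl⟩
  have h2 : w * Real.exp (l * t₁) ≤ 2 * (1 + Q * E 0) * Real.exp (l * t₁) := by
    gcongr
    linarith
  linarith

/-- The conserved bounds on u and θ produce a number R depending only on T and M, and
`exists_growth_bound` applies with this R at all times up to t. The solution-dependent K and B drop
out. -/
theorem exists_integral_rpow_combined_le {α β p : ℝ} (hα : 4 / 5 < α) (hα' : α < 1)
    (hαβ : α + β = 1) (hp : 0 < p) (hp' : p ≤ 2) (T M : ℝ) : ∃ X : ℝ,
    ∀ (S K B : ℝ) (u : ℝ → Fin 2 → L2) (θ : ℝ → L2), Regular α β S K B u θ →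
      (∀ i, ‖u 0 i‖ ≤ M ∧ ‖absD 2 (u 0 i)‖ ≤ M) → (‖θ 0‖ ≤ M ∧ ‖absD 2 (θ 0)‖ ≤ M) →
      ∀ t ∈ Icc 0 S, t ≤ T → ∫ x, |combined α (u t) (θ t) x| ^ (p + 2) ≤ X := by
  obtain ⟨c, hc, hsup⟩ := exists_sup_bound
  -- The three summands bound the `L²` norm of the velocity, the `L²` norm of θ and the supremum of
  -- |θ|.
  set R := Real.sqrt (Real.exp T * (M ^ 2 + M ^ 2 + M ^ 2)) + M + c * (M + M) with hR
  obtain ⟨C, hC, hgrow⟩ := exists_growth_bound hα hα' hp hp' R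
  have hκ : 0 ≤ 8 * Real.pi + 2 * rieszConst α := by
    have := rieszConst_nonneg α
    positivity
  set κ := 8 * Real.pi + 2 * rieszConst α
  have har := area_pos
  set Q : ℝ := 2 ^ (p + 2) with hQ
  have hQ0 : 0 ≤ Q := by positivity
  set E₀ := (κ * M) ^ 2 + 64 * area * (κ * M) ^ 4 with hE₀
  have hE₀0 : 0 ≤ E₀ := by positivity
  refine ⟨2 * (1 + Q * E₀) * Real.exp ((2 * Q * C + 1) * T),
    fun S K B u θ h hu0 hθ0 t ht htT => ?_⟩
  have hM : 0 ≤ M := (norm_nonneg _).trans hθ0.1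
  have hβ : 0 < β := by linarith
  have hβ' : β < 2 := by linarith
  set G : ℝ → L2 := fun τ => combined α (u τ) (θ τ) with hG
  have hsub : ∀ τ ∈ Icc 0 t, τ ∈ Icc 0 S := fun τ hτ => ⟨hτ.1, hτ.2.trans ht.2⟩
  have hS0 : (0 : ℝ) ∈ Icc 0 S := ⟨le_rfl, ht.1.trans ht.2⟩
  have hGH : ∀ τ ∈ Icc 0 S, InH 1 (G τ) := fun τ hτ =>
    (h.sol τ hτ).inH_combined (h.temp_inH τ hτ) (by linarith) hα'.le
  have hGi : ∀ τ ∈ Icc 0 S, Integrable fun x => |G τ x| ^ (p + 2) := fun τ hτ =>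
    (hGH τ hτ).integrable_rpow (by linarith) (by linarith)
  have hGb : ∀ τ ∈ Icc 0 S, ∀ b : ℝ, (∀ i, ‖u τ i‖ ≤ b ∧ ‖absD 2 (u τ i)‖ ≤ b) →
      (‖θ τ‖ ≤ b ∧ ‖absD 2 (θ τ)‖ ≤ b) →
      ∫ x, |G τ x| ^ (p + 2) ≤ (κ * b) ^ 2 + 64 * area * (κ * b) ^ 4 := by
    intro τ hτ b h1 h2
    obtain ⟨h3, h4⟩ := (h.sol τ hτ).norm_combined_le (by linarith : 0 ≤ α) hα'.le
      (h.temp_inH τ hτ) h1 h2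
    have h5 := (hGH τ hτ).integral_rpow_le (q := p + 2) (l := 1) (R := κ * b) (by linarith)
      (by linarith) zero_lt_one (by rw [one_mul]; exact h3) (by rw [one_mul]; exact h4)
    rwa [Real.one_rpow, mul_one] at h5
  -- bounds of the unknowns
  have hθsup : ∀ᵐ x : Plane, |θ 0 x| ≤ c * (M + M) := by
    filter_upwards [hsup _ (h.temp_inH 0 hS0)] with x hx
    refine hx.trans ?_
    gcongr
    · exact hθ0.1
    · exact hθ0.2
  have hsq : 0 ≤ Real.sqrt (Real.exp T * (M ^ 2 + M ^ 2 + M ^ 2)) := Real.sqrt_nonneg _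
  have hcM : 0 ≤ c * (M + M) := by positivity
  have huR : ∀ τ ∈ Icc 0 t, ∀ i, ‖u τ i‖ ≤ R := by
    intro τ hτ i
    have h1 := h.sq_norm_vel_le (by linarith) (by linarith) hβ hβ' (hsub τ hτ)
    have h2 : ‖u τ i‖ ^ 2 ≤ Real.exp T * (M ^ 2 + M ^ 2 + M ^ 2) := by
      have h3 : ‖u τ i‖ ^ 2 ≤ ‖u τ 0‖ ^ 2 + ‖u τ 1‖ ^ 2 := by
        fin_cases i
        · exact le_add_of_nonneg_right (sq_nonneg _)
        · exact le_add_of_nonneg_left (sq_nonneg _)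
      have h4 := (hu0 0).1
      have h5 := (hu0 1).1
      have h6 := hθ0.1
      have h7 : τ ≤ T := hτ.2.trans htT
      exact h3.trans (h1.trans (by gcongr))
    have h8 := Real.le_sqrt_of_sq_le h2
    linarith
  have hθR : ∀ τ ∈ Icc 0 t, ‖θ τ‖ ≤ R := fun τ hτ => by
    have h1 := h.norm_temp_le hβ hβ' (hsub τ hτ)
    have h2 := hθ0.1
    linarith
  have hθb : ∀ τ ∈ Icc 0 t, ∀ᵐ x : Plane, |θ τ x| ≤ R := fun τ hτ => by
    filter_upwards [h.ae_abs_temp_le hβ hβ' hcM hθsup (hsub τ hτ)] with x hx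
    linarith
  have hB : ∀ τ ∈ Icc 0 S, ∫ x, |G τ x| ^ (p + 2) ≤ (κ * B) ^ 2 + 64 * area * (κ * B) ^ 4 :=
    fun τ hτ => hGb τ hτ B (h.bound_vel τ hτ) (h.bound_temp τ hτ)
  have key := gronwall_of_truncations ht.1 hC hQ0 (E := fun τ => ∫ x, |G τ x| ^ (p + 2))
    (fun τ _ => integral_nonneg fun x => by positivity) (fun τ hτ => hB τ (hsub τ hτ))
    (e := fun n τ => (nonlin_powTrunc hp.le n.cast_nonneg).energy (G τ))
    (fun n => (nonlin_powTrunc hp.le n.cast_nonneg).continuous_energy.comp_continuousOn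
      (h.cont_combined.mono hsub))
    (fun n τ hτ => by
      have hτ' := Ioo_subset_Icc_self hτ
      exact ⟨_, h.hasDerivAt_energy (by linarith) hα' hαβ (nonlin_powTrunc hp.le n.cast_nonneg)
        ⟨hτ.1, hτ.2.trans_le ht.2⟩, hgrow (u τ) K (θ τ) (h.sol τ (hsub τ hτ'))
        (h.temp_inH τ (hsub τ hτ')) (huR τ hτ') (hθR τ hτ') (hθb τ hτ') n n.cast_nonneg⟩)
    (fun n => energy_powTrunc_le hp.le n.cast_nonneg (hGi 0 hS0))
    (fun τ hτ M hM => integral_rpow_le_of_energy_le hp.le (hGi τ (hsub τ hτ)) hM)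
  refine key.trans ?_
  have h1 := hGb 0 hS0 M hu0 hθ0
  have h2 : (2 * Q * C + 1) * t ≤ (2 * Q * C + 1) * T := by gcongr
  have h3 : 0 ≤ ∫ x, |G 0 x| ^ (p + 2) := integral_nonneg fun x => by positivity
  gcongr

theorem exists_eLpNorm_combined_le (LP : LittlewoodPaley) {α β q : ℝ} (hα : 4 / 5 < α) (hα' : α < 1)
    (hαβ : α + β = 1) (hq : 2 < q) (hq' : q ≤ 4) (T M : ℝ) :
    ∃ C : ℝ, ∀ (u₀ : Fin 2 → L2) (θ₀ : L2), (∀ i, sobolevNorm 2 (u₀ i) ≤ ENNReal.ofReal M) →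
      LP.besovNorm 2 θ₀ ≤ ENNReal.ofReal M →
      ∀ (S : ℝ) (u : ℝ → Fin 2 → L2) (p : ℝ → Plane → ℝ) (θ : ℝ → L2),
        IsSolution LP α β S u₀ θ₀ u p θ → ∀ t ∈ Icc 0 S, t ≤ T →
          eLpNorm (combined α (u t) (θ t)) (ENNReal.ofReal q) volume ≤ ENNReal.ofReal C := by
  obtain ⟨p, rfl⟩ : ∃ p, q = p + 2 := ⟨q - 2, by ring⟩
  have hp : 0 < p := by linarith
  have hp' : p ≤ 2 := by linarith
  -- The factor 8 is the constant in the comparison of the H² and Besov norms; the maximum covers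
  -- negative M, for which `ENNReal.ofReal M` is 0.
  set M' := 8 * max M 0 with hM'
  have hM0 : 0 ≤ max M 0 := le_max_right _ _
  have hM'0 : 0 ≤ M' := by positivity
  obtain ⟨X, hX⟩ := exists_integral_rpow_combined_le (β := β) hα hα' hαβ hp hp' T M'
  refine ⟨X ^ (p + 2)⁻¹, fun u₀ θ₀ hu₀ hθ₀ S u pr θ h t ht htT => ?_⟩
  obtain ⟨K, B, -, hreg⟩ := h.regular (by linarith) hα'
  have hle : ENNReal.ofReal M ≤ ENNReal.ofReal M' := by
    refine ENNReal.ofReal_le_ofReal ?_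
    linarith [le_max_left M 0]
  have hu : ∀ i, ‖u 0 i‖ ≤ M' ∧ ‖absD 2 (u 0 i)‖ ≤ M' := fun i => by
    rw [h.velocity_init]
    exact (norm_bounds_of_sobolevNorm hM'0 ((hu₀ i).trans hle)).2
  have hθ : ‖θ 0‖ ≤ M' ∧ ‖absD 2 (θ 0)‖ ≤ M' := by
    rw [h.temperature_init]
    refine (norm_bounds_of_sobolevNorm hM'0 ((LP.sobolevNorm_le_besovNorm θ₀).trans ?_)).2
    rw [hM', ENNReal.ofReal_mul (by norm_num), ENNReal.ofReal_ofNat]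
    gcongr
    exact hθ₀.trans (ENNReal.ofReal_le_ofReal (le_max_left _ _))
  have hint := hX S K B u θ hreg hu hθ t ht htT
  have hG := (hreg.sol t ht).inH_combined (hreg.temp_inH t ht) (by linarith : 0 ≤ α) hα'.le
  have hGi := hG.integrable_rpow (q := p + 2) (by linarith) (by linarith)
  have hq0 : 0 < p + 2 := by linarith
  have hmem : MemLp (combined α (u t) (θ t)) (ENNReal.ofReal (p + 2)) :=
    (memLp_norm_iff (f := combined α (u t) (θ t)) (Lp.aestronglyMeasurable _)).1
      (memLp_of_integrable_rpow hq0 hGi)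
  rw [hmem.eLpNorm_eq_integral_rpow_norm (by simpa using hq0) ENNReal.ofReal_ne_top,
    ENNReal.toReal_ofReal hq0.le]
  refine ENNReal.ofReal_le_ofReal (Real.rpow_le_rpow ?_ hint (by positivity))
  exact integral_nonneg fun x => by positivity

end Boussinesq

end

/-- Global a priori `L^q` bound for `G = ω - Λ^{-α}∂₁θ`: the bound `C` depends only on
`α`, `q`, `T` and on an upper bound `M` for the norms of the data. The solution is given on some
interval `[0,S]`, of arbitrary length compared with `T`. -/
theorem theorem6p1 (LP : Boussinesq.LittlewoodPaley) (α β q : ℝ)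
    (hα : 4 / 5 < α) (hα' : α < 1) (hαβ : α + β = 1)
    (hq : 2 < q) (hq' : q < (8 - 4 * α) / (8 - 7 * α))
    (T : ℝ) (hT : 0 < T) (M : ℝ) :
    ∃ C : ℝ, ∀ (u₀ : Fin 2 → Boussinesq.L2) (θ₀ : Boussinesq.L2),
      (∀ i, Boussinesq.sobolevNorm 2 (u₀ i) ≤ ENNReal.ofReal M) →
      LP.besovNorm 2 θ₀ ≤ ENNReal.ofReal M →
      ∀ (S : ℝ) (u : ℝ → Fin 2 → Boussinesq.L2) (p : ℝ → Boussinesq.Plane → ℝ)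
        (θ : ℝ → Boussinesq.L2), 0 < S →
        Boussinesq.IsSolution LP α β S u₀ θ₀ u p θ →
        ∀ t ∈ Set.Icc 0 S, t ≤ T →
          MeasureTheory.eLpNorm (Boussinesq.combined α (u t) (θ t)) (ENNReal.ofReal q)
            MeasureTheory.volume ≤ ENNReal.ofReal C := by
  -- The inequality 8 - 4α < 4(8 - 7α) is equivalent to α < 1.
  have hq4 : q ≤ 4 := by
    rw [lt_div_iff₀ (by linarith)] at hq'
    nlinarith
  obtain ⟨C, hC⟩ := Boussinesq.exists_eLpNorm_combined_le LP hα hα' hαβ hq hq4 T M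
  exact ⟨C, fun u₀ θ₀ hu₀ hθ₀ S u p θ _ h t ht htT => hC u₀ θ₀ hu₀ hθ₀ S u p θ h t ht htT⟩
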